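/- **Theorem 2.** Let $G=(V,E)$ be a finite simple undirected graph with $V=\{0,\dots,|V|-1\}$ and let $k\ge 0$ be an integer. A connected vertex cover of $G$ is a set $X\subseteq V$ that contains at least one endpoint of every edge and for which the induced subgraph $G[X]$ has at most one connected component (so $X=\emptyset$ is one if $E=\emptyset$). There is a deterministic algorithm that, given $G$ (by adjacency lists, in any order) and $k$, computes the number of connected vertex covers $X$ of $G$ with $|X|\le k$ in $O(2^k k(|V|+|E|)+1)$ time and $O(2^k k+1)$ space; for $k\ge 1$ and $V\neq\emptyset$ this is $O(2^k k(|V|+|E|))$ time and $O(2^k k)$ space. The algorithm is a single program, and the constants in the $O$-bounds are absolute. Here the machine is a random access machine that performs integer addition, subtraction, multiplication, Euclidean division and comparison at unit cost, on integers of $O((k+1)^2\log(|V|+2))$ bits only. Time is the number of executed instructions, and space is the number of cells of the working memory, where the cells used are the initial ones and the read-only input is not counted. -/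

import Mathlib

/-- `X` is a connected vertex cover of `G`: every edge has an endpoint in `X`, and the subgraph
induced by `X` has at most one connected component. In an edgeless graph the empty set is
a connected vertex cover. -/
def IsConnectedVertexCover {V : Type*} (G : SimpleGraph V) (X : Set V) : Prop :=
  G.IsVertexCover X ∧ (G.induce X).Preconnected

/-- The number of connected vertex covers of `G` of cardinality at most `k`. -/
noncomputable def numConnectedVertexCovers {V : Type*} [Fintype V] (G : SimpleGraph V) (k : ℕ) :
    ℕ :=
  Set.ncard {X : Finset V | IsConnectedVertexCover G (X : Set V) ∧ X.card ≤ k}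

/-- `adj` lists, for every vertex, its neighbours without repetition, in any order. -/
def IsAdjacencyList {n : ℕ} (G : SimpleGraph (Fin n)) (adj : Fin n → List (Fin n)) : Prop :=
  ∀ v, (adj v).Nodup ∧ ∀ w, w ∈ adj v ↔ G.Adj v w

/-- The input: the number `n` of vertices, the number `m` of edges, the parameter `k`, then for
`i = 0, …, n` the input address at which the list of vertex `i` begins (for `i = n`: the end of the
input), then the adjacency lists of the vertices `0, …, n - 1`, one after the other. -/
def encodeInput {n : ℕ} (m k : ℕ) (adj : Fin n → List (Fin n)) : List ℤ :=
  [(n : ℤ), (m : ℤ), (k : ℤ)]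
    ++ (List.range (n + 1)).map
        (fun i => ((n + 4 + ((List.ofFn adj).take i).flatten.length : ℕ) : ℤ))
    ++ (List.ofFn adj).flatten.map (fun w => ((w : ℕ) : ℤ))

namespace RAM

/-- The arithmetic operations of the machine; `quot` and `rem` are Euclidean division. -/
inductive BinOp where
  | add | sub | mul | quot | rem

/-- The value of an arithmetic operation. -/
def BinOp.eval : BinOp → ℤ → ℤ → ℤ
  | .add, a, b => a + b
  | .sub, a, b => a - b
  | .mul, a, b => a * b
  | .quot, a, b => a / b
  | .rem, a, b => a % b

/-- Programs of a random access machine, in structured form. A program names finitely many integer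
registers; besides them there are a read-only input and a working memory, both addressed
indirectly. -/
inductive Program where
  /-- do nothing -/
  | skip
  /-- `x := c` -/
  | const (x : ℕ) (c : ℤ)
  /-- `x := y ∘ z` -/
  | arith (o : BinOp) (x y z : ℕ)
  /-- `x := input[y]` -/
  | read (x y : ℕ)
  /-- `x := memory[y]` -/
  | load (x y : ℕ)
  /-- `memory[x] := y` -/
  | store (x y : ℕ)
  /-- first `p`, then `q` -/
  | seq (p q : Program)
  /-- if `x < y` then `p` else `q` -/
  | branch (x y : ℕ) (p q : Program)
  /-- while `x < y` do `p` -/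
  | loop (x y : ℕ) (p : Program)

/-- The contents of the registers and of the working memory. -/
structure State where
  reg : ℕ → ℤ
  mem : ℕ → ℤ

/-- At the start all registers and all cells of the working memory hold `0`. -/
def State.init : State := ⟨fun _ => 0, fun _ => 0⟩

/-- Assign `v` to the register `x`. -/
def State.setReg (s : State) (x : ℕ) (v : ℤ) : State := ⟨Function.update s.reg x v, s.mem⟩

/-- Assign `v` to the memory cell `a`. -/
def State.setMem (s : State) (a : ℕ) (v : ℤ) : State := ⟨s.reg, Function.update s.mem a v⟩

/-- `Exec inp S W p s t s'`: on the input `inp` the program `p`, started in the state `s`, halts in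
the state `s'` after exactly `t` steps; all accesses to the working memory go to the cells
`0, …, S - 1`, and every integer that is computed, read or written down on the way has absolute
value less than `2 ^ W`. An elementary instruction is one step and so is every evaluation of the
condition of a branch or a loop. A program that addresses a cell outside of the input or of the
first `S` cells of the memory, or produces a longer integer, has no execution. -/
inductive Exec (inp : List ℤ) (S W : ℕ) : Program → State → ℕ → State → Prop where
  | skip (s : State) : Exec inp S W .skip s 1 s
  | const (s : State) (x : ℕ) (c : ℤ) (hc : c.natAbs < 2 ^ W) :
      Exec inp S W (.const x c) s 1 (s.setReg x c)
  | arith (s : State) (o : BinOp) (x y z : ℕ)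
      (hv : (o.eval (s.reg y) (s.reg z)).natAbs < 2 ^ W) :
      Exec inp S W (.arith o x y z) s 1 (s.setReg x (o.eval (s.reg y) (s.reg z)))
  | read (s : State) (x y a : ℕ) (v : ℤ) (ha : s.reg y = a) (hv : inp[a]? = some v)
      (hw : v.natAbs < 2 ^ W) :
      Exec inp S W (.read x y) s 1 (s.setReg x v)
  | load (s : State) (x y a : ℕ) (ha : s.reg y = a) (hS : a < S) :
      Exec inp S W (.load x y) s 1 (s.setReg x (s.mem a))
  | store (s : State) (x y a : ℕ) (ha : s.reg x = a) (hS : a < S) :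
      Exec inp S W (.store x y) s 1 (s.setMem a (s.reg y))
  | seq (s s₁ s₂ : State) (p q : Program) (t₁ t₂ : ℕ) (hp : Exec inp S W p s t₁ s₁)
      (hq : Exec inp S W q s₁ t₂ s₂) :
      Exec inp S W (.seq p q) s (t₁ + t₂) s₂
  | branch_true (s s₁ : State) (x y : ℕ) (p q : Program) (t : ℕ) (h : s.reg x < s.reg y)
      (hp : Exec inp S W p s t s₁) :
      Exec inp S W (.branch x y p q) s (t + 1) s₁
  | branch_false (s s₁ : State) (x y : ℕ) (p q : Program) (t : ℕ) (h : ¬ s.reg x < s.reg y)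
      (hq : Exec inp S W q s t s₁) :
      Exec inp S W (.branch x y p q) s (t + 1) s₁
  | loop_true (s s₁ s₂ : State) (x y : ℕ) (p : Program) (t₁ t₂ : ℕ) (h : s.reg x < s.reg y)
      (hp : Exec inp S W p s t₁ s₁) (hl : Exec inp S W (.loop x y p) s₁ t₂ s₂) :
      Exec inp S W (.loop x y p) s (t₁ + t₂ + 1) s₂
  | loop_false (s : State) (x y : ℕ) (p : Program) (h : ¬ s.reg x < s.reg y) :
      Exec inp S W (.loop x y p) s 1 s

end RAM

/-!
The algorithm is written in a small imperative language, `Cmd`, with registers, arrays and the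
input. A weakest precondition `wp` that counts steps reduces each claim about a program to
arithmetic, and `Cmd.comp_spec` compiles such a program, with its 32 arrays interleaved in the
memory, to the random access machine at a constant factor in time.

*A small cover.* `initList` collects disjoint edges, each with an endpoint adjacent to an earlier
one. A cover contains an endpoint of each of them (`PairList.le_card`), and if they miss an edge but
cannot be continued, then edges lie in different components (`PairList.no_cvc`). So the result
is a connected vertex cover with at most `2 * k + 2` vertices, or there is nothing to count. It is
shrunk by iterative compression (`chain`). An initial segment of the list, the root, is forced into
the cover; it loses one vertex at a time, and the list never exceeds it by more than `k + 1`
vertices. Counting the root as one position, `chainStep` searches the at most `2 ^ (k + 1)` traces on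
the list that contain the root for a cover with at most `k` vertices besides the root. If there is
none, then all connected vertex covers are too large, since enlarging one by the root keeps it
connected. In the end the list has at most `k + 2` vertices.

*Traces.* Fix a connected vertex cover, listed such that each member but the first has an earlier
neighbour, its parent, and let `A` be the trace on it of another cover. The vertices off the list
are independent. Those with a neighbour in the list outside of `A` are `forced`, and the others with
a neighbour are `free`. Joining the members of `A` to their parents in `A` yields the units of `A`.
The cover is connected iff the hyperedges that its vertices off the list and the edges inside of
the list induce on the units connect all units (`assemble_cvc_iff`). Vertices with the same
neighbours act alike, and `Entries` stores each neighbourhood once. The time for a trace with `c`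
units is proportional to `2 ^ c`, up to factors that do not matter exponentially, and although there
are `2 ^ (p + 1)` traces on `p + 1` positions, the traces that meet every tree edge satisfy
`∑ 2 ^ c = 3 * 2 ^ p` (`sum_two_pow_ucount`): a vertex whose parent is missing must be taken and
starts a unit (one choice of weight two), and otherwise it is left out or joins the unit of its
parent (two choices of weight one). This is where `2 ^ k` comes from.

*Deciding and counting.* In `chainStep`, a dynamic program over the sets of units that contain the
unit `0` finds the least number of free entries that connect all units (`Prices`, `Reach`). In
`count`, `Cover.sum_cvc` expresses the generating function of the covers with a given trace by that
of the sets of free hyperedges that connect the units, `con`. Sorting all sets of hyperedges by the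
component of the unit `0` gives a recursion between `con` and the simple product `tot`
(`tot_eq_sum`), that is, a quotient of set functions for the subset convolution. It is computed by a
ranked zeta transform and the division of power series in the rank (`ranked_division`,
`con_range`).

*Small numbers.* The generating function is evaluated at `bigM n k = (n + 2) ^ (k + 1)` modulo
`bigN n k = bigM n k ^ (k + 1)`, which removes the sets with more than `k` elements. The residue of
the result modulo `bigM n k - 1` is the number of the remaining sets, as there are fewer of them
than that (`Rep.count`). So all numbers have `O((k + 1) ^ 2 * log (n + 2))` bits. The machine
has no bitwise operations; intersections of masks are read off tables (`Tab`).
-/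

/-! ### A small imperative language and its compilation -/

namespace ConnVC

open Finset Function

/-- Expressions over natural-number registers, arrays and the input. -/
inductive Ex where
  | c (i : ℕ)
  | v (x : ℕ)
  | op (o : RAM.BinOp) (e e' : Ex)
  | ld (α : ℕ) (e : Ex)
  | inp (e : Ex)

/-- Commands. `ite` and `whil` test `e < e'`. -/
inductive Cmd where
  | skip
  | set (x : ℕ) (e : Ex)
  | sto (α : ℕ) (e e' : Ex)
  | seq (p q : Cmd)
  | ite (e e' : Ex) (p q : Cmd)
  | whil (e e' : Ex) (p : Cmd)

infixr:60 " ;; " => Cmd.seq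

/-- States of the language: registers and arrays, all holding natural numbers. -/
structure St where
  r : ℕ → ℕ
  a : ℕ → ℕ → ℕ

/-- Assign to a register. -/
def St.set (s : St) (x v : ℕ) : St := ⟨update s.r x v, s.a⟩

/-- Assign to an array cell. -/
def St.sto (s : St) (α i v : ℕ) : St :=
  ⟨s.r, update s.a α (update (s.a α) i v)⟩

@[simp] theorem St.set_a (s : St) (x v : ℕ) : (s.set x v).a = s.a := rfl
@[simp] theorem St.sto_r (s : St) (α i v : ℕ) : (s.sto α i v).r = s.r := rfl
@[simp] theorem St.set_r (s : St) (x v y : ℕ) : (s.set x v).r y = if y = x then v else s.r y := by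
  simp [St.set, update_apply]
theorem St.sto_a (s : St) (α i v β : ℕ) :
    (s.sto α i v).a β = if β = α then update (s.a α) i v else s.a β := by
  simp only [St.sto, update_apply]
@[simp] theorem St.sto_a_same (s : St) (α i v : ℕ) :
    (s.sto α i v).a α = update (s.a α) i v := by simp [St.sto_a]
@[simp] theorem St.sto_a_ne (s : St) {α β : ℕ} (i v : ℕ) (h : β ≠ α) :
    (s.sto α i v).a β = s.a β := by simp [St.sto_a, h]

/-- The limits of an execution: the input, the number of cells per array, and a strict bound for
all numbers. -/
structure Env where
  I : List ℕ
  cap : ℕ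
  bd : ℕ

variable {E : Env} {s s' : St} {Q : St → ℕ → Prop} {p q : Cmd} {e e' : Ex}

/-- The value of an arithmetic operation on natural numbers. -/
def opEval : RAM.BinOp → ℕ → ℕ → ℕ
  | .add, a, b => a + b
  | .sub, a, b => a - b
  | .mul, a, b => a * b
  | .quot, a, b => a / b
  | .rem, a, b => a % b

/-- The operation yields a nonnegative number below the bound. -/
def opOk (bd : ℕ) : RAM.BinOp → ℕ → ℕ → Prop
  | .add, a, b => a + b < bd
  | .sub, a, b => b ≤ a
  | .mul, a, b => a * b < bd
  | .quot, _, _ => True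
  | .rem, _, _ => True

/-- The value of an expression. -/
def Ex.ev (E : Env) (s : St) : Ex → ℕ
  | c i => i
  | v x => s.r x
  | op o e e' => opEval o (e.ev E s) (e'.ev E s)
  | ld α e => s.a α (e.ev E s)
  | inp e => E.I.getD (e.ev E s) 0

/-- An expression can be evaluated within the limits. -/
def Ex.ok (E : Env) (s : St) : Ex → Prop
  | c i => i < E.bd
  | v _ => True
  | op o e e' => e.ok E s ∧ e'.ok E s ∧ opOk E.bd o (e.ev E s) (e'.ev E s)
  | ld _ e => e.ok E s ∧ e.ev E s < E.cap
  | inp e => e.ok E s ∧ e.ev E s < E.I.length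

/-- The weakest precondition of a while loop that makes fewer than the given number of
iterations. -/
def iterWp (cond ok : St → Prop) (body : St → (St → ℕ → Prop) → Prop) :
    ℕ → St → (St → ℕ → Prop) → Prop
  | 0, _, _ => False
  | f + 1, s, Q => ok s ∧ (cond s →
      body s fun s' t => iterWp cond ok body f s' fun s'' t' => Q s'' (t + t' + 1)) ∧
      (¬ cond s → Q s 1)

/-- The weakest precondition for total correctness within the limits; the postcondition speaks of
the final state and the number of steps. -/
def wp (E : Env) : Cmd → St → (St → ℕ → Prop) → Prop
  | .skip, s, Q => Q s 1
  | .set x e, s, Q => e.ok E s ∧ Q (s.set x (e.ev E s)) 1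
  | .sto α e e', s, Q => e.ok E s ∧ e'.ok E s ∧ e.ev E s < E.cap ∧
      Q (s.sto α (e.ev E s) (e'.ev E s)) 1
  | .seq p q, s, Q => wp E p s fun s' t => wp E q s' fun s'' t' => Q s'' (t + t')
  | .ite e e' p q, s, Q => e.ok E s ∧ e'.ok E s ∧
      (e.ev E s < e'.ev E s → wp E p s fun s' t => Q s' (t + 1)) ∧
      (¬ e.ev E s < e'.ev E s → wp E q s fun s' t => Q s' (t + 1))
  | .whil e e' p, s, Q => ∃ f, iterWp (fun s => e.ev E s < e'.ev E s)
      (fun s => e.ok E s ∧ e'.ok E s) (wp E p) f s Q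

theorem iterWp_mono {cond ok : St → Prop} {body : St → (St → ℕ → Prop) → Prop}
    (hb : ∀ s (Q Q' : St → ℕ → Prop), (∀ s t, Q s t → Q' s t) → body s Q → body s Q') (f : ℕ) :
    ∀ (s : St) (Q Q' : St → ℕ → Prop), (∀ s t, Q s t → Q' s t) →
      iterWp cond ok body f s Q → iterWp cond ok body f s Q' := by
  induction f with
  | zero => intro s Q Q' _ h; exact h
  | succ f ih =>
    intro s Q Q' hQ h
    refine ⟨h.1, fun hc => hb _ _ _ ?_ (h.2.1 hc), fun hc => hQ _ _ (h.2.2 hc)⟩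
    intro s' t h'
    exact ih _ _ _ (fun _ _ h => hQ _ _ h) h'

theorem wp_mono :
    ∀ {s : St} {Q Q' : St → ℕ → Prop}, wp E p s Q → (∀ s t, Q s t → Q' s t) → wp E p s Q' := by
  induction p with
  | skip => intro s Q Q' h hQ; exact hQ _ _ h
  | set x e => intro s Q Q' h hQ; exact ⟨h.1, hQ _ _ h.2⟩
  | sto α e e' => intro s Q Q' h hQ; exact ⟨h.1, h.2.1, h.2.2.1, hQ _ _ h.2.2.2⟩
  | seq p q ihp ihq =>
    intro s Q Q' h hQ
    exact ihp h fun s t h' => ihq h' fun s' t' h'' => hQ _ _ h''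
  | ite e e' p q ihp ihq =>
    intro s Q Q' h hQ
    exact ⟨h.1, h.2.1, fun hc => ihp (h.2.2.1 hc) fun _ _ h => hQ _ _ h,
      fun hc => ihq (h.2.2.2 hc) fun _ _ h => hQ _ _ h⟩
  | whil e e' p ih =>
    intro s Q Q' h hQ
    obtain ⟨f, hf⟩ := h
    exact ⟨f, iterWp_mono (body := wp E p) (fun s Q Q' h h' => ih h' h) f _ _ _ hQ hf⟩

/-- Conditional on equality. -/
def Cmd.ifEq (e e' : Ex) (p q : Cmd) : Cmd := .ite e e' q (.ite e' e q p)

theorem wp_ifEq (h : e.ok E s) (h' : e'.ok E s)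
    (h1 : e.ev E s = e'.ev E s → wp E p s fun s' t => Q s' (t + 2))
    (h2 : e.ev E s ≠ e'.ev E s → wp E q s fun s' t => Q s' (t + 1) ∧ Q s' (t + 2)) :
    wp E (.ifEq e e' p q) s Q := by
  refine ⟨h, h', fun hc => wp_mono (h2 hc.ne) fun _ _ h => h.1, fun hc => ⟨h', h, fun hc' => ?_,
    fun hc' => ?_⟩⟩
  · exact wp_mono (h2 hc'.ne') fun _ _ h => h.2
  · exact wp_mono (h1 (by omega)) fun _ _ h => h

/-- `for x = e, …, y - 1 do p`, where `y` is a register. -/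
def Cmd.forr (x : ℕ) (e : Ex) (y : ℕ) (p : Cmd) : Cmd :=
  .set x e ;; .whil (.v x) (.v y) (p ;; .set x (.op .add (.v x) (.c 1)))

/-- The rule for loops that count up: the invariant `J i` holds whenever the counter is `i`. -/
theorem wp_forr {x y : ℕ} (J : ℕ → St → Prop) (f : ℕ → ℕ) (lo N : ℕ) (hok : e.ok E s)
    (he : e.ev E s = lo) (hxy : x ≠ y) (hy : s.r y = N) (hlo : lo ≤ N) (hN : N < E.bd)
    (h0 : J lo (s.set x lo)) (hstep : ∀ i, lo ≤ i → i < N → ∀ s1, J i s1 → s1.r x = i → s1.r y = N →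
      wp E p s1 fun s2 t => s2.r x = i ∧ s2.r y = N ∧ t ≤ f i ∧ J (i + 1) (s2.set x (i + 1)))
    (hQ : ∀ s' t, J N s' → s'.r x = N → s'.r y = N → t ≤ (∑ i ∈ Ico lo N, (f i + 2)) + 2 → Q s' t) :
    wp E (.forr x e y p) s Q := by
  have key : ∀ d i s1, i + d = N → lo ≤ i → J i s1 → s1.r x = i → s1.r y = N →
      ∀ Q' : St → ℕ → Prop, (∀ s' t, J N s' → s'.r x = N → s'.r y = N →
        t ≤ (∑ j ∈ Ico i N, (f j + 2)) + 1 → Q' s' t) →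
      iterWp (fun s => (Ex.v x).ev E s < (Ex.v y).ev E s)
        (fun s => (Ex.v x).ok E s ∧ (Ex.v y).ok E s)
        (wp E (p ;; .set x (.op .add (.v x) (.c 1)))) (d + 1) s1 Q' := by
    intro d
    induction d with
    | zero =>
      intro i s1 hi hli hJ hx hy' Q' hQ'
      have : i = N := by omega
      subst this
      refine ⟨⟨trivial, trivial⟩, fun hc => ?_, fun _ => hQ' _ _ hJ hx hy' (by omega)⟩
      simp only [Ex.ev] at hc
      omega
    | succ d ih =>
      intro i s1 hi hli hJ hx hy' Q' hQ'
      refine ⟨⟨trivial, trivial⟩, fun _ => ?_, fun hc => ?_⟩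
      · change wp E p s1 _
        refine wp_mono (hstep i hli (by omega) s1 hJ hx hy') ?_
        rintro s2 t ⟨hx2, hy2, ht, hJ2⟩
        refine ⟨⟨trivial, (by omega : 1 < E.bd), ?_⟩, ?_⟩
        · change s2.r x + 1 < E.bd
          omega
        · change iterWp _ _ _ _ (s2.set x (s2.r x + 1)) _
          rw [hx2]
          refine ih (i + 1) _ (by omega) (by omega) hJ2 (by simp) (by simp [hxy.symm, hy2]) _ ?_
          intro s' t' a b c d'
          refine hQ' _ _ a b c ?_
          rw [sum_eq_sum_Ico_succ_bot (by omega)]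
          omega
      · simp only [Ex.ev] at hc
        omega
  change wp E _ _ _
  refine ⟨hok, N - lo + 1, ?_⟩
  rw [he]
  refine key (N - lo) lo _ (by omega) le_rfl h0 (by simp) (by simp [hxy.symm, hy]) _ ?_
  intro s' t a b c d
  exact hQ _ _ a b c (by omega)

/-! ### Compilation to the random access machine -/

open RAM

/-- Evaluate an expression into the register `x`, with the registers from `d` on as scratch. -/
def Ex.comp : Ex → ℕ → ℕ → Program
  | c i, x, _ => .const x i
  | v y, x, d => .seq (.const d 0) (.arith .add x y d)
  | op o e e', x, d => .seq (e.comp d (d + 1)) (.seq (e'.comp (d + 1) (d + 2)) (.arith o x d (d + 1)))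
  | ld α e, x, d => .seq (e.comp d (d + 1)) (.seq (.const (d + 1) 32) (.seq (.arith .mul d d (d + 1))
      (.seq (.const (d + 1) α) (.seq (.arith .add d d (d + 1)) (.load x d)))))
  | inp e, x, d => .seq (e.comp d (d + 1)) (.read x d)

/-- The number of steps of a compiled expression. -/
def Ex.cost : Ex → ℕ
  | c _ => 1
  | v _ => 2
  | op _ e e' => e.cost + (e'.cost + 1)
  | ld _ e => e.cost + 5
  | inp e => e.cost + 1

/-- Registers are below 100 and array names below 32. -/
def Ex.wf : Ex → Bool
  | c _ => true
  | v y => decide (y < 100)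
  | op _ e e' => e.wf && e'.wf
  | ld α e => decide (α < 32) && e.wf
  | inp e => e.wf

/-- The compiled program. Cell `i` of the array `α` is the memory cell `32 * i + α`, and the
registers from 100 on are scratch. -/
def Cmd.comp : Cmd → Program
  | skip => .skip
  | set x e => e.comp x 100
  | sto α e e' => .seq (e.comp 100 101) (.seq (.const 101 32) (.seq (.arith .mul 100 100 101)
      (.seq (.const 101 α) (.seq (.arith .add 100 100 101) (.seq (e'.comp 101 102)
        (.store 100 101))))))
  | seq p q => .seq p.comp q.comp
  | ite e e' p q => .seq (e.comp 100 101) (.seq (e'.comp 101 102) (.branch 100 101 p.comp q.comp))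
  | whil e e' p => .seq (.seq (e.comp 100 101) (e'.comp 101 102))
      (.loop 100 101 (.seq p.comp (.seq (e.comp 100 101) (e'.comp 101 102))))

/-- A bound for the number of machine steps per step of the command. -/
def Cmd.fac : Cmd → ℕ
  | skip => 1
  | set _ e => e.cost
  | sto _ e e' => e.cost + e'.cost + 5
  | seq p q => p.fac + q.fac
  | ite e e' p q => e.cost + e'.cost + 1 + p.fac + q.fac
  | whil e e' p => e.cost + e'.cost + 1 + p.fac

/-- Registers are below 100 and array names below 32. -/
def Cmd.wf : Cmd → Bool
  | skip => true
  | set x e => decide (x < 100) && e.wf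
  | sto α e e' => decide (α < 32) && e.wf && e'.wf
  | seq p q => p.wf && q.wf
  | ite e e' p q => e.wf && e'.wf && p.wf && q.wf
  | whil e e' p => e.wf && e'.wf && p.wf

/-- A machine state represents a state of the language. -/
structure Match (W : ℕ) (m : State) (s : St) : Prop where
  reg : ∀ x < 100, m.reg x = s.r x
  mem : ∀ α < 32, ∀ i, m.mem (32 * i + α) = s.a α i
  regb : ∀ x, (m.reg x).natAbs < 2 ^ W
  memb : ∀ i, (m.mem i).natAbs < 2 ^ W

theorem Match.setReg_scratch {W : ℕ} {m : State} (h : Match W m s) {x : ℕ} (hx : 100 ≤ x) {v : ℤ}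
    (hv : v.natAbs < 2 ^ W) : Match W (m.setReg x v) s where
  reg y hy := by
    rw [← h.reg y hy]
    simp [State.setReg, show y ≠ x by omega]
  mem := h.mem
  regb y := by
    by_cases hyx : y = x
    · simp [State.setReg, hyx, hv]
    · simpa [State.setReg, hyx] using h.regb y
  memb := h.memb

theorem Match.setMem {W : ℕ} {m : State} (h : Match W m s) {α i : ℕ} (hα : α < 32) {v : ℕ}
    (hv : v < 2 ^ W) : Match W (m.setMem (32 * i + α) v) (s.sto α i v) where
  reg := h.reg
  mem β hβ j := by
    have := h.mem β hβ j
    simp only [State.setMem, update_apply, St.sto_a]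
    by_cases hb : β = α
    · subst hb
      by_cases hj : j = i
      · simp [hj]
      · rw [if_neg (by omega)]
        simp [hj, this]
    · rw [if_neg (by omega)]
      simp [hb, this]
  regb := h.regb
  memb j := by
    by_cases hyx : j = 32 * i + α
    · simp [State.setMem, hyx, hv]
    · simpa [State.setMem, hyx] using h.memb j

/-- The limits of the language are within those of the machine. -/
structure Env.Fits (E : Env) (S W : ℕ) : Prop where
  bd : E.bd ≤ 2 ^ W
  cap : 32 * E.cap ≤ S
  capW : 32 * E.cap ≤ 2 ^ W
  big : 32 < 2 ^ W
  inp : ∀ v ∈ E.I, v < 2 ^ W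

theorem opEval_cast {bd : ℕ} {o : BinOp} {a b : ℕ} (h : opOk bd o a b) :
    o.eval (a : ℤ) (b : ℤ) = (opEval o a b : ℕ) := by
  cases o <;> simp [opOk, opEval, BinOp.eval] at *
  omega

theorem Ex.comp_spec {S W : ℕ} (hE : E.Fits S W) (e : Ex) :
    ∀ (m : State) (s : St) (x d : ℕ), e.wf → e.ok E s → Match W m s → x < d → 100 ≤ d →
      e.ev E s < 2 ^ W ∧
      ∃ m' : State, Exec (E.I.map fun v : ℕ => (v : ℤ)) S W (e.comp x d) m e.cost m' ∧
        m'.reg x = (e.ev E s : ℕ) ∧ (∀ y < d, y ≠ x → m'.reg y = m.reg y) ∧ m'.mem = m.mem ∧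
        (∀ y, (m'.reg y).natAbs < 2 ^ W) := by
  have upd : ∀ (m : State) (x y : ℕ) (v : ℤ), (m.setReg x v).reg y = if y = x then v else m.reg y := by
    intro m x y v
    simp [State.setReg, update_apply]
  have keep : ∀ {m m' : State} {s : St} {x d : ℕ}, Match W m s → 100 ≤ x → x < d →
      (∀ y < d, y ≠ x → m'.reg y = m.reg y) → m'.mem = m.mem →
        (∀ y, (m'.reg y).natAbs < 2 ^ W) → Match W m' s := by
    intro m m' s x d h hx hd h1 h2 h3
    exact ⟨fun y hy => by rw [h1 y (by omega) (by omega), h.reg y hy],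
      fun α hα i => by rw [h2, h.mem α hα i], h3, fun i => by rw [h2]; exact h.memb i⟩
  induction e with
  | c i =>
    intro m s x d _ hok hm hx hd
    have hi : i < 2 ^ W := lt_of_lt_of_le hok hE.bd
    refine ⟨hi, _, Exec.const m x i (by simpa using hi), by simp [upd, Ex.ev], ?_, rfl, ?_⟩
    · intro y _ hy
      simp [upd, hy]
    · intro y
      rw [upd]
      split_ifs
      · simpa using hi
      · exact hm.regb y
  | v z =>
    intro m s x d hwf hok hm hx hd
    have hz : z < 100 := by simpa [Ex.wf] using hwf
    have hreg := hm.reg z hz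
    have hb : s.r z < 2 ^ W := by
      have := hm.regb z
      rwa [hreg] at this
    have hval : BinOp.eval .add ((m.setReg d 0).reg z) ((m.setReg d 0).reg d) = (s.r z : ℕ) := by
      rw [upd, upd, if_neg (by omega), if_pos rfl, hreg]
      simp [BinOp.eval]
    refine ⟨hb, _, Exec.seq _ _ _ _ _ _ _ (Exec.const m d 0 (by simp))
      (Exec.arith _ .add x z d (by rw [hval]; simpa using hb)), ?_, ?_, rfl, ?_⟩
    · rw [hval]; simp [upd, Ex.ev]
    · intro y hyd hy
      simp [upd, hy, hyd.ne]
    · intro y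
      rw [hval, upd, upd]
      split_ifs
      · simpa using hb
      · simp
      · exact hm.regb y
  | op o e e' ih ih' =>
    intro m s x d hwf hok hm hx hd
    simp only [Ex.wf, Bool.and_eq_true] at hwf
    obtain ⟨hok1, hok2, hok3⟩ := hok
    obtain ⟨hb1, m1, hx1, hv1, hf1, hm1, hr1⟩ := ih m s d (d + 1) hwf.1 hok1 hm (by omega) (by omega)
    have hM1 : Match W m1 s := keep hm hd (by omega) hf1 hm1 hr1
    obtain ⟨hb2, m2, hx2, hv2, hf2, hm2, hr2⟩ :=
      ih' m1 s (d + 1) (d + 2) hwf.2 hok2 hM1 (by omega) (by omega)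
    have hb3 : opEval o (e.ev E s) (e'.ev E s) < 2 ^ W := by
      cases o <;> simp only [opOk, opEval] at *
      · exact hok3.trans_le hE.bd
      · omega
      · exact hok3.trans_le hE.bd
      · exact (Nat.div_le_self _ _).trans_lt hb1
      · exact (Nat.mod_le _ _).trans_lt hb1
    have hval : o.eval (m2.reg d) (m2.reg (d + 1)) = (opEval o (e.ev E s) (e'.ev E s) : ℕ) := by
      rw [hv2, hf2 d (by omega) (by omega), hv1, opEval_cast hok3]
    refine ⟨hb3, _, Exec.seq _ _ _ _ _ _ _ hx1 (Exec.seq _ _ _ _ _ _ _ hx2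
      (Exec.arith m2 o x d (d + 1) (by rw [hval]; simpa using hb3))), ?_, ?_, ?_, ?_⟩
    · rw [hval]; simp [upd, Ex.ev]
    · intro y hyd hy
      rw [upd, if_neg hy, hf2 y (by omega) (by omega), hf1 y (by omega) (by omega)]
    · change m2.mem = m.mem
      rw [hm2, hm1]
    · intro y
      rw [hval, upd]
      split_ifs
      · simpa using hb3
      · exact hr2 y
  | ld α e ih =>
    intro m s x d hwf hok hm hx hd
    simp only [Ex.wf, Bool.and_eq_true, decide_eq_true_eq] at hwf
    obtain ⟨hok1, hcap⟩ := hok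
    obtain ⟨hb1, m1, hx1, hv1, hf1, hm1, hr1⟩ := ih m s d (d + 1) hwf.2 hok1 hm (by omega) (by omega)
    set i := e.ev E s
    have hW := hE.capW
    have hS := hE.cap
    have hbig := hE.big
    have h1 : BinOp.eval .mul ((m1.setReg (d + 1) 32).reg d) ((m1.setReg (d + 1) 32).reg (d + 1))
        = (i * 32 : ℕ) := by
      rw [upd, upd, if_neg (by omega), if_pos rfl, hv1]
      simp [BinOp.eval]
    set m3 := ((m1.setReg (d + 1) 32).setReg d (i * 32 : ℕ)).setReg (d + 1) (α : ℤ) with hm3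
    have h2 : BinOp.eval .add (m3.reg d) (m3.reg (d + 1)) = (32 * i + α : ℕ) := by
      rw [hm3, upd, upd, if_neg (by omega), if_pos rfl, upd, if_pos rfl]
      simp [BinOp.eval]
      ring
    have hld : s.a α i < 2 ^ W := by
      have := hm.memb (32 * i + α)
      rwa [hm.mem α hwf.1 i] at this
    refine ⟨hld, _, Exec.seq _ _ _ _ _ _ _ hx1 (Exec.seq _ _ _ _ _ _ _
      (Exec.const _ (d + 1) 32 (by simpa using hbig)) (Exec.seq _ _ _ _ _ _ _
      (Exec.arith _ .mul d d (d + 1) (by rw [h1]; simp only [Int.natAbs_natCast]; omega))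
      (Exec.seq _ _ _ _ _ _ _ (Exec.const _ (d + 1) (α : ℤ)
        (by simp only [Int.natAbs_natCast]; omega)) (Exec.seq _ _ _ _ _ _ _
      (Exec.arith _ .add d d (d + 1) ?_) (Exec.load _ x d (32 * i + α) ?_ ?_))))), ?_, ?_, ?_, ?_⟩
    · rw [h1, h2]; simp only [Int.natAbs_natCast]; omega
    · rw [h1, h2]; simp [upd]
    · omega
    · rw [h1, h2]
      change _ = ((s.a α i : ℕ) : ℤ)
      rw [← hm.mem α hwf.1 i, ← hm1, upd, if_pos rfl]
      rfl
    · intro y hyd hy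
      rw [upd, if_neg hy, upd, if_neg (by omega), upd, if_neg (by omega), upd, if_neg (by omega), upd,
        if_neg (by omega), hf1 y (by omega) (by omega)]
    · exact hm1
    · intro y
      rw [h1, h2]
      simp only [upd]
      split_ifs
      · change (m1.mem (32 * i + α)).natAbs < _
        rw [hm1]
        exact hm.memb _
      · simp only [Int.natAbs_natCast]; omega
      · simp only [Int.natAbs_natCast]; omega
      · exact hr1 y
  | inp e ih =>
    intro m s x d hwf hok hm hx hd
    obtain ⟨hok1, hlen⟩ := hok
    obtain ⟨hb1, m1, hx1, hv1, hf1, hm1, hr1⟩ := ih m s d (d + 1) hwf hok1 hm (by omega) (by omega)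
    have hb : E.I.getD (e.ev E s) 0 < 2 ^ W := by
      rw [List.getD_eq_getElem _ _ hlen]
      exact hE.inp _ (List.getElem_mem _)
    refine ⟨hb, _, Exec.seq _ _ _ _ _ _ _ hx1 (Exec.read _ x d (e.ev E s)
      ((E.I.getD (e.ev E s) 0 : ℕ) : ℤ) hv1 ?_ (by simpa using hb)), ?_, ?_, hm1, ?_⟩
    · rw [List.getD_eq_getElem _ _ hlen]
      simp [hlen]
    · simp [upd, Ex.ev]
    · intro y hyd hy
      rw [upd, if_neg hy, hf1 y (by omega) (by omega)]
    · intro y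
      rw [upd]
      split_ifs
      · simpa using hb
      · exact hr1 y

/-- Evaluation of the two sides of a condition into the first two scratch registers. -/
theorem cond_comp_spec {S W : ℕ} (hE : E.Fits S W) (e e' : Ex) (m : State) (s : St) (hwf : e.wf)
    (hwf' : e'.wf) (hok : e.ok E s) (hok' : e'.ok E s) (hm : Match W m s) :
    ∃ m' : State, Match W m' s ∧ m'.reg 100 = (e.ev E s : ℕ) ∧ m'.reg 101 = (e'.ev E s : ℕ) ∧
      ∃ m1, Exec (E.I.map fun v : ℕ => (v : ℤ)) S W (e.comp 100 101) m e.cost m1 ∧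
      Exec (E.I.map fun v : ℕ => (v : ℤ)) S W (e'.comp 101 102) m1 e'.cost m' := by
  obtain ⟨-, m1, hx1, hv1, hf1, hm1, hr1⟩ :=
    e.comp_spec hE m s 100 101 hwf hok hm (by omega) (by omega)
  have hM1 : Match W m1 s :=
    ⟨fun y hy => by rw [hf1 y (by omega) (by omega), hm.reg y hy],
      fun α hα i => by rw [hm1, hm.mem α hα i], hr1, fun i => by rw [hm1]; exact hm.memb i⟩
  obtain ⟨-, m2, hx2, hv2, hf2, hm2, hr2⟩ :=
    e'.comp_spec hE m1 s 101 102 hwf' hok' hM1 (by omega) (by omega)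
  exact ⟨m2, ⟨fun y hy => by rw [hf2 y (by omega) (by omega), hM1.reg y hy],
      fun α hα i => by rw [hm2, hM1.mem α hα i], hr2, fun i => by rw [hm2]; exact hM1.memb i⟩,
      by rw [hf2 100 (by omega) (by omega), hv1], hv2, m1, hx1, hx2⟩

/-- Compilation is correct: what holds of a command by its weakest precondition holds of the
compiled program, up to a constant factor in the running time. -/
theorem Cmd.comp_spec {S W : ℕ} (hE : E.Fits S W) (p : Cmd) :
    ∀ (m : State) (s : St) (Q : St → ℕ → Prop), p.wf → wp E p s Q → Match W m s →
      ∃ (m' : State) (s' : St) (t t' : ℕ),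
        Exec (E.I.map fun v : ℕ => (v : ℤ)) S W p.comp m t m' ∧ t ≤ p.fac * t' ∧ Q s' t' ∧
          Match W m' s' := by
  induction p with
  | skip =>
    intro m s Q _ h hm
    exact ⟨m, s, 1, 1, Exec.skip _, by simp [Cmd.fac], h, hm⟩
  | set x e =>
    intro m s Q hwf h hm
    simp only [Cmd.wf, Bool.and_eq_true, decide_eq_true_eq] at hwf
    obtain ⟨hb, m1, hx1, hv1, hf1, hm1, hr1⟩ :=
      e.comp_spec hE m s x 100 hwf.2 h.1 hm (by omega) le_rfl
    refine ⟨m1, _, _, 1, hx1, by simp [Cmd.fac], h.2, ?_, ?_, hr1, ?_⟩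
    · intro y hy
      simp only [St.set_r]
      split_ifs with hyx
      · rw [hyx, hv1]
      · rw [hf1 y hy hyx, hm.reg y hy]
    · intro α hα i
      rw [hm1, hm.mem α hα i]
      rfl
    · intro i
      rw [hm1]
      exact hm.memb i
  | sto α e e' =>
    intro m s Q hwf h hm
    simp only [Cmd.wf, Bool.and_eq_true, decide_eq_true_eq] at hwf
    obtain ⟨hok, hok', hcap, hQ⟩ := h
    obtain ⟨-, m1, hx1, hv1, hf1, hm1, hr1⟩ :=
      e.comp_spec hE m s 100 101 hwf.1.2 hok hm (by omega) (by omega)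
    have hM1 : Match W m1 s :=
      ⟨fun y hy => by rw [hf1 y (by omega) (by omega), hm.reg y hy],
        fun α hα i => by rw [hm1, hm.mem α hα i], hr1, fun i => by rw [hm1]; exact hm.memb i⟩
    set i := e.ev E s
    have hW := hE.capW
    have hS := hE.cap
    have hbig := hE.big
    have upd : ∀ (m : State) (x y : ℕ) (v : ℤ),
        (m.setReg x v).reg y = if y = x then v else m.reg y := by
      intro m x y v
      simp [State.setReg, update_apply]
    have h1 : BinOp.eval .mul ((m1.setReg 101 32).reg 100) ((m1.setReg 101 32).reg 101)
        = (i * 32 : ℕ) := by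
      rw [upd, upd, if_neg (by omega), if_pos rfl, hv1]
      simp [BinOp.eval]
    set m3 := ((m1.setReg 101 32).setReg 100 (i * 32 : ℕ)).setReg 101 (α : ℤ) with hm3
    have h2 : BinOp.eval .add (m3.reg 100) (m3.reg 101) = (32 * i + α : ℕ) := by
      rw [hm3, upd, upd, if_neg (by omega), if_pos rfl, upd, if_pos rfl]
      simp [BinOp.eval]
      ring
    have hM3 : Match W (m3.setReg 100 ((32 * i + α : ℕ) : ℤ)) s := by
      refine Match.setReg_scratch (Match.setReg_scratch (Match.setReg_scratch
        (Match.setReg_scratch hM1 (by omega) ?_) (by omega) ?_) (by omega) ?_) (by omega) ?_ <;>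
      first | simpa using hbig | (simp only [Int.natAbs_natCast]; omega)
    obtain ⟨hb, m4, hx4, hv4, hf4, hm4, hr4⟩ :=
      e'.comp_spec hE _ s 101 102 hwf.2 hok' hM3 (by omega) (by omega)
    have hM4 : Match W m4 s :=
      ⟨fun y hy => by rw [hf4 y (by omega) (by omega), hM3.reg y hy],
        fun α hα i => by rw [hm4, hM3.mem α hα i], hr4, fun i => by rw [hm4]; exact hM3.memb i⟩
    have hx3 : Exec (E.I.map fun v : ℕ => (v : ℤ)) S W (.seq (e'.comp 101 102) (.store 100 101))
        (m3.setReg 100 ((32 * i + α : ℕ) : ℤ)) (e'.cost + 1)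
        (m4.setMem (32 * i + α) (m4.reg 101)) := by
      refine Exec.seq _ _ _ _ _ _ _ hx4 (Exec.store m4 100 101 (32 * i + α) ?_ (by omega))
      rw [hf4 100 (by omega) (by omega), upd, if_pos rfl]
    have hx5 := Exec.arith (inp := E.I.map fun v : ℕ => (v : ℤ)) (S := S) (W := W) m3 .add 100 100 101
      (by rw [h2]; simp only [Int.natAbs_natCast]; omega)
    rw [h2] at hx5
    have hx6 := Exec.arith (inp := E.I.map fun v : ℕ => (v : ℤ)) (S := S) (W := W)
      (m1.setReg 101 32) .mul 100 100 101 (by rw [h1]; simp only [Int.natAbs_natCast]; omega)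
    rw [h1] at hx6
    refine ⟨_, _, _, 1, Exec.seq _ _ _ _ _ _ _ hx1 (Exec.seq _ _ _ _ _ _ _
      (Exec.const _ 101 32 (by simpa using hbig)) (Exec.seq _ _ _ _ _ _ _ hx6
      (Exec.seq _ _ _ _ _ _ _ (Exec.const _ 101 (α : ℤ)
        (by simp only [Int.natAbs_natCast]; omega)) (Exec.seq _ _ _ _ _ _ _ hx5 hx3)))), ?_, hQ, ?_⟩
    · simp only [Cmd.fac]; omega
    · rw [hv4]
      exact hM4.setMem hwf.1.1 hb
  | seq p q ihp ihq =>
    intro m s Q hwf h hm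
    simp only [Cmd.wf, Bool.and_eq_true] at hwf
    obtain ⟨m1, s1, t1, t1', hx1, ht1, h1, hM1⟩ := ihp m s _ hwf.1 h hm
    obtain ⟨m2, s2, t2, t2', hx2, ht2, h2, hM2⟩ := ihq m1 s1 _ hwf.2 h1 hM1
    refine ⟨m2, s2, _, _, Exec.seq _ _ _ _ _ _ _ hx1 hx2, ?_, h2, hM2⟩
    simp only [Cmd.fac]
    nlinarith [Nat.zero_le (q.fac * t1'), Nat.zero_le (p.fac * t2')]
  | ite e e' p q ihp ihq =>
    intro m s Q hwf h hm
    simp only [Cmd.wf, Bool.and_eq_true] at hwf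
    obtain ⟨⟨⟨hwe, hwe'⟩, hwp⟩, hwq⟩ := hwf
    obtain ⟨hok, hok', hp, hq⟩ := h
    obtain ⟨m1, hM1, hv, hv', m0, hx0, hx1⟩ := cond_comp_spec hE e e' m s hwe hwe' hok hok' hm
    by_cases hc : e.ev E s < e'.ev E s
    · obtain ⟨m2, s2, t2, t2', hx2, ht2, h2, hM2⟩ := ihp m1 s _ hwp (hp hc) hM1
      refine ⟨m2, s2, _, _, Exec.seq _ _ _ _ _ _ _ hx0 (Exec.seq _ _ _ _ _ _ _ hx1
        (Exec.branch_true _ _ _ _ _ _ _ (by rw [hv, hv']; exact_mod_cast hc) hx2)), ?_, h2, hM2⟩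
      simp only [Cmd.fac]
      nlinarith [Nat.zero_le (q.fac * (t2' + 1)), Nat.zero_le (p.fac),
        Nat.zero_le ((e.cost + e'.cost + 1) * t2')]
    · obtain ⟨m2, s2, t2, t2', hx2, ht2, h2, hM2⟩ := ihq m1 s _ hwq (hq hc) hM1
      refine ⟨m2, s2, _, _, Exec.seq _ _ _ _ _ _ _ hx0 (Exec.seq _ _ _ _ _ _ _ hx1
        (Exec.branch_false _ _ _ _ _ _ _ (by rw [hv, hv']; exact_mod_cast hc) hx2)), ?_, h2, hM2⟩
      simp only [Cmd.fac]
      nlinarith [Nat.zero_le (p.fac * (t2' + 1)), Nat.zero_le (q.fac),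
        Nat.zero_le ((e.cost + e'.cost + 1) * t2')]
  | whil e e' p ih =>
    intro m s Q hwf h hm
    simp only [Cmd.wf, Bool.and_eq_true] at hwf
    obtain ⟨⟨hwe, hwe'⟩, hwp⟩ := hwf
    obtain ⟨f, hf⟩ := h
    -- the condition is evaluated before the loop and at the end of its body
    have key : ∀ (f : ℕ) (m : State) (s : St) (Q : St → ℕ → Prop),
        iterWp (fun s => e.ev E s < e'.ev E s) (fun s => e.ok E s ∧ e'.ok E s) (wp E p) f s Q →
        Match W m s → ∃ (m1 m' : State) (s' : St) (t t' : ℕ),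
          Exec (E.I.map fun v : ℕ => (v : ℤ)) S W
            (.seq (e.comp 100 101) (e'.comp 101 102)) m (e.cost + e'.cost) m1 ∧
          Exec (E.I.map fun v : ℕ => (v : ℤ)) S W
            (.loop 100 101 (.seq p.comp (.seq (e.comp 100 101) (e'.comp 101 102)))) m1 t m' ∧
          e.cost + e'.cost + t ≤ (e.cost + e'.cost + 1 + p.fac) * t' ∧ Q s' t' ∧ Match W m' s' := by
      intro f
      induction f with
      | zero => intro m s Q h; exact h.elim
      | succ f ihf =>
        intro m s Q h hm
        obtain ⟨⟨hok, hok'⟩, h1, h2⟩ := h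
        obtain ⟨m1, hM1, hv, hv', m0, hx0, hx1⟩ := cond_comp_spec hE e e' m s hwe hwe' hok hok' hm
        by_cases hc : e.ev E s < e'.ev E s
        · obtain ⟨m2, s2, t2, t2', hx2, ht2, h2, hM2⟩ := ih m1 s _ hwp (h1 hc) hM1
          obtain ⟨m3, m4, s4, t4, t4', hx3, hx4, ht4, h4, hM4⟩ := ihf m2 s2 _ h2 hM2
          refine ⟨m1, m4, s4, _, _, Exec.seq _ _ _ _ _ _ _ hx0 hx1,
            Exec.loop_true _ _ _ _ _ _ _ _ (by rw [hv, hv']; exact_mod_cast hc)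
              (Exec.seq _ _ _ _ _ _ _ hx2 hx3) hx4, ?_, h4, hM4⟩
          nlinarith [Nat.zero_le ((e.cost + e'.cost + 1) * t2'), Nat.zero_le (p.fac)]
        · refine ⟨m1, m1, s, 1, 1, Exec.seq _ _ _ _ _ _ _ hx0 hx1,
            Exec.loop_false _ _ _ _ (by rw [hv, hv']; exact_mod_cast hc), ?_, h2 hc, hM1⟩
          omega
    obtain ⟨m1, m', s', t, t', hx1, hx2, ht, hQ, hM⟩ := key f m s Q hf hm
    exact ⟨m', s', _, t', Exec.seq _ _ _ _ _ _ _ hx1 hx2, by simpa only [Cmd.fac] using ht, hQ, hM⟩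

end ConnVC

/-! ### Bit masks -/

namespace ConnVC

open Finset Function

variable {i j x y z : ℕ} {A B : Finset ℕ}

/-- The set of the positions of the binary digits `1`. -/
def bs (y : ℕ) : Finset ℕ := (range y).filter fun i => y.testBit i

theorem mem_bs : i ∈ bs y ↔ y.testBit i = true := by
  simp only [bs, mem_filter, mem_range, and_iff_right_iff_imp]
  intro h
  exact (Nat.lt_two_pow_self).trans_le (Nat.ge_two_pow_of_testBit h)

theorem bs_injective (h : bs x = bs y) : x = y := by
  refine Nat.eq_of_testBit_eq fun i => ?_
  have := Finset.ext_iff.1 h i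
  simp only [mem_bs] at this
  grind

@[simp] theorem bs_zero : bs 0 = ∅ := rfl

theorem bs_eq_empty : bs y = ∅ ↔ y = 0 :=
  ⟨fun h => bs_injective (by simpa using h), fun h => by simp [h]⟩

theorem bs_nonempty : (bs y).Nonempty ↔ y ≠ 0 := by
  rw [nonempty_iff_ne_empty, Ne, bs_eq_empty]

theorem bs_land (x y : ℕ) : bs (x &&& y) = bs x ∩ bs y := by
  ext i; simp [mem_bs]

theorem bs_lor (x y : ℕ) : bs (x ||| y) = bs x ∪ bs y := by
  ext i; simp [mem_bs]

theorem land_eq_left : x &&& y = x ↔ bs x ⊆ bs y := by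
  rw [← inter_eq_left, ← bs_land]
  exact ⟨fun h => by rw [h], bs_injective⟩

theorem land_ne_zero : x &&& y ≠ 0 ↔ (bs x ∩ bs y).Nonempty := by
  rw [← bs_land, bs_nonempty]

theorem lt_two_pow_iff {c : ℕ} : y < 2 ^ c ↔ bs y ⊆ range c := by
  constructor
  · intro h i hi
    rw [mem_bs] at hi
    by_contra hc
    rw [mem_range, not_lt] at hc
    rw [Nat.testBit_lt_two_pow (h.trans_le (Nat.pow_le_pow_right (by omega) hc))] at hi
    simp at hi
  · intro h
    refine Nat.lt_pow_two_of_testBit _ fun i hi => ?_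
    by_contra hc
    rw [Bool.not_eq_false, ← mem_bs] at hc
    grind

theorem bs_two_pow (j : ℕ) : bs (2 ^ j) = {j} := by
  ext i; simp [mem_bs, Nat.testBit_two_pow, eq_comm]

theorem lor_add_land (x y : ℕ) : (x ||| y) + (x &&& y) = x + y := by
  induction x using Nat.binaryRec generalizing y with
  | zero => simp
  | bit b x ih =>
    induction y using Nat.binaryRec with
    | zero => simp
    | bit b' y _ =>
      rw [Nat.lor_bit, Nat.land_bit]
      have := ih y
      cases b <;> cases b' <;> simp only [Nat.bit_val, Bool.toNat_true, Bool.toNat_false,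
        Bool.or_self, Bool.and_self, Bool.or_true, Bool.or_false, Bool.and_true, Bool.and_false] <;>
      omega

theorem bs_add_sub_land (x y : ℕ) : bs (x + y - (x &&& y)) = bs x ∪ bs y := by
  rw [← bs_lor]
  congr 1
  have := lor_add_land x y
  omega

theorem bs_add_two_pow (h : j ∉ bs x) : bs (x + 2 ^ j) = insert j (bs x) := by
  have h1 := bs_add_sub_land x (2 ^ j)
  have : x &&& 2 ^ j = 0 := by
    rw [← bs_eq_empty, bs_land, bs_two_pow]
    grind
  rw [this, Nat.sub_zero, bs_two_pow] at h1
  grind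

theorem bs_two_pow_sub_one (c : ℕ) : bs (2 ^ c - 1) = range c := by
  ext i; simp [mem_bs, Nat.testBit_two_pow_sub_one]

theorem mem_bs_iff_div : i ∈ bs y ↔ y / 2 ^ i % 2 = 1 := by
  rw [mem_bs, Nat.testBit_eq_decide_div_mod_eq]
  simp

theorem succ_mem_bs : i + 1 ∈ bs y ↔ i ∈ bs (y / 2) := by
  rw [mem_bs, mem_bs, Nat.testBit_succ]

theorem zero_mem_bs : 0 ∈ bs y ↔ y % 2 = 1 := by
  rw [mem_bs_iff_div]; simp

/-- The number with a given set of binary digits `1`. -/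
def ofBits (A : Finset ℕ) : ℕ := ∑ i ∈ A, 2 ^ i

theorem bs_ofBits (A : Finset ℕ) : bs (ofBits A) = A := by
  induction A using Finset.induction_on with
  | empty => simp [ofBits]
  | insert a A ha ih =>
    have : ofBits (insert a A) = ofBits A + 2 ^ a := by
      rw [ofBits, sum_insert ha, add_comm, ofBits]
    rw [this, bs_add_two_pow (by rwa [ih]), ih]

theorem ofBits_bs (y : ℕ) : ofBits (bs y) = y := bs_injective (bs_ofBits _)

theorem sum_range_two_pow {M : Type*} [AddCommMonoid M] (c : ℕ) (f : Finset ℕ → M) :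
    ∑ y ∈ range (2 ^ c), f (bs y) = ∑ Y ∈ (range c).powerset, f Y := by
  refine sum_bij' (fun y _ => bs y) (fun Y _ => ofBits Y) ?_ ?_ ?_ ?_ ?_
  · intro y hy
    exact mem_powerset.2 (lt_two_pow_iff.1 (mem_range.1 hy))
  · intro Y hY
    rw [mem_range, lt_two_pow_iff, bs_ofBits]
    grind
  · intro y _; exact ofBits_bs y
  · intro Y _; exact bs_ofBits Y
  · intro y _; rfl

/-! ### Connected vertex covers in terms of cuts -/

/-- The lists `N u` are the adjacency lists of a simple graph with vertices `0, …, n - 1`. -/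
structure Gr (n : ℕ) (N : ℕ → List ℕ) : Prop where
  symm : ∀ u w, w ∈ N u → u ∈ N w
  irr : ∀ u, u ∉ N u
  lt : ∀ u w, w ∈ N u → w < n
  nodup : ∀ u, (N u).Nodup

theorem Gr.lt' {n : ℕ} {N : ℕ → List ℕ} (h : Gr n N) {u w : ℕ} (hw : w ∈ N u) : u < n :=
  h.lt _ _ (h.symm _ _ hw)

/-- `X` is connected: no proper nonempty part of it is closed under taking neighbours. -/
def Conn (N : ℕ → List ℕ) (X : Finset ℕ) : Prop :=
  ∀ Z ⊆ X, Z.Nonempty → (∀ u ∈ Z, ∀ w ∈ X, w ∈ N u → w ∈ Z) → Z = X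

/-- `X` is a connected vertex cover. -/
structure CVC (n : ℕ) (N : ℕ → List ℕ) (X : Finset ℕ) : Prop where
  sub : X ⊆ range n
  cov : ∀ u w, w ∈ N u → u ∈ X ∨ w ∈ X
  conn : Conn N X

/-- Vertices that are not isolated can be added to a connected vertex cover. -/
theorem CVC.union {n : ℕ} {N : ℕ → List ℕ} (hG : Gr n N) {X R : Finset ℕ} (hX : CVC n N X)
    (hR : ∀ u ∈ R, N u ≠ []) : CVC n N (X ∪ R) where
  sub := by
    refine union_subset hX.sub fun u hu => ?_
    obtain ⟨w, hw⟩ := List.exists_mem_of_ne_nil _ (hR u hu)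
    exact mem_range.2 (hG.lt' hw)
  cov u w h := by
    rcases hX.cov u w h with h | h <;> simp [h]
  conn := by
    have key : ∀ u ∈ X ∪ R, u ∉ X → ∃ w ∈ N u, w ∈ X := by
      intro u hu hx
      obtain ⟨w, hw⟩ := List.exists_mem_of_ne_nil _ (hR u ((mem_union.1 hu).resolve_left hx))
      exact ⟨w, hw, (hX.cov u w hw).resolve_left hx⟩
    intro Z hZ hne hcl
    have h1 : Z ∩ X = X := by
      refine hX.conn _ inter_subset_right ?_ ?_
      · obtain ⟨z, hz⟩ := hne
        by_cases hx : z ∈ X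
        · exact ⟨z, mem_inter.2 ⟨hz, hx⟩⟩
        · obtain ⟨w, hw, hwx⟩ := key z (hZ hz) hx
          exact ⟨w, mem_inter.2 ⟨hcl z hz w (mem_union_left _ hwx) hw, hwx⟩⟩
      grind
    refine Finset.Subset.antisymm hZ fun u hu => ?_
    by_cases hx : u ∈ X
    · grind
    · obtain ⟨w, hw, hwx⟩ := key u hu hx
      exact hcl w (mem_of_mem_inter_left (h1.symm ▸ hwx)) u hu (hG.symm _ _ hw)

/-- The adjacency lists with natural numbers in place of elements of `Fin n`. -/
def natAdj {n : ℕ} (adj : Fin n → List (Fin n)) (v : ℕ) : List ℕ :=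
  if h : v < n then (adj ⟨v, h⟩).map Fin.val else []

theorem mem_natAdj {n : ℕ} {G : SimpleGraph (Fin n)} {adj : Fin n → List (Fin n)}
    (h : IsAdjacencyList G adj) {u w : ℕ} :
    w ∈ natAdj adj u ↔ ∃ (hu : u < n) (hw : w < n), G.Adj ⟨u, hu⟩ ⟨w, hw⟩ := by
  unfold natAdj
  split_ifs with hu
  · simp only [List.mem_map, (h ⟨u, hu⟩).2]
    grind
  · simp [hu]

theorem gr_natAdj {n : ℕ} {G : SimpleGraph (Fin n)} {adj : Fin n → List (Fin n)}
    (h : IsAdjacencyList G adj) : Gr n (natAdj adj) where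
  symm u w hw := by
    rw [mem_natAdj h] at *
    obtain ⟨a, b, c⟩ := hw
    exact ⟨b, a, c.symm⟩
  irr u hu := by
    rw [mem_natAdj h] at hu
    obtain ⟨_, _, c⟩ := hu
    exact c.ne rfl
  lt u w hw := by
    rw [mem_natAdj h] at hw
    exact hw.2.1
  nodup u := by
    unfold natAdj
    split_ifs with hu
    · exact (h ⟨u, hu⟩).1.map Fin.val_injective
    · simp

theorem conn_iff_preconnected {n : ℕ} {G : SimpleGraph (Fin n)} {adj : Fin n → List (Fin n)}
    (h : IsAdjacencyList G adj) (X : Finset (Fin n)) :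
    Conn (natAdj adj) (X.map Fin.valEmbedding) ↔ (G.induce (X : Set (Fin n))).Preconnected := by
  classical
  constructor
  · intro hc x y
    -- the vertices that are reachable from `x` form a closed set
    set Z : Finset (Fin n) :=
      X.filter fun z => ∃ hz : z ∈ (X : Set (Fin n)), (G.induce (X : Set (Fin n))).Reachable x ⟨z, hz⟩
     
    have := hc (Z.map Fin.valEmbedding) (by grind)
      ⟨x.1, mem_map_of_mem Fin.valEmbedding (mem_filter.2
        ⟨x.2, x.2, SimpleGraph.Reachable.refl _⟩)⟩ ?_
    · have hZ : Z = X := map_injective _ this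
      grind
    · intro u hu w hw hN
      simp only [mem_map, Fin.valEmbedding_apply] at hu hw ⊢
      obtain ⟨u', hu', rfl⟩ := hu
      obtain ⟨w', hw', rfl⟩ := hw
      refine ⟨w', ?_, rfl⟩
      obtain ⟨hux, hr⟩ := (mem_filter.1 hu').2
      obtain ⟨_, _, hadj⟩ := (mem_natAdj h).1 hN
      refine mem_filter.2 ⟨hw', hw', hr.trans ?_⟩
      exact SimpleGraph.Adj.reachable (by simpa using hadj)
  · intro hp Z hZ hne hcl
    refine Finset.Subset.antisymm hZ fun w hw => ?_
    obtain ⟨z, hz⟩ := hne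
    obtain ⟨z', hz', rfl⟩ := mem_map.1 (hZ hz)
    obtain ⟨w', hw', rfl⟩ := mem_map.1 hw
    obtain ⟨p⟩ := hp ⟨z', hz'⟩ ⟨w', hw'⟩
    have : ∀ (a b : (X : Set (Fin n))), (G.induce (X : Set (Fin n))).Walk a b →
        (a.1 : ℕ) ∈ Z → (b.1 : ℕ) ∈ Z := by
      intro a b p
      induction p with
      | nil => exact id
      | @cons a b c hab _ ih =>
        intro ha
        refine ih (hcl _ ha _ (mem_map_of_mem _ b.2) ((mem_natAdj h).2 ⟨a.1.2, b.1.2, ?_⟩))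
        simpa using hab
    exact this _ _ p hz

theorem cvc_iff {n : ℕ} {G : SimpleGraph (Fin n)} {adj : Fin n → List (Fin n)}
    (h : IsAdjacencyList G adj) (X : Finset (Fin n)) :
    CVC n (natAdj adj) (X.map Fin.valEmbedding) ↔ IsConnectedVertexCover G (X : Set (Fin n)) := by
  have hm : ∀ v : Fin n, (v : ℕ) ∈ X.map Fin.valEmbedding ↔ v ∈ X := by
    intro v
    simp [Fin.val_inj]
  rw [IsConnectedVertexCover, ← conn_iff_preconnected h]
  constructor
  · rintro ⟨_, h2, h3⟩
    refine ⟨?_, h3⟩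
    intro u w huw
    have := h2 u w ((mem_natAdj h).2 ⟨u.2, w.2, huw⟩)
    simpa [hm] using this
  · rintro ⟨h2, h3⟩
    refine ⟨?_, ?_, h3⟩
    · intro v hv
      obtain ⟨w, _, rfl⟩ := mem_map.1 hv
      simp
    · intro u w huw
      obtain ⟨hu, hw, hadj⟩ := (mem_natAdj h).1 huw
      have := h2 hadj
      grind

open Classical in
/-- The connected vertex covers, as sets of natural numbers. -/
noncomputable def cvcs (n : ℕ) (N : ℕ → List ℕ) : Finset (Finset ℕ) :=
  (range n).powerset.filter fun X => CVC n N X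

theorem mem_cvcs {n : ℕ} {N : ℕ → List ℕ} {X : Finset ℕ} : X ∈ cvcs n N ↔ CVC n N X := by
  classical
  simp only [cvcs, mem_filter, mem_powerset, and_iff_right_iff_imp]
  exact CVC.sub

theorem num_eq {n : ℕ} {G : SimpleGraph (Fin n)} {adj : Fin n → List (Fin n)}
    (h : IsAdjacencyList G adj) (k : ℕ) :
    numConnectedVertexCovers G k = ((cvcs n (natAdj adj)).filter fun X => X.card ≤ k).card := by
  classical
  rw [numConnectedVertexCovers, ← Set.ncard_coe_finset]
  refine Set.ncard_congr (fun X _ => X.map Fin.valEmbedding) ?_ ?_ ?_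
  · rintro X ⟨h1, h2⟩
    simp [mem_cvcs, cvc_iff h, h1, h2]
  · simp
  · intro Y hY
    simp only [coe_filter, Set.mem_ofPred_eq, mem_cvcs] at hY
    have hY' : (Y.attachFin fun v hv => mem_range.1 (hY.1.sub hv)).map Fin.valEmbedding = Y := by
      ext v
      simp
    refine ⟨_, ⟨?_, ?_⟩, hY'⟩
    · rw [← cvc_iff h, hY']; exact hY.1
    grind

end ConnVC

/-! ### Connected vertex covers and connected hypergraphs -/

namespace ConnVC

open Finset Function

variable {n s r u v w i j c x : ℕ} {N : ℕ → List ℕ} {ℓ par κ : ℕ → ℕ} {A X Y B : Finset ℕ}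

/-- The first `s` values of `ℓ` list a connected vertex cover without repetition, each vertex but
the first being adjacent to an earlier one, its parent. -/
structure Cover (n : ℕ) (N : ℕ → List ℕ) (ℓ : ℕ → ℕ) (s : ℕ) (par : ℕ → ℕ) : Prop where
  inj : ∀ i < s, ∀ j < s, ℓ i = ℓ j → i = j
  lt : ∀ i < s, ℓ i < n
  par : ∀ i, 0 < i → i < s → par i < i ∧ ℓ (par i) ∈ N (ℓ i)
  cov : ∀ u w, w ∈ N u → (∃ i < s, ℓ i = u) ∨ ∃ i < s, ℓ i = w

/-- The positions of the neighbours of `v`. The vertices `ℓ 0, …, ℓ r` share the position `0`, and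
`ℓ (r + j)` has the position `j`. -/
def posSet (N : ℕ → List ℕ) (ℓ : ℕ → ℕ) (s r v : ℕ) : Finset ℕ :=
  ((range s).filter fun i => ℓ i ∈ N v).image fun i => i - r

theorem mem_posSet :
    j ∈ posSet N ℓ s r v ↔ ∃ i < s, ℓ i ∈ N v ∧ i - r = j := by
  simp [posSet, and_assoc]

/-- `κ` labels the tree components ("units") of the set `A` of positions with `0, …, c - 1`. -/
structure Units (A : Finset ℕ) (par : ℕ → ℕ) (c : ℕ) (κ : ℕ → ℕ) : Prop where
  lt : ∀ j ∈ A, κ j < c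
  surj : ∀ u < c, ∃ j ∈ A, κ j = u
  tree : ∀ j ∈ A, 0 < j → par j ∈ A → κ j = κ (par j)
  lead : ∀ j ∈ A, ∀ j' ∈ A, (j = 0 ∨ par j ∉ A) → (j' = 0 ∨ par j' ∉ A) → κ j = κ j' → j = j'

/-- The units that a set of positions meets. -/
def tau (A : Finset ℕ) (κ : ℕ → ℕ) (T : Finset ℕ) : Finset ℕ := (T ∩ A).image κ

theorem mem_tau {T : Finset ℕ} :
    u ∈ tau A κ T ↔ ∃ j ∈ T, j ∈ A ∧ κ j = u := by
  simp [tau, and_assoc]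

/-- No hyperedge crosses the boundary of `Y`. -/
def Closed (H : Set (Finset ℕ)) (Y : Finset ℕ) : Prop := ∀ h ∈ H, (h ∩ Y).Nonempty → h ⊆ Y

theorem Closed.compl {H : Set (Finset ℕ)} {V : Finset ℕ} (h : Closed H Y) (hV : ∀ h ∈ H, h ⊆ V) :
    Closed H (V \ Y) := by
  rintro e he ⟨a, ha⟩ b hb
  rw [mem_inter, mem_sdiff] at ha
  refine mem_sdiff.2 ⟨hV e he hb, fun hbY => ha.2.2 ?_⟩
  exact h e he ⟨b, mem_inter.2 ⟨hb, hbY⟩⟩ ha.1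

/-- The hypergraph `H` on the vertex set `V` is connected. -/
def HConn (H : Set (Finset ℕ)) (V : Finset ℕ) : Prop :=
  ∀ Y ⊆ V, 0 ∈ Y → Closed H Y → Y = V

/-- The masks that enter the hypergraph whatever the rest of the cover is: those of the edges
inside of the list, and those of the vertices outside that have a neighbour outside of `A`. -/
def Mand (n : ℕ) (N : ℕ → List ℕ) (ℓ : ℕ → ℕ) (s r : ℕ) (A : Finset ℕ) : Set (Finset ℕ) :=
  {T | (∃ i < s, ∃ j < s, ℓ j ∈ N (ℓ i) ∧ T = {i - r, j - r}) ∨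
    ∃ v < n, (∀ i < s, ℓ i ≠ v) ∧ ¬ posSet N ℓ s r v ⊆ A ∧ T = posSet N ℓ s r v}

/-- Every edge inside of the list and every vertex outside has a neighbour in `A`. -/
def Hits (n : ℕ) (N : ℕ → List ℕ) (ℓ : ℕ → ℕ) (s r : ℕ) (A : Finset ℕ) : Prop :=
  (∀ i < s, ∀ j < s, ℓ j ∈ N (ℓ i) → i - r ∈ A ∨ j - r ∈ A) ∧
  ∀ v < n, (∀ i < s, ℓ i ≠ v) → (posSet N ℓ s r v).Nonempty → (posSet N ℓ s r v ∩ A).Nonempty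

/-- A closed part of `X` contains with a vertex the first vertex of its unit. -/
theorem Cover.leader (hC : Cover n N ℓ s par) (hG : Gr n N) {Z : Finset ℕ}
    (hU : Units A (fun j => par (r + j) - r) c κ) (hX : ∀ i < s, ℓ i ∈ X ↔ i - r ∈ A)
    (hZ : ∀ u ∈ Z, ∀ w ∈ X, w ∈ N u → w ∈ Z) (i : ℕ) (hi : i < s) (hA : i - r ∈ A) :
    ∃ j ∈ A, (j = 0 ∨ par (r + j) - r ∉ A) ∧ κ j = κ (i - r) ∧
      (ℓ i ∈ Z ↔ ℓ (if j = 0 then 0 else r + j) ∈ Z) := by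
  induction i using Nat.strong_induction_on with
  | _ i ih =>
    rcases Nat.eq_zero_or_pos i with rfl | hi0
    · grind
    · obtain ⟨hp1, hp2⟩ := hC.par i hi0 hi
      have step : par i - r ∈ A → (ℓ i ∈ Z ↔ ℓ (par i) ∈ Z) := fun hpA =>
        ⟨fun h => hZ _ h _ ((hX _ (by omega)).2 hpA) hp2,
          fun h => hZ _ h _ ((hX _ hi).2 hA) (hG.symm _ _ hp2)⟩
      by_cases hpA : par i - r ∈ A
      · obtain ⟨j, h1, h2, h3, h4⟩ := ih (par i) hp1 (by omega) hpA
        refine ⟨j, h1, h2, ?_, (step hpA).trans h4⟩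
        rw [h3]
        by_cases hir : i - r = 0
        · congr 1; omega
        · have := hU.tree (i - r) hA (by omega)
          rw [show r + (i - r) = i by omega] at this
          exact (this hpA).symm
      · by_cases hir : i - r = 0
        · exact absurd (by grind) hpA
        · refine ⟨i - r, hA, Or.inr ?_, rfl, ?_⟩
          · rwa [show r + (i - r) = i by omega]
          · rw [if_neg hir, show r + (i - r) = i by omega]

/-- What a connected vertex cover with trace `A` looks like outside of the list. -/
theorem Cover.hits (hC : Cover n N ℓ s par) (hA : A.Nonempty) (hAs : A ⊆ range (s - r))
    (hX : ∀ i < s, ℓ i ∈ X ↔ i - r ∈ A) (hcvc : CVC n N X) :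
    Hits n N ℓ s r A ∧ (∀ v < n, (∀ i < s, ℓ i ≠ v) → ¬ posSet N ℓ s r v ⊆ A → v ∈ X) ∧
      ∀ v ∈ X, (∀ i < s, ℓ i ≠ v) → (posSet N ℓ s r v ∩ A).Nonempty := by
  have hforced : ∀ v < n, (∀ i < s, ℓ i ≠ v) → ¬ posSet N ℓ s r v ⊆ A → v ∈ X := by
    intro v _ hvs hnot
    by_contra hvX
    refine hnot fun j hj => ?_
    obtain ⟨i, hi, hiN, rfl⟩ := mem_posSet.1 hj
    exact (hX i hi).1 ((hcvc.cov v _ hiN).resolve_left hvX)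
  have hne : ∀ v ∈ X, (∀ i < s, ℓ i ≠ v) → (posSet N ℓ s r v ∩ A).Nonempty := by
    intro v hvX hvs
    by_contra hemp
    have hcl := hcvc.conn {v} (by simpa using hvX) ⟨v, by simp⟩ (by
      intro u hu w hw hN
      rw [mem_singleton] at hu
      subst hu
      obtain ⟨i, hi, rfl⟩ := (hC.cov _ _ hN).resolve_left fun ⟨i, hi, h⟩ => hvs i hi h
      exact absurd ⟨i - r, mem_inter.2 ⟨mem_posSet.2 ⟨i, hi, hN, rfl⟩, (hX i hi).1 hw⟩⟩ hemp)
    obtain ⟨j, hj⟩ := hA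
    have hjs := mem_range.1 (hAs hj)
    have : ℓ (r + j) ∈ X := (hX (r + j) (by omega)).2 (by simpa using hj)
    grind
  refine ⟨⟨?_, ?_⟩, hforced, hne⟩
  · intro i hi j hj hN
    rw [← hX i hi, ← hX j hj]
    exact hcvc.cov _ _ hN
  · intro v hv hvs hvne
    by_cases hsub : posSet N ℓ s r v ⊆ A
    · rwa [inter_eq_left.2 hsub]
    grind

/-- A set is a connected vertex cover iff the associated hypergraph on the units is connected. -/
theorem Cover.cvc_iff (hC : Cover n N ℓ s par) (hG : Gr n N)
    (hU : Units A (fun j => par (r + j) - r) c κ) (hA : A.Nonempty) (hAs : A ⊆ range (s - r))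
    (hXn : X ⊆ range n) (hX : ∀ i < s, ℓ i ∈ X ↔ i - r ∈ A) :
    CVC n N X ↔ Hits n N ℓ s r A ∧
      (∀ v < n, (∀ i < s, ℓ i ≠ v) → ¬ posSet N ℓ s r v ⊆ A → v ∈ X) ∧
      (∀ v ∈ X, (∀ i < s, ℓ i ≠ v) → (posSet N ℓ s r v).Nonempty) ∧
      HConn (tau A κ '' (Mand n N ℓ s r A ∪
        posSet N ℓ s r '' {v | v ∈ X ∧ (∀ i < s, ℓ i ≠ v) ∧ posSet N ℓ s r v ⊆ A})) (range c) := by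
  have hc : 0 < c := by
    obtain ⟨j, hj⟩ := hA
    exact (Nat.zero_le _).trans_lt (hU.lt j hj)
  -- vertices outside of the list have all their neighbours in the list
  have hout : ∀ v, (∀ i < s, ℓ i ≠ v) → ∀ w, w ∈ N v → ∃ i < s, ℓ i = w := by
    intro v hv w hw
    rcases hC.cov v w hw with ⟨i, hi, h⟩ | h
    · grind
    · exact h
  have hfam : ∀ v ∈ X, (∀ i < s, ℓ i ≠ v) → tau A κ (posSet N ℓ s r v) ∈
      tau A κ '' (Mand n N ℓ s r A ∪
        posSet N ℓ s r '' {v | v ∈ X ∧ (∀ i < s, ℓ i ≠ v) ∧ posSet N ℓ s r v ⊆ A}) := by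
    intro v hv hvs
    refine Set.mem_image_of_mem _ ?_
    by_cases hs : posSet N ℓ s r v ⊆ A
    · grind
    · exact Or.inl (Or.inr ⟨v, mem_range.1 (hXn hv), hvs, hs, rfl⟩)
  have hedge : ∀ i < s, ∀ j < s, ℓ j ∈ N (ℓ i) → tau A κ {i - r, j - r} ∈
      tau A κ '' (Mand n N ℓ s r A ∪
        posSet N ℓ s r '' {v | v ∈ X ∧ (∀ i < s, ℓ i ≠ v) ∧ posSet N ℓ s r v ⊆ A}) :=
    fun i hi j hj h => Set.mem_image_of_mem _ (Or.inl (Or.inl ⟨i, hi, j, hj, h, rfl⟩))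
  constructor
  · intro hcvc
    obtain ⟨hhits, hforced, hne⟩ := hC.hits hA hAs hX hcvc
    refine ⟨hhits, hforced, fun v hv hvs => (hne v hv hvs).mono inter_subset_left, ?_⟩
    · intro Y hY h0 hcl
      classical
      set Z := X.filter fun u => (∃ i < s, ℓ i = u ∧ κ (i - r) ∈ Y) ∨
        ((∀ i < s, ℓ i ≠ u) ∧ ∃ t ∈ posSet N ℓ s r u, t ∈ A ∧ κ t ∈ Y)
      have hZ : Z = X := by
        refine hcvc.conn Z (filter_subset _ _) ?_ ?_
        · obtain ⟨j, hj, hj0⟩ := hU.surj 0 hc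
          have hjs := mem_range.1 (hAs hj)
          refine ⟨ℓ (r + j), mem_filter.2 ⟨(hX (r + j) (by omega)).2 (by simpa using hj),
            Or.inl ⟨r + j, by omega, rfl, ?_⟩⟩⟩
          rw [show r + j - r = j by omega, hj0]
          exact h0
        · intro u hu w hw hN
          refine mem_filter.2 ⟨hw, ?_⟩
          obtain ⟨huX, hu⟩ := mem_filter.1 hu
          rcases hu with ⟨i, hi, rfl, hiY⟩ | ⟨hus, t, ht, htA, htY⟩
          · by_cases hws : ∃ j < s, ℓ j = w
            · obtain ⟨j, hj, rfl⟩ := hws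
              refine Or.inl ⟨j, hj, rfl, hcl _ (hedge i hi j hj hN) ⟨κ (i - r), ?_⟩ ?_⟩
              · exact mem_inter.2 ⟨mem_tau.2 ⟨i - r, by simp, (hX i hi).1 huX, rfl⟩, hiY⟩
              · exact mem_tau.2 ⟨j - r, by simp, (hX j hj).1 hw, rfl⟩
            · push Not at hws
              exact Or.inr ⟨hws, i - r, mem_posSet.2 ⟨i, hi, hG.symm _ _ hN, rfl⟩,
                (hX i hi).1 huX, hiY⟩
          · obtain ⟨j, hj, rfl⟩ := hout u hus w hN
            refine Or.inl ⟨j, hj, rfl, hcl _ (hfam u huX hus) ⟨κ t, ?_⟩ ?_⟩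
            · exact mem_inter.2 ⟨mem_tau.2 ⟨t, ht, htA, rfl⟩, htY⟩
            · exact mem_tau.2 ⟨j - r, mem_posSet.2 ⟨j, hj, hN, rfl⟩, (hX j hj).1 hw, rfl⟩
      refine Finset.Subset.antisymm hY fun u hu => ?_
      obtain ⟨j, hj, rfl⟩ := hU.surj u (mem_range.1 hu)
      have hjs := mem_range.1 (hAs hj)
      have hjX : ℓ (r + j) ∈ X := (hX (r + j) (by omega)).2 (by simpa using hj)
      rw [← hZ] at hjX
      rcases (mem_filter.1 hjX).2 with ⟨i, hi, hij, hiY⟩ | ⟨h, _⟩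
      · rw [hC.inj i hi (r + j) (by omega) hij, show r + j - r = j by omega] at hiY
        exact hiY
      grind
  · rintro ⟨⟨hhit1, hhit2⟩, hforced, hniso, hconn⟩
    refine ⟨hXn, ?_, ?_⟩
    · intro u w hN
      by_cases hus : ∃ i < s, ℓ i = u
      · obtain ⟨i, hi, rfl⟩ := hus
        by_cases hws : ∃ j < s, ℓ j = w
        · grind
        · push Not at hws
          by_cases hsub : posSet N ℓ s r w ⊆ A
          · exact Or.inl ((hX i hi).2 (hsub (mem_posSet.2 ⟨i, hi, hG.symm _ _ hN, rfl⟩)))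
          · exact Or.inr (hforced w (hG.lt _ _ hN) hws hsub)
      · push Not at hus
        by_cases hsub : posSet N ℓ s r u ⊆ A
        · obtain ⟨j, hj, rfl⟩ := hout u hus w hN
          exact Or.inr ((hX j hj).2 (hsub (mem_posSet.2 ⟨j, hj, hN, rfl⟩)))
        · exact Or.inl (hforced u (hG.lt' hN) hus hsub)
    · intro Z hZX hZne hcl
      have hnb : ∀ v ∈ X, (∀ i < s, ℓ i ≠ v) → ∃ i < s, ℓ i ∈ N v ∧ i - r ∈ A := by
        intro v hv hvs
        obtain ⟨j, hj⟩ := hhit2 v (mem_range.1 (hXn hv)) hvs (hniso v hv hvs)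
        rw [mem_inter] at hj
        obtain ⟨i, hi, hiN, rfl⟩ := mem_posSet.1 hj.1
        grind
      -- membership in `Z` depends on the unit only
      have hunit : ∀ i < s, ∀ j < s, i - r ∈ A → j - r ∈ A → κ (i - r) = κ (j - r) →
          ℓ i ∈ Z → ℓ j ∈ Z := by
        intro i hi j hj hiA hjA hκ hiZ
        obtain ⟨a, ha1, ha2, ha3, ha4⟩ := hC.leader hG hU hX hcl i hi hiA
        obtain ⟨b, hb1, hb2, hb3, hb4⟩ := hC.leader hG hU hX hcl j hj hjA
        have : a = b := hU.lead a ha1 b hb1 ha2 hb2 (by rw [ha3, hb3, hκ])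
        grind
      classical
      set Y := (range c).filter fun u => ∃ i < s, i - r ∈ A ∧ κ (i - r) = u ∧ ℓ i ∈ Z
       
      have hsub : ∀ h ∈ tau A κ '' (Mand n N ℓ s r A ∪
          posSet N ℓ s r '' {v | v ∈ X ∧ (∀ i < s, ℓ i ≠ v) ∧ posSet N ℓ s r v ⊆ A}),
          h ⊆ range c := by
        rintro _ ⟨T, _, rfl⟩ u hu
        obtain ⟨j, _, hj, rfl⟩ := mem_tau.1 hu
        exact mem_range.2 (hU.lt j hj)
      have hYcl : Closed (tau A κ '' (Mand n N ℓ s r A ∪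
          posSet N ℓ s r '' {v | v ∈ X ∧ (∀ i < s, ℓ i ≠ v) ∧ posSet N ℓ s r v ⊆ A})) Y := by
        -- a vertex `v` of the cover transports membership in `Z` between its neighbours
        have trans : ∀ v ∈ X, (∀ i < s, ℓ i ≠ v) → (tau A κ (posSet N ℓ s r v) ∩ Y).Nonempty →
            tau A κ (posSet N ℓ s r v) ⊆ Y := by
          rintro v hv hvs ⟨u, hu⟩ u' hu'
          rw [mem_inter] at hu
          obtain ⟨t, ht, htA, rfl⟩ := mem_tau.1 hu.1
          obtain ⟨i, hi, hiN, rfl⟩ := mem_posSet.1 ht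
          obtain ⟨_, i', hi', hiA', hκ', hiZ'⟩ := mem_filter.1 hu.2
          have hvZ := hcl _ (hunit i' hi' i hi hiA' htA hκ' hiZ') v hv (hG.symm _ _ hiN)
          obtain ⟨t', ht', htA', rfl⟩ := mem_tau.1 hu'
          obtain ⟨j, hj, hjN, rfl⟩ := mem_posSet.1 ht'
          exact mem_filter.2 ⟨mem_range.2 (hU.lt _ htA'), j, hj, htA', rfl,
            hcl _ hvZ _ ((hX j hj).2 htA') hjN⟩
        rintro _ ⟨T, (⟨i, hi, j, hj, hN, rfl⟩ | ⟨v, hv, hvs, hnot, rfl⟩) |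
          ⟨v, ⟨hv, hvs, _⟩, rfl⟩, rfl⟩ hne
        · have one : ∀ i < s, ∀ j < s, ℓ j ∈ N (ℓ i) → i - r ∈ A → j - r ∈ A → κ (i - r) ∈ Y →
              κ (j - r) ∈ Y := by
            intro i hi j hj hN hiA hjA hiY
            obtain ⟨_, i', hi', hiA', hκ', hiZ'⟩ := mem_filter.1 hiY
            exact mem_filter.2 ⟨mem_range.2 (hU.lt _ hjA), j, hj, hjA, rfl,
              hcl _ (hunit i' hi' i hi hiA' hiA hκ' hiZ') _ ((hX j hj).2 hjA) hN⟩
          obtain ⟨u, hu⟩ := hne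
          rw [mem_inter] at hu
          obtain ⟨t, ht, htA, rfl⟩ := mem_tau.1 hu.1
          intro u' hu'
          obtain ⟨t', ht', htA', rfl⟩ := mem_tau.1 hu'
          simp only [mem_insert, mem_singleton] at ht ht'
          rcases ht with rfl | rfl <;> rcases ht' with rfl | rfl
          · exact hu.2
          · grind
          · exact one j hj i hi (hG.symm _ _ hN) htA htA' hu.2
          · exact hu.2
        · grind
        grind
      have hYne : Y.Nonempty := by
        obtain ⟨z, hz⟩ := hZne
        by_cases hzs : ∃ i < s, ℓ i = z
        · obtain ⟨i, hi, rfl⟩ := hzs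
          have hiA := (hX i hi).1 (hZX hz)
          exact ⟨κ (i - r), mem_filter.2 ⟨mem_range.2 (hU.lt _ hiA), i, hi, hiA, rfl,
            hz⟩⟩
        · push Not at hzs
          obtain ⟨i, hi, hiN, hiA⟩ := hnb z (hZX hz) hzs
          exact ⟨κ (i - r), mem_filter.2 ⟨mem_range.2 (hU.lt _ hiA), i, hi, hiA, rfl,
            hcl z hz _ ((hX i hi).2 hiA) hiN⟩⟩
      have hYall : Y = range c := by
        by_cases h0 : 0 ∈ Y
        · exact hconn Y (filter_subset _ _) h0 hYcl
        · have := hconn (range c \ Y) sdiff_subset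
            (mem_sdiff.2 ⟨mem_range.2 hc, h0⟩) (hYcl.compl hsub)
          grind
      have hin : ∀ i < s, i - r ∈ A → ℓ i ∈ Z := by
        intro i hi hiA
        have : κ (i - r) ∈ Y := by rw [hYall]; exact mem_range.2 (hU.lt _ hiA)
        grind
      refine Finset.Subset.antisymm hZX fun w hw => ?_
      by_cases hws : ∃ i < s, ℓ i = w
      · grind
      · push Not at hws
        obtain ⟨i, hi, hiN, hiA⟩ := hnb w hw hws
        exact hcl _ (hin i hi hiA) w hw (hG.symm _ _ hiN)

end ConnVC

/-! ### Counting connected hypergraphs -/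

namespace ConnVC

open Finset Function

section Algebra

variable {R : Type*} [CommRing R]

open Classical in
/-- The sum of `x ^ |B|` over the sets `B` of free hyperedges `t v`, `v ∈ F`, inside of `Y` that
together with the mandatory hyperedges `D` connect `Y`. -/
noncomputable def con (x : R) (D : Set (Finset ℕ)) (F : Finset ℕ) (t : ℕ → Finset ℕ)
    (Y : Finset ℕ) : R :=
  if Closed D Y then
    ∑ B ∈ (F.filter fun v => t v ⊆ Y).powerset.filter fun B : Finset ℕ =>
      HConn (D ∪ t '' (B : Set ℕ)) Y, x ^ B.card
  else 0

open Classical in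
/-- The sum of `x ^ |B|` over all sets `B` of free hyperedges inside of `Y`, or `0` if a mandatory
hyperedge crosses the boundary of `Y`. -/
noncomputable def tot (x : R) (D : Set (Finset ℕ)) (F : Finset ℕ) (t : ℕ → Finset ℕ)
    (Y : Finset ℕ) : R :=
  if Closed D Y then (1 + x) ^ (F.filter fun v => t v ⊆ Y).card else 0

theorem one_add_pow_card (x : R) (F : Finset ℕ) :
    (1 + x) ^ F.card = ∑ B ∈ F.powerset, x ^ B.card := by
  rw [add_comm, ← sum_pow_mul_eq_add_pow]
  simp

theorem Closed.sdiff {D : Set (Finset ℕ)} {Y U : Finset ℕ} (hY : Closed D Y) (hU : Closed D U) :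
    Closed D (Y \ U) := by
  rintro h hh ⟨a, ha⟩ b hb
  rw [mem_inter, mem_sdiff] at ha
  refine mem_sdiff.2 ⟨hY h hh ⟨a, mem_inter.2 ⟨ha.1, ha.2.1⟩⟩ hb, fun hbU => ha.2.2 ?_⟩
  exact hU h hh ⟨b, mem_inter.2 ⟨hb, hbU⟩⟩ ha.1

theorem Closed.of_sdiff {D : Set (Finset ℕ)} {Y U : Finset ℕ} (hUY : U ⊆ Y) (hY : Closed D (Y \ U))
    (hU : Closed D U) : Closed D Y := by
  rintro h hh ⟨a, ha⟩
  rw [mem_inter] at ha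
  by_cases haU : a ∈ U
  · exact (hU h hh ⟨a, mem_inter.2 ⟨ha.1, haU⟩⟩).trans hUY
  · exact (hY h hh ⟨a, mem_inter.2 ⟨ha.1, mem_sdiff.2 ⟨ha.2, haU⟩⟩⟩).trans
      sdiff_subset

theorem Closed.mono {D D' : Set (Finset ℕ)} {Y : Finset ℕ} (h : Closed D Y) (hD : D' ⊆ D) :
    Closed D' Y := fun e he => h e (hD he)

open Classical in
/-- The connected component of `0`: the intersection of all closed sets containing `0`. -/
noncomputable def comp0 (H : Set (Finset ℕ)) (Y : Finset ℕ) : Finset ℕ :=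
  Y.filter fun u => ∀ U ⊆ Y, 0 ∈ U → Closed H U → u ∈ U

theorem mem_comp0 {H : Set (Finset ℕ)} {Y : Finset ℕ} {u : ℕ} :
    u ∈ comp0 H Y ↔ u ∈ Y ∧ ∀ U ⊆ Y, 0 ∈ U → Closed H U → u ∈ U := by
  classical
  simp [comp0]

theorem comp0_subset {H : Set (Finset ℕ)} {Y : Finset ℕ} : comp0 H Y ⊆ Y :=
  fun _ h => (mem_comp0.1 h).1

theorem comp0_subset_of {H : Set (Finset ℕ)} {Y U : Finset ℕ} (hU : U ⊆ Y) (h0 : 0 ∈ U)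
    (hcl : Closed H U) : comp0 H Y ⊆ U := fun _ hu => (mem_comp0.1 hu).2 U hU h0 hcl

theorem zero_mem_comp0 {H : Set (Finset ℕ)} {Y : Finset ℕ} (h0 : 0 ∈ Y) : 0 ∈ comp0 H Y :=
  mem_comp0.2 ⟨h0, fun _ _ h _ => h⟩

theorem closed_comp0 {H : Set (Finset ℕ)} {Y : Finset ℕ} (hY : Closed H Y) :
    Closed H (comp0 H Y) := by
  rintro h hh ⟨a, ha⟩ b hb
  rw [mem_inter] at ha
  have ha2 := mem_comp0.1 ha.2
  refine mem_comp0.2 ⟨hY h hh ⟨a, mem_inter.2 ⟨ha.1, ha2.1⟩⟩ hb, ?_⟩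
  intro U hU h0 hcl
  exact hcl h hh ⟨a, mem_inter.2 ⟨ha.1, ha2.2 U hU h0 hcl⟩⟩ hb

theorem closed_union_image {D : Set (Finset ℕ)} {t : ℕ → Finset ℕ} {B : Finset ℕ} {U : Finset ℕ} :
    Closed (D ∪ t '' B) U ↔ Closed D U ∧ ∀ v ∈ B, (t v ∩ U).Nonempty → t v ⊆ U := by
  constructor
  · intro h
    exact ⟨h.mono Set.subset_union_left, fun v hv => h _ (Or.inr ⟨v, hv, rfl⟩)⟩
  · rintro ⟨h1, h2⟩ _ (he | ⟨v, hv, rfl⟩)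
    · exact h1 _ he
    · exact h2 v hv

/-- Sorting the sets of hyperedges by the component of `0`. -/
theorem tot_eq_sum (x : R) (D : Set (Finset ℕ)) (F : Finset ℕ) (t : ℕ → Finset ℕ)
    (ht : ∀ v ∈ F, (t v).Nonempty) (Y : Finset ℕ) (h0 : 0 ∈ Y) :
    tot x D F t Y = ∑ U ∈ Y.powerset.filter (0 ∈ ·), con x D F t U * tot x D F t (Y \ U) := by
  classical
  by_cases hY : Closed D Y
  · rw [tot, if_pos hY, one_add_pow_card]
    have hYcl : ∀ B ∈ (F.filter fun v => t v ⊆ Y).powerset, Closed (D ∪ t '' B) Y := by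
      intro B hB
      refine closed_union_image.2 ⟨hY, fun v hv _ => ?_⟩
      grind
    rw [← sum_fiberwise_of_maps_to (s := (F.filter fun v => t v ⊆ Y).powerset)
      (t := Y.powerset.filter (0 ∈ ·)) (g := fun B => comp0 (D ∪ t '' B) Y)
      (fun B _ => mem_filter.2 ⟨mem_powerset.2 comp0_subset,
        zero_mem_comp0 h0⟩)]
    refine sum_congr rfl fun U hU => ?_
    obtain ⟨hUY, hU0⟩ := mem_filter.1 hU
    rw [mem_powerset] at hUY
    by_cases hUcl : Closed D U
    · rw [con, if_pos hUcl, tot, if_pos (hY.sdiff hUcl), one_add_pow_card, sum_mul_sum,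
        ← sum_product']
      refine sum_bij' (fun B _ => (B.filter fun v => t v ⊆ U, B.filter fun v => t v ⊆ Y \ U))
        (fun p _ => p.1 ∪ p.2) ?_ ?_ ?_ ?_ ?_
      · intro B hB
        obtain ⟨hBF, hcomp⟩ := mem_filter.1 hB
        rw [mem_powerset] at hBF
        refine mem_product.2 ⟨mem_filter.2 ⟨mem_powerset.2 ?_, ?_⟩,
          mem_powerset.2 ?_⟩
        · grind
        · intro W hWU hW0 hWcl
          refine Finset.Subset.antisymm hWU ?_
          rw [← hcomp]
          refine comp0_subset_of (hWU.trans hUY) hW0 ?_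
          obtain ⟨h1, h2⟩ := closed_union_image.1 hWcl
          refine closed_union_image.2 ⟨h1, fun v hv hne => ?_⟩
          -- the hyperedge of `v` meets the component `U`, hence lies inside
          have hUc : Closed (D ∪ t '' B) U := by
            rw [← hcomp]; exact closed_comp0 (hYcl B (mem_powerset.2 hBF))
          have hvU := (closed_union_image.1 hUc).2 v hv
            (hne.mono (inter_subset_inter_left hWU))
          grind
        grind
      · rintro ⟨B₁, B₂⟩ hp
        obtain ⟨h1, h2⟩ := mem_product.1 hp
        obtain ⟨h1, hconn⟩ := mem_filter.1 h1
        rw [mem_powerset] at h1 h2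
        dsimp only at h1 h2 hconn ⊢
        refine mem_filter.2 ⟨mem_powerset.2 (union_subset ?_ ?_), ?_⟩
        · grind
        · grind
        · have hle : comp0 (D ∪ t '' ↑(B₁ ∪ B₂)) Y ⊆ U := by
            refine comp0_subset_of hUY hU0 (closed_union_image.2 ⟨hUcl, fun v hv hne => ?_⟩)
            grind
          refine hconn _ hle (zero_mem_comp0 h0) ?_
          refine Closed.mono (closed_comp0 (closed_union_image.2 ⟨hY, fun v hv _ => ?_⟩)) ?_
          · grind
          grind
      · intro B hB
        obtain ⟨hBF, hcomp⟩ := mem_filter.1 hB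
        rw [mem_powerset] at hBF
        dsimp only
        rw [← filter_or, filter_eq_self]
        intro v hv
        have hUc : Closed (D ∪ t '' B) U := by
          rw [← hcomp]; exact closed_comp0 (hYcl B (mem_powerset.2 hBF))
        by_cases hne : (t v ∩ U).Nonempty
        · exact Or.inl ((closed_union_image.1 hUc).2 v hv hne)
        · refine Or.inr fun a ha => mem_sdiff.2 ⟨(mem_filter.1 (hBF hv)).2 ha, fun haU => ?_⟩
          exact hne ⟨a, mem_inter.2 ⟨ha, haU⟩⟩
      · rintro ⟨B₁, B₂⟩ hp
        obtain ⟨h1, h2⟩ := mem_product.1 hp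
        obtain ⟨h1, -⟩ := mem_filter.1 h1
        rw [mem_powerset] at h1 h2
        dsimp only at h1 h2 ⊢
        have hdis : ∀ v, v ∈ F → t v ⊆ U → t v ⊆ Y \ U → False := by grind
        refine Prod.ext ?_ ?_ <;> ext v <;> grind
      · intro B hB
        obtain ⟨hBF, hcomp⟩ := mem_filter.1 hB
        rw [mem_powerset] at hBF
        rw [← pow_add, ← card_union_of_disjoint]
        · congr 2
          rw [← filter_or, eq_comm, filter_eq_self]
          intro v hv
          have hUc : Closed (D ∪ t '' B) U := by
            rw [← hcomp]; exact closed_comp0 (hYcl B (mem_powerset.2 hBF))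
          by_cases hne : (t v ∩ U).Nonempty
          · exact Or.inl ((closed_union_image.1 hUc).2 v hv hne)
          · refine Or.inr fun a ha => mem_sdiff.2
              ⟨(mem_filter.1 (hBF hv)).2 ha, fun haU => ?_⟩
            exact hne ⟨a, mem_inter.2 ⟨ha, haU⟩⟩
        · rw [disjoint_filter]
          grind
    · rw [con, if_neg hUcl, zero_mul]
      refine sum_eq_zero fun B hB => ?_
      obtain ⟨hBF, hcomp⟩ := mem_filter.1 hB
      refine absurd ?_ hUcl
      rw [← hcomp]
      exact (closed_comp0 (hYcl B hBF)).mono Set.subset_union_left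
  · rw [tot, if_neg hY, eq_comm]
    refine sum_eq_zero fun U hU => ?_
    obtain ⟨hUY, -⟩ := mem_filter.1 hU
    by_cases hUcl : Closed D U
    · rw [tot, if_neg fun h => hY (h.of_sdiff (mem_powerset.1 hUY) hUcl), mul_zero]
    · rw [con, if_neg hUcl, zero_mul]

/-! ### Ranked division of set functions -/

/-- Möbius inversion on the subsets of `V`. -/
theorem sum_neg_one_pow_sum (V : Finset ℕ) : ∀ a : Finset ℕ → R,
    ∑ Y ∈ V.powerset, (-1) ^ (V.card - Y.card) * ∑ X ∈ Y.powerset, a X = a V := by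
  induction V using Finset.induction_on with
  | empty => intro a; simp
  | insert v V hv ih =>
    intro a
    rw [sum_powerset_insert hv, ← sum_add_distrib, ← ih fun X => a (insert v X)]
    refine sum_congr rfl fun Y hY => ?_
    rw [mem_powerset] at hY
    have hvY : v ∉ Y := fun h => hv (hY h)
    have hle := card_le_card hY
    rw [card_insert_of_notMem hv, card_insert_of_notMem hvY,
      sum_powerset_insert hvY, Nat.add_sub_add_right, Nat.sub_add_comm hle, pow_succ]
    ring

/-- The part of rank `i` of the zeta transform. -/
def rz (f : Finset ℕ → R) (i : ℕ) (Y : Finset ℕ) : R :=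
  ∑ Z ∈ Y.powerset.filter fun Z => Z.card = i, f Z

/-- If `g` is the subset convolution of `h` and `f`, then dividing the ranked zeta transforms as
power series in the rank, and inverting at the full set and full rank, recovers `h`. -/
theorem ranked_division (V : Finset ℕ) (f g h : Finset ℕ → R) (hf : f ∅ = 1)
    (hg : ∀ Z ⊆ V, g Z = ∑ U ∈ Z.powerset, h U * f (Z \ U)) (q : ℕ → Finset ℕ → R)
    (hq : ∀ j, j ≤ V.card → ∀ Y ⊆ V, q j Y = rz g j Y - ∑ i ∈ Icc 1 j, rz f i Y * q (j - i) Y) :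
    ∑ Y ∈ V.powerset, (-1) ^ (V.card - Y.card) * q V.card Y = h V := by
  classical
  have key : ∀ j, j ≤ V.card → ∃ a : Finset ℕ → R, (∀ X, j < X.card → a X = 0) ∧
      (∀ X ⊆ V, X.card = j → a X = h X) ∧ ∀ Y ⊆ V, q j Y = ∑ X ∈ Y.powerset, a X := by
    intro j
    induction j using Nat.strong_induction_on with
    | _ j ih =>
      intro hj
      have ih' : ∀ i, ∃ a : Finset ℕ → R, i ∈ Icc 1 j →
          (∀ X, j - i < X.card → a X = 0) ∧
          (∀ X ⊆ V, X.card = j - i → a X = h X) ∧ ∀ Y ⊆ V, q (j - i) Y = ∑ X ∈ Y.powerset, a X := by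
        intro i
        by_cases hi : i ∈ Icc 1 j
        · rw [mem_Icc] at hi
          obtain ⟨a, ha⟩ := ih (j - i) (by omega) (by omega)
          exact ⟨a, fun _ => ha⟩
        · exact ⟨fun _ => 0, fun h => absurd h hi⟩
      choose a ha using ih'
      set b : ℕ → Finset ℕ → R := fun i X =>
        ∑ p ∈ (X.powerset ×ˢ X.powerset).filter fun p => p.1 ∪ p.2 = X ∧ p.1.card = i,
          f p.1 * a i p.2 with hb
      have hbsum : ∀ i, ∀ Y, rz f i Y * ∑ X ∈ Y.powerset, a i X = ∑ X ∈ Y.powerset, b i X := by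
        intro i Y
        rw [rz, sum_mul_sum, ← sum_product',
          ← sum_fiberwise_of_maps_to (t := Y.powerset) (g := fun p => p.1 ∪ p.2)]
        · refine sum_congr rfl fun X hX => ?_
          refine sum_congr ?_ fun _ _ => rfl
          grind
        grind
      refine ⟨fun X => (if X.card = j then g X else 0) - ∑ i ∈ Icc 1 j, b i X, ?_, ?_, ?_⟩
      · intro X hX
        dsimp only
        rw [if_neg (by omega), zero_sub, neg_eq_zero]
        refine sum_eq_zero fun i hi => sum_eq_zero fun p hp => ?_
        grind
      · intro X hX hXj
        dsimp only
        rw [if_pos hXj, hg X hX]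
        have hbi : ∀ i ∈ Icc 1 j,
            b i X = ∑ U ∈ X.powerset.filter fun U => U.card = i, f U * h (X \ U) := by
          intro i hi
          obtain ⟨ha1, ha2, -⟩ := ha i hi
          rw [mem_Icc] at hi
          have hdis : ∀ p : Finset ℕ × Finset ℕ, p.1 ∪ p.2 = X → p.1.card = i → p.2.card ≤ j - i →
              p.2 = X \ p.1 := by
            intro p h1 h2 h3
            have hsub : X \ p.1 ⊆ p.2 := by grind
            refine (eq_of_subset_of_card_le hsub ?_).symm
            grind
          rw [hb]
          refine (sum_subset_zero_on_sdiff (s₁ := (X.powerset.filter fun U => U.card = i).image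
            fun U => (U, X \ U)) ?_ ?_ (fun _ _ => rfl)).symm.trans ?_
          · intro p hp
            grind
          · intro p hp
            grind
          · rw [sum_image (fun U _ U' _ h => (Prod.ext_iff.1 h).1)]
            refine sum_congr rfl fun U hU => ?_
            grind
        rw [sum_congr rfl hbi]
        have hswap : ∑ U ∈ X.powerset, h U * f (X \ U) = ∑ U ∈ X.powerset, f U * h (X \ U) := by
          refine sum_bij' (fun U _ => X \ U) (fun U _ => X \ U) ?_ ?_ ?_ ?_ ?_
          · simp
          · simp
          · simp
          · simp
          · intro U hU; rw [Finset.sdiff_sdiff_eq_self (mem_powerset.1 hU), mul_comm]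
        rw [hswap, ← sum_fiberwise_of_maps_to (s := X.powerset) (t := range (j + 1))
          (g := card), sum_range_eq_add_Ico _ (by omega)]
        · have h0 : X.powerset.filter (fun U => U.card = 0) = {∅} := by grind
          rw [h0, sum_singleton, hf, one_mul, sdiff_empty,
            show Ico 1 (j + 1) = Icc 1 j from rfl]
          ring
        · intro U hU
          have := card_le_card (mem_powerset.1 hU)
          grind
      · intro Y hY
        rw [hq j hj Y hY, sum_sub_distrib, sum_comm, rz, sum_filter]
        congr 1
        refine sum_congr rfl fun i hi => ?_
        grind
  obtain ⟨a, -, ha2, ha3⟩ := key V.card le_rfl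
  rw [← ha2 V subset_rfl rfl, ← sum_neg_one_pow_sum V a]
  refine sum_congr rfl fun Y hY => ?_
  grind

end Algebra

/-! ### The number of partial solutions -/

/-- The number of units of `A`: its elements without a parent in `A`. -/
def ucount (par : ℕ → ℕ) (A : Finset ℕ) : ℕ := (A.filter fun j => j = 0 ∨ par j ∉ A).card

open Classical in
/-- In a tree, the sets `A` that meet every edge have few units: for each position after the first
there are two choices. -/
theorem sum_two_pow_ucount (par : ℕ → ℕ) (p : ℕ) (hpar : ∀ j, 0 < j → j < p + 1 → par j < j) :
    ∑ A ∈ (range (p + 1)).powerset.filter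
      (fun A => ∀ j, 0 < j → j < p + 1 → j ∈ A ∨ par j ∈ A), 2 ^ ucount par A = 3 * 2 ^ p := by
  induction p with
  | zero =>
    rw [filter_true_of_mem (fun A _ j h1 h2 => by omega)]
    rw [show range (0 + 1) = insert 0 ∅ from rfl, sum_powerset_insert (by simp)]
    simp [ucount, filter_insert]
  | succ p ih =>
    have ih := ih fun j h1 h2 => hpar j h1 (by omega)
    have hlt := hpar (p + 1) (by omega) (by omega)
    rw [sum_filter, range_add_one, sum_powerset_insert (by simp),
      ← sum_add_distrib, pow_succ, ← mul_assoc, ← ih, sum_mul, sum_filter]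
    refine sum_congr rfl fun A hA => ?_
    rw [mem_powerset] at hA
    have hpA : p + 1 ∉ A := fun h => by simpa using hA h
    have hpar' : ∀ j ∈ A, j ≠ 0 → par j ≠ p + 1 := by grind
    have hins : ucount par (insert (p + 1) A) =
        ucount par A + if par (p + 1) ∈ A then 0 else 1 := by
      have h1 : (insert (p + 1) A).filter (fun j => j = 0 ∨ par j ∉ insert (p + 1) A) =
          (if par (p + 1) ∈ A then ∅ else {p + 1}) ∪ A.filter fun j => j = 0 ∨ par j ∉ A := by grind
      rw [ucount, h1, card_union_of_disjoint, add_comm, ucount]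
      · split_ifs <;> simp
      · split_ifs
        · simp
        · simp [hpA]
    grind

end ConnVC

/-! ### From covers to entries -/

namespace ConnVC

open Finset Function

variable {n s r u v w i j c x : ℕ} {N : ℕ → List ℕ} {ℓ par κ : ℕ → ℕ} {A X Y B U : Finset ℕ}

open Classical in
/-- The vertices outside of the list that every cover with trace `A` contains. -/
noncomputable def forced (n : ℕ) (N : ℕ → List ℕ) (ℓ : ℕ → ℕ) (s r : ℕ) (A : Finset ℕ) : Finset ℕ :=
  (range n).filter fun v => (∀ i < s, ℓ i ≠ v) ∧ ¬ posSet N ℓ s r v ⊆ A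

open Classical in
/-- The vertices outside of the list that a cover with trace `A` may contain or not. -/
noncomputable def free (n : ℕ) (N : ℕ → List ℕ) (ℓ : ℕ → ℕ) (s r : ℕ) (A : Finset ℕ) : Finset ℕ :=
  (range n).filter fun v =>
    (∀ i < s, ℓ i ≠ v) ∧ posSet N ℓ s r v ⊆ A ∧ (posSet N ℓ s r v).Nonempty

theorem mem_forced :
    v ∈ forced n N ℓ s r A ↔ v < n ∧ (∀ i < s, ℓ i ≠ v) ∧ ¬ posSet N ℓ s r v ⊆ A := by
  simp [forced]

theorem mem_free : v ∈ free n N ℓ s r A ↔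
    v < n ∧ (∀ i < s, ℓ i ≠ v) ∧ posSet N ℓ s r v ⊆ A ∧ (posSet N ℓ s r v).Nonempty := by
  simp [free]

/-- The vertices of the list at the positions in `A`. -/
def trace (ℓ : ℕ → ℕ) (s r : ℕ) (A : Finset ℕ) : Finset ℕ :=
  ((range s).filter fun i => i - r ∈ A).image ℓ

theorem mem_trace : v ∈ trace ℓ s r A ↔ ∃ i < s, i - r ∈ A ∧ ℓ i = v := by
  simp [trace, and_assoc]

/-- The sets with trace `A` that contain the forced vertices and some free ones. -/
noncomputable def assemble (n : ℕ) (N : ℕ → List ℕ) (ℓ : ℕ → ℕ) (s r : ℕ) (A B : Finset ℕ) :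
    Finset ℕ :=
  trace ℓ s r A ∪ forced n N ℓ s r A ∪ B

theorem card_assemble (hB : B ⊆ free n N ℓ s r A) :
    (assemble n N ℓ s r A B).card = (trace ℓ s r A).card + (forced n N ℓ s r A).card + B.card := by
  rw [assemble, card_union_of_disjoint, card_union_of_disjoint]
  · rw [disjoint_left]
    intro v hv hv'
    obtain ⟨i, hi, _, rfl⟩ := mem_trace.1 hv
    exact (mem_forced.1 hv').2.1 i hi rfl
  · rw [disjoint_left]
    intro v hv hvB
    have hf := mem_free.1 (hB hvB)
    rcases mem_union.1 hv with hv | hv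
    · obtain ⟨i, hi, _, rfl⟩ := mem_trace.1 hv
      exact hf.2.1 i hi rfl
    · exact (mem_forced.1 hv).2.2 hf.2.2.1

/-- Every set that satisfies the local conditions arises by `assemble`. -/
theorem assemble_inter (hXn : X ⊆ range n) (hX : ∀ i < s, ℓ i ∈ X ↔ i - r ∈ A)
    (h1 : ∀ v < n, (∀ i < s, ℓ i ≠ v) → ¬ posSet N ℓ s r v ⊆ A → v ∈ X)
    (h2 : ∀ v ∈ X, (∀ i < s, ℓ i ≠ v) → (posSet N ℓ s r v).Nonempty) :
    assemble n N ℓ s r A (X ∩ free n N ℓ s r A) = X := by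
  ext v
  simp only [assemble, mem_union, mem_inter, mem_trace, mem_forced, mem_free]
  grind

theorem assemble_subset (hC : Cover n N ℓ s par) (hB : B ⊆ free n N ℓ s r A) :
    assemble n N ℓ s r A B ⊆ range n := by
  intro v hv
  simp only [assemble, mem_union, mem_trace, mem_forced] at hv
  rcases hv with (⟨i, hi, _, rfl⟩ | h) | h
  · exact mem_range.2 (hC.lt i hi)
  · grind
  · exact mem_range.2 (mem_free.1 (hB h)).1

theorem mem_assemble_iff (hC : Cover n N ℓ s par) (hB : B ⊆ free n N ℓ s r A) (i : ℕ) (hi : i < s) :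
    ℓ i ∈ assemble n N ℓ s r A B ↔ i - r ∈ A := by
  simp only [assemble, mem_union, mem_trace, mem_forced]
  constructor
  · rintro ((⟨j, hj, hjA, h⟩ | h) | h)
    · rwa [← hC.inj j hj i hi h]
    · grind
    · exact absurd rfl ((mem_free.1 (hB h)).2.1 i hi)
  grind

theorem assemble_inter_free (hB : B ⊆ free n N ℓ s r A) :
    assemble n N ℓ s r A B ∩ free n N ℓ s r A = B := by
  ext v
  simp only [assemble, mem_union, mem_inter, mem_trace]
  constructor
  · rintro ⟨(⟨i, hi, _, rfl⟩ | h) | h, hf⟩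
    · exact absurd rfl ((mem_free.1 hf).2.1 i hi)
    · exact absurd (mem_free.1 hf).2.2.1 (mem_forced.1 h).2.2
    · exact h
  grind

/-- The assembled set is a connected vertex cover iff the hypergraph of its units is connected. -/
theorem assemble_cvc_iff (hC : Cover n N ℓ s par) (hG : Gr n N)
    (hU : Units A (fun j => par (r + j) - r) c κ) (hA : A.Nonempty) (hAs : A ⊆ range (s - r))
    (hB : B ⊆ free n N ℓ s r A) :
    CVC n N (assemble n N ℓ s r A B) ↔ Hits n N ℓ s r A ∧
      HConn (tau A κ '' Mand n N ℓ s r A ∪ (fun v => tau A κ (posSet N ℓ s r v)) '' B)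
        (range c) := by
  rw [hC.cvc_iff hG hU hA hAs (assemble_subset hC hB) (fun i hi => mem_assemble_iff hC hB i hi)]
  have h3 : posSet N ℓ s r '' {v | v ∈ assemble n N ℓ s r A B ∧ (∀ i < s, ℓ i ≠ v) ∧
      posSet N ℓ s r v ⊆ A} ⊆ posSet N ℓ s r '' (B : Set ℕ) := by
    rintro _ ⟨v, ⟨h1, h2, h3⟩, rfl⟩
    refine ⟨v, ?_, rfl⟩
    simp only [assemble, mem_union, mem_trace] at h1
    rcases h1 with (⟨i, hi, _, rfl⟩ | h) | h
    · grind
    · exact absurd h3 (mem_forced.1 h).2.2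
    · exact h
  have h4 : posSet N ℓ s r '' {v | v ∈ assemble n N ℓ s r A B ∧ (∀ i < s, ℓ i ≠ v) ∧
      posSet N ℓ s r v ⊆ A} = posSet N ℓ s r '' (B : Set ℕ) := by
    refine Set.Subset.antisymm h3 ?_
    rintro _ ⟨v, hv, rfl⟩
    have := mem_free.1 (hB hv)
    exact ⟨v, ⟨mem_union_right _ hv, this.2.1, this.2.2.1⟩, rfl⟩
  rw [h4, Set.image_union, Set.image_image]
  constructor
  · grind
  · refine fun h => ⟨h.1, fun v a b c => ?_, fun v hv hvs => ?_, h.2⟩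
    · exact mem_union_left _ (mem_union_right _ (mem_forced.2 ⟨a, b, c⟩))
    · simp only [assemble, mem_union, mem_trace] at hv
      rcases hv with (⟨i, hi, _, rfl⟩ | h) | h
      · grind
      · by_contra hne
        rw [not_nonempty_iff_eq_empty] at hne
        exact (mem_forced.1 h).2.2 (by simp [hne])
      · exact (mem_free.1 (hB h)).2.2.2

open Classical in
/-- The generating function of the connected vertex covers with a given trace on the list. -/
theorem Cover.sum_cvc {R : Type*} [CommRing R] (x : R) (hC : Cover n N ℓ s par) (hG : Gr n N)
    (hU : Units A (fun j => par (r + j) - r) c κ) (hA : A.Nonempty) (hAs : A ⊆ range (s - r)) :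
    ∑ X ∈ (cvcs n N).filter (fun X => ∀ i < s, ℓ i ∈ X ↔ i - r ∈ A), x ^ X.card =
      if Hits n N ℓ s r A then
        x ^ ((trace ℓ s r A).card + (forced n N ℓ s r A).card) *
          con x (tau A κ '' Mand n N ℓ s r A) (free n N ℓ s r A)
            (fun v => tau A κ (posSet N ℓ s r v)) (range c)
      else 0 := by
  have hsub : ∀ T, tau A κ T ⊆ range c := by
    intro T u hu
    obtain ⟨j, _, hj, rfl⟩ := mem_tau.1 hu
    exact mem_range.2 (hU.lt j hj)
  have hfil : (free n N ℓ s r A).filter (fun v => tau A κ (posSet N ℓ s r v) ⊆ range c) =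
      free n N ℓ s r A := filter_true_of_mem fun v _ => hsub _
  have hX : ∀ X ∈ (cvcs n N).filter (fun X => ∀ i < s, ℓ i ∈ X ↔ i - r ∈ A), Hits n N ℓ s r A ∧
      assemble n N ℓ s r A (X ∩ free n N ℓ s r A) = X := by
    intro X hX
    obtain ⟨h1, h2⟩ := mem_filter.1 hX
    rw [mem_cvcs] at h1
    have h3 := (hC.cvc_iff hG hU hA hAs h1.sub h2).1 h1
    exact ⟨h3.1, assemble_inter h1.sub h2 h3.2.1 h3.2.2.1⟩
  split_ifs with hH
  · have hcl : Closed (tau A κ '' Mand n N ℓ s r A) (range c) := by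
      rintro _ ⟨T, _, rfl⟩ _
      exact hsub T
    rw [con, if_pos hcl, hfil, mul_sum]
    refine sum_bij' (fun X _ => X ∩ free n N ℓ s r A)
      (fun B _ => assemble n N ℓ s r A B) ?_ ?_ ?_ ?_ ?_
    · intro X hX'
      obtain ⟨-, h2⟩ := hX X hX'
      refine mem_filter.2 ⟨mem_powerset.2 inter_subset_right, ?_⟩
      have h3 := mem_cvcs.1 (mem_filter.1 hX').1
      rw [← h2, assemble_cvc_iff hC hG hU hA hAs inter_subset_right] at h3
      exact h3.2
    · intro B hB
      obtain ⟨h1, h2⟩ := mem_filter.1 hB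
      rw [mem_powerset] at h1
      refine mem_filter.2 ⟨mem_cvcs.2 ?_, mem_assemble_iff hC h1⟩
      rw [assemble_cvc_iff hC hG hU hA hAs h1]
      exact ⟨hH, h2⟩
    · grind
    · intro B hB
      exact assemble_inter_free (mem_powerset.1 (mem_filter.1 hB).1)
    · intro X hX'
      rw [← pow_add, ← card_assemble inter_subset_right, (hX X hX').2]
  · rw [filter_eq_empty_iff.2, sum_empty]
    intro X hX1 hX2
    exact hH (hX X (mem_filter.2 ⟨hX1, hX2⟩)).1

/-- The masks of the instance, each stored once. An even key `2 * T` stands for the vertices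
outside of the list with mask `T`, of which there are `cnt` and `rep` is one; an odd key
`2 * T + 1` stands for the edges inside of the list between the two positions in `T`. -/
structure Entries (n : ℕ) (N : ℕ → List ℕ) (ℓ : ℕ → ℕ) (s r H : ℕ) (key cnt rep : ℕ → ℕ) :
    Prop where
  inj : ∀ e < H, ∀ e' < H, key e = key e' → e = e'
  even : ∀ e < H, key e % 2 = 0 → rep e < n ∧ (∀ i < s, ℓ i ≠ rep e) ∧
    bs (key e / 2) = posSet N ℓ s r (rep e) ∧ key e / 2 ≠ 0
  cnt : ∀ e < H, key e % 2 = 0 → cnt e = ((range n).filter fun v =>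
    (∀ i < s, ℓ i ≠ v) ∧ posSet N ℓ s r v = bs (key e / 2)).card
  odd : ∀ e < H, key e % 2 = 1 → ∃ i < s, ∃ j < s, ℓ j ∈ N (ℓ i) ∧ i - r ≠ j - r ∧
    bs (key e / 2) = {i - r, j - r}
  ofVertex : ∀ v < n, (∀ i < s, ℓ i ≠ v) → (posSet N ℓ s r v).Nonempty →
    ∃ e < H, key e % 2 = 0 ∧ bs (key e / 2) = posSet N ℓ s r v
  ofEdge : ∀ i < s, ∀ j < s, ℓ j ∈ N (ℓ i) → i - r ≠ j - r →
    ∃ e < H, key e % 2 = 1 ∧ bs (key e / 2) = {i - r, j - r}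

/-- The mask of an entry. -/
def emask (key : ℕ → ℕ) (e : ℕ) : Finset ℕ := bs (key e / 2)

/-- The entry is a hyperedge of every cover with trace `A`. -/
def EMand (key : ℕ → ℕ) (A : Finset ℕ) (e : ℕ) : Prop := key e % 2 = 1 ∨ ¬ emask key e ⊆ A

variable {H : ℕ} {key cnt rep : ℕ → ℕ}

theorem Entries.hits_iff (hE : Entries n N ℓ s r H key cnt rep) (hG : Gr n N) (h0 : r = 0 ∨ 0 ∈ A) :
    Hits n N ℓ s r A ↔ ∀ e < H, (emask key e ∩ A).Nonempty := by
  constructor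
  · rintro ⟨h1, h2⟩ e he
    rcases Nat.mod_two_eq_zero_or_one (key e) with hk | hk
    · obtain ⟨a, b, c, d⟩ := hE.even e he hk
      have := h2 _ a b (by rw [← c]; exact bs_nonempty.2 d)
      rwa [← c] at this
    · obtain ⟨i, hi, j, hj, hN, -, hb⟩ := hE.odd e he hk
      rw [emask, hb]
      rcases h1 i hi j hj hN with h | h
      · exact ⟨i - r, by simp [h]⟩
      · exact ⟨j - r, by simp [h]⟩
  · intro h
    refine ⟨fun i hi j hj hN => ?_, fun v hv hvs hne => ?_⟩
    · by_cases hij : i - r = j - r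
      · have : i ≠ j := by rintro rfl; exact hG.irr _ hN
        grind
      · obtain ⟨e, he, -, hb⟩ := hE.ofEdge i hi j hj hN hij
        have := h e he
        rw [emask, hb] at this
        grind
    · obtain ⟨e, he, -, hb⟩ := hE.ofVertex v hv hvs hne
      have := h e he
      rwa [emask, hb] at this

/-- Closedness under the mandatory hyperedges, in terms of the entries. -/
theorem Entries.closed_iff (hE : Entries n N ℓ s r H key cnt rep) :
    Closed (tau A κ '' Mand n N ℓ s r A) Y ↔ ∀ e < H, EMand key A e →
      (tau A κ (emask key e) ∩ Y).Nonempty → tau A κ (emask key e) ⊆ Y := by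
  constructor
  · intro h e he hm
    refine h _ (Set.mem_image_of_mem _ ?_)
    rcases Nat.mod_two_eq_zero_or_one (key e) with hk | hk
    · obtain ⟨a, b, c, d⟩ := hE.even e he hk
      refine Or.inr ⟨rep e, a, b, ?_, c⟩
      rw [← c]
      exact hm.resolve_left (by omega)
    · obtain ⟨i, hi, j, hj, hN, -, hb⟩ := hE.odd e he hk
      exact Or.inl ⟨i, hi, j, hj, hN, hb⟩
  · rintro h _ ⟨T, (⟨i, hi, j, hj, hN, rfl⟩ | ⟨v, hv, hvs, hnot, rfl⟩), rfl⟩ hne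
    · by_cases hij : i - r = j - r
      · rw [hij, pair_eq_singleton] at hne ⊢
        obtain ⟨u, hu⟩ := hne
        rw [mem_inter] at hu
        intro u' hu'
        obtain ⟨t, ht, -, rfl⟩ := mem_tau.1 hu.1
        obtain ⟨t', ht', -, rfl⟩ := mem_tau.1 hu'
        grind
      · obtain ⟨e, he, hk, hb⟩ := hE.ofEdge i hi j hj hN hij
        have := h e he (Or.inl hk)
        rw [emask, hb] at this
        exact this hne
    · have hne' : (posSet N ℓ s r v).Nonempty := by grind
      obtain ⟨e, he, -, hb⟩ := hE.ofVertex v hv hvs hne'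
      have := h e he (Or.inr (by rwa [emask, hb]))
      rw [emask, hb] at this
      exact this hne

open Classical in
/-- The number of forced vertices is the sum of the multiplicities of the mandatory even entries. -/
theorem Entries.card_forced (hE : Entries n N ℓ s r H key cnt rep) :
    (forced n N ℓ s r A).card = ∑ e ∈ (range H).filter
      (fun e => key e % 2 = 0 ∧ ¬ emask key e ⊆ A), cnt e := by
  have hne : ∀ v ∈ forced n N ℓ s r A, (posSet N ℓ s r v).Nonempty := by
    intro v hv
    rw [nonempty_iff_ne_empty]
    intro h
    have := (mem_forced.1 hv).2.2
    simp [h] at this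
  have hex : ∀ v, ∃ e, v ∈ forced n N ℓ s r A →
      e < H ∧ key e % 2 = 0 ∧ bs (key e / 2) = posSet N ℓ s r v := by
    intro v
    by_cases hv : v ∈ forced n N ℓ s r A
    · obtain ⟨a, b, c⟩ := mem_forced.1 hv
      obtain ⟨e, h⟩ := hE.ofVertex v a b (hne v hv)
      grind
    · exact ⟨0, fun h => absurd h hv⟩
  choose g hg using hex
  rw [card_eq_sum_card_fiberwise (f := g) (t := (range H).filter
      (fun e => key e % 2 = 0 ∧ ¬ emask key e ⊆ A))]
  · refine sum_congr rfl fun e he => ?_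
    simp only [mem_filter, mem_range] at he
    rw [hE.cnt e he.1 he.2.1]
    congr 1
    ext v
    simp only [mem_filter, mem_range, mem_forced]
    constructor
    · rintro ⟨⟨a, b, c⟩, rfl⟩
      exact ⟨a, b, (hg v (mem_forced.2 ⟨a, b, c⟩)).2.2.symm⟩
    · rintro ⟨a, b, c⟩
      have hv : v ∈ forced n N ℓ s r A := mem_forced.2 ⟨a, b, by rw [c]; exact he.2.2⟩
      refine ⟨⟨a, b, by rw [c]; exact he.2.2⟩, ?_⟩
      obtain ⟨h1, h2, h3⟩ := hg v hv
      refine hE.inj _ h1 _ he.1 ?_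
      have : key (g v) / 2 = key e / 2 := bs_injective (h3.trans c)
      omega
  · intro v hv
    obtain ⟨h1, h2, h3⟩ := hg v hv
    refine mem_coe.2 (mem_filter.2 ⟨mem_range.2 h1, h2, ?_⟩)
    rw [emask, h3]
    exact (mem_forced.1 hv).2.2

open Classical in
/-- The number of free hyperedges inside of `Y` is a sum of multiplicities. -/
theorem Entries.card_free (hE : Entries n N ℓ s r H key cnt rep) :
    ((free n N ℓ s r A).filter fun v => tau A κ (posSet N ℓ s r v) ⊆ Y).card =
      ∑ e ∈ (range H).filter
        (fun e => ¬ EMand key A e ∧ tau A κ (emask key e) ⊆ Y), cnt e := by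
  have hex : ∀ v, ∃ e, v ∈ free n N ℓ s r A →
      e < H ∧ key e % 2 = 0 ∧ bs (key e / 2) = posSet N ℓ s r v := by
    intro v
    by_cases hv : v ∈ free n N ℓ s r A
    · obtain ⟨a, b, c, d⟩ := mem_free.1 hv
      obtain ⟨e, h⟩ := hE.ofVertex v a b d
      grind
    · exact ⟨0, fun h => absurd h hv⟩
  choose g hg using hex
  rw [card_eq_sum_card_fiberwise (f := g) (t := (range H).filter
      (fun e => ¬ EMand key A e ∧ tau A κ (emask key e) ⊆ Y))]
  · refine sum_congr rfl fun e he => ?_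
    simp only [mem_filter, mem_range, EMand, not_or, not_not] at he
    obtain ⟨heH, ⟨hek, heA⟩, heY⟩ := he
    rw [hE.cnt e heH (by omega)]
    congr 1
    ext v
    simp only [mem_filter, mem_range, mem_free]
    constructor
    · rintro ⟨⟨⟨a, b, c, d⟩, _⟩, rfl⟩
      exact ⟨a, b, (hg v (mem_free.2 ⟨a, b, c, d⟩)).2.2.symm⟩
    · rintro ⟨a, b, c⟩
      have d : (posSet N ℓ s r v).Nonempty := by
        rw [c]; exact bs_nonempty.2 (hE.even e heH (by omega)).2.2.2
      have hv : v ∈ free n N ℓ s r A := mem_free.2 ⟨a, b, by rw [c]; exact heA, d⟩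
      refine ⟨⟨⟨a, b, by rw [c]; exact heA, d⟩, by rw [c]; exact heY⟩, ?_⟩
      obtain ⟨h1, h2, h3⟩ := hg v hv
      refine hE.inj _ h1 _ heH ?_
      have : key (g v) / 2 = key e / 2 := bs_injective (h3.trans c)
      omega
  · intro v hv
    obtain ⟨hv, hvY⟩ := mem_filter.1 hv
    obtain ⟨h1, h2, h3⟩ := hg v hv
    refine mem_coe.2 (mem_filter.2 ⟨mem_range.2 h1, ?_, ?_⟩)
    · rw [EMand, emask, h3]
      have := (mem_free.1 hv).2.2.1
      grind
    · rw [emask, h3]; exact hvY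

/-! ### The search for a small cover -/

/-- The hyperedges of the entries in `L` and of the mandatory ones. -/
def EClosed (H : ℕ) (key : ℕ → ℕ) (A : Finset ℕ) (κ : ℕ → ℕ) (L : Finset ℕ) (U : Finset ℕ) : Prop :=
  ∀ e < H, EMand key A e ∨ e ∈ L → (tau A κ (emask key e) ∩ U).Nonempty → tau A κ (emask key e) ⊆ U

/-- `d` is closed under extending a reached set of units by an entry, at the price of one for an
entry that is not mandatory, as long as the price stays below `k + 1`. -/
def Relaxed (H : ℕ) (key : ℕ → ℕ) (A : Finset ℕ) (κ : ℕ → ℕ) (k : ℕ) (d : Finset ℕ → ℕ) : Prop :=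
  ∀ Y, 0 ∈ Y → d Y ≤ k → ∀ e < H, (tau A κ (emask key e) ∩ Y).Nonempty →
    (EMand key A e → d (Y ∪ tau A κ (emask key e)) ≤ d Y) ∧
      d (Y ∪ tau A κ (emask key e)) ≤ d Y + 1

/-- A relaxed labelling is at most the size of every connecting set of entries. -/
theorem Relaxed.le_card {k : ℕ} {d : Finset ℕ → ℕ} (hd : Relaxed H key A κ k d) (hd0 : d {0} = 0)
    (hc : 0 < c) (hκ : ∀ j ∈ A, κ j < c) (L : Finset ℕ) (hL : L.card ≤ k)
    (hconn : ∀ U ⊆ range c, 0 ∈ U → EClosed H key A κ L U → U = range c) :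
    d (range c) ≤ L.card := by
  classical
  have hsub : ∀ e, tau A κ (emask key e) ⊆ range c := by
    intro e u hu
    obtain ⟨j, _, hj, rfl⟩ := mem_tau.1 hu
    grind
  -- the price so far plus the number of entries not yet absorbed never exceeds `|L|`
  have key' : ∀ m Y, Y ⊆ range c → 0 ∈ Y → c - Y.card = m →
      d Y + (L.filter fun e => ¬ tau A κ (emask key e) ⊆ Y).card ≤ L.card →
      d (range c) ≤ L.card := by
    intro m
    induction m using Nat.strong_induction_on with
    | _ m ih =>
      intro Y hY h0 hm hle
      by_cases hYc : Y = range c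
      · subst hYc; omega
      · have : ¬ EClosed H key A κ L Y := fun h => hYc (hconn Y hY h0 h)
        unfold EClosed at this
        push Not at this
        obtain ⟨e, he, heL, hne, hnot⟩ := this
        obtain ⟨h1, h2⟩ := hd Y h0 (by omega) e he hne
        have hss : Y ⊂ Y ∪ tau A κ (emask key e) := by
          refine Finset.ssubset_iff_subset_ne.2 ⟨subset_union_left, fun h => hnot ?_⟩
          grind
        have hcard := card_lt_card hss
        have hY' : Y ∪ tau A κ (emask key e) ⊆ range c := union_subset hY (hsub e)
        have hc' := card_le_card hY'
        rw [card_range] at hc'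
        refine ih _ ?_ _ hY' (mem_union_left _ h0) rfl ?_
        · omega
        · have hmono : (L.filter fun e' => ¬ tau A κ (emask key e') ⊆ Y ∪ tau A κ (emask key e)) ⊆
              L.filter fun e' => ¬ tau A κ (emask key e') ⊆ Y := by grind
          by_cases hm : EMand key A e
          · have := card_le_card hmono
            grind
          · have heL := heL.resolve_left hm
            have : (L.filter fun e' => ¬ tau A κ (emask key e') ⊆ Y ∪ tau A κ (emask key e)) ⊂
                L.filter fun e' => ¬ tau A κ (emask key e') ⊆ Y := by
              refine Finset.ssubset_iff_subset_ne.2 ⟨hmono, fun h => ?_⟩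
              have : e ∈ L.filter fun e' => ¬ tau A κ (emask key e') ⊆ Y :=
                mem_filter.2 ⟨heL, hnot⟩
              rw [← h, mem_filter] at this
              grind
            have := card_lt_card this
            omega
  grind

/-- The vertices that all share the position `0`. -/
def root (ℓ : ℕ → ℕ) (r : ℕ) : Finset ℕ := (range (r + 1)).image ℓ

theorem filter_positions (hr : r < s) (h0 : 0 ∈ A) (hAs : A ⊆ range (s - r)) :
    (range s).filter (fun i => i - r ∈ A) = range r ∪ A.image (r + ·) := by grind

theorem card_trace (hC : Cover n N ℓ s par) (hr : r < s) (h0 : 0 ∈ A) (hAs : A ⊆ range (s - r)) :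
    (trace ℓ s r A).card = r + A.card := by
  rw [trace, card_image_of_injOn, filter_positions hr h0 hAs, card_union_of_disjoint,
    card_range, card_image_of_injective _ (add_right_injective r)]
  · rw [disjoint_left]
    grind
  · intro i hi j hj h
    rw [mem_coe, mem_filter, mem_range] at hi hj
    exact hC.inj i hi.1 j hj.1 h

theorem card_trace_zero (hC : Cover n N ℓ s par) (hAs : A ⊆ range s) :
    (trace ℓ s 0 A).card = A.card := by
  have h1 : (range s).filter (fun i => i - 0 ∈ A) = A := by grind
  rw [trace, card_image_of_injOn, h1]
  intro i hi j hj h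
  rw [mem_coe, mem_filter, mem_range] at hi hj
  exact hC.inj i hi.1 j hj.1 h

/-- From connecting entries to a cover: one vertex per entry suffices. -/
theorem cvc_of_entries (hC : Cover n N ℓ s par) (hG : Gr n N) (hE : Entries n N ℓ s r H key cnt rep)
    (hU : Units A (fun j => par (r + j) - r) c κ) (h0 : 0 ∈ A) (hAs : A ⊆ range (s - r))
    (hhit : ∀ e < H, (emask key e ∩ A).Nonempty) (L : Finset ℕ)
    (hL : ∀ e ∈ L, e < H ∧ ¬ EMand key A e)
    (hconn : ∀ U ⊆ range c, 0 ∈ U → EClosed H key A κ L U → U = range c) :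
    L.image rep ⊆ free n N ℓ s r A ∧ CVC n N (assemble n N ℓ s r A (L.image rep)) := by
  have hB : L.image rep ⊆ free n N ℓ s r A := by
    intro v hv
    obtain ⟨e, he, rfl⟩ := mem_image.1 hv
    obtain ⟨h1, h2⟩ := hL e he
    simp only [EMand, not_or, not_not] at h2
    obtain ⟨a, b, c, d⟩ := hE.even e h1 (by omega)
    refine mem_free.2 ⟨a, b, ?_, ?_⟩
    · rw [← c]; exact h2.2
    · rw [← c]; exact bs_nonempty.2 d
  refine ⟨hB, (assemble_cvc_iff hC hG hU ⟨0, h0⟩ hAs hB).2 ⟨(hE.hits_iff hG (Or.inr h0)).2 hhit, ?_⟩⟩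
  intro U hUc hU0 hcl
  refine hconn U hUc hU0 fun e he hm hne => ?_
  by_cases hem : EMand key A e
  · exact hE.closed_iff.1 (hcl.mono Set.subset_union_left) e he hem hne
  · have heL := hm.resolve_left hem
    simp only [EMand, not_or, not_not] at hem
    have hb := (hE.even e he (by omega)).2.2.1
    have := hcl (tau A κ (posSet N ℓ s r (rep e)))
      (Or.inr ⟨rep e, by grind, rfl⟩)
    rw [← hb] at this
    exact this hne

/-- From a cover to connecting entries. -/
theorem entries_of_cvc (hC : Cover n N ℓ s par) (hG : Gr n N) (hE : Entries n N ℓ s r H key cnt rep)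
    (hr : r < s) (hX : CVC n N X) (hroot : root ℓ r ⊆ X) :
    ∃ A ⊆ range (s - r), 0 ∈ A ∧ (∀ e < H, (emask key e ∩ A).Nonempty) ∧
      ∀ c κ, Units A (fun j => par (r + j) - r) c κ → ∃ L : Finset ℕ,
        A.card - 1 + (forced n N ℓ s r A).card + L.card ≤ (X \ root ℓ r).card ∧
        ∀ U ⊆ range c, 0 ∈ U → EClosed H key A κ L U → U = range c := by
  classical
  set A := (range (s - r)).filter fun j => ℓ (r + j) ∈ X
  have hroot' : ∀ i ≤ r, ℓ i ∈ X := fun i hi =>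
    hroot (mem_image_of_mem _ (mem_range.2 (by omega)))
  have h0 : 0 ∈ A := mem_filter.2 ⟨mem_range.2 (by omega), hroot' _ (by omega)⟩
  have hAs : A ⊆ range (s - r) := filter_subset _ _
  have hXA : ∀ i < s, ℓ i ∈ X ↔ i - r ∈ A := by grind
  have hhits : Hits n N ℓ s r A := by
    have hcov : ∀ v, (∀ i < s, ℓ i ≠ v) → ∀ w, w ∈ N v → ∃ i < s, ℓ i = w := by
      intro v hv w hw
      rcases hC.cov v w hw with ⟨i, hi, h⟩ | h
      · grind
      · exact h
    refine ⟨fun i hi j hj hN => ?_, fun v hv hvs hne => ?_⟩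
    · rw [← hXA i hi, ← hXA j hj]
      exact hX.cov _ _ hN
    · by_contra hem
      obtain ⟨j, hj⟩ := hne
      obtain ⟨i, hi, hiN, rfl⟩ := mem_posSet.1 hj
      have hnA : ∀ i < s, ℓ i ∈ N v → ℓ i ∉ X := fun i hi hiN hiX =>
        hem ⟨i - r, mem_inter.2 ⟨mem_posSet.2 ⟨i, hi, hiN, rfl⟩, (hXA i hi).1 hiX⟩⟩
      have hvX : v ∈ X := (hX.cov _ _ hiN).resolve_right (hnA i hi hiN)
      have := hX.conn {v} (by simpa using hvX) ⟨v, by simp⟩ (by grind)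
      grind
  refine ⟨A, hAs, h0, (hE.hits_iff hG (Or.inr h0)).1 hhits, fun c κ hU => ?_⟩
  have h3 := (hC.cvc_iff hG hU ⟨0, h0⟩ hAs hX.sub hXA).1 hX
  have hass := assemble_inter hX.sub hXA h3.2.1 h3.2.2.1
  set B := X ∩ free n N ℓ s r A
  have hBf : B ⊆ free n N ℓ s r A := inter_subset_right
  have hconn : HConn _ _ := ((assemble_cvc_iff hC hG hU ⟨0, h0⟩ hAs hBf).1 (by rw [hass]; exact hX)).2
  have hex : ∀ v, ∃ e, v ∈ B → e < H ∧ key e % 2 = 0 ∧ bs (key e / 2) = posSet N ℓ s r v := by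
    intro v
    by_cases hv : v ∈ B
    · obtain ⟨a, b, c, d⟩ := mem_free.1 (hBf hv)
      obtain ⟨e, h⟩ := hE.ofVertex v a b d
      grind
    · exact ⟨0, fun h => absurd h hv⟩
  choose g hg using hex
  refine ⟨B.image g, ?_, ?_⟩
  · have hc1 := card_assemble hBf
    rw [hass, card_trace hC hr h0 hAs] at hc1
    have hc2 : (root ℓ r).card = r + 1 := by
      rw [root, card_image_of_injOn, card_range]
      intro i hi j hj h
      rw [mem_coe, mem_range] at hi hj
      exact hC.inj i (by omega) j (by omega) h
    grind
  · intro U hUc hU0 hcl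
    refine hconn U hUc hU0 ?_
    rintro _ (hm | ⟨v, hv, rfl⟩) hne
    · exact hE.closed_iff.2 (fun e he hm => hcl e he (Or.inl hm)) _ hm hne
    · obtain ⟨h1, -, h2⟩ := hg v hv
      have := hcl (g v) h1 (Or.inr (mem_image_of_mem _ hv))
      rw [emask, h2] at this
      exact this hne

end ConnVC

/-! ### Rules with frames -/

namespace ConnVC

open Finset Function RAM.BinOp

variable {n m k S r H W a b c i j u v w x y z flag : ℕ} {E : Env} {N : ℕ → List ℕ}
  {ℓ par pf κ key cnt rep : ℕ → ℕ} {A B X Y Z U : Finset ℕ} {s s' : St} {Q : St → ℕ → Prop}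
  {p : Cmd} {e e' : Ex}

/-- The registers that a command may write. -/
def Cmd.wr : Cmd → ℕ → Bool
  | skip, _ => false
  | set x _, y => x == y
  | sto _ _ _, _ => false
  | seq p q, y => p.wr y || q.wr y
  | ite _ _ p q, y => p.wr y || q.wr y
  | whil _ _ p, y => p.wr y

/-- The arrays that a command may write. -/
def Cmd.wa : Cmd → ℕ → Bool
  | skip, _ => false
  | set _ _, _ => false
  | sto α _ _, β => α == β
  | seq p q, y => p.wa y || q.wa y
  | ite _ _ p q, y => p.wa y || q.wa y
  | whil _ _ p, y => p.wa y

/-- The states agree on everything that the command does not write. -/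
structure Fr (p : Cmd) (s s' : St) : Prop where
  r : ∀ x, p.wr x = false → s'.r x = s.r x
  a : ∀ α, p.wa α = false → s'.a α = s.a α

theorem Fr.refl (p : Cmd) (s : St) : Fr p s s := ⟨fun _ _ => rfl, fun _ _ => rfl⟩

theorem Fr.trans {s'' : St} (h : Fr p s s') (h' : Fr p s' s'') : Fr p s s'' :=
  ⟨fun x hx => (h'.r x hx).trans (h.r x hx), fun x hx => (h'.a x hx).trans (h.a x hx)⟩

theorem Fr.mono {q : Cmd} (h : Fr p s s') (hr : ∀ x, q.wr x = false → p.wr x = false)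
    (ha : ∀ x, q.wa x = false → p.wa x = false) : Fr q s s' :=
  ⟨fun x hx => h.r x (hr x hx), fun x hx => h.a x (ha x hx)⟩

/-- A command changes only what it may write. -/
theorem wp_frame :
    ∀ {s : St} {Q : St → ℕ → Prop}, wp E p s Q → wp E p s fun s' t => Q s' t ∧ Fr p s s' := by
  induction p with
  | skip => intro s Q h; exact ⟨h, Fr.refl _ _⟩
  | set x e =>
    intro s Q h
    refine ⟨h.1, h.2, fun y hy => ?_, fun _ _ => rfl⟩
    simp only [Cmd.wr, beq_eq_false_iff_ne] at hy
    simp [hy.symm]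
  | sto α e e' =>
    intro s Q h
    refine ⟨h.1, h.2.1, h.2.2.1, h.2.2.2, fun _ _ => rfl, fun y hy => ?_⟩
    simp only [Cmd.wa, beq_eq_false_iff_ne] at hy
    simp [hy.symm]
  | seq p q ihp ihq =>
    intro s Q h
    change wp E p s _
    refine wp_mono (ihp h) ?_
    rintro s1 t ⟨h1, f1⟩
    refine wp_mono (ihq h1) ?_
    rintro s2 t2 ⟨h2, f2⟩
    refine ⟨h2, (f1.mono ?_ ?_).trans (f2.mono ?_ ?_)⟩ <;> simp +contextual [Cmd.wr, Cmd.wa]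
  | ite e e' p q ihp ihq =>
    intro s Q h
    refine ⟨h.1, h.2.1, fun hc => wp_mono (ihp (h.2.2.1 hc)) ?_,
      fun hc => wp_mono (ihq (h.2.2.2 hc)) ?_⟩ <;>
    · rintro s1 t ⟨h1, f1⟩
      refine ⟨h1, f1.mono ?_ ?_⟩ <;> simp +contextual [Cmd.wr, Cmd.wa]
  | whil e e' p ih =>
    intro s Q h
    obtain ⟨f, hf⟩ := h
    refine ⟨f, ?_⟩
    induction f generalizing s Q with
    | zero => exact hf
    | succ f ihf =>
      refine ⟨hf.1, fun hc => wp_mono (ih (hf.2.1 hc)) ?_, fun hc => ⟨hf.2.2 hc, Fr.refl _ _⟩⟩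
      rintro s1 t ⟨h1, f1⟩
      refine iterWp_mono (body := wp E p) (fun _ _ _ h h' => wp_mono h' h) _ _ _ _ ?_ (ihf h1)
      rintro s2 t2 ⟨h2, f2⟩
      exact ⟨h2, Fr.trans ⟨f1.r, f1.a⟩ f2⟩

theorem wp_seq {q : Cmd} (h : wp E p s fun s' t => wp E q s' fun s'' t' => Q s'' (t + t')) :
    wp E (p ;; q) s Q := h

theorem wp_set (v : ℕ) (h : e.ok E s) (hv : e.ev E s = v) (hQ : Q (s.set x v) 1) :
    wp E (.set x e) s Q :=
  ⟨h, by rw [hv]; exact hQ⟩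

theorem wp_sto {α : ℕ} (i v : ℕ) (h : e.ok E s) (h' : e'.ok E s) (hi : e.ev E s = i)
    (hv : e'.ev E s = v) (hc : i < E.cap) (hQ : Q (s.sto α i v) 1) : wp E (.sto α e e') s Q :=
  ⟨h, h', by rwa [hi], by rw [hi, hv]; exact hQ⟩

theorem wp_ite {q : Cmd} (a b : ℕ) (h : e.ok E s) (h' : e'.ok E s) (ha : e.ev E s = a)
    (hb : e'.ev E s = b) (hp : a < b → wp E p s fun s' t => Q s' (t + 1))
    (hq : ¬ a < b → wp E q s fun s' t => Q s' (t + 1)) : wp E (.ite e e' p q) s Q :=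
  ⟨h, h', by rwa [ha, hb], by rwa [ha, hb]⟩

/-- Weaken the postcondition, and add the frame. -/
theorem wp_post {P B : St → ℕ → Prop} (hQ : ∀ s' t, P s' t → Fr p s s' → B s' t → Q s' t)
    (h : wp E p s fun s' t => P s' t ∧ B s' t) : wp E p s Q :=
  wp_mono (wp_frame h) fun s' t h => hQ s' t h.1.1 h.2 h.1.2

/-- The rule for calls: the called command has the stated postcondition, and changes nothing else. -/
theorem wp_call {P : St → ℕ → Prop} (h : wp E p s P) (hQ : ∀ s' t, P s' t → Fr p s s' → Q s' t) :
    wp E p s Q :=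
  wp_mono (wp_frame h) fun s' t h => hQ s' t h.1 h.2

/-- The rule for counting loops with frame: the body leaves the counter and its limit alone. -/
theorem wp_for (J : ℕ → St → Prop) (f : ℕ → ℕ) (lo N : ℕ) (hok : e.ok E s) (he : e.ev E s = lo)
    (hys : s.r y = N) (hlo : lo ≤ N) (hN : N < E.bd) (h0 : J lo (s.set x lo))
    (hstep : ∀ i, lo ≤ i → i < N → ∀ s1, J i s1 → s1.r x = i → Fr (.forr x e y p) s s1 →
      wp E p s1 fun s2 t => t ≤ f i ∧ J (i + 1) (s2.set x (i + 1)))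
    (hQ : ∀ s' t, J N s' → s'.r x = N → Fr (.forr x e y p) s s' →
      t ≤ (∑ i ∈ Ico lo N, (f i + 2)) + 2 → Q s' t) (hx : p.wr x = false := by rfl)
    (hy : p.wr y = false := by rfl) (hxy : x ≠ y := by decide) :
    wp E (.forr x e y p) s Q := by
  have hset : ∀ s1 v, Fr (.forr x e y p) s1 (s1.set x v) := by
    refine fun s1 v => ⟨fun z hz => ?_, fun _ _ => rfl⟩
    simp only [Cmd.forr, Cmd.wr, Bool.or_eq_false_iff, beq_eq_false_iff_ne] at hz
    simp [hz.1.symm]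
  refine wp_forr (fun i s1 => J i s1 ∧ Fr (.forr x e y p) s s1) f lo N hok he hxy hys hlo hN
    ⟨h0, hset _ _⟩ ?_ ?_
  · rintro i hi hiN s1 ⟨hJ, hF⟩ hx1 hy1
    refine wp_mono (wp_frame (hstep i hi hiN s1 hJ hx1 hF)) ?_
    rintro s2 t ⟨⟨ht, hJ2⟩, f2⟩
    refine ⟨by rw [f2.r x hx, hx1], by rw [f2.r y hy, hy1], ht, hJ2, (hF.trans ?_).trans (hset _ _)⟩
    refine f2.mono ?_ ?_ <;> simp +contextual [Cmd.forr, Cmd.wr, Cmd.wa]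
  grind

/-- The rule for loops that start at `0` and whose iterations all have the same bound. -/
theorem wp_for0 (J : ℕ → St → Prop) (f N : ℕ) (hys : s.r y = N) (hN : N < E.bd)
    (h0 : J 0 (s.set x 0))
    (hstep : ∀ i < N, ∀ s1, J i s1 → s1.r x = i → Fr (.forr x (.c 0) y p) s s1 →
      wp E p s1 fun s2 t => t ≤ f ∧ J (i + 1) (s2.set x (i + 1)))
    (hQ : ∀ s' t, J N s' → s'.r x = N → Fr (.forr x (.c 0) y p) s s' → t ≤ N * (f + 2) + 2 → Q s' t)
    (hx : p.wr x = false := by rfl) (hy : p.wr y = false := by rfl) (hxy : x ≠ y := by decide) :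
    wp E (.forr x (.c 0) y p) s Q :=
  wp_for J (fun _ => f) 0 N (by simp only [Ex.ok]; omega) rfl hys (Nat.zero_le _) hN h0
    (fun i _ => hstep i) (fun s' t h1 h2 h3 h4 => hQ s' t h1 h2 h3 (by simpa using h4)) hx hy hxy

/-! ### The input and the limits -/

/-- The address at which the list of the vertex `v` begins. -/
def off (n : ℕ) (N : ℕ → List ℕ) (v : ℕ) : ℕ := n + 4 + ∑ u ∈ range v, (N u).length

/-- The input describes the graph `N` on `n` vertices, and the limits are large enough. -/
structure Ctx (E : Env) (n m k : ℕ) (N : ℕ → List ℕ) : Prop where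
  gr : Gr n N
  sum : ∑ v ∈ range n, (N v).length = 2 * m
  i0 : E.I.getD 0 0 = n
  i1 : E.I.getD 1 0 = m
  i2 : E.I.getD 2 0 = k
  ioff : ∀ v ≤ n, E.I.getD (3 + v) 0 = off n N v
  iadj : ∀ v < n, ∀ j < (N v).length, E.I.getD (off n N v + j) 0 = (N v).getD j 0
  len : E.I.length = n + 4 + 2 * m
  lin : 16 * (n + m + k + 16) ≤ E.bd
  exp : 2 ^ (2 * k + 20) ≤ E.bd
  mod : 4 * (n + 2) ^ (2 * (k + 1) ^ 2) ≤ E.bd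
  cap : 2 ^ (k + 4) * (k + 4) ≤ E.cap

namespace Ctx

theorem one_lt (h : Ctx E n m k N) : 1 < E.bd := by have := h.lin; omega

theorem off_succ (v : ℕ) : off n N (v + 1) = off n N v + (N v).length := by
  rw [off, off, sum_range_succ]; ring

theorem off_le (h : Ctx E n m k N) (hv : v ≤ n) : off n N v ≤ n + 4 + 2 * m := by
  rw [off, ← h.sum]
  have := sum_le_sum_of_subset (f := fun u => (N u).length)
    (range_subset_range.2 hv)
  omega

theorem length_le (h : Ctx E n m k N) (hv : v < n) : (N v).length ≤ 2 * m := by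
  rw [← h.sum]
  exact single_le_sum (f := fun u => (N u).length) (fun _ _ => Nat.zero_le _)
    (mem_range.2 hv)

end Ctx

/-- A loop over the neighbours of the vertex in register `x`: the address runs in register `z`, its
limit is in `y`, and the neighbour is in `w`. -/
def nbrs (x z y w : ℕ) (p : Cmd) : Cmd :=
  .set y (.inp (.op .add (.v x) (.c 4))) ;;
    .forr z (.inp (.op .add (.v x) (.c 3))) y (.set w (.inp (.v z)) ;; p)

theorem wp_nbrs (hC : Ctx E n m k N) (J : ℕ → St → Prop) (f : ℕ) (hv : s.r x = v) (hvn : v < n)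
    (hz : p.wr z = false) (hy : p.wr y = false) (hzy : z ≠ y) (hxy : x ≠ y) (hwz : w ≠ z)
    (hwy : w ≠ y)
    (hJ : ∀ i s1 s2, J i s1 → (∀ r, r ≠ z → r ≠ y → r ≠ w → s2.r r = s1.r r) → s2.a = s1.a → J i s2)
    (h0 : J 0 s) (hstep : ∀ i (hi : i < (N v).length), ∀ s1, J i s1 → s1.r w = (N v)[i] →
      Fr (nbrs x z y w p) s s1 → wp E p s1 fun s2 t => t ≤ f ∧ J (i + 1) s2)
    (hQ : ∀ s' t, J (N v).length s' → Fr (nbrs x z y w p) s s' →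
      t ≤ (N v).length * (f + 3) + 3 → Q s' t) :
    wp E (nbrs x z y w p) s Q := by
  have hlin := hC.lin
  have hlen := hC.len
  have hoff := hC.off_le (v := v + 1) hvn
  have hsucc : off n N (v + 1) = off n N v + (N v).length := Ctx.off_succ v
  have hwr : ∀ r, (nbrs x z y w p).wr r = false → r ≠ z ∧ r ≠ y ∧ r ≠ w ∧ p.wr r = false := by
    intro r hr
    simp only [nbrs, Cmd.forr, Cmd.wr, Bool.or_eq_false_iff, beq_eq_false_iff_ne] at hr
    grind
  have hwa : ∀ r, (nbrs x z y w p).wa r = false → p.wa r = false := by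
    intro r hr
    simpa [nbrs, Cmd.forr, Cmd.wa] using hr
  refine wp_seq (wp_set (off n N (v + 1)) ⟨⟨trivial, ?_, ?_⟩, ?_⟩ ?_ ?_)
  · simp only [Ex.ok]; omega
  · simp only [opOk, Ex.ev, hv]; omega
  · simp only [Ex.ev, opEval, hv]; omega
  · simp only [Ex.ev, opEval, hv, ← hC.ioff (v + 1) hvn]
    congr 1; omega
  refine wp_for (fun i s1 => J (i - off n N v) s1) (fun _ => f + 1) (off n N v) (off n N (v + 1))
    ⟨⟨trivial, ?_, ?_⟩, ?_⟩ ?_ ?_ ?_ ?_ ?_ ?_ ?_ (hx := by simp [Cmd.wr, hz, hwz]) (hy := by simp [Cmd.wr, hy, hwy]) (hxy := hzy)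
  · simp only [Ex.ok]; omega
  · simp only [opOk, Ex.ev, St.set_r, if_neg hxy, hv]; omega
  · simp only [Ex.ev, opEval, St.set_r, if_neg hxy, hv]; omega
  · simp only [Ex.ev, opEval, St.set_r, if_neg hxy, hv, ← hC.ioff v hvn.le]
    congr 1; omega
  · simp
  · omega
  · omega
  · rw [Nat.sub_self]
    exact hJ _ _ _ h0 (fun r h1 h2 _ => by simp [h1, h2]) rfl
  · intro i hi hi' s1 hJ1 hz1 hF1
    have hi2 : i - off n N v < (N v).length := by omega
    have hval : E.I.getD i 0 = (N v)[i - off n N v] := by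
      have := hC.iadj v hvn (i - off n N v) hi2
      grind
    refine wp_seq (wp_set ((N v)[i - off n N v]) ⟨trivial, ?_⟩ ?_ ?_)
    · simp only [Ex.ev, hz1]; omega
    · simp only [Ex.ev, hz1]; exact hval
    refine wp_mono (hstep (i - off n N v) hi2 _ ?_ (by simp) ?_) ?_
    · exact hJ _ _ _ hJ1 (fun r h1 h2 h3 => by simp [h3]) rfl
    · constructor
      · intro r hr
        obtain ⟨a, b, c, d⟩ := hwr r hr
        rw [St.set_r, if_neg c, hF1.r r (by simp [Cmd.forr, Cmd.wr, a.symm, c.symm, d]), St.set_r,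
          if_neg b]
      · intro r hr
        exact hF1.a r (by simp [Cmd.forr, Cmd.wa, hwa r hr])
    · rintro s2 t ⟨ht, hJ2⟩
      refine ⟨by omega, ?_⟩
      rw [show i + 1 - off n N v = i - off n N v + 1 by omega]
      exact hJ _ _ _ hJ2 (fun r h1 _ _ => by simp [h1]) rfl
  · intro s' t hJ' _ hF ht
    refine hQ _ _ (by grind) ⟨?_, ?_⟩ ?_
    · intro r hr
      obtain ⟨a, b, c, d⟩ := hwr r hr
      rw [hF.r r (by simp [Cmd.forr, Cmd.wr, a.symm, c.symm, d]), St.set_r, if_neg b]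
    · intro r hr
      exact hF.a r (by simp [Cmd.forr, Cmd.wa, hwa r hr])
    · rw [sum_const, Nat.card_Ico, smul_eq_mul, hsucc, Nat.add_sub_cancel_left,
        show f + 1 + 2 = f + 3 from rfl] at ht
      omega

/-! ### Tables for operations on bit masks -/

/-- The bitwise conjunction by table lookup: words are split into two halves. -/
def andE (e e' : Ex) : Ex :=
  .op add (.op mul (.ld 0 (.op add (.op mul (.op quot e (.v 6)) (.v 6)) (.op quot e' (.v 6)))) (.v 6))
    (.ld 0 (.op add (.op mul (.op rem e (.v 6)) (.v 6)) (.op rem e' (.v 6))))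

/-- The number of bits of a half word. -/
def half (k : ℕ) : ℕ := k / 2 + 2

/-- The tables: bitwise conjunctions of half words, powers of two, and numbers of ones. -/
structure Tab (k : ℕ) (s : St) : Prop where
  base : s.r 6 = 2 ^ half k
  and : ∀ i < 2 ^ half k, ∀ j < 2 ^ half k, s.a 0 (i * 2 ^ half k + j) = i &&& j
  pow : ∀ j < k + 4, s.a 4 j = 2 ^ j
  pop : ∀ y < 2 ^ (k + 3), s.a 16 y = (bs y).card

theorem Tab.congr (h : Tab k s) (h6 : s'.r 6 = s.r 6) (h0 : s'.a 0 = s.a 0) (h4 : s'.a 4 = s.a 4)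
    (h16 : s'.a 16 = s.a 16) : Tab k s' :=
  ⟨by rw [h6, h.base], by rw [h0]; exact h.and, by rw [h4]; exact h.pow, by rw [h16]; exact h.pop⟩

theorem land_split (h x y : ℕ) :
    ((x / 2 ^ h) &&& (y / 2 ^ h)) * 2 ^ h + ((x % 2 ^ h) &&& (y % 2 ^ h)) = x &&& y := by
  rw [← Nat.and_div_two_pow, ← Nat.and_mod_two_pow, mul_comm, Nat.div_add_mod]

theorem two_pow_half_sq (k : ℕ) :
    2 ^ half k * 2 ^ half k ≤ 2 ^ (k + 4) ∧ 2 ^ (k + 3) ≤ 2 ^ half k * 2 ^ half k := by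
  rw [← pow_add]
  constructor <;> refine Nat.pow_le_pow_right (by omega) ?_ <;> unfold half <;> omega

theorem Ctx.cap_pow (h : Ctx E n m k N) : 2 ^ (k + 4) ≤ E.cap :=
  (Nat.le_mul_of_pos_right _ (by omega)).trans h.cap

theorem Ctx.exp_le (h : Ctx E n m k N) (hi : i ≤ 2 * k + 20) : 2 ^ i ≤ E.bd :=
  (Nat.pow_le_pow_right (by omega) hi).trans h.exp

/-- The conjunction expression evaluates to the bitwise conjunction. -/
theorem andE_spec (hC : Ctx E n m k N) (hT : Tab k s) (ho : e.ok E s) (ho' : e'.ok E s)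
    (hx : e.ev E s = x) (hy : e'.ev E s = y) (hxb : x < 2 ^ (k + 3)) (hyb : y < 2 ^ (k + 3)) :
    (andE e e').ok E s ∧ (andE e e').ev E s = x &&& y := by
  have hB := hT.base
  obtain ⟨h1, h2⟩ := two_pow_half_sq k
  set B := 2 ^ half k with hBd
  have hBpos : 0 < B := by positivity
  have hq : ∀ z < 2 ^ (k + 3), z / B < B := fun z hz => Nat.div_lt_of_lt_mul (hz.trans_le h2)
  have hr : ∀ z, z % B < B := fun z => Nat.mod_lt _ hBpos
  have hix : ∀ i < B, ∀ j < B, i * B + j < B * B := by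
    intro i hi j hj
    nlinarith
  have hcap := hC.cap_pow
  have hbd := hC.exp_le (i := k + 4) (by omega)
  have hland : ∀ a b c : ℕ, a < c → a &&& b < c := fun a b c h => lt_of_le_of_lt Nat.and_le_left h
  have hv1 : s.a 0 (x / B * B + y / B) = x / B &&& y / B := hT.and _ (hq x hxb) _ (hq y hyb)
  have hv2 : s.a 0 (x % B * B + y % B) = x % B &&& y % B := hT.and _ (hr x) _ (hr y)
  have hspl := land_split (half k) x y
  rw [← hBd] at hspl
  have hlt : x &&& y < 2 ^ (k + 4) := hland _ _ _ (hxb.trans_le (Nat.pow_le_pow_right (by omega) (by omega)))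
  have hi1 := hix _ (hq x hxb) _ (hq y hyb)
  have hi2 := hix _ (hr x) _ (hr y)
  have hle1 : x / B * B ≤ x / B * B + y / B := Nat.le_add_right _ _
  refine ⟨?_, ?_⟩
  · simp only [andE, Ex.ok, Ex.ev, opEval, opOk, ho, ho', hx, hy, hB, hv1, hv2, hspl, true_and, and_true]
    omega
  · simp only [andE, Ex.ev, opEval, hx, hy, hB, hv1, hv2, hspl]

/-- Computation of the tables. -/
def tables : Cmd :=
  .set 21 (.op add (.op quot (.v 3) (.c 2)) (.c 2)) ;;
  .set 6 (.c 1) ;;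
  .forr 20 (.c 0) 21 (.set 6 (.op mul (.v 6) (.c 2))) ;;
  .set 21 (.op mul (.v 6) (.v 6)) ;;
  .sto 0 (.c 0) (.c 0) ;;
  .forr 20 (.c 1) 21 (.sto 0 (.v 20) (.op add (.op mul (.c 2)
    (.ld 0 (.op add (.op mul (.op quot (.op quot (.v 20) (.v 6)) (.c 2)) (.v 6))
      (.op quot (.op rem (.v 20) (.v 6)) (.c 2)))))
    (.op mul (.op rem (.op quot (.v 20) (.v 6)) (.c 2))
      (.op rem (.op rem (.v 20) (.v 6)) (.c 2))))) ;;
  .set 21 (.op add (.v 3) (.c 4)) ;;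
  .sto 4 (.c 0) (.c 1) ;;
  .forr 20 (.c 1) 21 (.sto 4 (.v 20) (.op mul (.c 2) (.ld 4 (.op sub (.v 20) (.c 1))))) ;;
  .set 21 (.ld 4 (.op add (.v 3) (.c 3))) ;;
  .sto 16 (.c 0) (.c 0) ;;
  .forr 20 (.c 1) 21 (.sto 16 (.v 20) (.op add (.ld 16 (.op quot (.v 20) (.c 2)))
    (.op rem (.v 20) (.c 2))))

theorem mul_add_div_mod (i : ℕ) {B : ℕ} (h : j < B) :
    (i * B + j) / B = i ∧ (i * B + j) % B = j := by
  rw [mul_comm, Nat.mul_add_div (by omega), Nat.mul_add_mod, Nat.div_eq_of_lt h, Nat.mod_eq_of_lt h]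
  exact ⟨rfl, rfl⟩

theorem land_halves (x y : ℕ) : 2 * (x / 2 &&& y / 2) + x % 2 * (y % 2) = x &&& y := by
  have h := land_split 1 x y
  rw [pow_one] at h
  rw [← h, mul_comm]
  congr 1
  rcases Nat.mod_two_eq_zero_or_one x with h1 | h1 <;> grind

theorem card_bs (y : ℕ) : (bs y).card = (bs (y / 2)).card + y % 2 := by
  have h : bs y = ((bs (y / 2)).map ⟨Nat.succ, Nat.succ_injective⟩) ∪
      (if y % 2 = 1 then {0} else ∅) := by
    ext i
    cases i with
    | zero => rw [zero_mem_bs]; split_ifs <;> simp_all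
    | succ i => rw [succ_mem_bs]; split_ifs <;> simp
  rw [h, card_union_of_disjoint, card_map]
  · grind
  · rw [disjoint_left]
    intro i hi
    obtain ⟨j, -, rfl⟩ := mem_map.1 hi
    split_ifs <;> simp

theorem wp_tables (hC : Ctx E n m k N) (h3 : s.r 3 = k)
    (hQ : ∀ s' t, Tab k s' → Fr tables s s' → t ≤ 200 * 2 ^ k → Q s' t) : wp E tables s Q := by
  have hlin := hC.lin
  have hcap := hC.cap_pow
  obtain ⟨hsq1, hsq2⟩ := two_pow_half_sq k
  have hhk : half k < k + 4 := by unfold half; omega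
  have hlt := Nat.lt_two_pow_self (n := k + 4)
  have hbig : 2 ^ (k + 4) * 2 ^ 16 ≤ E.bd := by
    rw [← pow_add]; exact hC.exp_le (by omega)
  have hpk : 2 ^ (k + 4) = 16 * 2 ^ k := by ring
  refine wp_post hQ ?_
  unfold tables
  refine wp_seq (wp_set (half k) ⟨⟨trivial, ?_, trivial⟩, ?_, ?_⟩ ?_ ?_)
  · simp only [Ex.ok]; omega
  · simp only [Ex.ok]; omega
  · simp only [opOk, Ex.ev, opEval, h3]; omega
  · simp only [Ex.ev, opEval, h3, half]
  refine wp_seq (wp_set 1 ?_ rfl ?_)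
  · simp only [Ex.ok]; omega
  have h2h : ∀ i < half k, 2 ^ i * 2 ≤ 2 ^ (k + 4) := by
    intro i hi
    rw [← pow_succ]
    exact Nat.pow_le_pow_right (by omega) (by omega)
  refine wp_seq (wp_for (fun i s1 => s1.r 6 = 2 ^ i) (fun _ => 1) 0 (half k) ?_ rfl (by simp)
    (Nat.zero_le _) (by omega) (by simp) ?_ ?_)
  · simp only [Ex.ok]; omega
  · intro i _ hi s1 hJ hx _
    have := h2h i hi
    refine wp_set (2 ^ (i + 1)) ⟨trivial, ?_, ?_⟩ ?_ ⟨le_rfl, by simp⟩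
    · simp only [Ex.ok]; omega
    · simp only [opOk, Ex.ev, hJ]; omega
    · simp only [opEval, Ex.ev, hJ]; ring
  intro s1 t1 hJ1 _ f1 ht1
  have h31 : s1.r 3 = k := by rw [f1.r 3 rfl]; simp [h3]
  set B := 2 ^ half k with hB
  have hBpos : 0 < B := by positivity
  refine wp_seq (wp_set (B * B) ⟨trivial, trivial, ?_⟩ ?_ ?_)
  · simp only [opOk, Ex.ev, hJ1]; omega
  · simp only [opEval, Ex.ev, hJ1]
  refine wp_seq (wp_sto 0 0 (show 0 < _ by omega) (show 0 < _ by omega) rfl rfl (by omega) ?_)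
  refine wp_seq (wp_for (fun i s2 => ∀ j < i, s2.a 0 j = (j / B) &&& (j % B)) (fun _ => 1) 1 (B * B)
    ?_ rfl (by simp) (Nat.mul_pos hBpos hBpos) (by omega) ?_ ?_ ?_)
  · simp only [Ex.ok]; omega
  · simp
  · intro i hi hiN s2 hJ hx hF
    have h6 : s2.r 6 = B := by rw [hF.r 6 rfl]; simp [hJ1]
    have hm : i % B < B := Nat.mod_lt _ hBpos
    have hdm : i / B * B + i % B = i := Nat.div_add_mod' i B
    have hlt' : i / B / 2 * B + i % B / 2 < i := by
      have h1 : i / B / 2 ≤ i / B := Nat.div_le_self _ _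
      have h2 : i / B / 2 * B ≤ i / B * B := Nat.mul_le_mul_right _ h1
      by_cases h0 : i % B = 0
      · have : 0 < i / B := by grind
        have h3 : i / B / 2 < i / B := by omega
        have h4 : i / B / 2 * B < i / B * B := Nat.mul_lt_mul_of_pos_right h3 hBpos
        omega
      · omega
    have hval : s2.a 0 (i / B / 2 * B + i % B / 2) = (i / B / 2) &&& (i % B / 2) := by
      obtain ⟨q1, q2⟩ := mul_add_div_mod (i / B / 2) (show i % B / 2 < B by omega)
      grind
    have hle : (i / B / 2) &&& (i % B / 2) ≤ i / B / 2 := Nat.and_le_left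
    have hdi : i / B ≤ i := Nat.div_le_self _ _
    have hrr : i / B % 2 * (i % B % 2) ≤ 1 := by
      have h1 : i / B % 2 ≤ 1 := by omega
      have h2 : i % B % 2 ≤ 1 := by omega
      exact Nat.mul_le_mul h1 h2
    refine wp_sto i ((i / B) &&& (i % B)) trivial ?_ hx ?_ (by omega) ⟨le_rfl, ?_⟩
    · simp only [Ex.ok, Ex.ev, opEval, opOk, hx, h6, hval, true_and, and_true]
      omega
    · simp only [Ex.ev, opEval, hx, h6, hval, land_halves]
    · intro j hj
      simp only [St.set_a, St.sto_a_same, update_apply]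
      grind
  intro s2 t2 hJ2 _ f2 ht2
  have h62 : s2.r 6 = B := by rw [f2.r 6 rfl]; simp [hJ1]
  have h32 : s2.r 3 = k := by rw [f2.r 3 rfl]; simp [h31]
  refine wp_seq (wp_set (k + 4) ⟨trivial, ?_, ?_⟩ ?_ ?_)
  · simp only [Ex.ok]; omega
  · simp only [opOk, Ex.ev, h32]; omega
  · simp only [opEval, Ex.ev, h32]
  refine wp_seq (wp_sto 0 1 (show 0 < _ by omega) (show 1 < _ by omega) rfl rfl (by omega) ?_)
  refine wp_seq (wp_for (fun i s3 => ∀ j < i, s3.a 4 j = 2 ^ j) (fun _ => 1) 1 (k + 4) ?_ rfl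
    (by simp) (by omega) (by omega) ?_ ?_ ?_)
  · simp only [Ex.ok]; omega
  · simp
  · intro i hi hiN s3 hJ hx hF
    have hv := hJ (i - 1) (by omega)
    have h2 : 2 * 2 ^ (i - 1) = 2 ^ i := by
      rw [← pow_succ', Nat.sub_add_cancel hi]
    have h2' : 2 ^ i ≤ 2 ^ (k + 4) := Nat.pow_le_pow_right (by omega) (by omega)
    refine wp_sto i (2 ^ i) trivial ?_ hx ?_ (by omega) ⟨le_rfl, ?_⟩
    · simp only [Ex.ok, Ex.ev, opEval, opOk, hx, hv, true_and]
      omega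
    · simp only [Ex.ev, opEval, hx, hv, h2]
    · intro j hj
      simp only [St.set_a, St.sto_a_same, update_apply]
      grind
  intro s3 t3 hJ3 _ f3 ht3
  have h63 : s3.r 6 = B := by rw [f3.r 6 rfl]; simp [h62]
  have h33 : s3.r 3 = k := by rw [f3.r 3 rfl]; simp [h32]
  have h03 : s3.a 0 = s2.a 0 := by rw [f3.a 0 rfl]; simp
  have hk3 := hJ3 (k + 3) (by omega)
  have hpk3 : 2 ^ (k + 3) = 8 * 2 ^ k := by ring
  refine wp_seq (wp_set (2 ^ (k + 3)) ⟨⟨trivial, ?_, ?_⟩, ?_⟩ ?_ ?_)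
  · simp only [Ex.ok]; omega
  · simp only [opOk, Ex.ev, h33]; omega
  · simp only [opEval, Ex.ev, h33]; omega
  · simp only [opEval, Ex.ev, h33, hk3]
  refine wp_seq (wp_sto 0 0 (show 0 < _ by omega) (show 0 < _ by omega) rfl rfl (by omega) ?_)
  refine wp_for (fun i s4 => ∀ j < i, s4.a 16 j = (bs j).card) (fun _ => 1) 1 (2 ^ (k + 3)) ?_ rfl
    (by simp) (by omega) (by omega) ?_ ?_ ?_
  · simp only [Ex.ok]; omega
  · simp
  · intro i hi hiN s4 hJ hx hF
    have hv := hJ (i / 2) (by omega)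
    have hc : (bs (i / 2)).card ≤ i := by
      refine (card_le_card (t := range (i / 2)) (filter_subset _ _)).trans ?_
      grind
    refine wp_sto i ((bs i).card) trivial ?_ hx ?_ (by omega) ⟨le_rfl, ?_⟩
    · simp only [Ex.ok, Ex.ev, opEval, opOk, hx, hv, true_and, and_true]
      omega
    · simp only [Ex.ev, opEval, hx, hv, card_bs i]
    · intro j hj
      simp only [St.set_a, St.sto_a_same, update_apply]
      grind
  intro s4 t4 hJ4 _ f4 ht4
  refine ⟨⟨?_, ?_, ?_, hJ4⟩, ?_⟩
  · rw [f4.r 6 rfl]; simp [h63, hB]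
  · intro i hi j hj
    rw [← hB] at hi hj ⊢
    have h04 : s4.a 0 = s2.a 0 := by rw [f4.a 0 rfl]; simp [h03]
    have : i * B + j < B * B := by nlinarith
    obtain ⟨q1, q2⟩ := mul_add_div_mod i hj
    grind
  · intro j hj
    have h44 : s4.a 4 = s3.a 4 := by rw [f4.a 4 rfl]; simp
    rw [h44, hJ3 j hj]
  · simp only [sum_const, Nat.card_Ico, smul_eq_mul] at ht1 ht2 ht3 ht4
    omega

/-! ### Searching for uncovered edges -/

/-- The value occurs among the first `S` values of `ℓ`. -/
def InL (ℓ : ℕ → ℕ) (S w : ℕ) : Prop := ∃ i < S, ℓ i = w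

/-- `i` is an index of `w` in the list `ℓ 0, …, ℓ (S - 1)`, or `S` if there is none. -/
def Idx (ℓ : ℕ → ℕ) (S w i : ℕ) : Prop := i ≤ S ∧ (i < S → ℓ i = w) ∧ (i = S → ¬ InL ℓ S w)

theorem Idx.inL (h : Idx ℓ S w i) : InL ℓ S w ↔ i < S := by
  refine ⟨fun hw => lt_of_le_of_ne h.1 fun hi => h.2.2 hi hw, fun hi => ⟨i, hi, h.2.1 hi⟩⟩

/-- Look up the value of register 80 in the list; the index goes to register 81. -/
def mem : Cmd :=
  .set 81 (.v 7) ;;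
  .forr 82 (.c 0) 7 (.ifEq (.ld 1 (.v 82)) (.v 80) (.set 81 (.v 82)) .skip)

theorem Ctx.bd_pos (h : Ctx E n m k N) : 0 < E.bd := by have := h.one_lt; omega

theorem Ctx.cap_lin (h : Ctx E n m k N) : 3 * k + 8 ≤ E.cap := by
  have := h.cap_pow
  have h1 : k < 2 ^ k := Nat.lt_two_pow_self
  grind

theorem wp_mem (hC : Ctx E n m k N) (h7 : s.r 7 = S) (hS : S ≤ 3 * k + 8)
    (hQ : ∀ s' t, Idx (s.a 1) S (s.r 80) (s'.r 81) → Fr mem s s' → t ≤ 5 * S + 3 → Q s' t) :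
    wp E mem s Q := by
  have hcap := hC.cap_lin
  have hlin := hC.lin
  refine wp_post hQ ?_
  unfold mem
  refine wp_seq (wp_set S trivial h7 ?_)
  refine wp_for0 (fun i s1 => (s1.r 81 = S ∧ ¬ InL (s.a 1) i (s.r 80)) ∨
    (s1.r 81 < S ∧ s.a 1 (s1.r 81) = s.r 80)) 3 S (by simp [h7]) (by omega) (Or.inl ?_) ?_ ?_
  · simp [InL]
  · intro i hi s1 hJ hx hF
    have h80 : s1.r 80 = s.r 80 := by rw [hF.r 80 rfl]; simp
    have h1 : s1.a 1 = s.a 1 := by rw [hF.a 1 rfl]; simp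
    refine wp_ifEq ⟨trivial, ?_⟩ trivial (fun he => ?_) fun he => ⟨⟨by omega, ?_⟩, by omega, ?_⟩
    · simp only [Ex.ev, hx]; omega
    · simp only [Ex.ev, hx, h80, h1] at he
      refine wp_set i trivial hx ⟨by omega, Or.inr ?_⟩
      simp [hi, he]
    all_goals
    · simp only [Ex.ev, hx, h80, h1] at he
      rcases hJ with ⟨hJ, hJ'⟩ | hJ
      · refine Or.inl ⟨by simp [hJ], ?_⟩
        rintro ⟨j, hj, hw⟩
        rcases Nat.lt_succ_iff_lt_or_eq.1 hj with h | h
        · exact hJ' ⟨j, h, hw⟩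
        grind
      · exact Or.inr (by simpa using hJ)
  · intro s' t hJ _ _ ht
    refine ⟨?_, ?_⟩
    · rcases hJ with ⟨hJ, hJ'⟩ | ⟨hJ, hJ'⟩
      · exact ⟨hJ.le, fun h => by omega, fun _ => hJ'⟩
      · exact ⟨hJ.le, fun _ => hJ', fun h => by omega⟩
    · omega

theorem mem_take_succ {α : Type*} {l : List α} (hi : i < l.length) {w : α} :
    w ∈ l.take (i + 1) ↔ w ∈ l.take i ∨ w = l[i] := by
  rw [List.take_add_one, List.getElem?_eq_getElem hi, List.mem_append]
  simp

/-- The search among the neighbours of the vertex in register 20: register 21 is set to `1` if one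
of them is in the list, and register 23 if one of them is not; this one goes to register 24. -/
def scanNbrs : Cmd :=
  nbrs 20 25 26 80 (mem ;;
    .ite (.v 81) (.v 7) (.set 21 (.c 1)) (.set 23 (.c 1) ;; .set 24 (.v 80)))

theorem wp_scanNbrs (hC : Ctx E n m k N) (h7 : s.r 7 = S) (hS : S ≤ 3 * k + 8) (h20 : s.r 20 = u)
    (hu : u < n) (h21 : s.r 21 = flag) (hfl : flag ≤ 1) (h23 : s.r 23 = 0)
    (hQ : ∀ s' t, s'.r 21 ≤ 1 → (s'.r 21 = 1 ↔ flag = 1 ∨ ∃ x ∈ N u, InL (s.a 1) S x) →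
      (s'.r 23 = 1 ∧ s'.r 24 ∈ N u ∧ ¬ InL (s.a 1) S (s'.r 24) ∨
      s'.r 23 = 0 ∧ ∀ x ∈ N u, InL (s.a 1) S x) →
      Fr scanNbrs s s' → t ≤ (5 * S + 9) * (N u).length + 3 → Q s' t) :
    wp E scanNbrs s Q := by
  refine wp_nbrs hC (v := u) (fun i s3 => s3.r 7 = S ∧ s3.a 1 = s.a 1 ∧
      s3.r 21 ≤ 1 ∧ (s3.r 21 = 1 ↔ flag = 1 ∨ ∃ x ∈ (N u).take i, InL (s.a 1) S x) ∧
      (s3.r 23 = 1 ∧ s3.r 24 ∈ N u ∧ ¬ InL (s.a 1) S (s3.r 24) ∨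
        s3.r 23 = 0 ∧ ∀ x ∈ (N u).take i, InL (s.a 1) S x)) (5 * S + 6) h20 hu rfl rfl
      (by omega) (by omega) (by omega) (by omega) ?_ ?_ ?_ ?_
  · grind
  · grind
  · rintro i hi s3 ⟨a1, a2, a3, a4, a5⟩ hw hF3
    refine wp_seq (wp_mem hC a1 hS ?_)
    intro s4 t4 hI4 f4 ht4
    rw [a2, hw] at hI4
    have b7 : s4.r 7 = S := by rw [f4.r 7 rfl, a1]
    have b1 : s4.a 1 = s.a 1 := by rw [f4.a 1 rfl, a2]
    have b21 : s4.r 21 = s3.r 21 := f4.r 21 rfl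
    have b23 : s4.r 23 = s3.r 23 := f4.r 23 rfl
    have b24 : s4.r 24 = s3.r 24 := f4.r 24 rfl
    have b80 : s4.r 80 = (N u)[i] := by rw [f4.r 80 rfl, hw]
    refine wp_ite _ _ trivial trivial rfl b7 (fun hlt => ?_) fun hge => ?_
    · have hin := hI4.inL.2 hlt
      refine wp_set 1 hC.one_lt rfl ⟨by omega, by simp [b7], by simp [b1], by simp, ?_, ?_⟩
      · simp only [St.set_r, if_true, true_iff]
        exact Or.inr ⟨_, (mem_take_succ hi).2 (Or.inr rfl), hin⟩
      · simp only [St.set_r, mem_take_succ hi, show (23 : ℕ) ≠ 21 by omega, show (24 : ℕ) ≠ 21 by omega,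
          if_false, b23, b24]
        grind
    · have hin : ¬ InL (s.a 1) S (N u)[i] := by rw [hI4.inL]; exact hge
      refine wp_seq (wp_set 1 hC.one_lt rfl (wp_set ((N u)[i]) trivial (by simp [Ex.ev, b80]) ?_))
      refine ⟨by omega, by simp [b7], by simp [b1], by simp [b21, a3], ?_, Or.inl ?_⟩
      · simp only [St.set_r, mem_take_succ hi, show (21 : ℕ) ≠ 23 by omega, show (21 : ℕ) ≠ 24 by omega,
          if_false, b21]
        grind
      · simp [hin]
  · rintro s3 t3 ⟨a1, a2, a3, a4, a5⟩ hF3 ht3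
    rw [List.take_length] at a4 a5
    exact hQ s3 t3 a3 a4 a5 hF3 (by grind)

/-- Look for an edge between the vertex in register 20 and a vertex outside of the list. -/
def scanVertex : Cmd :=
  .set 80 (.v 20) ;; mem ;;
  .ite (.v 81) (.v 7) .skip (
    .set 21 (.v 22) ;; .set 23 (.c 0) ;; scanNbrs ;;
    .ite (.c 0) (.op mul (.v 21) (.v 23))
      (.set 12 (.c 1) ;; .set 13 (.v 20) ;; .set 14 (.v 24)) .skip)

/-- The pair is an edge as looked for by `scan`. -/
def ScanHit (N : ℕ → List ℕ) (ℓ : ℕ → ℕ) (S flag u w : ℕ) : Prop :=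
  ¬ InL ℓ S u ∧ w ∈ N u ∧ ¬ InL ℓ S w ∧ (flag = 1 ∨ ∃ x ∈ N u, InL ℓ S x)

theorem wp_scanVertex (hC : Ctx E n m k N) (h7 : s.r 7 = S) (hS : S ≤ 3 * k + 8) (h20 : s.r 20 = u)
    (hu : u < n) (h22 : s.r 22 = flag) (hfl : flag ≤ 1)
    (hQ : ∀ s' t, (s'.r 12 = s.r 12 ∧ s'.r 13 = s.r 13 ∧ s'.r 14 = s.r 14 ∧
      (∀ w, ¬ ScanHit N (s.a 1) S flag u w) ∨
      s'.r 12 = 1 ∧ ScanHit N (s.a 1) S flag (s'.r 13) (s'.r 14)) →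
      Fr scanVertex s s' → t ≤ (5 * S + 9) * (N u).length + (5 * S + 25) → Q s' t) :
    wp E scanVertex s Q := by
  refine wp_post hQ ?_
  unfold scanVertex
  refine wp_seq (wp_set u trivial h20 ?_)
  refine wp_seq (wp_mem hC (S := S) (by simp [h7]) hS ?_)
  intro s2 t2 hI f2 ht2
  simp only [St.set_r, if_true, St.set_a] at hI
  have h72 : s2.r 7 = S := by rw [f2.r 7 rfl]; simp [h7]
  have h122 : s2.r 12 = s.r 12 := by rw [f2.r 12 rfl]; simp
  have h132 : s2.r 13 = s.r 13 := by rw [f2.r 13 rfl]; simp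
  have h142 : s2.r 14 = s.r 14 := by rw [f2.r 14 rfl]; simp
  have h202 : s2.r 20 = u := by rw [f2.r 20 rfl]; simp [h20]
  have h222 : s2.r 22 = flag := by rw [f2.r 22 rfl]; simp [h22]
  have ha2 : s2.a 1 = s.a 1 := by rw [f2.a 1 rfl]; simp
  refine wp_ite _ _ trivial trivial rfl h72 (fun hlt => ?_) fun hge => ?_
  · refine ⟨Or.inl ⟨h122, h132, h142, ?_⟩, by omega⟩
    intro w hw
    exact hw.1 (hI.inL.2 hlt)
  have hnot : ¬ InL (s.a 1) S u := by rw [hI.inL]; exact hge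
  refine wp_seq (wp_set flag trivial h222 ?_)
  refine wp_seq (wp_set 0 hC.bd_pos rfl ?_)
  refine wp_seq (wp_scanNbrs hC (u := u) (flag := flag) (S := S) (by simp [h72]) hS (by simp [h202]) hu
    (by simp) hfl (by simp) ?_)
  intro s3 t3 a3 a4 a5 f3 ht3
  simp only [St.set_a, ha2] at a4 a5
  have c12 : s3.r 12 = s.r 12 := by rw [f3.r 12 rfl]; simp [h122]
  have c13 : s3.r 13 = s.r 13 := by rw [f3.r 13 rfl]; simp [h132]
  have c14 : s3.r 14 = s.r 14 := by rw [f3.r 14 rfl]; simp [h142]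
  have c20 : s3.r 20 = u := by rw [f3.r 20 rfl]; simp [h202]
  have h23 : s3.r 23 ≤ 1 := by omega
  have hmul := Nat.mul_le_mul a3 h23
  have hlin := hC.lin
  refine wp_ite 0 (s3.r 21 * s3.r 23) hC.bd_pos ⟨trivial, trivial, ?_⟩ rfl rfl (fun hpos => ?_)
    fun hz => ?_
  · simp only [opOk, Ex.ev]; omega
  · have e1 : s3.r 21 = 1 := by grind
    have e2 : s3.r 23 = 1 := by grind
    have e3 := a5.resolve_right (by omega)
    refine wp_seq (wp_set 1 hC.one_lt rfl (wp_seq (wp_set u trivial (by simp [Ex.ev, c20])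
      (wp_set (s3.r 24) trivial (by simp [Ex.ev]) ⟨Or.inr ⟨by simp, ?_⟩, by omega⟩))))
    simp only [St.set_r]
    exact ⟨hnot, e3.2.1, e3.2.2, a4.1 e1⟩
  · refine ⟨Or.inl ⟨c12, c13, c14, ?_⟩, by omega⟩
    rintro w ⟨-, hw2, hw3, hw4⟩
    grind

/-- Look for an edge between vertices outside of the list. If register 22 is `0`, one of them has to
have a neighbour in the list. Register 12 tells about success; the edge goes to 13 and 14. -/
def scan : Cmd := .set 12 (.c 0) ;; .forr 20 (.c 0) 1 scanVertex

theorem wp_scan (hC : Ctx E n m k N) (h1 : s.r 1 = n) (h7 : s.r 7 = S) (hS : S ≤ 3 * k + 8)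
    (h22 : s.r 22 = flag) (hfl : flag ≤ 1)
    (hQ : ∀ s' t, (s'.r 12 = 0 ∧ (∀ u < n, ∀ w, ¬ ScanHit N (s.a 1) S flag u w) ∨
      s'.r 12 = 1 ∧ ScanHit N (s.a 1) S flag (s'.r 13) (s'.r 14)) →
      Fr scan s s' → t ≤ (n + 2 * m) * (5 * S + 30) + 3 → Q s' t) :
    wp E scan s Q := by
  have hlin := hC.lin
  refine wp_post hQ ?_
  unfold scan
  refine wp_seq (wp_set 0 hC.bd_pos rfl ?_)
  refine wp_for (fun i s1 => s1.r 12 = 0 ∧ (∀ u < i, ∀ w, ¬ ScanHit N (s.a 1) S flag u w) ∨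
        s1.r 12 = 1 ∧ ScanHit N (s.a 1) S flag (s1.r 13) (s1.r 14))
    (fun u => (5 * S + 9) * (N u).length + (5 * S + 25)) 0 n hC.bd_pos rfl (by simp [h1])
    (Nat.zero_le _) (by omega) (Or.inl (by simp)) ?_ ?_
  · intro u _ hu s1 hJ hx hF
    have h71 : s1.r 7 = S := by rw [hF.r 7 rfl]; simp [h7]
    have h221 : s1.r 22 = flag := by rw [hF.r 22 rfl]; simp [h22]
    have ha1 : s1.a 1 = s.a 1 := by rw [hF.a 1 rfl]; simp
    refine wp_scanVertex hC h71 hS hx hu h221 hfl fun s2 t2 h2 f2 ht2 => ⟨ht2, ?_⟩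
    rw [ha1] at h2
    simp only [St.set_r, show (12 : ℕ) ≠ 20 by omega, show (13 : ℕ) ≠ 20 by omega,
      show (14 : ℕ) ≠ 20 by omega, if_false]
    grind
  · intro s' t hJ _ _ ht
    refine ⟨hJ, ?_⟩
    have h2 := hC.sum
    simp only [sum_add_distrib, ← mul_sum, sum_const, smul_eq_mul,
      ← range_eq_Ico, h2, card_range] at ht
    nlinarith

/-! ### The initial cover -/

/-- A list of distinct vertices, each but the first adjacent to an earlier one, that consists of
the endpoints of disjoint edges. -/
structure PairList (n : ℕ) (N : ℕ → List ℕ) (ℓ : ℕ → ℕ) (S : ℕ) : Prop where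
  inj : ∀ i < S, ∀ j < S, ℓ i = ℓ j → i = j
  lt : ∀ i < S, ℓ i < n
  par : ∀ i, 0 < i → i < S → ∃ j < i, ℓ j ∈ N (ℓ i)
  pair : ∀ i, 2 * i < S → 2 * i + 1 < S ∧ ℓ (2 * i + 1) ∈ N (ℓ (2 * i))

/-- A vertex cover has at least as many elements as there are disjoint edges. -/
theorem PairList.le_card (h : PairList n N ℓ S) (hc : 2 * c ≤ S) (hX : CVC n N X) : c ≤ X.card := by
  classical
  rw [← card_range c]
  have hcov : ∀ i < c, ¬ ℓ (2 * i) ∈ X → ℓ (2 * i + 1) ∈ X := fun i hi hn =>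
    (hX.cov _ _ (h.pair i (by omega)).2).resolve_left hn
  refine card_le_card_of_injOn
    (fun i => if ℓ (2 * i) ∈ X then ℓ (2 * i) else ℓ (2 * i + 1)) ?_ ?_
  · intro i hi
    grind
  · intro i hi j hj hij
    have hi : i < c := by simpa using hi
    have hj : j < c := by simpa using hj
    dsimp only at hij
    split_ifs at hij <;> have := h.inj _ (by omega) _ (by omega) hij <;> omega

/-- If a nonempty list cannot be extended by an edge near it although there is one elsewhere, the
graph has several components with edges. -/
theorem PairList.no_cvc (hG : Gr n N) (h : PairList n N ℓ S) (hS : 2 ≤ S)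
    (hst : ∀ u w, ¬ ScanHit N ℓ S 0 u w) (huw : ScanHit N ℓ S 1 u w) (hX : CVC n N X) : False := by
  classical
  have hin : ∀ v, ¬ InL ℓ S v → (∃ x ∈ N v, InL ℓ S x) → ∀ y ∈ N v, InL ℓ S y := by
    intro v hv hx y hy
    by_contra hn
    exact hst v y ⟨hv, hy, hn, Or.inr hx⟩
  have hZ := hX.conn (X.filter fun v => InL ℓ S v ∨ ∃ x ∈ N v, InL ℓ S x) (filter_subset _ _) ?_ ?_
  · rcases hX.cov _ _ huw.2.1 with hu | hw
    · rw [← hZ, mem_filter] at hu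
      exact huw.2.2.1 (hin u huw.1 (hu.2.resolve_left huw.1) w huw.2.1)
    · rw [← hZ, mem_filter] at hw
      exact huw.1 (hin w huw.2.2.1 (hw.2.resolve_left huw.2.2.1) u (hG.symm _ _ huw.2.1))
  · rcases hX.cov _ _ (h.pair 0 (by omega)).2 with h0 | h0
    · exact ⟨_, mem_filter.2 ⟨h0, Or.inl ⟨_, by omega, rfl⟩⟩⟩
    · exact ⟨_, mem_filter.2 ⟨h0, Or.inl ⟨_, by omega, rfl⟩⟩⟩
  · intro z hz x hx hN
    refine mem_filter.2 ⟨hx, ?_⟩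
    by_cases hzL : InL ℓ S z
    · exact Or.inr ⟨z, hG.symm _ _ hN, hzL⟩
    grind

/-- A new pair can be appended. -/
theorem PairList.append (hG : Gr n N) (h : PairList n N ℓ S) (hev : S % 2 = 0)
    (huw : ScanHit N ℓ S flag u w) (hfl : flag = 1 → S = 0) :
    PairList n N (update (update ℓ S u) (S + 1) w) (S + 2) := by
  obtain ⟨h1, h2, h3, h4⟩ := huw
  have hold : ∀ i < S, update (update ℓ S u) (S + 1) w i = ℓ i := fun i hi => by
    grind
  have hu : update (update ℓ S u) (S + 1) w S = u := by simp
  have hw : update (update ℓ S u) (S + 1) w (S + 1) = w := by simp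
  have hne : u ≠ w := by rintro rfl; exact hG.irr _ h2
  have hu' : ∀ i < S, ℓ i ≠ u := fun i hi hh => h1 ⟨i, hi, hh⟩
  have hw' : ∀ i < S, ℓ i ≠ w := fun i hi hh => h3 ⟨i, hi, hh⟩
  set ℓ' := update (update ℓ S u) (S + 1) w
  have hcase : ∀ i < S + 2, i < S ∨ i = S ∨ i = S + 1 := fun i hi => by omega
  refine ⟨?_, ?_, ?_, ?_⟩
  · intro i hi j hj hij
    rcases hcase i hi with h5 | rfl | rfl <;> rcases hcase j hj with h6 | rfl | rfl
    · rw [hold i h5, hold j h6] at hij; exact h.inj i h5 j h6 hij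
    · grind
    · grind
    · grind
    · rfl
    · omega
    · grind
    · omega
    · rfl
  · intro i hi
    rcases hcase i hi with h5 | rfl | rfl
    · rw [hold i h5]; exact h.lt i h5
    · rw [hu]; exact hG.lt' h2
    · rw [hw]; exact hG.lt _ _ h2
  · intro i h0 hi
    rcases hcase i hi with h5 | rfl | rfl
    · obtain ⟨j, hj, hN⟩ := h.par i h0 h5
      grind
    · rcases h4 with h4 | ⟨x, hx, j, hj, rfl⟩
      · omega
      grind
    · exact ⟨S, by omega, by rw [hu, hw]; exact hG.symm _ _ h2⟩
  · intro i hi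
    by_cases h5 : 2 * i < S
    · obtain ⟨h6, h7⟩ := h.pair i h5
      grind
    grind

/-- One step of the search for the initial cover. -/
def initStep : Cmd :=
  .ite (.c 0) (.v 30)
    (.ite (.v 30) (.op sub (.v 31) (.c 1)) (.set 22 (.c 0)) (.set 22 (.c 1))) (.set 22 (.c 1)) ;;
  scan ;;
  .ite (.c 0) (.v 12)
    (.ite (.v 30) (.op sub (.v 31) (.c 1))
      (.sto 1 (.v 7) (.v 13) ;; .sto 1 (.op add (.v 7) (.c 1)) (.v 14) ;;
        .set 7 (.op add (.v 7) (.c 2)))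
      (.set 15 (.c 1))) .skip

/-- The state after the given number of steps. -/
def InitInv (n : ℕ) (N : ℕ → List ℕ) (k it : ℕ) (s : St) : Prop :=
  if it ≤ k + 1 then s.r 15 = 0 ∧ PairList n N (s.a 1) (s.r 7) ∧ s.r 7 % 2 = 0 ∧ s.r 7 ≤ 2 * it ∧
      (0 < it → 2 ≤ s.r 7) ∧
      (s.r 7 = 2 * it ∨ 0 < it ∧ ∀ u w, ¬ ScanHit N (s.a 1) (s.r 7) 0 u w)
  else s.r 15 = 0 ∧ PairList n N (s.a 1) (s.r 7) ∧ 2 ≤ s.r 7 ∧ s.r 7 ≤ 2 * k + 2 ∧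
        (∀ u w, ¬ ScanHit N (s.a 1) (s.r 7) 1 u w) ∨
      s.r 15 = 1 ∧ ∀ X, CVC n N X → k < X.card

theorem wp_initStep (hC : Ctx E n m k N) (hm : ∃ u w, w ∈ N u) {it : ℕ} (h1 : s.r 1 = n)
    (h30 : s.r 30 = it) (h31 : s.r 31 = k + 2) (hit : it < k + 2) (hI : InitInv n N k it s)
    (hQ : ∀ s' t, InitInv n N k (it + 1) s' → t ≤ (n + 2 * m) * (10 * k + 40) + 20 → Q s' t) :
    wp E initStep s Q := by
  have hlin := hC.lin
  have hcap := hC.cap_lin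
  rw [InitInv, if_pos (by omega)] at hI
  obtain ⟨i1, i2, i3, i4, i5, i6⟩ := hI
  unfold initStep
  -- the flag is raised in the first and in the last step
  have hflag : wp E (.ite (.c 0) (.v 30)
      (.ite (.v 30) (.op sub (.v 31) (.c 1)) (.set 22 (.c 0)) (.set 22 (.c 1))) (.set 22 (.c 1))) s
      fun s' t => t ≤ 3 ∧ s'.r 22 = (if 0 < it ∧ it < k + 1 then 0 else 1) ∧ s'.r 1 = n ∧
        s'.r 30 = it ∧ s'.r 31 = k + 2 ∧ s'.r 7 = s.r 7 ∧ s'.r 15 = 0 ∧ s'.a = s.a := by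
    refine wp_ite 0 it hC.bd_pos trivial rfl h30 (fun h => ?_) fun h => ?_
    · refine wp_ite it (k + 1) trivial ⟨trivial, hC.one_lt, ?_⟩ h30 ?_ (fun h' => ?_) fun h' => ?_
      · simp only [opOk, Ex.ev, h31]; omega
      · simp [Ex.ev, opEval, h31]
      · refine wp_set 0 hC.bd_pos rfl ⟨by omega, ?_⟩
        simp [h, h', h1, h30, h31, i1]
      · refine wp_set 1 hC.one_lt rfl ⟨by omega, ?_⟩
        simp [h', h1, h30, h31, i1]
    · refine wp_set 1 hC.one_lt rfl ⟨by omega, ?_⟩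
      simp [h, h1, h30, h31, i1]
  refine wp_seq (wp_mono hflag ?_)
  rintro s1 t1 ⟨ht1, f22, f1, f30, f31, f7, f15, fa⟩
  have hSk : s.r 7 ≤ 2 * k + 2 := by omega
  refine wp_seq (wp_scan hC f1 f7 (by omega) f22 (by split_ifs <;> omega) ?_)
  intro s2 t2 hres f2 ht2
  rw [fa] at hres
  have g30 : s2.r 30 = it := by rw [f2.r 30 rfl, f30]
  have g31 : s2.r 31 = k + 2 := by rw [f2.r 31 rfl, f31]
  have g7 : s2.r 7 = s.r 7 := by rw [f2.r 7 rfl, f7]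
  have g15 : s2.r 15 = 0 := by rw [f2.r 15 rfl, f15]
  have ga : s2.a 1 = s.a 1 := by rw [f2.a 1 rfl, fa]
  have ht : t2 ≤ (n + 2 * m) * (10 * k + 40) + 3 := by
    have : (n + 2 * m) * (5 * s.r 7 + 30) ≤ (n + 2 * m) * (10 * k + 40) :=
      Nat.mul_le_mul_left _ (by omega)
    omega
  rcases hres with ⟨h12, hno⟩ | ⟨h12, hhit⟩
  · -- nothing found
    have hno' : ∀ u w, ¬ ScanHit N (s.a 1) (s.r 7) (if 0 < it ∧ it < k + 1 then 0 else 1) u w :=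
      fun u w h => hno u (hC.gr.lt' h.2.1) w h
    refine wp_ite 0 0 hC.bd_pos trivial rfl h12 (fun h => by omega) fun _ => ?_
    refine hQ _ _ ?_ (by omega)
    have hit0 : 0 < it := by
      by_contra h0
      obtain ⟨u, w, huw⟩ := hm
      have h70 : s.r 7 = 0 := by omega
      refine hno' u w ⟨?_, huw, ?_, Or.inl (by simp [h0])⟩ <;> simp [InL, h70]
    rw [InitInv, ga, g7]
    grind
  · refine wp_ite 0 1 hC.bd_pos trivial rfl h12 (fun _ => ?_) fun h => by omega
    refine wp_ite it (k + 1) trivial ⟨trivial, hC.one_lt, ?_⟩ g30 ?_ (fun h' => ?_) fun h' => ?_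
    · simp only [opOk, Ex.ev, g31]; omega
    · simp [Ex.ev, opEval, g31]
    · have hu := hC.gr.lt' hhit.2.1
      refine wp_seq (wp_sto (s.r 7) (s2.r 13) trivial trivial g7 rfl (by omega) ?_)
      refine wp_seq (wp_sto (s.r 7 + 1) (s2.r 14) ⟨trivial, hC.one_lt, ?_⟩ trivial ?_ rfl (by omega) ?_)
      · simp only [opOk, Ex.ev, St.sto_r, g7]; omega
      · simp only [opEval, Ex.ev, St.sto_r, g7]
      refine wp_set (s.r 7 + 2) ⟨trivial, ?_, ?_⟩ ?_ (hQ _ _ ?_ (by omega))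
      · simp only [Ex.ok]; omega
      · simp only [opOk, Ex.ev, St.sto_r, g7]; omega
      · simp only [opEval, Ex.ev, St.sto_r, g7]
      · rw [InitInv, if_pos (by omega)]
        simp only [St.set_r, St.sto_r, St.set_a, St.sto_a_same, if_true, ga,
          show (15 : ℕ) ≠ 7 by omega, if_false, g15, true_and]
        have hSit : s.r 7 = 2 * it := by grind
        refine ⟨PairList.append hC.gr i2 i3 hhit fun hf => ?_, by omega, by omega, fun _ => by omega,
          Or.inl (by omega)⟩
        grind
    · refine wp_set 1 hC.one_lt rfl (hQ _ _ ?_ (by omega))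
      rw [InitInv, if_neg (by omega)]
      refine Or.inr ⟨by simp, fun X hX => ?_⟩
      have hit : it = k + 1 := by omega
      rcases i6 with h6 | ⟨h6, h6'⟩
      · exact (i2.le_card (c := k + 1) (by omega) hX)
      · rw [if_neg (by omega)] at hhit
        exact (i2.no_cvc hC.gr (i5 h6) h6' hhit hX).elim

/-- Find a list of at most `2 * k + 2` vertices that is a connected vertex cover; register 15 is set
to `1` if there is no connected vertex cover with at most `k` elements. -/
def initList : Cmd :=
  .set 7 (.c 0) ;; .set 15 (.c 0) ;; .set 31 (.op add (.v 3) (.c 2)) ;; .forr 30 (.c 0) 31 initStep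

theorem wp_initList (hC : Ctx E n m k N) (hm : ∃ u w, w ∈ N u) (h1 : s.r 1 = n) (h3 : s.r 3 = k)
    (hQ : ∀ s' t, (s'.r 15 = 0 ∧ PairList n N (s'.a 1) (s'.r 7) ∧ 2 ≤ s'.r 7 ∧ s'.r 7 ≤ 2 * k + 2 ∧
      (∀ u w, ¬ ScanHit N (s'.a 1) (s'.r 7) 1 u w) ∨
      s'.r 15 = 1 ∧ ∀ X, CVC n N X → k < X.card) → Fr initList s s' →
      t ≤ (k + 2) * ((n + 2 * m) * (10 * k + 40) + 22) + 5 → Q s' t) :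
    wp E initList s Q := by
  have hlin := hC.lin
  refine wp_post hQ ?_
  unfold initList
  refine wp_seq (wp_set 0 hC.bd_pos rfl (wp_seq (wp_set 0 hC.bd_pos rfl ?_)))
  refine wp_seq (wp_set (k + 2) ⟨trivial, ?_, ?_⟩ ?_ ?_)
  · simp only [Ex.ok]; omega
  · simp only [opOk, Ex.ev, St.set_r]; simp [h3]; omega
  · simp [opEval, Ex.ev, h3]
  refine wp_for0 (InitInv n N k) ((n + 2 * m) * (10 * k + 40) + 20) (k + 2) (by simp) (by omega) ?_
    ?_ ?_
  · rw [InitInv, if_pos (by omega)]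
    simp only [St.set_r]
    simp
    constructor <;> simp
  · intro it hit s1 hJ hx hF
    refine wp_initStep hC hm ?_ hx ?_ hit hJ fun s2 t2 h2 ht2 => ⟨ht2, ?_⟩
    · rw [hF.r 1 rfl]; simp [h1]
    · rw [hF.r 31 rfl]; simp
    · simpa [InitInv] using h2
  · intro s' t hJ _ _ ht
    rw [InitInv, if_neg (by omega)] at hJ
    refine ⟨hJ, ?_⟩
    grind

/-! ### Rearranging the list -/

/-- The vertices of a list. -/
def lset (ℓ : ℕ → ℕ) (S : ℕ) : Finset ℕ := (range S).image ℓ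

theorem mem_lset : w ∈ lset ℓ S ↔ InL ℓ S w := by
  simp [lset, InL]

/-- The list is a connected vertex cover, and up to the index `r` each vertex but the first is
adjacent to an earlier one. -/
structure CList (n : ℕ) (N : ℕ → List ℕ) (ℓ : ℕ → ℕ) (S r : ℕ) : Prop where
  inj : ∀ i < S, ∀ j < S, ℓ i = ℓ j → i = j
  pre : ∀ i, 0 < i → i ≤ r → ∃ j < i, ℓ j ∈ N (ℓ i)
  cvc : CVC n N (lset ℓ S)
  lt : r < S

theorem CList.lt_n (h : CList n N ℓ S r) (hi : i < S) : ℓ i < n :=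
  mem_range.1 (h.cvc.sub (mem_lset.2 ⟨i, hi, rfl⟩))

theorem CList.le_n (h : CList n N ℓ S r) : S ≤ n := by
  have h1 := card_le_card h.cvc.sub
  rwa [lset, card_image_of_injOn, card_range, card_range] at h1
  intro i hi j hj hij
  exact h.inj i (by simpa using hi) j (by simpa using hj) hij

theorem sum_length_le (hC : Ctx E n m k N) (hinj : ∀ i < S, ∀ j < S, ℓ i = ℓ j → i = j)
    (hlt : ∀ i < S, ℓ i < n) :
    ∑ i ∈ range S, (N (ℓ i)).length ≤ 2 * m := by
  rw [← hC.sum, ← sum_image (f := fun v => (N v).length) (g := ℓ) (s := range S)]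
  · refine sum_le_sum_of_subset fun v hv => ?_
    grind
  · intro i hi j hj hij
    grind

/-- For the vertex number register 31 of the list, look for a neighbour among the vertices before
number register 30; the two numbers are put into the registers 33 and 34. -/
def findParentOf : Cmd :=
  .set 32 (.ld 1 (.v 31)) ;;
  nbrs 32 25 26 80 (mem ;; .ite (.v 81) (.v 30) (.set 33 (.v 31) ;; .set 34 (.v 81)) .skip)

/-- The registers 33 and 34 contain a vertex that can be moved to the place `t`, and its parent. -/
def ParentOk (N : ℕ → List ℕ) (ℓ : ℕ → ℕ) (S t q i : ℕ) : Prop :=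
  t ≤ q ∧ q < S ∧ i < t ∧ ℓ i ∈ N (ℓ q)

theorem wp_findParentOf (hC : Ctx E n m k N) {t q : ℕ} (h7 : s.r 7 = S) (hS : S ≤ 3 * k + 8)
    (h30 : s.r 30 = t) (h31 : s.r 31 = q) (htq : t ≤ q) (hq : q < S)
    (hinj : ∀ i < S, ∀ j < S, s.a 1 i = s.a 1 j → i = j) (hlt : ∀ i < S, s.a 1 i < n)
    (hQ : ∀ s' t', (ParentOk N (s.a 1) S t (s'.r 33) (s'.r 34) ∨
      s'.r 33 = s.r 33 ∧ s'.r 34 = s.r 34 ∧ ∀ i < t, s.a 1 i ∉ N (s.a 1 q)) →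
      Fr findParentOf s s' → t' ≤ (5 * S + 10) * (N (s.a 1 q)).length + 4 → Q s' t') :
    wp E findParentOf s Q := by
  have hcap := hC.cap_lin
  refine wp_post hQ ?_
  unfold findParentOf
  refine wp_seq (wp_set (s.a 1 q) ⟨trivial, ?_⟩ ?_ ?_)
  · simp only [Ex.ev, h31]; omega
  · simp only [Ex.ev, h31]
  refine wp_nbrs hC (v := s.a 1 q) (fun z s1 => s1.r 7 = S ∧ s1.r 30 = t ∧ s1.r 31 = q ∧
      s1.a 1 = s.a 1 ∧ (ParentOk N (s.a 1) S t (s1.r 33) (s1.r 34) ∨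
        s1.r 33 = s.r 33 ∧ s1.r 34 = s.r 34 ∧ ∀ i < t, s.a 1 i ∉ (N (s.a 1 q)).take z)) (5 * S + 7)
      (by simp) (hlt q hq) rfl rfl (by omega) (by omega) (by omega) (by omega) ?_ ?_ ?_ ?_
  · grind
  · exact ⟨by simp [h7], by simp [h30], by simp [h31], rfl, Or.inr ⟨by simp, by simp, by simp⟩⟩
  · rintro z hz s3 ⟨a1, a2, a3, a4, a5⟩ hw hF3
    refine wp_seq (wp_mem hC a1 hS ?_)
    intro s4 t4 hI4 f4 ht4
    rw [a4, hw] at hI4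
    have b7 : s4.r 7 = S := by rw [f4.r 7 rfl, a1]
    have b1 : s4.a 1 = s.a 1 := by rw [f4.a 1 rfl, a4]
    have b30 : s4.r 30 = t := by rw [f4.r 30 rfl, a2]
    have b31 : s4.r 31 = q := by rw [f4.r 31 rfl, a3]
    have b33 : s4.r 33 = s3.r 33 := f4.r 33 rfl
    have b34 : s4.r 34 = s3.r 34 := f4.r 34 rfl
    refine wp_ite _ _ trivial trivial rfl b30 (fun hlt' => ?_) fun hge => ?_
    · change s4.r 81 < t at hlt'
      refine wp_seq (wp_set q trivial b31 (wp_set (s4.r 81) trivial (by simp [Ex.ev]) ?_))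
      refine ⟨by omega, by simp [b7], by simp [b30], by simp [b31], by simp [b1], Or.inl ?_⟩
      refine ⟨by simpa using htq, by simpa using hq, by simpa using hlt', ?_⟩
      have h1 : s.a 1 (s4.r 81) = (N (s.a 1 q))[z] := hI4.2.1 (by omega)
      simp only [St.set_r, if_true, show (33 : ℕ) ≠ 34 by omega, if_false, h1]
      simp
    · change ¬ s4.r 81 < t at hge
      refine ⟨by omega, b7, b30, b31, b1, ?_⟩
      rw [b33, b34]
      refine a5.imp id fun h => ⟨h.1, h.2.1, fun i hi hmem => ?_⟩
      rcases (mem_take_succ hz).1 hmem with h' | h'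
      · exact h.2.2 i hi h'
      · have hin := hI4.inL.1 ⟨i, by omega, h'⟩
        have := hinj _ (by omega) _ hin (h'.trans (hI4.2.1 hin).symm)
        omega
  grind

/-- Look for a vertex to be moved to the place in register 30. -/
def findParent : Cmd := .forr 31 (.v 30) 7 findParentOf

theorem wp_findParent (hC : Ctx E n m k N) {t : ℕ} (h7 : s.r 7 = S) (hS : S ≤ 3 * k + 8)
    (h30 : s.r 30 = t) (ht : t < S) (hinj : ∀ i < S, ∀ j < S, s.a 1 i = s.a 1 j → i = j)
    (hlt : ∀ i < S, s.a 1 i < n) (hex : ∃ q i, ParentOk N (s.a 1) S t q i)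
    (hQ : ∀ s' t', ParentOk N (s.a 1) S t (s'.r 33) (s'.r 34) →
      Fr findParent s s' → t' ≤ (5 * S + 10) * (2 * m) + 6 * S + 2 → Q s' t') :
    wp E findParent s Q := by
  have hlin := hC.lin
  refine wp_for (fun q s1 => ParentOk N (s.a 1) S t (s1.r 33) (s1.r 34) ∨
      ∀ q' < q, t ≤ q' → ∀ i < t, s.a 1 i ∉ N (s.a 1 q'))
    (fun q => (5 * S + 10) * (N (s.a 1 q)).length + 4) t S trivial h30 h7 ht.le (by omega)
    (Or.inr fun q' h1 h2 => by omega) ?_ ?_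
  · intro q htq hq s1 hJ hx hF
    have ha : s1.a 1 = s.a 1 := by rw [hF.a 1 rfl]
    refine wp_findParentOf hC (S := S) (t := t) (q := q) (by rw [hF.r 7 rfl, h7]) hS
      (by rw [hF.r 30 rfl, h30]) hx htq hq (by rw [ha]; exact hinj) (by rw [ha]; exact hlt) ?_
    intro s2 t2 h2 f2 ht2
    rw [ha] at h2 ht2
    refine ⟨ht2, ?_⟩
    simp only [St.set_r, show (33 : ℕ) ≠ 31 by omega, show (34 : ℕ) ≠ 31 by omega, if_false]
    grind
  · intro s' t' hJ _ hF ht'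
    refine hQ _ _ (hJ.resolve_right fun h => ?_) hF ?_
    · obtain ⟨q, i, h1, h2, h3, h4⟩ := hex
      grind
    · have h1 := sum_length_le hC hinj hlt
      have h2 : ∑ q ∈ Ico t S, (N (s.a 1 q)).length ≤
          ∑ i ∈ range S, (N (s.a 1 i)).length := by
        refine sum_le_sum_of_subset fun v hv => ?_
        grind
      simp only [sum_add_distrib, ← mul_sum, sum_const, smul_eq_mul,
        Nat.card_Ico] at ht'
      have := Nat.mul_le_mul_left (5 * S + 10) (h2.trans h1)
      omega

/-- Move a vertex with a neighbour among the earlier ones to the place in register 30. -/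
def orderStep : Cmd :=
  findParent ;;
  .set 35 (.ld 1 (.v 30)) ;; .sto 1 (.v 30) (.ld 1 (.v 33)) ;; .sto 1 (.v 33) (.v 35) ;;
  .ite (.v 34) (.v 8) (.sto 3 (.op sub (.v 30) (.v 8)) (.c 0))
    (.sto 3 (.op sub (.v 30) (.v 8)) (.op sub (.v 34) (.v 8)))

/-- The list after rearrangement of the places from `r + 1` to `t - 1`. -/
structure OrdInv (N : ℕ → List ℕ) (ℓ : ℕ → ℕ) (S r t : ℕ) (s : St) : Prop where
  eq : ∀ i ≤ r, s.a 1 i = ℓ i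
  set : ∀ w, InL (s.a 1) S w ↔ InL ℓ S w
  inj : ∀ i < S, ∀ j < S, s.a 1 i = s.a 1 j → i = j
  par : ∀ i, r < i → i < t → ∃ j < i, s.a 1 j ∈ N (s.a 1 i) ∧ s.a 3 (i - r) = j - r

theorem swap_spec {ℓ' : ℕ → ℕ} {t q : ℕ} (ht : t < S) (hq : q < S)
    (hinj : ∀ i < S, ∀ j < S, ℓ i = ℓ j → i = j) (h : ℓ' = update (update ℓ t (ℓ q)) q (ℓ t)) :
    (∀ w, InL ℓ' S w ↔ InL ℓ S w) ∧ (∀ i < S, ∀ j < S, ℓ' i = ℓ' j → i = j) := by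
  have h' : ∀ i, ℓ' i = ℓ (Equiv.swap t q i) := by
    intro i
    rw [h, Equiv.swap_apply_def]
    grind
  have hlt : ∀ i < S, Equiv.swap t q i < S := by grind
  refine ⟨fun w => ⟨?_, ?_⟩, fun i hi j hj hij => ?_⟩
  · rintro ⟨i, hi, rfl⟩
    exact ⟨_, hlt i hi, (h' i).symm⟩
  · rintro ⟨i, hi, rfl⟩
    exact ⟨_, hlt i hi, by rw [h', Equiv.swap_apply_self]⟩
  · rw [h', h'] at hij
    exact (Equiv.swap t q).injective (hinj _ (hlt i hi) _ (hlt j hj) hij)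

theorem wp_orderStep (hC : Ctx E n m k N) {t : ℕ} (h7 : s.r 7 = S) (hS : S ≤ 3 * k + 8)
    (h8 : s.r 8 = r) (h30 : s.r 30 = t) (hrt : r < t) (ht : t < S) (hL : CList n N ℓ S r)
    (hI : OrdInv N ℓ S r t s)
    (hQ : ∀ s' t', OrdInv N ℓ S r (t + 1) s' → t' ≤ (5 * S + 10) * (2 * m) + 6 * S + 10 → Q s' t') :
    wp E orderStep s Q := by
  have hcap := hC.cap_lin
  have hlt : ∀ i < S, s.a 1 i < n := by
    intro i hi
    obtain ⟨j, hj, h⟩ := (hI.set (s.a 1 i)).1 ⟨i, hi, rfl⟩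
    rw [← h]; exact hL.lt_n hj
  have hlset : lset (s.a 1) S = lset ℓ S := by
    ext w; rw [mem_lset, mem_lset, hI.set]
  -- the first `t` vertices are not closed under taking neighbours
  have hex : ∃ q i, ParentOk N (s.a 1) S t q i := by
    by_contra hno
    have hconn := hL.cvc.conn
    rw [← hlset] at hconn
    have h1 := hconn (lset (s.a 1) t) ?_ ⟨s.a 1 0, mem_lset.2 ⟨0, by omega, rfl⟩⟩ ?_
    · have h2 : s.a 1 t ∈ lset (s.a 1) t := by rw [h1]; exact mem_lset.2 ⟨t, ht, rfl⟩
      obtain ⟨i, hi, h3⟩ := mem_lset.1 h2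
      have := hI.inj i (by omega) t ht h3
      omega
    · intro w hw
      obtain ⟨i, hi, h⟩ := mem_lset.1 hw
      exact mem_lset.2 ⟨i, by omega, h⟩
    · intro u hu w hw hN
      obtain ⟨i, hi, rfl⟩ := mem_lset.1 hu
      obtain ⟨q, hq, rfl⟩ := mem_lset.1 hw
      by_contra hnot
      refine hno ⟨q, i, ?_, hq, hi, hC.gr.symm _ _ hN⟩
      by_contra hlt
      exact hnot (mem_lset.2 ⟨q, by omega, rfl⟩)
  unfold orderStep
  refine wp_seq (wp_findParent hC h7 hS h30 ht hI.inj hlt hex ?_)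
  rintro s1 t1 ⟨p1, p2, p3, p4⟩ f1 ht1
  have g8 : s1.r 8 = r := by rw [f1.r 8 rfl, h8]
  have g30 : s1.r 30 = t := by rw [f1.r 30 rfl, h30]
  have ga : s1.a 1 = s.a 1 := f1.a 1 rfl
  have ga3 : s1.a 3 = s.a 3 := f1.a 3 rfl
  set q := s1.r 33 with hq
  set i := s1.r 34 with hi
  refine wp_seq (wp_set (s.a 1 t) ⟨trivial, ?_⟩ ?_ ?_)
  · simp only [Ex.ev, g30]; omega
  · simp only [Ex.ev, g30, ga]
  refine wp_seq (wp_sto t (s.a 1 q) trivial ⟨trivial, ?_⟩ ?_ ?_ (by omega) ?_)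
  · simp only [Ex.ev, St.set_r]; simp; omega
  · simp [Ex.ev, g30]
  · simp [Ex.ev, ga, ← hq]
  refine wp_seq (wp_sto q (s.a 1 t) trivial trivial ?_ ?_ (by omega) ?_)
  · simp [Ex.ev, ← hq]
  · simp [Ex.ev]
  set s2 := (((s1.set 35 (s.a 1 t)).sto 1 t (s.a 1 q)).sto 1 q (s.a 1 t)) with hs2
  have e8 : s2.r 8 = r := by simp [hs2, g8]
  have e30 : s2.r 30 = t := by simp [hs2, g30]
  have e34 : s2.r 34 = i := by simp [hs2, ← hi]
  have e3 : s2.a 3 = s.a 3 := by simp [hs2, ga3]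
  have e1 : s2.a 1 = update (update (s.a 1) t (s.a 1 q)) q (s.a 1 t) := by
    simp [hs2, ga]
  obtain ⟨w1, w2⟩ := swap_spec ht p2 hI.inj e1
  have hne : ∀ j < t, s2.a 1 j = s.a 1 j := by
    intro j hj
    rw [e1, update_of_ne (by omega), update_of_ne (by omega)]
  have het : s2.a 1 t = s.a 1 q := by
    rw [e1]
    grind
  have hfin : ∀ s3 : St, s3.a 1 = s2.a 1 → s3.a 3 = update (s.a 3) (t - r) (i - r) →
      OrdInv N ℓ S r (t + 1) s3 := by
    intro s3 h1 h3
    refine ⟨fun j hj => ?_, fun w => ?_, ?_, fun j hj hjt => ?_⟩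
    · rw [h1, hne j (by omega), hI.eq j hj]
    · rw [h1, w1, hI.set]
    · rw [h1]; exact w2
    · rw [h1, h3]
      rcases Nat.lt_succ_iff_lt_or_eq.1 hjt with h' | rfl
      · obtain ⟨j', a, b, c⟩ := hI.par j hj h'
        grind
      grind
  refine wp_ite i r trivial trivial e34 e8 (fun h => ?_) fun h => ?_
  · refine wp_sto (t - r) 0 ⟨trivial, trivial, ?_⟩ hC.bd_pos ?_ rfl (by omega) (hQ _ _ (hfin _ ?_ ?_) ?_)
    · simp only [opOk, Ex.ev, e30, e8]; omega
    · simp only [opEval, Ex.ev, e30, e8]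
    · simp
    · rw [St.sto_a_same, e3, show i - r = 0 by omega]
    · omega
  · refine wp_sto (t - r) (i - r) ⟨trivial, trivial, ?_⟩ ⟨trivial, trivial, ?_⟩ ?_ ?_ (by omega)
      (hQ _ _ (hfin _ ?_ ?_) ?_)
    · simp only [opOk, Ex.ev, e30, e8]; omega
    · simp only [opOk, Ex.ev, e34, e8]; omega
    · simp only [opEval, Ex.ev, e30, e8]
    · simp only [opEval, Ex.ev, e34, e8]
    · simp
    · rw [St.sto_a_same, e3]
    · omega

/-- Rearrange the list behind the index in register 8 so that each vertex has a neighbour before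
it; the positions of these parents go to the array 3. -/
def order : Cmd := .forr 30 (.op add (.v 8) (.c 1)) 7 orderStep

theorem wp_order (hC : Ctx E n m k N) (h7 : s.r 7 = S) (hS : S ≤ 3 * k + 8) (h8 : s.r 8 = r)
    (hL : CList n N (s.a 1) S r)
    (hQ : ∀ s' t' par, Cover n N (s'.a 1) S par → (∀ i ≤ r, s'.a 1 i = s.a 1 i) →
      lset (s'.a 1) S = lset (s.a 1) S →
      (∀ j, 0 < j → j < S - r → s'.a 3 j = par (r + j) - r) → Fr order s s' →
      t' ≤ S * ((5 * S + 20) * (n + 2 * m) + 12) + 2 → Q s' t') :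
    wp E order s Q := by
  have hlin := hC.lin
  have hr := hL.lt
  refine wp_for (fun t s1 => OrdInv N (s.a 1) S r t s1)
    (fun _ => (5 * S + 10) * (2 * m) + 6 * S + 10) (r + 1) S ⟨trivial, hC.one_lt, ?_⟩ ?_ h7 hr
    (by omega) ?_ ?_ ?_
  · simp only [opOk, Ex.ev, h8]; omega
  · simp only [opEval, Ex.ev, h8]
  · exact ⟨fun _ _ => rfl, fun _ => Iff.rfl, hL.inj, fun i h1 h2 => by omega⟩
  · intro t ht htS s1 hJ hx hF
    refine wp_orderStep hC (S := S) (r := r) (t := t) (by rw [hF.r 7 rfl, h7]) hS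
      (by rw [hF.r 8 rfl, h8]) hx (by omega) htS hL hJ fun s2 t2 h2 ht2 => ⟨ht2, ?_⟩
    exact ⟨h2.eq, h2.set, h2.inj, h2.par⟩
  · intro s' t' hJ _ hF ht'
    have hset : lset (s'.a 1) S = lset (s.a 1) S := by
      ext w; rw [mem_lset, mem_lset, hJ.set]
    have hpar : ∀ i, ∃ j, (0 < i → i < S → j < i ∧ s'.a 1 j ∈ N (s'.a 1 i)) ∧
        (r < i → i < S → s'.a 3 (i - r) = j - r) := by
      intro i
      by_cases hi : r < i
      · by_cases hiS : i < S
        · obtain ⟨j, a, b, c⟩ := hJ.par i hi hiS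
          grind
        grind
      · by_cases h0 : 0 < i
        · obtain ⟨j, a, b⟩ := hL.pre i h0 (by omega)
          refine ⟨j, fun _ _ => ⟨a, ?_⟩, fun h => absurd h hi⟩
          rw [hJ.eq j (by omega), hJ.eq i (by omega)]; exact b
        · exact ⟨0, fun h => absurd h h0, fun h => absurd h hi⟩
    choose par hpar using hpar
    have hcvc := hL.cvc
    rw [← hset] at hcvc
    refine hQ s' t' par ⟨hJ.inj, ?_, fun i h0 hi => (hpar i).1 h0 hi, ?_⟩ hJ.eq hset ?_ hF ?_
    · intro i hi
      exact mem_range.1 (hcvc.sub (mem_lset.2 ⟨i, hi, rfl⟩))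
    · intro u w hN
      exact (hcvc.cov u w hN).imp mem_lset.1 mem_lset.1
    · intro j h0 hj
      have := (hpar (r + j)).2 (by omega) (by omega)
      rwa [Nat.add_sub_cancel_left] at this
    · have hSn := hL.le_n
      simp only [sum_const, Nat.card_Ico, smul_eq_mul] at ht'
      refine ht'.trans (Nat.add_le_add_right (Nat.mul_le_mul (by omega) ?_) _)
      nlinarith

/-! ### The table of masks -/

/-- The number whose powers count covers by size. -/
def bigM (n k : ℕ) : ℕ := (n + 2) ^ (k + 1)

/-- The modulus of the computation. -/
def bigN (n k : ℕ) : ℕ := (n + 2) ^ ((k + 1) ^ 2)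

theorem bigN_eq (n k : ℕ) : bigN n k = bigM n k ^ (k + 1) := by
  rw [bigN, bigM, ← pow_mul, sq]

theorem bigM_le_bigN (n k : ℕ) : bigM n k ≤ bigN n k := by
  rw [bigN_eq]
  exact Nat.le_self_pow (by omega) _

theorem two_le_bigM (n k : ℕ) : 2 ≤ bigM n k :=
  le_trans (by omega) (Nat.le_self_pow (by omega : k + 1 ≠ 0) (n + 2))

theorem Ctx.bigN_sq (h : Ctx E n m k N) : 4 * (bigN n k * bigN n k) ≤ E.bd := by
  have := h.mod
  rwa [mul_comm 2 ((k + 1) ^ 2), pow_mul, sq] at this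

/-- A list `l` of pairs of a key below `V` and a vertex is stored by key: `tab` locates the entry of
a key, `cnt` counts the pairs with this key, `rep` is the vertex of one of them, and `pw` is the
power of `M + 1` with exponent `cnt`. -/
structure Keyed (M Nm V H : ℕ) (tab key cnt rep pw : ℕ → ℕ) (l : List (ℕ × ℕ)) : Prop where
  lt : ∀ q ∈ l, q.1 < V
  tab_le : ∀ x < V, tab x ≤ H
  key_of_tab : ∀ x < V, tab x ≠ 0 → key (tab x - 1) = x
  tab_of_key : ∀ e < H, key e < V ∧ tab (key e) = e + 1
  tab_ne : ∀ q ∈ l, tab q.1 ≠ 0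
  cnt_eq : ∀ e < H, cnt e = l.countP fun q => q.1 = key e
  rep_mem : ∀ e < H, (key e, rep e) ∈ l
  pw_eq : ∀ e < H, pw e = (1 + M) ^ cnt e % Nm

namespace Keyed

variable {M Nm V : ℕ} {tab pw : ℕ → ℕ} {l : List (ℕ × ℕ)}

theorem inj (h : Keyed M Nm V H tab key cnt rep pw l) :
    ∀ e < H, ∀ e' < H, key e = key e' → e = e' := by
  intro e he e' he' hk
  have h1 := (h.tab_of_key e he).2
  have h2 := (h.tab_of_key e' he').2
  rw [hk] at h1
  omega

theorem le_V (h : Keyed M Nm V H tab key cnt rep pw l) : H ≤ V := by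
  have := card_le_card_of_injOn (s := range H) (t := range V) key
    (fun e he => mem_coe.2 (mem_range.2 (h.tab_of_key e (by simpa using he)).1))
    (fun e he e' he' => h.inj e (by simpa using he) e' (by simpa using he'))
  simpa using this

theorem le_length (h : Keyed M Nm V H tab key cnt rep pw l) : H ≤ l.length := by
  classical
  have := card_le_card_of_injOn (s := range H) (t := (l.map Prod.fst).toFinset) key
    (fun e he => mem_coe.2 (List.mem_toFinset.2 (List.mem_map.2 ⟨_, h.rep_mem e (by simpa using he), rfl⟩)))
    (fun e he e' he' => h.inj e (by simpa using he) e' (by simpa using he'))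
  rw [card_range] at this
  refine this.trans ((List.toFinset_card_le _).trans ?_)
  simp

theorem nil : Keyed M Nm V 0 tab key cnt rep pw [] ↔ ∀ x < V, tab x = 0 := by
  constructor
  · intro h x hx
    have := h.tab_le x hx
    omega
  · intro h
    refine ⟨?_, fun x hx => (h x hx).le, fun x hx h' => absurd (h x hx) h', ?_, ?_, ?_, ?_, ?_⟩ <;> simp

/-- A pair with a new key. -/
theorem new (h : Keyed M Nm V H tab key cnt rep pw l) (hx : x < V) (h0 : tab x = 0) :
    Keyed M Nm V (H + 1) (update tab x (H + 1)) (update key H x)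
      (update cnt H 1) (update rep H v) (update pw H ((M + 1) % Nm))
      (l ++ [(x, v)]) := by
  have hne : ∀ e < H, key e ≠ x := by
    rintro e he rfl
    have := (h.tab_of_key e he).2
    omega
  have hcase : ∀ e < H + 1, e < H ∨ e = H := fun e he => by omega
  refine ⟨?_, ?_, ?_, ?_, ?_, ?_, ?_, ?_⟩
  · intro q hq
    rcases List.mem_append.1 hq with hq | hq
    · exact h.lt q hq
    grind
  · intro y hy
    rw [update_apply]
    split_ifs
    · exact le_rfl
    · have := h.tab_le y hy; omega
  · intro y hy hne'
    by_cases hyx : y = x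
    · subst hyx; simp
    · rw [update_of_ne hyx] at hne' ⊢
      have := h.tab_le y hy
      rw [update_of_ne (by omega)]
      exact h.key_of_tab y hy hne'
  · intro e he
    rcases hcase e he with he | rfl
    · rw [update_of_ne (by omega), update_of_ne (hne e he)]
      exact h.tab_of_key e he
    · simp [hx]
  · intro q hq
    rcases List.mem_append.1 hq with hq | hq
    · rw [update_apply]
      split_ifs
      · omega
      · exact h.tab_ne q hq
    grind
  · intro e he
    rw [List.countP_append]
    rcases hcase e he with he | rfl
    · rw [update_of_ne (by omega), update_of_ne (by omega), h.cnt_eq e he]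
      grind
    · have : l.countP (fun q => q.1 = x) = 0 := by
        rw [List.countP_eq_zero]
        intro q hq hqx
        rw [decide_eq_true_eq] at hqx
        exact h.tab_ne q hq (by rw [hqx, h0])
      simp [this]
  · intro e he
    rcases hcase e he with he | rfl
    · rw [update_of_ne (by omega), update_of_ne (by omega)]
      exact List.mem_append_left _ (h.rep_mem e he)
    · simp
  · intro e he
    rcases hcase e he with he | rfl
    · rw [update_of_ne (by omega), update_of_ne (by omega)]
      exact h.pw_eq e he
    · simp [add_comm]

/-- A pair with a known key. -/
theorem old (h : Keyed M Nm V H tab key cnt rep pw l) (hx : x < V) (h0 : tab x ≠ 0) :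
    Keyed M Nm V H tab key (update cnt (tab x - 1) (cnt (tab x - 1) + 1)) rep
      (update pw (tab x - 1) (pw (tab x - 1) * (M + 1) % Nm)) (l ++ [(x, v)]) := by
  have hkx := h.key_of_tab x hx h0
  refine ⟨?_, h.tab_le, h.key_of_tab, h.tab_of_key, ?_, ?_, ?_, ?_⟩
  · intro q hq
    rcases List.mem_append.1 hq with hq | hq
    · exact h.lt q hq
    grind
  · intro q hq
    rcases List.mem_append.1 hq with hq | hq
    · exact h.tab_ne q hq
    grind
  · intro e he
    rw [List.countP_append, ← h.cnt_eq e he, update_apply]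
    split_ifs with hE
    · grind
    · have hne : x ≠ key e := by
        rintro rfl
        exact hE (by rw [(h.tab_of_key e he).2]; omega)
      simp [hne]
  · exact fun e he => List.mem_append_left _ (h.rep_mem e he)
  · intro e he
    rw [update_apply, update_apply]
    split_ifs with hE
    · rw [← hE, h.pw_eq e he, pow_succ, add_comm M 1, Nat.mod_mul_mod]
    · exact h.pw_eq e he

end Keyed

/-- The list is stored in the state. -/
def KeyedIn (n k V : ℕ) (s : St) (l : List (ℕ × ℕ)) : Prop :=
  Keyed (bigM n k) (bigN n k) V (s.r 10) (s.a 5) (s.a 6) (s.a 7) (s.a 8) (s.a 20) l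

theorem KeyedIn.congr {V : ℕ} {l : List (ℕ × ℕ)} (h : KeyedIn n k V s l) (h10 : s'.r 10 = s.r 10)
    (h5 : s'.a 5 = s.a 5) (h6 : s'.a 6 = s.a 6) (h7 : s'.a 7 = s.a 7) (h8 : s'.a 8 = s.a 8)
    (h20 : s'.a 20 = s.a 20) : KeyedIn n k V s' l := by
  rw [KeyedIn, h10, h5, h6, h7, h8, h20]; exact h

/-- Store the pair of the key in register 70 and the vertex in register 71. -/
def addPair : Cmd :=
  .ifEq (.ld 5 (.v 70)) (.c 0)
    (.sto 6 (.v 10) (.v 70) ;; .sto 7 (.v 10) (.c 1) ;; .sto 8 (.v 10) (.v 71) ;;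
      .sto 20 (.v 10) (.op rem (.op add (.v 4) (.c 1)) (.v 5)) ;;
      .set 10 (.op add (.v 10) (.c 1)) ;; .sto 5 (.v 70) (.v 10))
    (.set 72 (.op sub (.ld 5 (.v 70)) (.c 1)) ;;
      .sto 7 (.v 72) (.op add (.ld 7 (.v 72)) (.c 1)) ;;
      .sto 20 (.v 72) (.op rem (.op mul (.ld 20 (.v 72)) (.op add (.v 4) (.c 1))) (.v 5)))

theorem wp_addPair (hC : Ctx E n m k N) {V : ℕ} {l : List (ℕ × ℕ)} (h4 : s.r 4 = bigM n k)
    (h5 : s.r 5 = bigN n k) (hV : V < E.cap) (hK : KeyedIn n k V s l) (h70 : s.r 70 = x)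
    (h71 : s.r 71 = v) (hx : x < V) (hl : l.length ≤ n + 2 * m)
    (hQ : ∀ s' t, KeyedIn n k V s' (l ++ [(x, v)]) → Fr addPair s s' → t ≤ 8 → Q s' t) :
    wp E addPair s Q := by
  have hlin := hC.lin
  have hN := hC.bigN_sq
  have hM := bigM_le_bigN n k
  have hM2 := two_le_bigM n k
  have hNN : bigN n k * (bigM n k + 1) ≤ 2 * (bigN n k * bigN n k) := by nlinarith
  have hNN2 : bigN n k ≤ bigN n k * bigN n k := Nat.le_mul_of_pos_right _ (by omega)
  have hHV := hK.le_V
  have hHl := hK.le_length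
  refine wp_post hQ ?_
  refine wp_ifEq ⟨trivial, ?_⟩ hC.bd_pos (fun he => ?_) fun he => ?_
  · simp only [Ex.ev, h70]; omega
  · simp only [Ex.ev, h70] at he
    have hnew := hK.new (v := v) hx he
    have hlt : s.r 10 < V := by
      by_contra hge
      -- a key that is not stored makes the number of entries smaller than the number of keys
      have h1 := hnew.le_V
      omega
    refine wp_seq (wp_sto (s.r 10) x trivial trivial rfl h70 (by omega) ?_)
    refine wp_seq (wp_sto (s.r 10) 1 trivial hC.one_lt rfl rfl (by omega) ?_)
    refine wp_seq (wp_sto (s.r 10) v trivial trivial rfl h71 (by omega) ?_)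
    refine wp_seq (wp_sto (s.r 10) ((bigM n k + 1) % bigN n k) trivial
      ⟨⟨trivial, hC.one_lt, ?_⟩, trivial, trivial⟩ rfl ?_ (by omega) ?_)
    · simp only [opOk, Ex.ev, St.sto_r, h4]; omega
    · simp only [opEval, Ex.ev, St.sto_r, h4, h5]
    refine wp_seq (wp_set (s.r 10 + 1) ⟨trivial, hC.one_lt, ?_⟩ rfl ?_)
    · simp only [opOk, Ex.ev, St.sto_r]; omega
    refine wp_sto x (s.r 10 + 1) trivial trivial ?_ ?_ (by omega) ⟨?_, by omega⟩
    · simp [Ex.ev, h70]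
    · simp [Ex.ev]
    · simpa [KeyedIn] using hnew
  · simp only [Ex.ev, h70] at he
    have hold := hK.old (v := v) hx he
    have hle := hK.tab_le x hx
    have hcnt : s.a 7 (s.a 5 x - 1) ≤ l.length := by
      rw [hK.cnt_eq _ (by omega)]; grind
    have hpw : s.a 20 (s.a 5 x - 1) < bigN n k := by
      rw [hK.pw_eq _ (by omega)]; exact Nat.mod_lt _ (by omega)
    have hpw2 : s.a 20 (s.a 5 x - 1) * (bigM n k + 1) ≤ bigN n k * (bigM n k + 1) :=
      Nat.mul_le_mul_right _ hpw.le
    have main : wp E (.set 72 (.op sub (.ld 5 (.v 70)) (.c 1)) ;;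
        .sto 7 (.v 72) (.op add (.ld 7 (.v 72)) (.c 1)) ;;
        .sto 20 (.v 72) (.op rem (.op mul (.ld 20 (.v 72)) (.op add (.v 4) (.c 1))) (.v 5))) s
        fun s' t => KeyedIn n k V s' (l ++ [(x, v)]) ∧ t ≤ 3 := by
      refine wp_seq (wp_set (s.a 5 x - 1) ⟨⟨trivial, ?_⟩, hC.one_lt, ?_⟩ ?_ ?_)
      · simp only [Ex.ev, h70]; omega
      · simp only [opOk, Ex.ev, h70]; omega
      · simp only [opEval, Ex.ev, h70]
      refine wp_seq (wp_sto (s.a 5 x - 1) (s.a 7 (s.a 5 x - 1) + 1) trivial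
        ⟨⟨trivial, ?_⟩, hC.one_lt, ?_⟩ ?_ ?_ (by omega) ?_)
      · simp [Ex.ev]; omega
      · simp [opOk, Ex.ev]; omega
      · simp [Ex.ev]
      · simp [opEval, Ex.ev]
      refine wp_sto (s.a 5 x - 1) (s.a 20 (s.a 5 x - 1) * (bigM n k + 1) % bigN n k) trivial
        ⟨⟨⟨trivial, ?_⟩, ⟨trivial, hC.one_lt, ?_⟩, ?_⟩, trivial, trivial⟩ ?_ ?_ (by omega) ⟨?_, le_rfl⟩
      · simp [Ex.ev]; omega
      · simp [opOk, Ex.ev, h4]; omega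
      · simp [opOk, opEval, Ex.ev, h4]; omega
      · simp [Ex.ev]
      · simp [opEval, Ex.ev, h4, h5]
      · simpa [KeyedIn] using hold
    refine wp_mono main fun s' t h => ⟨⟨h.1, by omega⟩, h.1, by omega⟩

/-! ### Collecting the masks -/

/-- The registers and arrays that stay fixed while a list is processed. -/
structure Base (n k : ℕ) (ℓ : ℕ → ℕ) (S r : ℕ) (s : St) : Prop where
  r1 : s.r 1 = n
  r3 : s.r 3 = k
  r4 : s.r 4 = bigM n k
  r5 : s.r 5 = bigN n k
  r7 : s.r 7 = S
  r8 : s.r 8 = r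
  a1 : s.a 1 = ℓ
  tab : Tab k s

theorem Base.congr (h : Base n k ℓ S r s) (hr : ∀ x, x ∈ [1, 3, 4, 5, 6, 7, 8] → s'.r x = s.r x)
    (ha : ∀ x, x ∈ [0, 1, 4, 16] → s'.a x = s.a x) : Base n k ℓ S r s' := by
  refine ⟨?_, ?_, ?_, ?_, ?_, ?_, ?_, h.tab.congr ?_ ?_ ?_ ?_⟩
  · rw [hr 1 (by simp)]; exact h.r1
  · rw [hr 3 (by simp)]; exact h.r3
  · rw [hr 4 (by simp)]; exact h.r4
  · rw [hr 5 (by simp)]; exact h.r5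
  · rw [hr 7 (by simp)]; exact h.r7
  · rw [hr 8 (by simp)]; exact h.r8
  · rw [ha 1 (by simp)]; exact h.a1
  · exact hr 6 (by simp)
  · exact ha 0 (by simp)
  · exact ha 4 (by simp)
  grind

theorem Base.fr (h : Base n k ℓ S r s) (f : Fr p s s')
    (hp : (∀ x ∈ [1, 3, 4, 5, 6, 7, 8], p.wr x = false) ∧ ∀ x ∈ [0, 1, 4, 16], p.wa x = false) :
    Base n k ℓ S r s' :=
  h.congr (fun x hx => f.r x (hp.1 x hx)) fun x hx => f.a x (hp.2 x hx)

theorem Base.set (h : Base n k ℓ S r s) (hx : 8 < x) :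
    Base n k ℓ S r (s.set x v) := by
  refine h.congr (fun y hy => ?_) fun _ _ => rfl
  rw [St.set_r, if_neg]
  grind

open Classical in
/-- The index of a vertex in a list, or the length of the list. -/
noncomputable def ix (ℓ : ℕ → ℕ) (S w : ℕ) : ℕ := if h : InL ℓ S w then Classical.choose h else S

theorem idx_ix (w : ℕ) : Idx ℓ S w (ix ℓ S w) := by
  unfold ix
  split_ifs with h
  · exact ⟨(Classical.choose_spec h).1.le, fun _ => (Classical.choose_spec h).2, fun h' =>
      absurd h' (Classical.choose_spec h).1.ne⟩
  · exact ⟨le_rfl, fun h => by omega, fun _ => h⟩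

theorem Idx.eq_ix (h : Idx ℓ S w i) (hinj : ∀ i < S, ∀ j < S, ℓ i = ℓ j → i = j) :
    i = ix ℓ S w := by
  have h' := idx_ix (ℓ := ℓ) (S := S) w
  by_cases hi : i < S
  · have hj := h'.inL.1 (h.inL.2 hi)
    exact hinj _ hi _ hj ((h.2.1 hi).trans (h'.2.1 hj).symm)
  · have hj : ¬ ix ℓ S w < S := fun hj => hi (h.inL.1 (h'.inL.2 hj))
    have := h.1
    have := h'.1
    omega

theorem ix_apply (hinj : ∀ i < S, ∀ j < S, ℓ i = ℓ j → i = j) (hi : i < S) :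
    ix ℓ S (ℓ i) = i :=
  (Idx.eq_ix ⟨hi.le, fun _ => rfl, fun h => by omega⟩ hinj).symm

/-- Turn the index in register 81 into a position, in register 46. -/
def posOf : Cmd := .ite (.v 81) (.v 8) (.set 46 (.c 0)) (.set 46 (.op sub (.v 81) (.v 8)))

theorem wp_posOf (hC : Ctx E n m k N) (hQ : Q (s.set 46 (s.r 81 - s.r 8)) 2) : wp E posOf s Q := by
  refine wp_ite _ _ trivial trivial rfl rfl (fun h => ?_) fun h => ?_
  · refine wp_set _ hC.bd_pos rfl ?_
    simp only [Ex.ev] at h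
    rwa [show s.r 81 - s.r 8 = 0 by omega] at hQ
  · simp only [Ex.ev] at h
    refine wp_set _ ⟨trivial, trivial, ?_⟩ rfl hQ
    simp only [opOk, Ex.ev]; omega

/-- The positions of the vertices in a list of vertices. -/
noncomputable def posIn (ℓ : ℕ → ℕ) (S r : ℕ) (l : List ℕ) : Finset ℕ :=
  (l.toFinset.filter fun w => ix ℓ S w < S).image fun w => ix ℓ S w - r

theorem posIn_eq (hinj : ∀ i < S, ∀ j < S, ℓ i = ℓ j → i = j) (v : ℕ) :
    posIn ℓ S r (N v) = posSet N ℓ S r v := by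
  ext j
  simp only [posIn, mem_image, mem_filter, List.mem_toFinset, mem_posSet]
  constructor
  · rintro ⟨w, ⟨hw, hi⟩, rfl⟩
    refine ⟨_, hi, ?_, rfl⟩
    rw [(idx_ix w).2.1 hi]; exact hw
  · rintro ⟨i, hi, hN, rfl⟩
    exact ⟨ℓ i, ⟨hN, by rw [ix_apply hinj hi]; exact hi⟩, by rw [ix_apply hinj hi]⟩

theorem posIn_take_succ {l : List ℕ} (hz : z < l.length) :
    posIn ℓ S r (l.take (z + 1)) =
      posIn ℓ S r (l.take z) ∪ if ix ℓ S l[z] < S then {ix ℓ S l[z] - r} else ∅ := by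
  ext j
  split_ifs with h <;>
  simp only [posIn, mem_image, mem_filter, List.mem_toFinset, mem_take_succ hz,
    mem_union, mem_singleton, notMem_empty, or_false] <;>
  constructor
  · grind
  · grind
  · grind
  grind

/-- Compute the mask of the vertex in register 42 in register 47. -/
def maskOf : Cmd :=
  .set 47 (.c 0) ;;
  nbrs 42 44 45 80 (mem ;; .ite (.v 81) (.v 7)
    (posOf ;; .ite (.c 0) (.op rem (.op quot (.v 47) (.ld 4 (.v 46))) (.c 2)) .skip
      (.set 47 (.op add (.v 47) (.ld 4 (.v 46))))) .skip)

theorem wp_maskOf (hC : Ctx E n m k N) (hB : Base n k ℓ S r s) (hS : S ≤ 3 * k + 8)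
    (hp : S - r ≤ k + 2) (hinj : ∀ i < S, ∀ j < S, ℓ i = ℓ j → i = j) (h42 : s.r 42 = v)
    (hv : v < n) (hQ : ∀ s' t, bs (s'.r 47) = posSet N ℓ S r v → Fr maskOf s s' →
      t ≤ (5 * S + 14) * (N v).length + 4 → Q s' t) :
    wp E maskOf s Q := by
  have hcap := hC.cap_lin
  refine wp_post hQ ?_
  unfold maskOf
  refine wp_seq (wp_set 0 hC.bd_pos rfl ?_)
  refine wp_nbrs hC (v := v) (fun z s1 => Base n k ℓ S r s1 ∧
      bs (s1.r 47) = posIn ℓ S r ((N v).take z)) (5 * S + 11)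
      (by simp [h42]) hv rfl rfl (by omega) (by omega) (by omega) (by omega) ?_ ?_ ?_ ?_
  · rintro i s3 s4 ⟨hB3, hJ3⟩ hr ha
    refine ⟨hB3.congr (fun x hx => hr x ?_ ?_ ?_) fun x _ => by rw [ha], ?_⟩
    · grind
    · grind
    · grind
    grind
  · exact ⟨hB.set (by omega), by simp [posIn]⟩
  · rintro z hz s3 ⟨hB3, hJ3⟩ hw hF3
    refine wp_seq (wp_mem hC hB3.r7 hS ?_)
    intro s4 t4 hI4 f4 ht4
    rw [hB3.a1, hw] at hI4
    have hB4 := hB3.fr f4 (by decide)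
    have b47 : s4.r 47 = s3.r 47 := f4.r 47 rfl
    have hix := hI4.eq_ix hinj
    rw [posIn_take_succ hz, ← hix]
    refine wp_ite (s4.r 81) S trivial trivial rfl hB4.r7 (fun hlt => ?_) fun hge => ?_
    · rw [if_pos hlt]
      refine wp_seq (wp_posOf hC ?_)
      set j := s4.r 81 - s4.r 8 with hj
      have hj8 : j = s4.r 81 - r := by rw [hj, hB4.r8]
      rw [← hj8]
      have hB5 : Base n k ℓ S r (s4.set 46 j) := hB4.set (by omega)
      have hpow := hB4.tab.pow j (by omega)
      have hbs : bs (s4.r 47) = posIn ℓ S r ((N v).take z) := by rw [b47, hJ3]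
      have hsub : bs (s4.r 47) ⊆ range (k + 3) := by
        rw [hbs]
        intro x hx
        simp only [posIn, mem_image, mem_filter] at hx
        grind
      have h47 := lt_two_pow_iff.2 hsub
      have hpk : 2 ^ j ≤ 2 ^ (k + 3) := Nat.pow_le_pow_right (by omega) (by omega)
      have hbd := hC.exp_le (i := k + 4) (by omega)
      have h24 : 2 ^ (k + 4) = 2 ^ (k + 3) + 2 ^ (k + 3) := by ring
      have hlin := hC.lin
      refine wp_ite 0 (s4.r 47 / 2 ^ j % 2) hC.bd_pos ⟨⟨trivial, ⟨trivial, ?_⟩, trivial⟩, ?_, trivial⟩ rfl ?_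
        (fun h => ?_) fun h => ?_
      · simp [Ex.ev]; omega
      · simp only [Ex.ok]; omega
      · simp [opEval, Ex.ev, hpow, b47]
      · refine ⟨by omega, hB5, ?_⟩
        have hmem : j ∈ bs (s4.r 47) := mem_bs_iff_div.2 (by omega)
        simp only [St.set_r, show (47 : ℕ) ≠ 46 by omega, if_false]
        grind
      · have hmem : j ∉ bs (s4.r 47) := fun h' => h (by rw [mem_bs_iff_div.1 h']; omega)
        refine wp_set (s4.r 47 + 2 ^ j) ⟨trivial, ⟨trivial, ?_⟩, ?_⟩ ?_ ⟨by omega, hB5.set (by omega), ?_⟩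
        · simp [Ex.ev]; omega
        · simp [opOk, Ex.ev, hpow]; omega
        · simp [opEval, Ex.ev, hpow]
        · simp only [St.set_r, if_true]
          rw [bs_add_two_pow hmem, hbs, insert_eq, union_comm]
    · rw [if_neg hge, union_empty]
      exact ⟨by omega, hB4, by rw [b47, hJ3]⟩
  · rintro s3 t3 ⟨-, hJ⟩ hF3 ht3
    rw [List.take_length, posIn_eq hinj] at hJ
    grind

/-- The pairs that an edge inside of the list contributes. -/
noncomputable def pairsIn (ℓ : ℕ → ℕ) (S r v : ℕ) (l : List ℕ) : List (ℕ × ℕ) :=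
  (l.filter fun w => ix ℓ S w < S ∧ ix ℓ S w - r ≠ ix ℓ S v - r).map fun w =>
    (2 * (2 ^ (ix ℓ S v - r) + 2 ^ (ix ℓ S w - r)) + 1, v)

/-- The pairs that a vertex contributes. -/
noncomputable def contr (N : ℕ → List ℕ) (ℓ : ℕ → ℕ) (S r v : ℕ) : List (ℕ × ℕ) :=
  if ix ℓ S v < S then pairsIn ℓ S r v (N v)
  else if posSet N ℓ S r v = ∅ then [] else [(2 * ofBits (posSet N ℓ S r v), v)]

/-- Store the masks of the edges between the vertex in register 42 and others in the list. -/
def typesIn : Cmd :=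
  posOf ;; .set 43 (.v 46) ;;
  nbrs 42 44 45 80 (mem ;; .ite (.v 81) (.v 7)
    (posOf ;; .ifEq (.v 46) (.v 43) .skip
      (.set 70 (.op add (.op mul (.c 2) (.op add (.ld 4 (.v 43)) (.ld 4 (.v 46)))) (.c 1)) ;;
        .set 71 (.v 42) ;; addPair)) .skip)

theorem pairsIn_take_succ {l : List ℕ} (hz : z < l.length) :
    pairsIn ℓ S r v (l.take (z + 1)) = pairsIn ℓ S r v (l.take z) ++
      if ix ℓ S l[z] < S ∧ ix ℓ S l[z] - r ≠ ix ℓ S v - r then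
        [(2 * (2 ^ (ix ℓ S v - r) + 2 ^ (ix ℓ S l[z] - r)) + 1, v)] else [] := by
  rw [pairsIn, List.take_add_one, List.getElem?_eq_getElem hz, Option.toList_some, List.filter_append,
    List.map_append, List.filter_singleton]
  congr 1
  grind

theorem length_pairsIn_le (v : ℕ) (l : List ℕ) : (pairsIn ℓ S r v l).length ≤ l.length := by
  rw [pairsIn, List.length_map]
  grind

theorem two_pow_add_lt {p : ℕ} (ha : a < p) (hb : b < p) (hab : a ≠ b) : 2 ^ a + 2 ^ b < 2 ^ p := by
  rw [lt_two_pow_iff, bs_add_two_pow, bs_two_pow]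
  · grind
  · rw [bs_two_pow, mem_singleton]; exact hab.symm

theorem wp_typesIn (hC : Ctx E n m k N) (hB : Base n k ℓ S r s) (hS : S ≤ 3 * k + 8)
    (hp : S - r ≤ k + 2) (hr : r < S) (hinj : ∀ i < S, ∀ j < S, ℓ i = ℓ j → i = j)
    (h42 : s.r 42 = v) (hv : v < n) (h81 : s.r 81 = ix ℓ S v) (hvS : ix ℓ S v < S)
    {l : List (ℕ × ℕ)} (hl : l.length + (N v).length ≤ n + 2 * m)
    (hK : KeyedIn n k (2 ^ (S - r + 1)) s l)
    (hQ : ∀ s' t, KeyedIn n k (2 ^ (S - r + 1)) s' (l ++ pairsIn ℓ S r v (N v)) → Fr typesIn s s' →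
      t ≤ (5 * S + 22) * (N v).length + 6 → Q s' t) :
    wp E typesIn s Q := by
  have hcap := hC.cap_lin
  refine wp_post hQ ?_
  unfold typesIn
  refine wp_seq (wp_posOf hC ?_)
  rw [hB.r8, h81]
  refine wp_seq (wp_set (ix ℓ S v - r) trivial (by simp [Ex.ev]) ?_)
  refine wp_nbrs hC (v := v) (fun z s1 => Base n k ℓ S r s1 ∧ s1.r 43 = ix ℓ S v - r ∧ s1.r 42 = v ∧
      KeyedIn n k (2 ^ (S - r + 1)) s1 (l ++ pairsIn ℓ S r v ((N v).take z))) (5 * S + 19)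
      (by simp [h42]) hv rfl rfl (by omega) (by omega) (by omega) (by omega) ?_ ?_ ?_ ?_
  · rintro i s3 s4 ⟨hB3, h43, h42, hJ3⟩ hr ha
    refine ⟨hB3.congr (fun x hx => hr x ?_ ?_ ?_) fun x _ => by rw [ha], ?_, ?_, ?_⟩
    · grind
    · grind
    · grind
    · grind
    · grind
    · exact hJ3.congr (hr 10 (by omega) (by omega) (by omega)) (by rw [ha]) (by rw [ha])
        (by rw [ha]) (by rw [ha]) (by rw [ha])
  · refine ⟨(hB.set (by omega)).set (by omega), by simp, by simp [h42], ?_⟩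
    rw [show pairsIn ℓ S r v ((N v).take 0) = [] by simp [pairsIn], List.append_nil]
    exact hK.congr (by simp) rfl rfl rfl rfl rfl
  · rintro z hz s3 ⟨hB3, h43, h42, hJ3⟩ hw hF3
    refine wp_seq (wp_mem hC hB3.r7 hS ?_)
    intro s4 t4 hI4 f4 ht4
    rw [hB3.a1, hw] at hI4
    have hB4 := hB3.fr f4 (by decide)
    have hJ4 : KeyedIn n k (2 ^ (S - r + 1)) s4 (l ++ pairsIn ℓ S r v ((N v).take z)) :=
      hJ3.congr (f4.r 10 rfl) (f4.a 5 rfl) (f4.a 6 rfl) (f4.a 7 rfl) (f4.a 8 rfl) (f4.a 20 rfl)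
    have b43 : s4.r 43 = ix ℓ S v - r := by rw [f4.r 43 rfl, h43]
    have b42 : s4.r 42 = v := by rw [f4.r 42 rfl, h42]
    have hix := hI4.eq_ix hinj
    rw [pairsIn_take_succ hz, ← hix]
    refine wp_ite (s4.r 81) S trivial trivial rfl hB4.r7 (fun hlt => ?_) fun hge => ?_
    · refine wp_seq (wp_posOf hC ?_)
      set j := s4.r 81 - s4.r 8 with hj
      have hj8 : j = s4.r 81 - r := by rw [hj, hB4.r8]
      rw [← hj8]
      have hB5 : Base n k ℓ S r (s4.set 46 j) := hB4.set (by omega)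
      set i := ix ℓ S v - r
      have hpow := hB4.tab.pow j (by omega)
      have hpowi := hB4.tab.pow i (by omega)
      refine wp_ifEq trivial trivial (fun he => ?_) fun he => ?_
      · simp only [Ex.ev, St.set_r] at he
        simp [b43] at he
        rw [if_neg (by simp [he])]
        rw [List.append_nil]
        refine ⟨by omega, hB5, by simp [b43], by simp [b42], hJ4.congr (by simp) rfl rfl rfl rfl rfl⟩
      · simp only [Ex.ev, St.set_r] at he
        simp [b43] at he
        rw [if_pos ⟨hlt, he⟩]
        have hmask := two_pow_add_lt (p := S - r) (show i < S - r by omega) (show j < S - r by omega)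
          (Ne.symm he)
        have hV : 2 ^ (S - r + 1) ≤ 2 ^ (k + 3) := Nat.pow_le_pow_right (by omega) (by omega)
        have hbd := hC.exp_le (i := k + 3) (by omega)
        have hcap' := hC.cap_pow
        have h34 : 2 ^ (k + 4) = 2 * 2 ^ (k + 3) := by ring
        have hlin := hC.lin
        have hwp : wp E (.set 70 (.op add (.op mul (.c 2) (.op add (.ld 4 (.v 43)) (.ld 4 (.v 46)))) (.c 1)) ;;
            .set 71 (.v 42) ;; addPair) (s4.set 46 j) fun s' t => t ≤ 10 ∧ Base n k ℓ S r s' ∧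
              s'.r 43 = i ∧ s'.r 42 = v ∧ KeyedIn n k (2 ^ (S - r + 1)) s'
                ((l ++ pairsIn ℓ S r v ((N v).take z)) ++ [(2 * (2 ^ i + 2 ^ j) + 1, v)]) := by
          refine wp_seq (wp_set (2 * (2 ^ i + 2 ^ j) + 1)
            ⟨⟨?_, ⟨⟨trivial, ?_⟩, ⟨trivial, ?_⟩, ?_⟩, ?_⟩, hC.one_lt, ?_⟩ ?_ ?_)
          · simp only [Ex.ok]; omega
          · simp [Ex.ev, b43]; omega
          · simp [Ex.ev]; omega
          · simp [opOk, Ex.ev, hpow, b43, hpowi]; omega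
          · simp [opOk, opEval, Ex.ev, hpow, b43, hpowi]; omega
          · simp [opOk, opEval, Ex.ev, hpow, b43, hpowi]; omega
          · simp [opEval, Ex.ev, hpow, b43, hpowi]
          refine wp_seq (wp_set v trivial (by simp [Ex.ev, b42]) ?_)
          have hB6 := (hB5.set (x := 70) (v := 2 * (2 ^ i + 2 ^ j) + 1) (by omega)).set (x := 71) (v := v)
            (by omega)
          refine wp_addPair hC (V := 2 ^ (S - r + 1)) hB6.r4 hB6.r5 (by omega)
            (l := l ++ pairsIn ℓ S r v ((N v).take z)) (hJ4.congr (by simp) rfl rfl rfl rfl rfl)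
            (x := 2 * (2 ^ i + 2 ^ j) + 1) (v := v) (by simp) (by simp) (by omega) ?_ ?_
          · have := length_pairsIn_le (ℓ := ℓ) (S := S) (r := r) v ((N v).take z)
            grind
          · intro s5 t5 hK5 f5 ht5
            refine ⟨by omega, hB6.fr f5 (by decide), ?_, ?_, hK5⟩
            · rw [f5.r 43 rfl]; simp [b43]
            · rw [f5.r 42 rfl]; simp [b42]
        refine wp_mono hwp ?_
        grind
    · rw [if_neg (fun h => hge h.1), List.append_nil]
      exact ⟨by omega, hB4, b43, b42, hJ4⟩
  grind

/-! ### The entries -/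

/-- All pairs that the first `v` vertices contribute. -/
noncomputable def pairs (N : ℕ → List ℕ) (ℓ : ℕ → ℕ) (S r v : ℕ) : List (ℕ × ℕ) :=
  (List.range v).flatMap (contr N ℓ S r)

theorem pairs_succ (v : ℕ) : pairs N ℓ S r (v + 1) = pairs N ℓ S r v ++ contr N ℓ S r v := by
  simp [pairs, List.range_succ]

theorem length_contr_le (v : ℕ) : (contr N ℓ S r v).length ≤ 1 + (N v).length := by
  unfold contr
  split_ifs
  · have := length_pairsIn_le (ℓ := ℓ) (S := S) (r := r) v (N v)
    omega
  · simp
  · simp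

theorem length_pairs_le (v : ℕ) :
    (pairs N ℓ S r v).length ≤ v + ∑ u ∈ range v, (N u).length := by
  induction v with
  | zero => simp [pairs]
  | succ v ih =>
    rw [pairs_succ, List.length_append, sum_range_succ]
    have := length_contr_le (N := N) (ℓ := ℓ) (S := S) (r := r) v
    omega

theorem mem_pairs {q : ℕ × ℕ} : q ∈ pairs N ℓ S r v ↔ ∃ u < v, q ∈ contr N ℓ S r u := by
  simp [pairs, List.mem_flatMap]

theorem contr_in {q : ℕ × ℕ} (hv : ix ℓ S v < S) : q ∈ contr N ℓ S r v ↔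
    ∃ w ∈ N v, ix ℓ S w < S ∧ ix ℓ S w - r ≠ ix ℓ S v - r ∧
      q = (2 * (2 ^ (ix ℓ S v - r) + 2 ^ (ix ℓ S w - r)) + 1, v) := by
  rw [contr, if_pos hv, pairsIn, List.mem_map]
  grind

theorem contr_out {q : ℕ × ℕ} (hv : ¬ ix ℓ S v < S) :
    q ∈ contr N ℓ S r v ↔ (posSet N ℓ S r v).Nonempty ∧ q = (2 * ofBits (posSet N ℓ S r v), v) := by
  rw [contr, if_neg hv]
  grind

theorem ix_not_lt : ¬ ix ℓ S v < S ↔ ∀ i < S, ℓ i ≠ v := by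
  rw [← (idx_ix v).inL, InL]
  push Not
  rfl

theorem bs_pair (h : a ≠ b) : bs (2 ^ a + 2 ^ b) = {a, b} := by
  rw [bs_add_two_pow, bs_two_pow, insert_eq, insert_eq, union_comm]
  rw [bs_two_pow, mem_singleton]; exact h.symm

/-- Stored pairs of all vertices are entries. -/
theorem entries_of_keyed {M Nm V : ℕ} {tab pw : ℕ → ℕ} (hG : Gr n N)
    (hinj : ∀ i < S, ∀ j < S, ℓ i = ℓ j → i = j)
    (hK : Keyed M Nm V H tab key cnt rep pw (pairs N ℓ S r n)) :
    Entries n N ℓ S r H key cnt rep := by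
  have hmem : ∀ q ∈ pairs N ℓ S r n, ∃ e < H, key e = q.1 := by
    intro q hq
    have h1 := hK.tab_ne q hq
    have h2 := hK.lt q hq
    have h3 := hK.tab_le _ h2
    exact ⟨tab q.1 - 1, by omega, hK.key_of_tab _ h2 h1⟩
  refine ⟨hK.inj, ?_, ?_, ?_, ?_, ?_⟩
  · intro e he h0
    obtain ⟨u, hu, hq⟩ := mem_pairs.1 (hK.rep_mem e he)
    by_cases hin : ix ℓ S u < S
    · obtain ⟨w, -, -, -, heq⟩ := (contr_in hin).1 hq
      grind
    · obtain ⟨h1, heq⟩ := (contr_out hin).1 hq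
      obtain ⟨h2, h3⟩ := Prod.mk.inj heq
      have h4 : key e / 2 = ofBits (posSet N ℓ S r u) := by omega
      rw [h3]
      refine ⟨hu, ix_not_lt.1 hin, by rw [h4, bs_ofBits], ?_⟩
      rw [← bs_nonempty, h4, bs_ofBits]; exact h1
  · intro e he h0
    rw [hK.cnt_eq e he]
    have hne : key e / 2 ≠ 0 := by
      obtain ⟨u, hu, hq⟩ := mem_pairs.1 (hK.rep_mem e he)
      by_cases hin : ix ℓ S u < S
      · obtain ⟨w, -, -, -, heq⟩ := (contr_in hin).1 hq
        grind
      · obtain ⟨h1, heq⟩ := (contr_out hin).1 hq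
        have h4 : key e / 2 = ofBits (posSet N ℓ S r u) := by grind
        rw [← bs_nonempty, h4, bs_ofBits]; exact h1
    have : ∀ v, (pairs N ℓ S r v).countP (fun q => q.1 = key e) = ((range v).filter fun v =>
        (∀ i < S, ℓ i ≠ v) ∧ posSet N ℓ S r v = bs (key e / 2)).card := by
      intro v
      induction v with
      | zero => simp [pairs]
      | succ v ih =>
        rw [pairs_succ, List.countP_append, ih, range_add_one, filter_insert]
        by_cases hin : ix ℓ S v < S
        · rw [if_neg (fun h => ix_not_lt.2 h.1 hin), List.countP_eq_zero.2, add_zero]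
          intro q hq hqe
          obtain ⟨w, -, -, -, rfl⟩ := (contr_in hin).1 hq
          grind
        · by_cases hpos : posSet N ℓ S r v = bs (key e / 2)
          · rw [if_pos ⟨ix_not_lt.1 hin, hpos⟩, card_insert_of_notMem (by simp), contr,
              if_neg hin, if_neg, hpos, ofBits_bs]
            · simp; omega
            · rw [hpos, bs_eq_empty]; exact hne
          · rw [if_neg (fun h => hpos h.2), List.countP_eq_zero.2, add_zero]
            intro q hq hqe
            obtain ⟨-, rfl⟩ := (contr_out hin).1 hq
            simp only [decide_eq_true_eq] at hqe
            apply hpos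
            rw [show key e / 2 = ofBits (posSet N ℓ S r v) by omega, bs_ofBits]
    exact this n
  · intro e he h1
    obtain ⟨u, hu, hq⟩ := mem_pairs.1 (hK.rep_mem e he)
    by_cases hin : ix ℓ S u < S
    · obtain ⟨w, hw, hws, hne, heq⟩ := (contr_in hin).1 hq
      refine ⟨_, hin, _, hws, ?_, hne.symm, ?_⟩
      · rw [(idx_ix w).2.1 hws, (idx_ix u).2.1 hin]; exact hw
      · rw [show key e / 2 = 2 ^ (ix ℓ S u - r) + 2 ^ (ix ℓ S w - r) by grind, bs_pair hne.symm]
    · obtain ⟨-, heq⟩ := (contr_out hin).1 hq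
      grind
  · intro v hv hvs hne
    obtain ⟨e, he, hk⟩ := hmem (2 * ofBits (posSet N ℓ S r v), v)
      (mem_pairs.2 ⟨v, hv, (contr_out (ix_not_lt.2 hvs)).2 ⟨hne, rfl⟩⟩)
    refine ⟨e, he, by omega, ?_⟩
    rw [hk, show 2 * ofBits (posSet N ℓ S r v) / 2 = ofBits (posSet N ℓ S r v) by omega, bs_ofBits]
  · intro i hi j hj hN hne
    have hii := ix_apply hinj hi
    have hjj := ix_apply hinj hj
    obtain ⟨e, he, hk⟩ := hmem (2 * (2 ^ (i - r) + 2 ^ (j - r)) + 1, ℓ i)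
      (mem_pairs.2 ⟨ℓ i, hG.lt' hN, (contr_in (by omega)).2
        ⟨ℓ j, hN, by omega, by omega, by rw [hii, hjj]⟩⟩)
    refine ⟨e, he, by omega, ?_⟩
    rw [hk, show (2 * (2 ^ (i - r) + 2 ^ (j - r)) + 1) / 2 = 2 ^ (i - r) + 2 ^ (j - r) by omega,
      bs_pair hne]

/-- Store the masks that the vertex in register 42 contributes. -/
def typesVertex : Cmd :=
  .set 80 (.v 42) ;; mem ;;
  .ite (.v 81) (.v 7) typesIn
    (maskOf ;; .ite (.c 0) (.v 47)
      (.set 70 (.op mul (.c 2) (.v 47)) ;; .set 71 (.v 42) ;; addPair) .skip)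

theorem posSet_subset_range (hr : r < S) (v : ℕ) : posSet N ℓ S r v ⊆ range (S - r) := by
  intro j hj
  obtain ⟨i, hi, -, rfl⟩ := mem_posSet.1 hj
  grind

theorem wp_typesVertex (hC : Ctx E n m k N) (hB : Base n k ℓ S r s) (hS : S ≤ 3 * k + 8)
    (hp : S - r ≤ k + 2) (hr : r < S) (hinj : ∀ i < S, ∀ j < S, ℓ i = ℓ j → i = j)
    (h42 : s.r 42 = v) (hv : v < n) (hK : KeyedIn n k (2 ^ (S - r + 1)) s (pairs N ℓ S r v))
    (hQ : ∀ s' t, KeyedIn n k (2 ^ (S - r + 1)) s' (pairs N ℓ S r (v + 1)) →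
      t ≤ (5 * S + 22) * (N v).length + (5 * S + 25) → Q s' t) :
    wp E typesVertex s Q := by
  have hl : (pairs N ℓ S r v).length + (N v).length + 1 ≤ n + 2 * m := by
    have h1 := length_pairs_le (N := N) (ℓ := ℓ) (S := S) (r := r) v
    have h2 := sum_le_sum_of_subset (f := fun u => (N u).length)
      (range_subset_range.2 (show v + 1 ≤ n from hv))
    rw [hC.sum, sum_range_succ] at h2
    omega
  rw [pairs_succ] at hQ
  unfold typesVertex
  refine wp_seq (wp_set v trivial h42 ?_)
  have hB1 := hB.set (x := 80) (v := v) (by omega)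
  refine wp_seq (wp_mem hC hB1.r7 hS ?_)
  intro s2 t2 hI f2 ht2
  rw [hB1.a1] at hI
  simp only [St.set_r, if_true] at hI
  have hix := hI.eq_ix hinj
  have hB2 := hB1.fr f2 (by decide)
  have h422 : s2.r 42 = v := by rw [f2.r 42 rfl]; simp [h42]
  have hK2 : KeyedIn n k (2 ^ (S - r + 1)) s2 (pairs N ℓ S r v) := by
    refine hK.congr ?_ (f2.a 5 rfl) (f2.a 6 rfl) (f2.a 7 rfl) (f2.a 8 rfl) (f2.a 20 rfl)
    rw [f2.r 10 rfl]; simp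
  refine wp_ite (s2.r 81) S trivial trivial rfl hB2.r7 (fun hlt => ?_) fun hge => ?_
  · refine wp_typesIn hC hB2 hS hp hr hinj h422 hv hix (by omega) (by omega) hK2 ?_
    intro s3 t3 hK3 f3 ht3
    refine hQ _ _ ?_ (by omega)
    rw [contr, if_pos (by omega)]; exact hK3
  · have hout : ¬ ix ℓ S v < S := by omega
    refine wp_seq (wp_maskOf hC hB2 hS hp hinj h422 hv ?_)
    intro s3 t3 hbs f3 ht3
    have hB3 := hB2.fr f3 (by decide)
    have hK3 : KeyedIn n k (2 ^ (S - r + 1)) s3 (pairs N ℓ S r v) :=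
      hK2.congr (f3.r 10 rfl) (f3.a 5 rfl) (f3.a 6 rfl) (f3.a 7 rfl) (f3.a 8 rfl) (f3.a 20 rfl)
    have h423 : s3.r 42 = v := by rw [f3.r 42 rfl, h422]
    have hmlt : s3.r 47 < 2 ^ (S - r) := by
      rw [lt_two_pow_iff, hbs]; exact posSet_subset_range hr v
    have hmul : (5 * S + 14) * (N v).length ≤ (5 * S + 22) * (N v).length :=
      Nat.mul_le_mul_right _ (by omega)
    refine wp_ite 0 (s3.r 47) hC.bd_pos trivial rfl rfl (fun hpos => ?_) fun hz => ?_
    · have hV : 2 ^ (S - r + 1) ≤ 2 ^ (k + 3) := Nat.pow_le_pow_right (by omega) (by omega)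
      have hbd := hC.exp_le (i := k + 3) (by omega)
      have hcap' := hC.cap_pow
      have h34 : 2 ^ (k + 4) = 2 * 2 ^ (k + 3) := by ring
      refine wp_seq (wp_set (2 * s3.r 47) ⟨?_, trivial, ?_⟩ rfl ?_)
      · simp only [Ex.ok]; omega
      · simp only [opOk, Ex.ev]; omega
      refine wp_seq (wp_set v trivial (by simp [Ex.ev, h423]) ?_)
      have hB4 := (hB3.set (x := 70) (v := 2 * s3.r 47) (by omega)).set (x := 71) (v := v) (by omega)
      refine wp_addPair hC (V := 2 ^ (S - r + 1)) hB4.r4 hB4.r5 (by omega)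
          (l := pairs N ℓ S r v) (hK3.congr (by simp) rfl rfl rfl rfl rfl)
          (x := 2 * s3.r 47) (v := v) (by simp) (by simp) (by omega) (by omega) ?_
      intro s5 t5 hK5 f5 ht5
      refine hQ _ _ ?_ (by omega)
      rw [contr, if_neg hout, if_neg, ← hbs, ofBits_bs]
      · exact hK5
      · rw [← hbs, bs_eq_empty]; omega
    · refine hQ _ _ ?_ (by omega)
      rw [contr, if_neg hout, if_pos, List.append_nil]
      · exact hK3
      · rw [← hbs, bs_eq_empty]; omega

/-- Compute the entries. -/
def types : Cmd :=
  .set 9 (.op sub (.v 7) (.v 8)) ;; .set 11 (.ld 4 (.v 9)) ;; .set 40 (.op mul (.v 11) (.c 2)) ;;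
  .forr 41 (.c 0) 40 (.sto 5 (.v 41) (.c 0)) ;;
  .set 10 (.c 0) ;; .forr 42 (.c 0) 1 typesVertex

/-- The entries are stored in the state. -/
structure EntIn (n m k : ℕ) (N : ℕ → List ℕ) (ℓ : ℕ → ℕ) (S r : ℕ) (s : St) : Prop where
  ent : Entries n N ℓ S r (s.r 10) (s.a 6) (s.a 7) (s.a 8)
  pw : ∀ e < s.r 10, s.a 20 e = (1 + bigM n k) ^ s.a 7 e % bigN n k
  key_lt : ∀ e < s.r 10, s.a 6 e < 2 ^ (S - r + 1)
  H_le : s.r 10 ≤ 2 ^ (S - r + 1)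
  H_le' : s.r 10 ≤ n + 2 * m
  r9 : s.r 9 = S - r
  r11 : s.r 11 = 2 ^ (S - r)

theorem wp_types (hC : Ctx E n m k N) (hB : Base n k ℓ S r s) (hS : S ≤ 3 * k + 8)
    (hp : S - r ≤ k + 2) (hr : r < S) (hinj : ∀ i < S, ∀ j < S, ℓ i = ℓ j → i = j)
    (hQ : ∀ s' t, EntIn n m k N ℓ S r s' → Fr types s s' →
      t ≤ (5 * S + 27) * (n + 2 * m) + 6 * 2 ^ (S - r) + 10 → Q s' t) :
    wp E types s Q := by
  have hlin := hC.lin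
  have hcap := hC.cap_lin
  have hV : 2 ^ (S - r + 1) ≤ 2 ^ (k + 3) := Nat.pow_le_pow_right (by omega) (by omega)
  have hV2 : 2 ^ (S - r + 1) = 2 ^ (S - r) * 2 := by ring
  have hbd := hC.exp_le (i := k + 4) (by omega)
  have hcap' := hC.cap_pow
  have h34 : 2 ^ (k + 4) = 2 * 2 ^ (k + 3) := by ring
  have hpos : 0 < 2 ^ (k + 3) := by positivity
  refine wp_post hQ ?_
  unfold types
  refine wp_seq (wp_set (S - r) ⟨trivial, trivial, ?_⟩ ?_ ?_)
  · simp only [opOk, Ex.ev, hB.r7, hB.r8]; omega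
  · simp only [opEval, Ex.ev, hB.r7, hB.r8]
  have hB1 := hB.set (x := 9) (v := S - r) (by omega)
  refine wp_seq (wp_set (2 ^ (S - r)) ⟨trivial, ?_⟩ ?_ ?_)
  · simp [Ex.ev]; omega
  · simp [Ex.ev, hB.tab.pow (S - r) (by omega)]
  have hB2 := hB1.set (x := 11) (v := 2 ^ (S - r)) (by omega)
  refine wp_seq (wp_set (2 ^ (S - r + 1)) ⟨trivial, ?_, ?_⟩ ?_ ?_)
  · simp only [Ex.ok]; omega
  · simp [opOk, Ex.ev]; omega
  · simp [opEval, Ex.ev, hV2]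
  have hB3 := hB2.set (x := 40) (v := 2 ^ (S - r + 1)) (by omega)
  refine wp_seq (wp_for0 (fun i s1 => ∀ x < i, s1.a 5 x = 0) 1 (2 ^ (S - r + 1)) (by simp)
    (by omega) (by simp) ?_ ?_)
  · intro i hi s1 hJ hx _
    refine wp_sto i 0 trivial hC.bd_pos hx rfl (by omega) ⟨le_rfl, fun x hx => ?_⟩
    simp only [St.set_a, St.sto_a_same, update_apply]
    grind
  intro s4 t4 hJ4 _ f4 ht4
  have hB4 := hB3.fr f4 (by decide)
  refine wp_seq (wp_set 0 hC.bd_pos rfl ?_)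
  have hB5 := hB4.set (x := 10) (v := 0) (by omega)
  refine wp_for (fun v s1 => KeyedIn n k (2 ^ (S - r + 1)) s1 (pairs N ℓ S r v))
    (fun v => (5 * S + 22) * (N v).length + (5 * S + 25)) 0 n hC.bd_pos rfl hB5.r1 (Nat.zero_le _)
    (by omega) ?_ ?_ ?_
  · simp only [KeyedIn, pairs, List.range_zero, List.flatMap_nil, St.set_r, St.set_a]
    simpa [Keyed.nil] using hJ4
  · intro v _ hv s6 hJ hx hF
    refine wp_typesVertex hC (hB5.fr hF (by decide)) hS hp hr hinj hx hv hJ fun s7 t7 h7 ht7 =>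
      ⟨ht7, ?_⟩
    exact h7.congr (by simp) rfl rfl rfl rfl rfl
  · intro s6 t6 hJ _ f6 ht6
    refine ⟨⟨entries_of_keyed hC.gr hinj hJ, hJ.pw_eq, fun e he => (hJ.tab_of_key e he).1, hJ.le_V, ?_, ?_,
      ?_⟩, ?_⟩
    · have h1 := length_pairs_le (N := N) (ℓ := ℓ) (S := S) (r := r) n
      rw [hC.sum] at h1
      exact hJ.le_length.trans h1
    · rw [f6.r 9 rfl, St.set_r, if_neg (by omega), f4.r 9 rfl]; simp
    · rw [f6.r 11 rfl, St.set_r, if_neg (by omega), f4.r 11 rfl]; simp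
    · have h2 := hC.sum
      simp only [sum_add_distrib, ← mul_sum, sum_const, smul_eq_mul,
        ← range_eq_Ico, h2, card_range] at ht6
      grind

/-! ### Units of a trace -/

/-- A list with parents and entries, ready for the enumeration of traces. -/
structure Inst (n m k : ℕ) (N : ℕ → List ℕ) (ℓ : ℕ → ℕ) (S r : ℕ) (par : ℕ → ℕ) (s : St) :
    Prop where
  base : Base n k ℓ S r s
  ent : EntIn n m k N ℓ S r s
  cov : Cover n N ℓ S par
  par3 : ∀ j, 0 < j → j < S - r → s.a 3 j = par (r + j) - r
  hr : r < S
  hp : S - r ≤ k + 2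

theorem Inst.congr (h : Inst n m k N ℓ S r par s)
    (hr : ∀ x, x ∈ [1, 3, 4, 5, 6, 7, 8, 9, 10, 11] → s'.r x = s.r x)
    (ha : ∀ x, x ∈ [0, 1, 3, 4, 6, 7, 8, 16, 20] → s'.a x = s.a x) : Inst n m k N ℓ S r par s' where
  base := h.base.congr
    (fun x hx => hr x (by simp only [List.mem_cons, List.not_mem_nil, or_false] at hx ⊢; omega))
    (fun x hx => ha x (by simp only [List.mem_cons, List.not_mem_nil, or_false] at hx ⊢; omega))
  ent := by
    have := h.ent
    have h6 := ha 6 (by simp)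
    have h7 := ha 7 (by simp)
    have h8 := ha 8 (by simp)
    have h20 := ha 20 (by simp)
    have r9 := hr 9 (by simp)
    have r10 := hr 10 (by simp)
    have r11 := hr 11 (by simp)
    constructor
    · rw [r10, h6, h7, h8]; exact this.ent
    · rw [r10, h7, h20]; exact this.pw
    · rw [r10, h6]; exact this.key_lt
    · rw [r10]; exact this.H_le
    · rw [r10]; exact this.H_le'
    · rw [r9]; exact this.r9
    · rw [r11]; exact this.r11
  cov := h.cov
  par3 := by rw [ha 3 (by simp)]; exact h.par3
  hr := h.hr
  hp := h.hp

theorem Inst.fr (h : Inst n m k N ℓ S r par s) (f : Fr p s s')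
    (hp : (∀ x ∈ [1, 3, 4, 5, 6, 7, 8, 9, 10, 11], p.wr x = false) ∧
      ∀ x ∈ [0, 1, 3, 4, 6, 7, 8, 16, 20], p.wa x = false) : Inst n m k N ℓ S r par s' :=
  h.congr (fun x hx => f.r x (hp.1 x hx)) fun x hx => f.a x (hp.2 x hx)

theorem Inst.set (h : Inst n m k N ℓ S r par s) (hx : 11 < x) :
    Inst n m k N ℓ S r par (s.set x v) := by
  refine h.congr (fun y hy => ?_) fun _ _ => rfl
  rw [St.set_r, if_neg]
  simp only [List.mem_cons, List.not_mem_nil, or_false] at hy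
  omega

theorem Inst.sto (h : Inst n m k N ℓ S r par s) (hx : x ∉ [0, 1, 3, 4, 6, 7, 8, 16, 20]) :
    Inst n m k N ℓ S r par (s.sto x i v) := by
  refine h.congr (fun y _ => rfl) fun y hy => St.sto_a_ne _ _ _ ?_
  grind

/-- The parent of a position. -/
def ppar (par : ℕ → ℕ) (r j : ℕ) : ℕ := par (r + j) - r

theorem Inst.ppar_lt (h : Inst n m k N ℓ S r par s) (h0 : 0 < j) (hj : j < S - r) :
    ppar par r j < j := by
  have := (h.cov.par (r + j) (by omega) (by omega)).1
  unfold ppar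
  omega

/-- Facts about the limits used when traces are enumerated. -/
theorem Inst.limits (hC : Ctx E n m k N) (h : Inst n m k N ℓ S r par s) :
    2 ^ (S - r) ≤ 2 ^ (k + 2) ∧ 2 ^ (k + 3) = 2 * 2 ^ (k + 2) ∧ 4 * 2 ^ (k + 2) ≤ E.cap ∧
      4 * 2 ^ (k + 2) ≤ E.bd ∧ s.r 10 ≤ 2 ^ (k + 3) ∧ 2 ^ (S - r + 1) = 2 * 2 ^ (S - r) ∧
      8 * (k + 2) ≤ E.bd ∧ k + 2 < 2 ^ (k + 2) := by
  have h1 : 2 ^ (S - r) ≤ 2 ^ (k + 2) := Nat.pow_le_pow_right (by omega) h.hp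
  have h2 : 2 ^ (k + 3) = 2 * 2 ^ (k + 2) := by ring
  have h3 : 2 ^ (k + 4) = 4 * 2 ^ (k + 2) := by ring
  have h4 := hC.cap_pow
  have h5 := hC.exp_le (i := k + 4) (by omega)
  have h6 := h.ent.H_le
  have h8 := hC.lin
  have h9 : k + 2 < 2 ^ (k + 2) := Nat.lt_two_pow_self
  omega

/-- The binary digit number `e'` of `e`. -/
def bitE (e e' : Ex) : Ex := .op rem (.op quot e (.ld 4 e')) (.c 2)

theorem bitE_spec (hC : Ctx E n m k N) (hT : Tab k s) (ho : e.ok E s) (ho' : e'.ok E s)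
    (hx : e.ev E s = x) (hj : e'.ev E s = j) (hjk : j < k + 4) :
    (bitE e e').ok E s ∧ (0 < (bitE e e').ev E s ↔ j ∈ bs x) := by
  have hcap := hC.cap_pow
  have hlin := hC.lin
  have h1 : k + 4 < 2 ^ (k + 4) := Nat.lt_two_pow_self
  refine ⟨⟨⟨ho, ⟨ho', by omega⟩, trivial⟩, ?_, trivial⟩, ?_⟩
  · simp only [Ex.ok]; omega
  · simp only [bitE, Ex.ev, opEval, hx, hj, hT.pow j hjk, mem_bs_iff_div]
    omega

/-- The units of a set with one more element. -/
theorem Units.insert_new (h : Units A pf c κ) (hj : ∀ i ∈ A, i < j)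
    (hpf : ∀ i ∈ A, 0 < i → pf i < i) (hnew : j = 0 ∨ pf j ∉ A ∧ pf j < j) :
    Units (insert j A) pf (c + 1) (update κ j c) := by
  have hjA : j ∉ A := fun h' => (hj j h').false
  have hne : ∀ i ∈ A, update κ j c i = κ i := fun i hi =>
    update_of_ne (by grind) _ _
  have hlead : ∀ i ∈ A, (i = 0 ∨ pf i ∉ insert j A) → (i = 0 ∨ pf i ∉ A) := fun i _ h' =>
    h'.imp id fun h'' => fun h''' => h'' (mem_insert_of_mem h''')
  refine ⟨?_, ?_, ?_, ?_⟩
  · intro i hi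
    rcases mem_insert.1 hi with rfl | hi
    · simp
    · rw [hne i hi]; exact (h.lt i hi).trans (by omega)
  · intro u hu
    by_cases huc : u = c
    · grind
    · obtain ⟨i, hi, hiu⟩ := h.surj u (by omega)
      grind
  · intro i hi h0 hp
    rcases mem_insert.1 hi with rfl | hi
    · grind
    · have h2 := hpf i hi h0
      have h3 := hj i hi
      rcases mem_insert.1 hp with h4 | h4
      · omega
      · rw [hne i hi, hne _ h4]; exact h.tree i hi h0 h4
  · intro i hi i' hi' hl hl' he
    rcases mem_insert.1 hi with h1 | h1 <;> rcases mem_insert.1 hi' with h2 | h2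
    · rw [h1, h2]
    · rw [hne i' h2, h1, update_self] at he
      exact absurd he.symm (h.lt i' h2).ne
    · rw [hne i h1, h2, update_self] at he
      exact absurd he (h.lt i h1).ne
    · rw [hne i h1, hne i' h2] at he
      exact h.lead i h1 i' h2 (hlead i h1 hl) (hlead i' h2 hl') he

theorem Units.insert_old (h : Units A pf c κ) (hj : ∀ i ∈ A, i < j)
    (hpf : ∀ i ∈ A, 0 < i → pf i < i) (h0 : 0 < j) (hold : pf j ∈ A) :
    Units (insert j A) pf c (update κ j (κ (pf j))) := by
  have hjA : j ∉ A := fun h' => (hj j h').false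
  have hne : ∀ i ∈ A, update κ j (κ (pf j)) i = κ i := fun i hi =>
    update_of_ne (by grind) _ _
  have hlead : ∀ i ∈ A, (i = 0 ∨ pf i ∉ insert j A) → (i = 0 ∨ pf i ∉ A) := fun i _ h' =>
    h'.imp id fun h'' => fun h''' => h'' (mem_insert_of_mem h''')
  have hjl : ¬ (j = 0 ∨ pf j ∉ insert j A) := by grind
  refine ⟨?_, ?_, ?_, ?_⟩
  · intro i hi
    rcases mem_insert.1 hi with rfl | hi
    · rw [update_self]; exact h.lt _ hold
    · rw [hne i hi]; exact h.lt i hi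
  · intro u hu
    obtain ⟨i, hi, hiu⟩ := h.surj u hu
    grind
  · intro i hi h0 hp
    rcases mem_insert.1 hi with rfl | hi
    · grind
    · have h2 := hpf i hi h0
      have h3 := hj i hi
      rcases mem_insert.1 hp with h4 | h4
      · omega
      · rw [hne i hi, hne _ h4]; exact h.tree i hi h0 h4
  · intro i hi i' hi' hl hl' he
    rcases mem_insert.1 hi with rfl | hi
    · exact absurd hl hjl
    rcases mem_insert.1 hi' with rfl | hi'
    · exact absurd hl' hjl
    rw [hne i hi, hne i' hi'] at he
    exact h.lead i hi i' hi' (hlead i hi hl) (hlead i' hi' hl') he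

theorem Units.card_eq (h : Units A pf c κ) (hpf : ∀ i ∈ A, 0 < i → pf i < i) : c = ucount pf A := by
  classical
  rw [ucount, ← card_range c]
  symm
  refine card_bij (fun j _ => κ j) ?_ ?_ ?_
  · intro j hj
    exact mem_range.2 (h.lt j (mem_filter.1 hj).1)
  · intro j hj j' hj' he
    obtain ⟨h1, h2⟩ := mem_filter.1 hj
    obtain ⟨h3, h4⟩ := mem_filter.1 hj'
    exact h.lead j h1 j' h3 h2 h4 he
  · intro u hu
    have hex := h.surj u (mem_range.1 hu)
    obtain ⟨h1, h2⟩ := Nat.find_spec hex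
    refine ⟨Nat.find hex, mem_filter.2 ⟨h1, ?_⟩, h2⟩
    by_contra hno
    push Not at hno
    have h0 : 0 < Nat.find hex := by omega
    exact Nat.find_min hex (hpf _ h1 h0) ⟨hno.2, by rw [← h.tree _ h1 h0 hno.2, h2]⟩

theorem Units.le_card (h : Units A pf c κ) :
    c ≤ A.card := by
  rw [← card_range c]
  refine card_le_card_of_surjOn κ fun u hu => ?_
  obtain ⟨j, hj, hu⟩ := h.surj u (by simpa using hu)
  exact ⟨j, hj, hu⟩

/-- Register 52 is set to `1` if all entries meet the set in register 50, and to `0` otherwise. -/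
def checkHits : Cmd :=
  .set 52 (.c 1) ;;
  .forr 54 (.c 0) 10 (.ite (.c 0) (andE (.op quot (.ld 6 (.v 54)) (.c 2)) (.v 50)) .skip (.set 52 (.c 0)))

theorem wp_checkHits (hC : Ctx E n m k N) (hI : Inst n m k N ℓ S r par s) (h50 : s.r 50 = a)
    (ha : a < 2 ^ (S - r))
    (hQ : ∀ s' t, (s'.r 52 = 1 ∧ (∀ e < s.r 10, (emask (s.a 6) e ∩ bs a).Nonempty) ∨
      s'.r 52 = 0 ∧ ¬ ∀ e < s.r 10, (emask (s.a 6) e ∩ bs a).Nonempty) → Fr checkHits s s' →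
      t ≤ 4 * s.r 10 + 3 → Q s' t) :
    wp E checkHits s Q := by
  obtain ⟨l1, l2, l3, l4, l5, l6, l7, l8⟩ := hI.limits hC
  refine wp_post hQ ?_
  unfold checkHits
  refine wp_seq (wp_set 1 hC.one_lt rfl ?_)
  have hI1 := hI.set (x := 52) (v := 1) (by omega)
  refine wp_for0 (fun i s1 => s1.r 52 = 1 ∧ (∀ e < i, (emask (s.a 6) e ∩ bs a).Nonempty) ∨
        s1.r 52 = 0 ∧ ∃ e < s.r 10, ¬ (emask (s.a 6) e ∩ bs a).Nonempty) 2 (s.r 10) (by simp)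
    (by omega) (Or.inl (by simp)) ?_ ?_
  · intro e he s1 hJ hx hF
    have hI2 := hI1.fr hF (by decide)
    have h6 : s1.a 6 = s.a 6 := by rw [hF.a 6 rfl]; rfl
    have h501 : s1.r 50 = a := by rw [hF.r 50 rfl]; simp [h50]
    have hkl := hI.ent.key_lt e he
    obtain ⟨ho, hv⟩ := andE_spec hC hI2.base.tab (e := .op quot (.ld 6 (.v 54)) (.c 2)) (e' := .v 50)
      (x := s.a 6 e / 2) (y := a) ⟨⟨trivial, by simp only [Ex.ev, hx]; omega⟩, by simp only [Ex.ok]; omega, trivial⟩ trivial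
      (by simp only [Ex.ev, opEval, hx, h6]) h501 (by omega) (by omega)
    have hiff : 0 < s.a 6 e / 2 &&& a ↔ (emask (s.a 6) e ∩ bs a).Nonempty := by
      rw [emask, ← land_ne_zero]; omega
    refine wp_ite 0 _ hC.bd_pos ho rfl hv (fun h => ⟨by omega, ?_⟩) fun h => ?_
    · simp only [St.set_r, show (52 : ℕ) ≠ 54 by omega, if_false]
      grind
    · refine wp_set 0 hC.bd_pos rfl ⟨by omega, Or.inr ⟨by simp, e, he, fun h' => h (hiff.2 h')⟩⟩
  · intro s' t hJ _ _ ht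
    refine ⟨hJ.imp id fun h => ⟨h.1, fun hall => ?_⟩, ?_⟩
    · grind
    · omega

/-- Insert the position in register 55 into the units. -/
def unitStep : Cmd :=
  .ite (.c 0) (bitE (.v 50) (.v 55))
    (.set 56 (.c 1) ;;
      .ite (.c 0) (.v 55)
        (.set 57 (.ld 3 (.v 55)) ;; .ite (.c 0) (bitE (.v 50) (.v 57)) (.set 56 (.c 0)) .skip) .skip ;;
      .ite (.c 0) (.v 56)
        (.sto 10 (.v 55) (.v 51) ;; .sto 11 (.v 51) (.ld 4 (.v 55)) ;; .set 51 (.op add (.v 51) (.c 1)))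
        (.set 58 (.ld 10 (.v 57)) ;; .sto 10 (.v 55) (.v 58) ;;
          .sto 11 (.v 58) (.op add (.ld 11 (.v 58)) (.ld 4 (.v 55)))))
    .skip

/-- The units of a set of positions are stored in the state. -/
structure UnitsIn (pf : ℕ → ℕ) (A : Finset ℕ) (s : St) : Prop where
  units : Units A pf (s.r 51) (s.a 10)
  um : ∀ u < s.r 51, bs (s.a 11 u) = A.filter fun j => s.a 10 j = u

theorem filter_lt_succ (A : Finset ℕ) (j : ℕ) : A.filter (· < j + 1) =
    if j ∈ A then insert j (A.filter (· < j)) else A.filter (· < j) := by grind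

theorem wp_unitStep (hC : Ctx E n m k N) (hI : Inst n m k N ℓ S r par s) (h50 : s.r 50 = a)
    (hj : j < S - r) (h55 : s.r 55 = j) (hU : UnitsIn (ppar par r) ((bs a).filter (· < j)) s)
    (hQ : ∀ s' t, UnitsIn (ppar par r) ((bs a).filter (· < j + 1)) s' → t ≤ 12 → Q s' t) :
    wp E unitStep s Q := by
  obtain ⟨l1, l2, l3, l4, l5, l6, l7, l8⟩ := hI.limits hC
  have hp := hI.hp
  obtain ⟨ho, hv⟩ := bitE_spec hC hI.base.tab (e := .v 50) (e' := .v 55) (x := a) (j := j)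
    trivial trivial h50 h55 (by omega)
  rw [filter_lt_succ] at hQ
  set A := (bs a).filter (· < j) with hA
  have hAj : ∀ i ∈ A, i < j := fun i hi => (mem_filter.1 hi).2
  have hpf : ∀ i ∈ A, 0 < i → ppar par r i < i := fun i hi h0 =>
    hI.ppar_lt h0 (by grind)
  have hjA : j ∉ A := fun h => (hAj j h).false
  have hcle := hU.units.le_card
  have hAc : A.card ≤ j := by
    have : A ⊆ range j := fun i hi => mem_range.2 (hAj i hi)
    simpa using card_le_card this
  unfold unitStep
  refine wp_ite 0 _ hC.bd_pos ho rfl rfl (fun hbit => ?_) fun hbit => ?_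
  swap
  · rw [hv] at hbit
    refine hQ _ _ ?_ (by omega)
    grind
  rw [hv] at hbit
  rw [if_pos hbit] at hQ
  refine wp_seq (wp_set 1 hC.one_lt rfl ?_)
  -- decide whether the position starts a new unit
  have hdec : wp E (.ite (.c 0) (.v 55)
      (.set 57 (.ld 3 (.v 55)) ;; .ite (.c 0) (bitE (.v 50) (.v 57)) (.set 56 (.c 0)) .skip) .skip)
      (s.set 56 1) fun s' t => t ≤ 4 ∧ Inst n m k N ℓ S r par s' ∧ s'.a = s.a ∧ s'.r 51 = s.r 51 ∧
        s'.r 55 = j ∧ (s'.r 56 = 1 ∧ (j = 0 ∨ ppar par r j ∉ A ∧ ppar par r j < j) ∨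
          s'.r 56 = 0 ∧ 0 < j ∧ ppar par r j ∈ A ∧ s'.r 57 = ppar par r j) := by
    have hI1 := hI.set (x := 56) (v := 1) (by omega)
    refine wp_ite 0 j hC.bd_pos trivial rfl (by simp [Ex.ev, h55]) (fun h0 => ?_) fun h0 => ?_
    · have hlt := hI.ppar_lt h0 hj
      refine wp_seq (wp_set (ppar par r j) ⟨trivial, ?_⟩ ?_ ?_)
      · simp [Ex.ev, h55]; omega
      · simp [Ex.ev, h55, hI.par3 j h0 hj, ppar]
      have hI2 := hI1.set (x := 57) (v := ppar par r j) (by omega)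
      obtain ⟨ho', hv'⟩ := bitE_spec hC hI2.base.tab (e := .v 50) (e' := .v 57) (x := a)
        (j := ppar par r j) trivial trivial (by simp [Ex.ev, h50]) (by simp [Ex.ev]) (by omega)
      have hmem : ppar par r j ∈ A ↔ ppar par r j ∈ bs a := by grind
      refine wp_ite 0 _ hC.bd_pos ho' rfl rfl (fun h => ?_) fun h => ?_
      · rw [hv', ← hmem] at h
        refine wp_set 0 hC.bd_pos rfl ⟨by omega, hI2.set (by omega), rfl, by simp, by simp [h55],
          Or.inr ⟨by simp, h0, h, by simp⟩⟩
      · rw [hv', ← hmem] at h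
        exact ⟨by omega, hI2, rfl, by simp, by simp [h55], Or.inl ⟨by simp, Or.inr ⟨h, hlt⟩⟩⟩
    · exact ⟨by omega, hI1, rfl, by simp, by simp [h55], Or.inl ⟨by simp, Or.inl (by omega)⟩⟩
  refine wp_seq (wp_mono hdec ?_)
  rintro s1 t1 ⟨ht1, hI1, ha1, h51, h551, hcase⟩
  have hpow := hI1.base.tab.pow j (by omega)
  have hum : ∀ u < s.r 51, s.a 11 u + 2 ^ j ≤ 2 ^ (S - r) ∧ j ∉ bs (s.a 11 u) := by
    intro u hu
    have h1 := hU.um u hu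
    have h2 : bs (s.a 11 u) ⊆ range j := by grind
    have h3 := lt_two_pow_iff.2 h2
    have h4 : 2 ^ (j + 1) ≤ 2 ^ (S - r) := Nat.pow_le_pow_right (by omega) hj
    grind
  rcases hcase with ⟨h56, hnew⟩ | ⟨h56, h0, hold, h57⟩
  · refine wp_ite 0 1 hC.bd_pos trivial rfl h56 (fun _ => ?_) fun h => by omega
    refine wp_seq (wp_sto j (s.r 51) trivial trivial h551 h51 (by omega) ?_)
    refine wp_seq (wp_sto (s.r 51) (2 ^ j) trivial ⟨trivial, ?_⟩ ?_ ?_ (by omega) ?_)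
    · simp only [Ex.ev, St.sto_r, h551]; omega
    · simp [Ex.ev, h51]
    · simp [Ex.ev, h551, hpow]
    refine wp_set (s.r 51 + 1) ⟨trivial, hC.one_lt, ?_⟩ ?_ (hQ _ _ ?_ (by omega))
    · simp [opOk, Ex.ev, h51]; omega
    · simp [opEval, Ex.ev, h51]
    · have e10 : ((((s1.sto 10 j (s.r 51)).sto 11 (s.r 51) (2 ^ j)).set 51 (s.r 51 + 1)).a 10) =
          update (s.a 10) j (s.r 51) := by simp [ha1]
      have e11 : ((((s1.sto 10 j (s.r 51)).sto 11 (s.r 51) (2 ^ j)).set 51 (s.r 51 + 1)).a 11) =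
          update (s.a 11) (s.r 51) (2 ^ j) := by simp [ha1]
      refine ⟨?_, ?_⟩
      · rw [e10, St.set_r, if_pos rfl]
        exact hU.units.insert_new hAj hpf hnew
      · rw [e10, e11, St.set_r, if_pos rfl]
        intro u hu
        by_cases huc : u = s.r 51
        · subst huc
          rw [update_self, bs_two_pow]
          ext i
          simp only [mem_singleton, mem_filter, mem_insert]
          constructor
          · rintro rfl; simp
          · rintro ⟨h1 | h1, h2⟩
            · exact h1
            · rw [update_of_ne (by grind)] at h2
              exact absurd h2 (hU.units.lt i h1).ne
        · rw [update_of_ne huc, hU.um u (by omega)]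
          ext i
          grind
  · refine wp_ite 0 0 hC.bd_pos trivial rfl h56 (fun h => by omega) fun _ => ?_
    set q := ppar par r j
    have hqj := hAj q hold
    have hκ := hU.units.lt q hold
    obtain ⟨hs1, hs2⟩ := hum _ hκ
    refine wp_seq (wp_set (s.a 10 q) ⟨trivial, ?_⟩ ?_ ?_)
    · simp only [Ex.ev, h57]; omega
    · simp only [Ex.ev, h57, ha1]
    refine wp_seq (wp_sto j (s.a 10 q) trivial trivial ?_ ?_ (by omega) ?_)
    · simp [Ex.ev, h551]
    · simp [Ex.ev]
    refine wp_sto (s.a 10 q) (s.a 11 (s.a 10 q) + 2 ^ j) trivial ⟨⟨trivial, ?_⟩, ⟨trivial, ?_⟩, ?_⟩ ?_ ?_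
      (by omega) (hQ _ _ ?_ (by omega))
    · simp [Ex.ev]; omega
    · simp [Ex.ev, h551]; omega
    · have h4 : s1.a 4 j = 2 ^ j := hpow
      simp [opOk, Ex.ev, h551, h4, ha1]
      omega
    · simp [Ex.ev]
    · have h4 : s1.a 4 j = 2 ^ j := hpow
      rw [ha1] at h4
      simp [opEval, Ex.ev, h551, h4, ha1]
    · have e10 : (((s1.set 58 (s.a 10 q)).sto 10 j (s.a 10 q)).sto 11 (s.a 10 q)
          (s.a 11 (s.a 10 q) + 2 ^ j)).a 10 = update (s.a 10) j (s.a 10 q) := by simp [ha1]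
      have e11 : (((s1.set 58 (s.a 10 q)).sto 10 j (s.a 10 q)).sto 11 (s.a 10 q)
          (s.a 11 (s.a 10 q) + 2 ^ j)).a 11 =
          update (s.a 11) (s.a 10 q) (s.a 11 (s.a 10 q) + 2 ^ j) := by simp [ha1]
      have e51 : (((s1.set 58 (s.a 10 q)).sto 10 j (s.a 10 q)).sto 11 (s.a 10 q)
          (s.a 11 (s.a 10 q) + 2 ^ j)).r 51 = s.r 51 := by simp [h51]
      refine ⟨?_, ?_⟩
      · rw [e10, e51]
        exact hU.units.insert_old hAj hpf h0 hold
      · rw [e10, e11, e51]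
        intro u hu
        by_cases huc : u = s.a 10 q
        · rw [huc, update_self, bs_add_two_pow hs2, hU.um _ hκ]
          ext i
          grind
        · rw [update_of_ne huc, hU.um u hu]
          ext i
          grind

/-- Compute the units of the set in register 50. -/
def units : Cmd := .set 51 (.c 0) ;; .forr 55 (.c 0) 9 unitStep

theorem wp_units (hC : Ctx E n m k N) (hI : Inst n m k N ℓ S r par s) (h50 : s.r 50 = a)
    (ha : a < 2 ^ (S - r))
    (hQ : ∀ s' t, UnitsIn (ppar par r) (bs a) s' → Fr units s s' → t ≤ 14 * (S - r) + 3 → Q s' t) :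
    wp E units s Q := by
  obtain ⟨l1, l2, l3, l4, l5, l6, l7, l8⟩ := hI.limits hC
  have hp := hI.hp
  refine wp_post hQ ?_
  unfold units
  refine wp_seq (wp_set 0 hC.bd_pos rfl ?_)
  have hI1 := hI.set (x := 51) (v := 0) (by omega)
  refine wp_for0 (fun j s1 => UnitsIn (ppar par r) ((bs a).filter (· < j)) s1) 12 (S - r) hI1.ent.r9
    (by omega) ?_ ?_ ?_
  · refine ⟨⟨?_, ?_, ?_, ?_⟩, ?_⟩ <;> simp
  · intro j hj s1 hJ hx hF
    refine wp_unitStep hC (hI1.fr hF (by decide)) (by rw [hF.r 50 rfl]; simp [h50]) hj hx hJ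
      fun s2 t2 h2 ht2 => ⟨ht2, ?_⟩
    exact ⟨by simpa using h2.units, by simpa using h2.um⟩
  · intro s' t hJ _ _ ht
    have hsub := lt_two_pow_iff.1 ha
    rw [filter_true_of_mem fun i hi => mem_range.1 (hsub hi)] at hJ
    refine ⟨hJ, ?_⟩
    omega

/-! ### Masks of units -/

/-- Register 60 is set to the mask of the units that the mask in register 59 meets. -/
def unitMask : Cmd :=
  .set 60 (.c 0) ;;
  .forr 61 (.c 0) 51 (.ite (.c 0) (andE (.v 59) (.ld 11 (.v 61)))
    (.set 60 (.op add (.v 60) (.ld 4 (.v 61)))) .skip)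

theorem wp_unitMask (hC : Ctx E n m k N) (hI : Inst n m k N ℓ S r par s) (ha : a < 2 ^ (S - r))
    (hU : UnitsIn pf (bs a) s) (h59 : s.r 59 = x) (hx : x < 2 ^ (k + 3))
    (hQ : ∀ s' t, bs (s'.r 60) = tau (bs a) (s.a 10) (bs x) → Fr unitMask s s' →
      t ≤ 4 * s.r 51 + 3 → Q s' t) :
    wp E unitMask s Q := by
  obtain ⟨l1, l2, l3, l4, l5, l6, l7, l8⟩ := hI.limits hC
  have hA : bs a ⊆ range (k + 2) := lt_two_pow_iff.1 (by omega)
  have hc : s.r 51 ≤ k + 2 := by simpa using hU.units.le_card.trans (card_le_card hA)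
  have hmem : ∀ u < s.r 51, u ∈ tau (bs a) (s.a 10) (bs x) ↔ (bs x ∩ bs (s.a 11 u)).Nonempty := by
    intro u hu
    rw [mem_tau, hU.um u hu]
    constructor
    · rintro ⟨j, h1, h2, h3⟩
      exact ⟨j, by simp [h1, h2, h3]⟩
    grind
  refine wp_post hQ ?_
  unfold unitMask
  refine wp_seq (wp_set 0 hC.bd_pos rfl ?_)
  have hI1 := hI.set (x := 60) (v := 0) (by omega)
  refine wp_for0 (fun u s1 => bs (s1.r 60) = (tau (bs a) (s.a 10) (bs x)).filter (· < u)) 2 (s.r 51)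
    (by simp) (by omega) (by simp [bs]) ?_ ?_
  · intro u hu s1 hJ hx1 hF
    have hI2 := hI1.fr hF (by decide)
    have h59' : s1.r 59 = x := by rw [hF.r 59 rfl]; simp [h59]
    have h11 : s1.a 11 = s.a 11 := by rw [hF.a 11 rfl]; rfl
    have hum : s.a 11 u < 2 ^ (k + 2) := by
      rw [lt_two_pow_iff, hU.um u hu]; grind
    obtain ⟨ho, hv⟩ := andE_spec hC hI2.base.tab (e := .v 59) (e' := .ld 11 (.v 61))
      (x := x) (y := s.a 11 u) trivial ⟨trivial, by simp only [Ex.ev, hx1]; omega⟩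
      h59' (by simp only [Ex.ev, hx1, h11]) hx (by omega)
    have hlt : s1.r 60 < 2 ^ u := by
      rw [lt_two_pow_iff, hJ]; grind
    have h2u : 2 ^ u < 2 ^ (k + 2) := Nat.pow_lt_pow_right (by omega) (by omega)
    have hpow := hI2.base.tab.pow u (by omega)
    refine wp_ite 0 _ hC.bd_pos ho rfl hv (fun h => ?_) fun h => ?_
    · refine wp_set (s1.r 60 + 2 ^ u) ⟨trivial, ⟨trivial, ?_⟩, ?_⟩ ?_ ⟨by omega, ?_⟩
      · simp only [Ex.ev, hx1]; omega
      · simp only [opOk, Ex.ev, hx1, hpow]; omega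
      · simp only [opEval, Ex.ev, hx1, hpow]
      · rw [filter_lt_succ, if_pos ((hmem u hu).2 (land_ne_zero.1 (by omega)))]
        simp only [St.set_r, show (60 : ℕ) ≠ 61 by omega, if_false, if_true]
        rw [bs_add_two_pow (by rw [hJ]; simp), hJ]
    · refine ⟨by omega, ?_⟩
      rw [filter_lt_succ, if_neg fun h' => h (by have := land_ne_zero.2 ((hmem u hu).1 h'); omega)]
      simpa using hJ
  · intro s' t hJ _ _ ht
    refine ⟨hJ.trans (filter_true_of_mem fun u hu => ?_), ?_⟩
    · obtain ⟨j, _, hj, rfl⟩ := mem_tau.1 hu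
      exact hU.units.lt j hj
    · omega

open Classical in
/-- The first `e` entries have been compared with the units of `A`: array 12 tells which of them are
mandatory, array 13 holds their masks of units, and register 53 the number of forced vertices. -/
structure SetTo (pf : ℕ → ℕ) (A : Finset ℕ) (e : ℕ) (s : St) : Prop where
  units : UnitsIn pf A s
  mand : ∀ e' < e, s.a 12 e' = if EMand (s.a 6) A e' then 1 else 0
  tau : ∀ e' < e, bs (s.a 13 e') = tau A (s.a 10) (emask (s.a 6) e')
  forced : s.r 53 = ∑ e' ∈ (range e).filter
    (fun e' => s.a 6 e' % 2 = 0 ∧ ¬ emask (s.a 6) e' ⊆ A), s.a 7 e'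

theorem UnitsIn.congr (h : UnitsIn pf A s) (h51 : s'.r 51 = s.r 51) (h10 : s'.a 10 = s.a 10)
    (h11 : s'.a 11 = s.a 11) :
    UnitsIn pf A s' := by
  constructor
  · rw [h51, h10]; exact h.units
  · rw [h51, h10, h11]; exact h.um

theorem SetTo.congr {e : ℕ} (h : SetTo pf A e s) (h51 : s'.r 51 = s.r 51) (h53 : s'.r 53 = s.r 53)
    (ha : ∀ x, x ∈ [6, 7, 10, 11, 12, 13] → s'.a x = s.a x) : SetTo pf A e s' := by
  have h6 := ha 6 (by simp)
  have h7 := ha 7 (by simp)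
  have h10 := ha 10 (by simp)
  have h12 := ha 12 (by simp)
  have h13 := ha 13 (by simp)
  refine ⟨h.units.congr h51 h10 (ha 11 (by simp)), ?_, ?_, ?_⟩
  · rw [h6, h12]; exact h.mand
  · rw [h6, h10, h13]; exact h.tau
  · rw [h6, h7, h53]; exact h.forced

theorem SetTo.fr {e : ℕ} (h : SetTo pf A e s) (f : Fr p s s')
    (hp : p.wr 51 = false ∧ p.wr 53 = false ∧ ∀ x ∈ [6, 7, 10, 11, 12, 13], p.wa x = false) :
    SetTo pf A e s' :=
  h.congr (f.r _ hp.1) (f.r _ hp.2.1) fun x hx => f.a x (hp.2.2 x hx)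

/-- Compare the entry in register 54 with the units. -/
def setupStep : Cmd :=
  .set 59 (.op quot (.ld 6 (.v 54)) (.c 2)) ;; unitMask ;;
  .sto 13 (.v 54) (.v 60) ;; .sto 12 (.v 54) (.c 1) ;;
  .ite (.c 0) (.op rem (.ld 6 (.v 54)) (.c 2)) .skip
    (.ite (andE (.v 59) (.v 50)) (.v 59) (.set 53 (.op add (.v 53) (.ld 7 (.v 54))))
      (.sto 12 (.v 54) (.c 0)))

theorem wp_setupStep (hC : Ctx E n m k N) {e : ℕ} (hI : Inst n m k N ℓ S r par s) (h50 : s.r 50 = a)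
    (ha : a < 2 ^ (S - r)) (h54 : s.r 54 = e) (he : e < s.r 10) (hU : SetTo pf (bs a) e s)
    (hQ : ∀ s' t, SetTo pf (bs a) (e + 1) s' → t ≤ 4 * s.r 51 + 9 → Q s' t) :
    wp E setupStep s Q := by
  classical
  obtain ⟨l1, l2, l3, l4, l5, l6, l7, l8⟩ := hI.limits hC
  have hp := hI.hp
  have hkl := hI.ent.key_lt e he
  have hlin := hC.lin
  have hbd2 : 2 < E.bd := by omega
  -- the number of forced vertices found so far is at most the number of all vertices
  have hforced : (∑ e' ∈ (range (e + 1)).filter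
      (fun e' => s.a 6 e' % 2 = 0 ∧ ¬ emask (s.a 6) e' ⊆ bs a), s.a 7 e') ≤ n := by
    have h1 := hI.ent.ent.card_forced (A := bs a)
    have h2 : (forced n N ℓ S r (bs a)).card ≤ n :=
      (card_le_card (filter_subset _ _)).trans (card_range n).le
    refine le_trans (sum_le_sum_of_subset ?_) (h1 ▸ h2)
    grind
  rw [range_add_one, filter_insert] at hforced
  unfold setupStep
  refine wp_seq (wp_set (s.a 6 e / 2) ⟨⟨trivial, ?_⟩, hbd2, trivial⟩ ?_ ?_)
  · simp only [Ex.ev, h54]; omega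
  · simp only [Ex.ev, opEval, h54]
  refine wp_seq (wp_unitMask hC (hI.set (x := 59) (by omega)) ha
    (x := s.a 6 e / 2) (hU.units.congr rfl rfl rfl) (by simp) (by omega) fun s1 t1 h60 hF1 ht1 => ?_)
  have hI1 := (hI.set (x := 59) (v := s.a 6 e / 2) (by omega)).fr hF1 (by decide)
  have hU1 : SetTo pf (bs a) e s1 := (hU.congr (s' := s.set 59 (s.a 6 e / 2)) rfl rfl
    fun _ _ => rfl).fr hF1 (by decide)
  have h541 : s1.r 54 = e := by rw [hF1.r 54 rfl]; simp [h54]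
  have h501 : s1.r 50 = a := by rw [hF1.r 50 rfl]; simp [h50]
  have h591 : s1.r 59 = s.a 6 e / 2 := by rw [hF1.r 59 rfl]; simp
  have h61 : s1.a 6 = s.a 6 := by rw [hF1.a 6 rfl]; rfl
  have h71 : s1.a 7 = s.a 7 := by rw [hF1.a 7 rfl]; rfl
  have h101 : s1.a 10 = s.a 10 := by rw [hF1.a 10 rfl]; rfl
  rw [St.set_a] at h60
  simp only [St.set_r, show (51 : ℕ) ≠ 59 by omega, if_false] at ht1
  refine wp_seq (wp_sto e (s1.r 60) trivial trivial h541 rfl (by omega) ?_)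
  refine wp_seq (wp_sto e 1 trivial hC.one_lt (by simp [Ex.ev, h541]) rfl (by omega) ?_)
  set s2 := (s1.sto 13 e (s1.r 60)).sto 12 e 1 with hs2
  have hI2 : Inst n m k N ℓ S r par s2 := (hI1.sto (by simp)).sto (by simp)
  have hr2 : s2.r = s1.r := rfl
  have h62 : s2.a 6 = s.a 6 := by simp [hs2, h61]
  have h72 : s2.a 7 = s.a 7 := by simp [hs2, h71]
  have hmand : ∀ v, ∀ e' < e + 1, (v = if EMand (s.a 6) (bs a) e then 1 else 0) →
      update (s1.a 12) e v e' = if EMand (s.a 6) (bs a) e' then 1 else 0 := by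
    intro v e' he' hv
    by_cases h : e' = e
    · grind
    · rw [update_of_ne h, hU1.mand e' (by omega), h61]
  -- the bookkeeping common to all cases
  have hset : ∀ s3 v, s3.a = (s1.sto 13 e (s1.r 60)).a ∨ (∃ u, s3.a = ((s1.sto 13 e (s1.r 60)).sto 12 e u).a) →
      s3.r 51 = s1.r 51 → s3.a 12 = update (s1.a 12) e v →
      (v = if EMand (s.a 6) (bs a) e then 1 else 0) →
      (s3.r 53 = ∑ e' ∈ (range (e + 1)).filter
        (fun e' => s.a 6 e' % 2 = 0 ∧ ¬ emask (s.a 6) e' ⊆ bs a), s.a 7 e') →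
      SetTo pf (bs a) (e + 1) s3 := by
    intro s3 v ha3 h51 h12 hv h53
    have hag : ∀ x, x ≠ 12 → x ≠ 13 → s3.a x = s1.a x := by
      intro x h1 h2
      rcases ha3 with h | ⟨u, h⟩
      · rw [h, St.sto_a_ne _ _ _ h2]
      · rw [h, St.sto_a_ne _ _ _ h1, St.sto_a_ne _ _ _ h2]
    have h13 : s3.a 13 = update (s1.a 13) e (s1.r 60) := by
      rcases ha3 with h | ⟨u, h⟩ <;> rw [h] <;> simp
    have h6 := (hag 6 (by omega) (by omega)).trans h61
    have h10 := (hag 10 (by omega) (by omega)).trans h101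
    refine ⟨hU1.units.congr h51 (hag 10 (by omega) (by omega)) (hag 11 (by omega) (by omega)), ?_, ?_, ?_⟩
    · rw [h6, h12]; grind
    · rw [h6, h10, h13]
      intro e' he'
      by_cases h : e' = e
      · rw [h, update_self, h60, emask]
      · rw [update_of_ne h, hU1.tau e' (by omega), h61, h101]
    · rw [h53, h6, (hag 7 (by omega) (by omega)).trans h71]
  have h53 : s1.r 53 = ∑ e' ∈ (range e).filter
        (fun e' => s.a 6 e' % 2 = 0 ∧ ¬ emask (s.a 6) e' ⊆ bs a), s.a 7 e' := by
    rw [hU1.forced, h61, h71]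
  have hnot : e ∉ (range e).filter
      (fun e' => s.a 6 e' % 2 = 0 ∧ ¬ emask (s.a 6) e' ⊆ bs a) := by simp
  refine wp_ite 0 (s.a 6 e % 2) hC.bd_pos ⟨⟨trivial, ?_⟩, hbd2, trivial⟩ rfl ?_ (fun h => ?_) fun h => ?_
  · simp only [Ex.ev, hr2, h541]; omega
  · simp only [Ex.ev, opEval, hr2, h541, h62]
  · refine hQ _ _ (hset _ 1 (Or.inr ⟨1, rfl⟩) rfl (by simp [hs2]) ?_ ?_) (by omega)
    · rw [if_pos (show EMand _ _ _ from Or.inl (by omega))]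
    · rw [range_add_one, filter_insert, if_neg fun h' => by omega]
      exact h53
  · obtain ⟨ho, hv⟩ := andE_spec hC hI2.base.tab (e := .v 59) (e' := .v 50)
      (x := s.a 6 e / 2) (y := a) trivial trivial h591 h501 (by omega) (by omega)
    have hle : s.a 6 e / 2 &&& a ≤ s.a 6 e / 2 := Nat.and_le_left
    refine wp_ite (s.a 6 e / 2 &&& a) (s.a 6 e / 2) ho trivial hv h591 (fun h' => ?_) fun h' => ?_
    · have hns : ¬ emask (s.a 6) e ⊆ bs a := fun hs => by
        rw [emask, ← land_eq_left] at hs; omega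
      rw [if_pos ⟨by omega, hns⟩, sum_insert hnot, ← h53] at hforced
      refine wp_set (s1.r 53 + s.a 7 e) ⟨trivial, ⟨trivial, ?_⟩, ?_⟩ ?_ (hQ _ _ (hset _ 1
        (Or.inr ⟨1, rfl⟩) rfl (by simp [hs2]) ?_ ?_) (by omega))
      · simp only [Ex.ev, hr2, h541]; omega
      · simp only [opOk, Ex.ev, hr2, h541, h72]; omega
      · simp only [opEval, Ex.ev, hr2, h541, h72]
      · rw [if_pos (show EMand _ _ _ from Or.inr hns)]
      · rw [range_add_one, filter_insert, if_pos ⟨by omega, hns⟩,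
          sum_insert hnot, ← h53, St.set_r, if_pos rfl, add_comm]
    · have hs : emask (s.a 6) e ⊆ bs a := by rw [emask, ← land_eq_left]; omega
      refine wp_sto e 0 trivial hC.bd_pos (by simp [Ex.ev, hr2, h541]) rfl (by omega)
        (hQ _ _ (hset _ 0 (Or.inr ⟨0, ?_⟩) rfl (by simp [hs2]) ?_ ?_) (by omega))
      · funext x
        by_cases hx : x = 12
        · subst hx; simp [hs2]
        · rw [St.sto_a_ne _ _ _ hx, hs2, St.sto_a_ne _ _ _ hx, St.sto_a_ne _ _ _ hx]
      · rw [if_neg]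
        rintro (h1 | h1)
        · omega
        · exact h1 hs
      · rw [range_add_one, filter_insert, if_neg fun h' => h'.2 hs]
        exact h53

/-- Test the set in register 50 and prepare its units. -/
def prep : Cmd :=
  checkHits ;; .ite (.c 0) (.v 52) (units ;; .set 53 (.c 0) ;; .forr 54 (.c 0) 10 setupStep) .skip

theorem wp_prep (hC : Ctx E n m k N) (hI : Inst n m k N ℓ S r par s) (h50 : s.r 50 = a)
    (ha : a < 2 ^ (S - r)) :
    wp E prep s fun s' t =>
      (s'.r 52 = 1 ∧ (∀ e < s.r 10, (emask (s.a 6) e ∩ bs a).Nonempty) ∧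
        SetTo (ppar par r) (bs a) (s.r 10) s' ∧
        t ≤ 4 * s.r 10 + 14 * (S - r) + 10 + s.r 10 * (4 * s'.r 51 + 11)) ∨
      (s'.r 52 = 0 ∧ (¬ ∀ e < s.r 10, (emask (s.a 6) e ∩ bs a).Nonempty) ∧
        t ≤ 4 * s.r 10 + 5) := by
  obtain ⟨l1, l2, l3, l4, l5, l6, l7, l8⟩ := hI.limits hC
  unfold prep
  refine wp_seq (wp_checkHits hC hI h50 ha fun s1 t1 hcase hF1 ht1 => ?_)
  rcases hcase with ⟨h52, hh⟩ | ⟨h52, hh⟩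
  swap
  · exact wp_ite 0 0 hC.bd_pos trivial rfl h52 (fun h => absurd h (by omega))
      fun _ => Or.inr ⟨h52, hh, by omega⟩
  refine wp_ite 0 1 hC.bd_pos trivial rfl h52 (fun _ => ?_) fun h => by omega
  have hI1 := hI.fr hF1 (by decide)
  have h501 : s1.r 50 = a := by rw [hF1.r 50 rfl, h50]
  have h101 : s1.r 10 = s.r 10 := hF1.r 10 rfl
  refine wp_seq (wp_units hC hI1 h501 ha fun s2 t2 hU hF2 ht2 => ?_)
  have hI2 := (hI1.fr hF2 (by decide)).set (x := 53) (v := 0) (by omega)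
  have h102 : s2.r 10 = s.r 10 := (hF2.r 10 rfl).trans h101
  have h502 : s2.r 50 = a := (hF2.r 50 rfl).trans h501
  have h522 : s2.r 52 = 1 := (hF2.r 52 rfl).trans h52
  refine wp_seq (wp_set 0 hC.bd_pos rfl ?_)
  refine wp_for0 (fun e s3 => SetTo (ppar par r) (bs a) e s3 ∧ s3.r 51 = s2.r 51) (4 * s2.r 51 + 9)
    (s.r 10) (by simp [h102]) (by omega) ⟨⟨hU.congr rfl rfl rfl, ?_, ?_, ?_⟩, rfl⟩ ?_ ?_
  · intro e he; omega
  · intro e he; omega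
  · rw [range_zero, filter_empty, sum_empty]; rfl
  · rintro e he s3 ⟨hJ, hJ51⟩ hx hF
    have hI3 := hI2.fr hF (by decide)
    have h103 : s3.r 10 = s.r 10 := by rw [hF.r 10 rfl]; simp [h102]
    have h503 : s3.r 50 = a := by rw [hF.r 50 rfl]; simp [h502]
    refine wp_mono (wp_frame (wp_setupStep hC hI3 h503 ha hx (by omega) hJ
      (Q := fun s' t => SetTo (ppar par r) (bs a) (e + 1) s' ∧ t ≤ 4 * s3.r 51 + 9)
      fun s4 t4 h4 ht4 => ⟨h4, ht4⟩)) ?_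
    rintro s4 t4 ⟨⟨h4, ht4⟩, hF4⟩
    refine ⟨by omega, h4.congr rfl rfl fun _ _ => rfl, ?_⟩
    rw [St.set_r, if_neg (by omega), hF4.r 51 rfl, hJ51]
  · rintro s3 t3 ⟨hJ, hJ51⟩ _ hF ht
    refine Or.inl ⟨by rw [hF.r 52 rfl]; simp [h522], hh, hJ, ?_⟩
    grind

/-! ### The loop over the traces -/

/-- Every entry meets the set. -/
def EHits (H : ℕ) (key : ℕ → ℕ) (A : Finset ℕ) : Prop := ∀ e < H, (emask key e ∩ A).Nonempty

open Classical in
/-- The tree edges bound the sum of the sizes of the tables for all traces: not the number of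
traces, but the sum of `2 ^ c` over them is about `2 ^ p`. -/
theorem Inst.sum_le (hI : Inst n m k N ℓ S r par s) :
    ∑ a ∈ range (2 ^ (S - r)), (if EHits (s.r 10) (s.a 6) (bs a) then
      2 ^ ucount (ppar par r) (bs a) else 0) ≤ 2 * 2 ^ (S - r) := by
  have hr := hI.hr
  rw [sum_range_two_pow (S - r) fun A => if EHits (s.r 10) (s.a 6) A then
    2 ^ ucount (ppar par r) A else 0, ← sum_filter]
  obtain ⟨p, hp⟩ : ∃ p, S - r = p + 1 := ⟨S - r - 1, by omega⟩
  have h := sum_two_pow_ucount (ppar par r) p fun j h0 h1 => hI.ppar_lt h0 (by omega)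
  have h2 : 2 ^ (p + 1) = 2 * 2 ^ p := by ring
  rw [hp, h2]
  refine le_trans (sum_le_sum_of_subset ?_) (h.le.trans (by omega))
  intro A hA
  obtain ⟨h1, hh⟩ := mem_filter.1 hA
  refine mem_filter.2 ⟨h1, fun j h0 hj => ?_⟩
  have hlt := hI.ppar_lt h0 (by omega)
  obtain ⟨hpl, hpN⟩ := hI.cov.par (r + j) (by omega) (by omega)
  unfold ppar at hlt ⊢
  obtain ⟨e, he, -, hb⟩ := hI.ent.ent.ofEdge (r + j) (by omega) (par (r + j)) (by omega) hpN (by omega)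
  obtain ⟨x, hx⟩ := hh e he
  rw [emask, hb] at hx
  grind

/-- Run `body` for all traces that are selected by `sel` and meet all entries. -/
def traces (sel : Ex) (body : Cmd) : Cmd :=
  .forr 50 (.c 0) 11 (.ite (.c 0) sel (prep ;; .ite (.c 0) (.v 52) body .skip) .skip)

/-- Two states that agree outside of the work space of a single trace. -/
def Same (s s' : St) : Prop :=
  (∀ x < 50, s'.r x = s.r x) ∧ ∀ x, x < 10 ∨ 15 < x → s'.a x = s.a x

theorem wp_traces (hC : Ctx E n m k N) {sel : Ex} {body : Cmd} (g : ℕ) (J : ℕ → St → Prop)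
    (hI : Inst n m k N ℓ S r par s)
    (hb : (∀ x ∈ [1, 3, 4, 5, 6, 7, 8, 9, 10, 11, 50], body.wr x = false) ∧
      ∀ x ∈ [0, 1, 3, 4, 6, 7, 8, 16, 20], body.wa x = false)
    (hJ : ∀ a s1 s2, J a s1 → Same s1 s2 → J a s2)
    (hsel : ∀ a s1, a < 2 ^ (S - r) → J a s1 → s1.r 50 = a → sel.ok E s1)
    (hsel' : ∀ s1 s2, Same s1 s2 → s2.r 50 = s1.r 50 → sel.ev E s2 = sel.ev E s1)
    (hskip : ∀ a s1, a < 2 ^ (S - r) → J a s1 → s1.r 50 = a →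
      (¬ 0 < sel.ev E s1 ∨ ¬ EHits (s.r 10) (s.a 6) (bs a)) → J (a + 1) s1)
    (hbody : ∀ a s1, a < 2 ^ (S - r) → J a s1 → Inst n m k N ℓ S r par s1 → s1.r 50 = a →
      0 < sel.ev E s1 → EHits (s1.r 10) (s1.a 6) (bs a) →
      SetTo (ppar par r) (bs a) (s1.r 10) s1 → wp E body s1 fun s2 t =>
      t ≤ g * 2 ^ s1.r 51 ∧ J (a + 1) s2) (h0 : J 0 s)
    (hQ : ∀ s' t, J (2 ^ (S - r)) s' → Inst n m k N ℓ S r par s' →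
      t ≤ 2 ^ (S - r) * (34 * s.r 10 + 28 * (S - r) + 32 + 2 * g) + 2 → Q s' t) :
    wp E (traces sel body) s Q := by
  classical
  obtain ⟨l1, l2, l3, l4, l5, l6, l7, l8⟩ := hI.limits hC
  have hwr : ∀ x, (traces sel body).wr x = (50 == x || (prep.wr x || (body.wr x || false)) || false ||
      (50 == x)) := by
    intro x; simp [traces, Cmd.forr, Cmd.wr]
    grind
  have hInst : ∀ s', Fr (traces sel body) s s' → Inst n m k N ℓ S r par s' := by
    intro s' hF
    refine hI.congr (fun x hx => hF.r x ?_) fun x hx => hF.a x ?_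
    · have h1 := hb.1 x (by simp only [List.mem_cons, List.not_mem_nil, or_false] at hx ⊢; omega)
      have h2 : prep.wr x = false := by
        clear h1; revert x; decide
      rw [hwr, h1, h2]
      simp only [List.mem_cons, List.not_mem_nil, or_false] at hx
      simp; omega
    · have h1 := hb.2 x hx
      have h2 : prep.wa x = false := by
        clear h1; revert x; decide
      simp [traces, Cmd.forr, Cmd.wa, h1, h2]
  have hprep : ∀ s1 s2, Fr prep s1 s2 → Same s1 s2 := by
    intro s1 s2 hF
    refine ⟨fun x hx => hF.r x ?_, fun x hx => hF.a x ?_⟩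
    · revert x; decide
    · have : prep.wa x = (10 == x || 11 == x || 12 == x || 13 == x) := by
        simp [prep, checkHits, units, unitStep, setupStep, unitMask, Cmd.forr, Cmd.wa]
        grind
      grind
  refine wp_for (fun a s1 => J a s1)
    (fun a => 4 * s.r 10 + 8 + (if EHits (s.r 10) (s.a 6) (bs a) then
      2 ^ ucount (ppar par r) (bs a) else 0) * (15 * s.r 10 + 14 * (S - r) + 10 + g)) 0
    (2 ^ (S - r)) hC.bd_pos rfl hI.ent.r11 (Nat.zero_le _) (by omega) ?_ ?_ ?_ (hx := by simp only [Cmd.wr, hb.1 50 (by simp)]; rfl) 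
    (hy := by simp only [Cmd.wr, hb.1 11 (by simp)]; rfl)
  · refine hJ _ _ _ h0 ⟨fun x hx => ?_, fun _ _ => rfl⟩
    rw [St.set_r, if_neg (by omega)]
  · intro a _ ha s1 hJ1 h50 hF
    have hI1 := hInst s1 hF
    have h10 : s1.r 10 = s.r 10 := by
      have h := hb.1 10 (by simp)
      exact hF.r 10 (by change (traces sel body).wr 10 = false; rw [hwr, h]; rfl)
    have h6 : s1.a 6 = s.a 6 := by
      have h := hb.2 6 (by simp)
      exact hF.a 6 (by simp only [Cmd.forr, Cmd.wa, h]; rfl)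
    have hnext : ∀ s2 v, J (a + 1) s2 → J (a + 1) (s2.set 50 v) := fun s2 v h =>
      hJ _ _ _ h ⟨fun x hx => by rw [St.set_r, if_neg (by omega)], fun _ _ => rfl⟩
    refine wp_ite 0 _ hC.bd_pos (hsel a s1 ha hJ1 h50) rfl rfl (fun hs => ?_) fun hs => ?_
    swap
    · exact ⟨by omega, hnext _ _ (hskip a s1 ha hJ1 h50 (Or.inl hs))⟩
    refine wp_seq (wp_call (wp_prep hC hI1 h50 ha) fun s2 t2 hcase hF2 => ?_)
    have hsame := hprep s1 s2 hF2
    have hI2 := hI1.fr hF2 (by decide)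
    have h502 : s2.r 50 = a := (hF2.r 50 rfl).trans h50
    have hJ2 := hJ a s1 s2 hJ1 hsame
    have h102 : s2.r 10 = s1.r 10 := hF2.r 10 rfl
    have h62 : s2.a 6 = s1.a 6 := hF2.a 6 rfl
    have hs2 : 0 < sel.ev E s2 := by grind
    rcases hcase with ⟨h52, hh, hset, ht⟩ | ⟨h52, hh, ht⟩
    swap
    · refine wp_ite 0 0 hC.bd_pos trivial rfl h52 (fun h => absurd h (by omega))
        fun _ => ⟨by omega, hnext _ _ (hskip a s2 ha hJ2 h502 (Or.inr ?_))⟩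
      rw [← h10, ← h6]; exact hh
    refine wp_ite 0 1 hC.bd_pos trivial rfl h52 (fun _ => ?_) fun h => absurd (by omega) h
    have hpf : ∀ i ∈ bs a, 0 < i → ppar par r i < i := fun i hi h0 =>
      hI.ppar_lt h0 (mem_range.1 (lt_two_pow_iff.1 ha hi))
    have hc := hset.units.units.card_eq hpf
    refine wp_mono (hbody a s2 ha hJ2 hI2 h502 hs2 (by rw [h102, h62]; exact hh) (by rwa [h102])) ?_
    rintro s3 t3 ⟨ht3, hJ3⟩
    refine ⟨?_, hnext _ _ hJ3⟩
    have hh' : EHits (s.r 10) (s.a 6) (bs a) := by rw [← h10, ← h6]; exact hh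
    rw [if_pos hh', ← hc]
    have h1 : s2.r 51 < 2 ^ s2.r 51 := Nat.lt_two_pow_self
    rw [h10] at ht
    have h2 : s.r 10 * (4 * s2.r 51 + 11) ≤ s.r 10 * (15 * 2 ^ s2.r 51) :=
      Nat.mul_le_mul_left _ (by omega)
    have h3 : (14 * (S - r) + 10) * 1 ≤ (14 * (S - r) + 10) * 2 ^ s2.r 51 :=
      Nat.mul_le_mul_left _ (by omega)
    grind
  · intro s' t hJ' _ hF ht
    refine hQ s' t hJ' (hInst s' hF) (ht.trans ?_)
    have h1 := hI.sum_le
    rw [← range_eq_Ico, sum_add_distrib, sum_add_distrib, ← sum_mul]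
    simp only [sum_const, card_range, smul_eq_mul]
    have h2 := Nat.mul_le_mul_right (15 * s.r 10 + 14 * (S - r) + 10 + g) h1
    nlinarith

/-! ### Connecting a trace with few vertices -/

section

/-- Some `d` entries that are not mandatory, with representatives encoded in `q`, connect the unit
`0` to all units in `Z`. -/
def Reach (n H : ℕ) (key rep : ℕ → ℕ) (A : Finset ℕ) (κ : ℕ → ℕ) (Z : Finset ℕ) (d q : ℕ) : Prop :=
  ∃ l : List ℕ, l.Nodup ∧ (∀ e ∈ l, e < H ∧ ¬ EMand key A e ∧ tau A κ (emask key e) ⊆ Z) ∧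
    l.length = d ∧ Nat.ofDigits n (l.map rep) = q ∧
    ∀ U, 0 ∈ U → EClosed H key A κ l.toFinset U → Z ⊆ U

theorem Reach.of_mand {d q e : ℕ} (h : Reach n H key rep A κ Z d q) (he : e < H)
    (hm : EMand key A e) (hne : (tau A κ (emask key e) ∩ Z).Nonempty) :
    Reach n H key rep A κ (Z ∪ tau A κ (emask key e)) d q := by
  obtain ⟨l, h1, h2, h3, h4, h5⟩ := h
  refine ⟨l, h1, fun e' he' => ?_, h3, h4, fun U hU hcl => ?_⟩
  · grind
  · have h6 := h5 U hU hcl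
    exact union_subset h6 (hcl e he (Or.inl hm)
      (hne.mono (inter_subset_inter_left h6)))

theorem Reach.of_free {d q e : ℕ} (h : Reach n H key rep A κ Z d q) (he : e < H)
    (hm : ¬ EMand key A e) (hne : (tau A κ (emask key e) ∩ Z).Nonempty)
    (hnot : ¬ tau A κ (emask key e) ⊆ Z) :
    Reach n H key rep A κ (Z ∪ tau A κ (emask key e)) (d + 1) (q * n + rep e) := by
  obtain ⟨l, h1, h2, h3, h4, h5⟩ := h
  refine ⟨e :: l, List.nodup_cons.2 ⟨fun h => hnot (h2 e h).2.2, h1⟩, fun e' he' => ?_, by simp [h3],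
    ?_, fun U hU hcl => ?_⟩
  · grind
  · rw [List.map_cons, Nat.ofDigits_cons, h4]
    ring
  · have h6 := h5 U hU fun e' he' hme => hcl e' he' (hme.imp id fun h => by simp [List.mem_toFinset.1 h])
    exact union_subset h6 (hcl e he (Or.inr (by simp))
      (hne.mono (inter_subset_inter_left h6)))

open Classical in
/-- The prices `d` and the codes `q` of all sets of units, when all sets before `Y` and the
first `e` entries for `Y` are processed. -/
structure Prices (n H k c : ℕ) (key rep : ℕ → ℕ) (A : Finset ℕ) (κ : ℕ → ℕ) (T : ℕ → ℕ) (Y e : ℕ)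
    (d q : ℕ → ℕ) : Prop where
  le : ∀ Z < 2 ^ c, d Z ≤ k + 1
  one : d 1 = 0
  sound : ∀ Z < 2 ^ c, d Z ≤ k → Reach n H key rep A κ (bs Z) (d Z) (q Z)
  relax : ∀ Z < 2 ^ c, ∀ e' < H, (Z < Y ∨ Z = Y ∧ e' < e) → 0 < T e' &&& Z →
    d (Z + T e' - (T e' &&& Z)) ≤ d Z + 1 - if EMand key A e' then 1 else 0

variable {Y e : ℕ} {T d q : ℕ → ℕ}

theorem bs_union (x y : ℕ) : bs (x + y - (y &&& x)) = bs x ∪ bs y := by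
  rw [Nat.land_comm, bs_add_sub_land]

theorem union_lt (hx : x < 2 ^ c) (hy : y < 2 ^ c) : x + y - (y &&& x) < 2 ^ c := by
  rw [lt_two_pow_iff, bs_union]
  exact union_subset (lt_two_pow_iff.1 hx) (lt_two_pow_iff.1 hy)

open Classical in
theorem Prices.succ_of_le (h : Prices n H k c key rep A κ T Y e d q)
    (hle : 0 < T e &&& Y → d (Y + T e - (T e &&& Y)) ≤ d Y + 1 - if EMand key A e then 1 else 0) :
    Prices n H k c key rep A κ T Y (e + 1) d q := by
  refine ⟨h.le, h.one, h.sound, fun Z hZ e' he' hor hne => ?_⟩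
  by_cases hnew : Z = Y ∧ e' = e
  · grind
  · exact h.relax Z hZ e' he' (by omega) hne

open Classical in
theorem Prices.update (h : Prices n H k c key rep A κ T Y e d q) (he : e < H) (hY : Y < 2 ^ c)
    (hT : T e < 2 ^ c) (hτ : bs (T e) = tau A κ (emask key e)) (hne : 0 < T e &&& Y)
    (hv : v = d Y + 1 - if EMand key A e then 1 else 0) (hlt : v < d (Y + T e - (T e &&& Y)))
    (hw : w = if EMand key A e then q Y else q Y * n + rep e) :
    Prices n H k c key rep A κ T Y (e + 1) (update d (Y + T e - (T e &&& Y)) v)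
      (update q (Y + T e - (T e &&& Y)) w) := by
  set Z := Y + T e - (T e &&& Y) with hZ
  have hZc : Z < 2 ^ c := union_lt hY hT
  have hge : d Y ≤ v := by grind
  have hYZ : Y < Z := by
    have h1 : T e &&& Y ≤ T e := Nat.and_le_left
    grind
  have hle := h.le Z hZc
  have hnonempty : (tau A κ (emask key e) ∩ bs Y).Nonempty := by
    rw [← hτ, ← land_ne_zero]; omega
  refine ⟨fun X hX => ?_, ?_, fun X hX hXk => ?_, fun X hX e' he' hor hne' => ?_⟩
  · by_cases hXZ : X = Z
    · grind
    · rw [update_of_ne hXZ]; exact h.le X hX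
  · rw [update_of_ne, h.one]
    rintro h1
    rw [← h1, h.one] at hlt
    omega
  · by_cases hXZ : X = Z
    · subst hXZ
      rw [update_self] at hXk ⊢
      have hr := h.sound Y hY (by omega)
      rw [update_self, bs_union, hτ]
      by_cases hm : EMand key A e
      · rw [if_pos hm] at hv hw
        rw [hv, hw]
        exact hr.of_mand he hm hnonempty
      · rw [if_neg hm] at hv hw
        rw [hv, hw]
        refine hr.of_free he hm hnonempty fun hsub => hYZ.ne (bs_injective ?_)
        rw [hZ, bs_union, hτ, union_eq_left.2 hsub]
    · rw [update_of_ne hXZ] at hXk ⊢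
      rw [update_of_ne hXZ]
      exact h.sound X hX hXk
  · rw [update_of_ne (show X ≠ Z by omega)]
    by_cases hnew : X = Y ∧ e' = e
    · grind
    · have h1 := h.relax X hX e' he' (by omega) hne'
      grind

/-- The price of the set of all units is the least number of connecting entries. -/
theorem Prices.le_card (h : Prices n H k c key rep A κ T (2 ^ c) 0 d q) (hc : 0 < c)
    (hκ : ∀ j ∈ A, κ j < c) (hτ : ∀ e < H, bs (T e) = tau A κ (emask key e)) (L : Finset ℕ)
    (hL : L.card ≤ k) (hconn : ∀ U ⊆ range c, 0 ∈ U → EClosed H key A κ L U → U = range c) :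
    d (2 ^ c - 1) ≤ L.card := by
  classical
  have hfull : ofBits (range c) = 2 ^ c - 1 := by rw [← bs_two_pow_sub_one, ofBits_bs]
  have hR : Relaxed H key A κ k fun Y => if Y ⊆ range c then d (ofBits Y) else k + 1 := by
    intro Y h0 hdY e he hne
    by_cases hYc : Y ⊆ range c
    swap
    · grind
    have hsub : tau A κ (emask key e) ⊆ range c := by
      intro u hu
      obtain ⟨j, _, hj, rfl⟩ := mem_tau.1 hu
      grind
    have h1 := h.relax (ofBits Y) (by rwa [lt_two_pow_iff, bs_ofBits]) e he
      (Or.inl (by rwa [lt_two_pow_iff, bs_ofBits])) (by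
        rw [Nat.pos_iff_ne_zero, land_ne_zero, bs_ofBits, hτ e he]; exact hne)
    have h2 : ofBits Y + T e - (T e &&& ofBits Y) = ofBits (Y ∪ tau A κ (emask key e)) :=
      bs_injective (by rw [bs_union, bs_ofBits, bs_ofBits, hτ e he])
    grind
  have h1 := hR.le_card (by
    simp only [singleton_subset_iff, mem_range, if_pos hc]
    simpa [ofBits] using h.one) hc hκ L hL hconn
  grind

/-- Relax the set in register 62 with the entry in register 54. -/
def dpStep : Cmd :=
  .set 64 (andE (.ld 13 (.v 54)) (.v 62)) ;;
  .ite (.c 0) (.v 64)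
    (.set 63 (.op sub (.op add (.v 62) (.ld 13 (.v 54))) (.v 64)) ;;
      .set 64 (.op sub (.op add (.ld 14 (.v 62)) (.c 1)) (.ld 12 (.v 54))) ;;
      .ite (.v 64) (.ld 14 (.v 63))
        (.sto 14 (.v 63) (.v 64) ;;
          .ite (.c 0) (.ld 12 (.v 54)) (.sto 15 (.v 63) (.ld 15 (.v 62)))
            (.sto 15 (.v 63) (.op add (.op mul (.ld 15 (.v 62)) (.v 1)) (.ld 8 (.v 54)))))
        .skip) .skip

theorem Reach.lt (hE : Entries n N ℓ S r H key cnt rep) (h : Reach n H key rep A κ Z x y)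
    (hn : 1 < n) : y < n ^ x := by
  obtain ⟨l, -, h2, rfl, rfl, -⟩ := h
  have h3 := Nat.ofDigits_lt_base_pow_length (b := n) (l := l.map rep) hn (by
    intro x hx
    obtain ⟨e, he, rfl⟩ := List.mem_map.1 hx
    obtain ⟨a, b, -⟩ := h2 e he
    simp only [EMand, not_or] at b
    exact (hE.even e a (by omega)).1)
  simpa using h3

theorem SetTo.mask_lt (hU : SetTo pf A H s) (he : e < H) :
    s.a 13 e < 2 ^ s.r 51 := by
  rw [lt_two_pow_iff, hU.tau e he]
  intro u hu
  obtain ⟨j, _, hj, rfl⟩ := mem_tau.1 hu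
  exact mem_range.2 (hU.units.units.lt j hj)

theorem SetTo.c_le (hU : SetTo pf (bs a) H s) (ha : a < 2 ^ (S - r)) : s.r 51 ≤ S - r := by
  simpa using hU.units.units.le_card.trans (card_le_card (lt_two_pow_iff.1 ha))

/-- The prices are stored in the state. -/
def PricesIn (n k a Y e : ℕ) (s : St) : Prop :=
  Prices n (s.r 10) k (s.r 51) (s.a 6) (s.a 8) (bs a) (s.a 10) (s.a 13) Y e (s.a 14) (s.a 15)

theorem wp_dpStep (hC : Ctx E n m k N) {Y e : ℕ} (hI : Inst n m k N ℓ S r par s)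
    (ha : a < 2 ^ (S - r)) (hn : 1 < n) (hU : SetTo pf (bs a) (s.r 10) s) (h54 : s.r 54 = e)
    (he : e < s.r 10) (h62 : s.r 62 = Y) (hY : Y < 2 ^ s.r 51) (hP : PricesIn n k a Y e s)
    (hQ : ∀ s' t, PricesIn n k a Y (e + 1) s' → t ≤ 8 → Q s' t) :
    wp E dpStep s Q := by
  obtain ⟨l1, l2, l3, l4, l5, l6, l7, l8⟩ := hI.limits hC
  have hp := hI.hp
  have hT := hU.mask_lt he
  have hc := hU.c_le ha
  have h2c : 2 ^ s.r 51 ≤ 2 ^ (k + 2) := Nat.pow_le_pow_right (by omega) (by omega)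
  have hlin := hC.lin
  obtain ⟨ho, hv⟩ := andE_spec hC hI.base.tab (e := .ld 13 (.v 54)) (e' := .v 62)
    (x := s.a 13 e) (y := Y) ⟨trivial, by simp only [Ex.ev, h54]; omega⟩ trivial
    (by simp only [Ex.ev, h54]) h62 (by omega) (by omega)
  have hmand := hU.mand e he
  have hdY := hP.le Y hY
  have hand : s.a 13 e &&& Y ≤ s.a 13 e := Nat.and_le_left
  unfold dpStep
  refine wp_seq (wp_set _ ho hv ?_)
  refine wp_ite 0 (s.a 13 e &&& Y) hC.bd_pos trivial rfl (by simp [Ex.ev]) (fun h => ?_) fun h => ?_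
  swap
  · exact hQ _ _ (hP.succ_of_le fun h' => absurd h' h) (by omega)
  have hZc := union_lt hY hT
  set Z := Y + s.a 13 e - (s.a 13 e &&& Y) with hZ
  refine wp_seq (wp_set Z ⟨⟨trivial, ⟨trivial, ?_⟩, ?_⟩, trivial, ?_⟩ ?_ ?_)
  · simp [Ex.ev, h54]; omega
  · simp [opOk, Ex.ev, h54, h62]; omega
  · simp [opOk, Ex.ev, opEval, h54, h62]; omega
  · simp [Ex.ev, opEval, h54, h62, hZ]
  have hcost : s.a 12 e ≤ 1 := by grind
  refine wp_seq (wp_set (s.a 14 Y + 1 - s.a 12 e) ⟨⟨⟨trivial, ?_⟩, hC.one_lt, ?_⟩, ⟨trivial, ?_⟩, ?_⟩ ?_ ?_)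
  · simp [Ex.ev, h62]; omega
  · simp [opOk, Ex.ev, h62]; omega
  · simp [Ex.ev, h54]; omega
  · simp [opOk, Ex.ev, opEval, h54, h62]; omega
  · simp [Ex.ev, opEval, h54, h62]
  refine wp_ite (s.a 14 Y + 1 - s.a 12 e) (s.a 14 Z) trivial ⟨trivial, ?_⟩ (by simp [Ex.ev])
    (by simp [Ex.ev]) (fun hlt => ?_) fun hlt => ?_
  · simp [Ex.ev]; omega
  swap
  · refine hQ _ _ (hP.succ_of_le fun _ => ?_) (by omega)
    grind
  refine wp_seq (wp_sto Z (s.a 14 Y + 1 - s.a 12 e) trivial trivial (by simp [Ex.ev]) (by simp [Ex.ev])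
    (by omega) ?_)
  have hfin : ∀ (s3 : St) w, s3.r 10 = s.r 10 → s3.r 51 = s.r 51 →
      (∀ x, x ≠ 14 → x ≠ 15 → s3.a x = s.a x) →
      s3.a 14 = update (s.a 14) Z (s.a 14 Y + 1 - s.a 12 e) →
      s3.a 15 = update (s.a 15) Z w →
      (w = if 0 < s.a 12 e then s.a 15 Y else s.a 15 Y * n + s.a 8 e) →
      PricesIn n k a Y (e + 1) s3 := by
    classical
    intro s3 w h10 h51 hag h14 h15 hw
    unfold PricesIn
    rw [h10, h51, h14, h15, hag 6 (by omega) (by omega), hag 8 (by omega) (by omega),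
      hag 10 (by omega) (by omega), hag 13 (by omega) (by omega)]
    refine hP.update he hY hT (hU.tau e he) h (by rw [hmand]) hlt ?_
    grind
  refine wp_ite 0 (s.a 12 e) hC.bd_pos ⟨trivial, ?_⟩ rfl (by simp [Ex.ev, h54]) (fun hm => ?_) fun hm => ?_
  · simp [Ex.ev, h54]; omega
  · refine wp_sto Z (s.a 15 Y) trivial ⟨trivial, ?_⟩ (by simp [Ex.ev]) (by simp [Ex.ev, h62]) (by omega)
      (hQ _ _ (hfin _ (s.a 15 Y) (by simp) (by simp) (fun x h1 h2 => ?_) (by simp) (by simp) ?_) (by omega))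
    · simp [Ex.ev, h62]; omega
    · rw [St.sto_a_ne _ _ _ h2, St.sto_a_ne _ _ _ h1]; rfl
    · rw [if_pos hm]
  · have hdk : s.a 14 Y < k := by have := hP.le Z hZc; omega
    have hnm : ¬ EMand (s.a 6) (bs a) e := fun h' => by grind
    have hrep : s.a 8 e < n := by
      simp only [EMand, not_or] at hnm
      exact (hI.ent.ent.even e he (by omega)).1
    have hq : s.a 15 Y < n ^ k := (Reach.lt hI.ent.ent (hP.sound Y hY hdk.le) hn).trans_le
      (Nat.pow_le_pow_right (by omega) hdk.le)
    have hmul : (s.a 15 Y + 1) * n ≤ n ^ (k + 1) := by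
      rw [pow_succ]; exact Nat.mul_le_mul_right _ hq
    have hM : n ^ (k + 1) ≤ bigM n k := Nat.pow_le_pow_left (by omega) _
    have hMN := bigM_le_bigN n k
    have hN1 := two_le_bigM n k
    have hNN := hC.bigN_sq
    have hNle : bigN n k * 1 ≤ bigN n k * bigN n k := Nat.mul_le_mul_left _ (by omega)
    rw [add_mul, one_mul] at hmul
    have h1 := hI.base.r1
    refine wp_sto Z (s.a 15 Y * n + s.a 8 e) trivial ⟨⟨⟨trivial, ?_⟩, trivial, ?_⟩, ⟨trivial, ?_⟩, ?_⟩
      (by simp [Ex.ev]) (by simp [Ex.ev, opEval, h62, h54, h1]) (by omega)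
      (hQ _ _ (hfin _ (s.a 15 Y * n + s.a 8 e) (by simp) (by simp) (fun x h1 h2 => ?_) (by simp) (by simp) ?_) (by omega))
    · simp [Ex.ev, h62]; omega
    · simp [opOk, Ex.ev, h62, h1]; omega
    · simp [Ex.ev, h54]; omega
    · simp [opOk, Ex.ev, opEval, h62, h54, h1]; omega
    · rw [St.sto_a_ne _ _ _ h2, St.sto_a_ne _ _ _ h1]; rfl
    · rw [if_neg hm]

/-- Compute the prices of all sets of units. -/
def dp : Cmd :=
  .set 65 (.ld 4 (.v 51)) ;; .forr 62 (.c 0) 65 (.sto 14 (.v 62) (.op add (.v 3) (.c 1))) ;;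
  .sto 14 (.c 1) (.c 0) ;; .sto 15 (.c 1) (.c 0) ;; .forr 62 (.c 0) 65 (.forr 54 (.c 0) 10 dpStep)

theorem wp_dp (hC : Ctx E n m k N) (hI : Inst n m k N ℓ S r par s) (ha : a < 2 ^ (S - r))
    (hn : 1 < n) (hU : SetTo pf (bs a) (s.r 10) s) (hc0 : 0 < s.r 51)
    (hQ : ∀ s' t, PricesIn n k a (2 ^ s.r 51) 0 s' → Fr dp s s' →
      t ≤ 2 ^ s.r 51 * (10 * s.r 10 + 7) + 7 → Q s' t) :
    wp E dp s Q := by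
  obtain ⟨l1, l2, l3, l4, l5, l6, l7, l8⟩ := hI.limits hC
  have hp := hI.hp
  have hc := hU.c_le ha
  have h2c : 2 ^ s.r 51 ≤ 2 ^ (k + 2) := Nat.pow_le_pow_right (by omega) (by omega)
  have h2c' : 2 ^ 1 ≤ 2 ^ s.r 51 := Nat.pow_le_pow_right (by omega) hc0
  refine wp_post hQ ?_
  unfold dp
  refine wp_seq (wp_set (2 ^ s.r 51) ⟨trivial, ?_⟩ ?_ ?_)
  · simp only [Ex.ev]; omega
  · simp only [Ex.ev]; exact hI.base.tab.pow _ (by omega)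
  set c := s.r 51 with hcd
  have hI0 := hI.set (x := 65) (v := 2 ^ c) (by omega)
  have hU0 : SetTo pf (bs a) (s.r 10) (s.set 65 (2 ^ c)) := hU.congr rfl rfl fun _ _ => rfl
  refine wp_seq (wp_for0 (fun y s1 => ∀ Z < y, s1.a 14 Z = k + 1) 1 (2 ^ c) (by simp) (by omega)
    (fun Z hZ => by omega) ?_ ?_)
  · intro y hy s1 hJ hx hF
    have hI1 := hI0.fr hF (by decide)
    have h3 := hI1.base.r3
    refine wp_sto y (k + 1) trivial ⟨trivial, hC.one_lt, ?_⟩ hx ?_ (by omega) ⟨by omega, fun Z hZ => ?_⟩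
    · simp only [opOk, Ex.ev, h3]; omega
    · simp only [opEval, Ex.ev, h3]
    · rw [St.set_a, St.sto_a_same]
      grind
  intro s1 t1 hJ1 _ hF1 ht1
  have hI1 := hI0.fr hF1 (by decide)
  have hU1 := hU0.fr hF1 (by decide)
  have h65 : s1.r 65 = 2 ^ c := by rw [hF1.r 65 rfl]; simp
  have h51 : s1.r 51 = c := by rw [hF1.r 51 rfl]; simp [hcd]
  have h10 : s1.r 10 = s.r 10 := by rw [hF1.r 10 rfl]; simp
  refine wp_seq (wp_sto 1 0 hC.one_lt hC.bd_pos rfl rfl (by omega) ?_)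
  refine wp_seq (wp_sto 1 0 hC.one_lt hC.bd_pos rfl rfl (by omega) ?_)
  set s2 := (s1.sto 14 1 0).sto 15 1 0 with hs2
  have hI2 : Inst n m k N ℓ S r par s2 := (hI1.sto (by simp)).sto (by simp)
  have hag : ∀ x, x ≠ 14 → x ≠ 15 → s2.a x = s1.a x := fun x h1 h2 => by
    rw [hs2, St.sto_a_ne _ _ _ h2, St.sto_a_ne _ _ _ h1]
  have hU2 : SetTo pf (bs a) (s.r 10) s2 := hU1.congr rfl rfl fun x hx => hag x
    (by grind) (by grind)
  have hP2 : PricesIn n k a 0 0 s2 := by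
    have h14 : s2.a 14 = update (s1.a 14) 1 0 := by simp [hs2]
    have h15 : s2.a 15 = update (s1.a 15) 1 0 := by simp [hs2]
    unfold PricesIn
    have hc2 : s2.r 51 = c := h51
    rw [h14, h15, hc2]
    refine ⟨fun Z hZ => ?_, by simp, fun Z hZ hZk => ?_, fun Z hZ e he h => by omega⟩
    · grind
    · by_cases h1 : Z = 1
      · rw [h1, update_self, update_self]
        have : bs 1 = {0} := bs_two_pow 0
        exact ⟨[], List.nodup_nil, by simp, rfl, rfl, fun U hU _ => by simpa [this] using hU⟩
      grind
  refine wp_for0 (fun Y s3 => PricesIn n k a Y 0 s3) (10 * s.r 10 + 2) (2 ^ c) h65 (by omega) hP2 ?_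
    ?_
  · intro Y hY s3 hJ hx hF
    have hI3 := hI2.fr hF (by decide)
    have hU3 := hU2.fr hF (by decide)
    have h103 : s3.r 10 = s.r 10 := (hF.r 10 rfl).trans h10
    have h513 : s3.r 51 = c := (hF.r 51 rfl).trans h51
    refine wp_for0 (fun e s4 => PricesIn n k a Y e s4) 8 (s.r 10) h103 (by omega) hJ ?_ ?_
    · intro e he s4 hJ4 hx4 hF4
      have hI4 := hI3.fr hF4 (by decide)
      have h104 : s4.r 10 = s.r 10 := (hF4.r 10 rfl).trans h103
      refine wp_dpStep hC hI4 ha hn (Y := Y) (by rw [h104]; exact hU3.fr hF4 (by decide)) hx4 (by omega)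
        ((hF4.r 62 rfl).trans hx) (by rw [hF4.r 51 rfl, h513]; exact hY) hJ4
        fun s5 t5 h5 ht5 => ⟨ht5, h5⟩
    · intro s4 t4 hJ4 _ hF4 ht4
      have h104 : s4.r 10 = s.r 10 := (hF4.r 10 rfl).trans h103
      refine ⟨by omega, hJ4.le, hJ4.one, hJ4.sound, fun Z hZ e he hor => hJ4.relax Z hZ e he ?_⟩
      have he' : e < s.r 10 := by rw [← h104]; exact he
      omega
  · intro s3 t3 hJ3 _ hF ht3
    refine ⟨hJ3, ?_⟩
    grind

end

/-! ### The search for a smaller list -/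

/-- The trace `a` and `d` connecting entries with the code `q` give a connected vertex cover with at
most `k` vertices besides the root. -/
structure Good (n k : ℕ) (N : ℕ → List ℕ) (ℓ : ℕ → ℕ) (S r : ℕ) (par : ℕ → ℕ) (H : ℕ)
    (key rep : ℕ → ℕ) (a q d : ℕ) : Prop where
  root : 0 ∈ bs a
  hits : EHits H key (bs a)
  ex : ∃ c κ, Units (bs a) (ppar par r) c κ ∧ Reach n H key rep (bs a) κ (range c) d q
  card : (bs a).card + (forced n N ℓ S r (bs a)).card + d < k + 2

/-- No connected vertex cover with the trace `a` contains the root and at most `k` vertices besides. -/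
def Bad (n k : ℕ) (N : ℕ → List ℕ) (ℓ : ℕ → ℕ) (S r : ℕ) (par : ℕ → ℕ) (H : ℕ)
    (key : ℕ → ℕ) (a : ℕ) : Prop :=
  0 ∈ bs a → EHits H key (bs a) → ∃ c κ, Units (bs a) (ppar par r) c κ ∧ ∀ L : Finset ℕ,
    (∀ U ⊆ range c, 0 ∈ U → EClosed H key (bs a) κ L U → U = range c) →
      k + 2 ≤ (bs a).card + (forced n N ℓ S r (bs a)).card + L.card

theorem lt_card_of_bad (hC : Cover n N ℓ S par) (hG : Gr n N) (hE : Entries n N ℓ S r H key cnt rep)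
    (hr : r < S) (hbad : ∀ a < 2 ^ (S - r), Bad n k N ℓ S r par H key a) (hX : CVC n N X)
    (hroot : root ℓ r ⊆ X) : k < (X \ root ℓ r).card := by
  obtain ⟨A, hA, h0, hh, hL⟩ := entries_of_cvc hC hG hE hr hX hroot
  have hb := hbad (ofBits A) (by rwa [lt_two_pow_iff, bs_ofBits])
  unfold Bad at hb
  rw [bs_ofBits] at hb
  obtain ⟨c, κ, hU, hle⟩ := hb h0 hh
  obtain ⟨L, h1, h2⟩ := hL c κ hU
  grind

/-- The traces that contain the root, as long as none is accepted. -/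
def searchSel : Ex := .op mul (.op rem (.v 50) (.c 2)) (.op sub (.c 1) (.v 16))

/-- Accept the trace in register 50 if its price is small enough. -/
def searchBody : Cmd :=
  dp ;; .set 66 (.op sub (.ld 4 (.v 51)) (.c 1)) ;;
  .ite (.op add (.op add (.ld 16 (.v 50)) (.v 53)) (.ld 14 (.v 66))) (.op add (.v 3) (.c 2))
    (.set 16 (.c 1) ;; .set 18 (.v 50) ;; .set 19 (.ld 15 (.v 66)) ;; .set 23 (.ld 14 (.v 66))) .skip

theorem wp_searchBody (hC : Ctx E n m k N) (hI : Inst n m k N ℓ S r par s) (ha : a < 2 ^ (S - r))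
    (hn : 1 < n) (h50 : s.r 50 = a) (hU : SetTo (ppar par r) (bs a) (s.r 10) s)
    (hh : EHits (s.r 10) (s.a 6) (bs a)) (h0 : 0 ∈ bs a)
    (hQ : ∀ s' t, (s'.r 16 = s.r 16 ∧ Bad n k N ℓ S r par (s.r 10) (s.a 6) a ∨
      s'.r 16 = 1 ∧ s'.r 18 = a ∧ Good n k N ℓ S r par (s.r 10) (s.a 6) (s.a 8) a (s'.r 19) (s'.r 23)) →
      Fr searchBody s s' → t ≤ 2 ^ s.r 51 * (10 * s.r 10 + 7) + 13 → Q s' t) :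
    wp E searchBody s Q := by
  obtain ⟨l1, l2, l3, l4, l5, l6, l7, l8⟩ := hI.limits hC
  have hp := hI.hp
  have hlin := hC.lin
  have hc := hU.c_le ha
  have h2c : 2 ^ s.r 51 ≤ 2 ^ (k + 2) := Nat.pow_le_pow_right (by omega) (by omega)
  have h2c' : 0 < 2 ^ s.r 51 := by positivity
  have hc0 : 0 < s.r 51 := (Nat.zero_le _).trans_lt (hU.units.units.lt 0 h0)
  refine wp_post hQ ?_
  unfold searchBody
  refine wp_seq (wp_dp hC hI ha hn hU hc0 fun s1 t1 hP hF1 ht1 => ?_)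
  have hI1 := hI.fr hF1 (by decide)
  have h51 : s1.r 51 = s.r 51 := hF1.r 51 rfl
  have h10 : s1.r 10 = s.r 10 := hF1.r 10 rfl
  have h6 : s1.a 6 = s.a 6 := hF1.a 6 rfl
  have h8 : s1.a 8 = s.a 8 := hF1.a 8 rfl
  have h501 : s1.r 50 = a := (hF1.r 50 rfl).trans h50
  have h53 : s1.r 53 = (forced n N ℓ S r (bs a)).card := by
    rw [hF1.r 53 rfl, hU.forced, hI.ent.ent.card_forced]
  have hforced : (forced n N ℓ S r (bs a)).card ≤ n :=
    (card_le_card (filter_subset _ _)).trans (card_range n).le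
  have hU1 : SetTo (ppar par r) (bs a) (s.r 10) s1 := hU.fr hF1 (by decide)
  unfold PricesIn at hP
  rw [h51, h10, h6, h8] at hP
  have hpow := hI1.base.tab.pow (s.r 51) (by omega)
  have hfull : bs (2 ^ s.r 51 - 1) = range (s.r 51) := bs_two_pow_sub_one _
  refine wp_seq (wp_set (2 ^ s.r 51 - 1) ⟨⟨trivial, ?_⟩, hC.one_lt, ?_⟩ ?_ ?_)
  · simp only [Ex.ev, h51]; omega
  · simp only [opOk, Ex.ev, h51, hpow]; omega
  · simp only [opEval, Ex.ev, h51, hpow]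
  set f := 2 ^ s.r 51 - 1
  have hpop := hI1.base.tab.pop a (by omega)
  have hdle := hP.le f (by omega)
  have hcardA : (bs a).card ≤ k + 2 :=
    (card_le_card (lt_two_pow_iff.1 ha)).trans (by simpa using hp)
  have h3 := hI1.base.r3
  refine wp_ite ((bs a).card + (forced n N ℓ S r (bs a)).card + s1.a 14 f) (k + 2)
    ⟨⟨⟨trivial, ?_⟩, trivial, ?_⟩, ⟨trivial, ?_⟩, ?_⟩ ⟨trivial, ?_, ?_⟩ ?_ ?_ (fun hlt => ?_) fun hge => ?_
  · simp [Ex.ev, h501]; omega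
  · simp [opOk, Ex.ev, h501, hpop, h53]; omega
  · simp [Ex.ev]; omega
  · simp [opOk, Ex.ev, opEval, h501, hpop, h53]; omega
  · simp only [Ex.ok]; omega
  · simp [opOk, Ex.ev, h3]; omega
  · simp [Ex.ev, opEval, h501, hpop, h53]
  · simp [Ex.ev, opEval, h3]
  · have hA1 := card_pos.2 ⟨0, h0⟩
    have hreach := hP.sound f (by omega) (by omega)
    rw [hfull, hF1.a 10 rfl] at hreach
    refine wp_seq (wp_set 1 hC.one_lt rfl ?_)
    refine wp_seq (wp_set a trivial (by simp [Ex.ev, h501]) ?_)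
    refine wp_seq (wp_set (s1.a 15 f) ⟨trivial, ?_⟩ (by simp [Ex.ev]) ?_)
    · simp [Ex.ev]; omega
    refine wp_set (s1.a 14 f) ⟨trivial, ?_⟩ (by simp [Ex.ev]) ⟨Or.inr ⟨by simp, by simp, ?_⟩, by omega⟩
    · simp [Ex.ev]; omega
    · simp only [St.set_r, if_true, show (19 : ℕ) ≠ 23 by omega, if_false]
      exact ⟨h0, hh, ⟨_, _, hU.units.units, hreach⟩, hlt⟩
  · refine ⟨Or.inl ⟨?_, fun _ _ => ⟨_, _, hU.units.units, fun L hL => ?_⟩⟩, by omega⟩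
    · rw [St.set_r, if_neg (by omega)]; exact hF1.r 16 rfl
    · by_cases hLk : L.card ≤ k
      · have hκ := hU1.units.units.lt
        rw [h51] at hκ
        have hle := hP.le_card hc0 hκ (fun e he => by rw [hU1.tau e he, h6]) L hLk (by
          rw [hF1.a 10 rfl]; exact hL)
        grind
      omega

/-- Search for an acceptable trace. -/
def search : Cmd := .set 16 (.c 0) ;; traces searchSel searchBody

theorem wp_search (hC : Ctx E n m k N) (hI : Inst n m k N ℓ S r par s) (hn : 1 < n)
    (hQ : ∀ s' t, (s'.r 16 = 0 ∧ (∀ X, CVC n N X → root ℓ r ⊆ X → k < (X \ root ℓ r).card) ∨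
      s'.r 16 = 1 ∧ s'.r 18 < 2 ^ (S - r) ∧
      Good n k N ℓ S r par (s.r 10) (s.a 6) (s.a 8) (s'.r 18) (s'.r 19) (s'.r 23)) →
      Fr search s s' → t ≤ 2 ^ (S - r) * (54 * s.r 10 + 28 * (S - r) + 72) + 3 → Q s' t) :
    wp E search s Q := by
  refine wp_post hQ ?_
  have hlin := hC.lin
  unfold search
  refine wp_seq (wp_set 0 hC.bd_pos rfl ?_)
  have hI1 := hI.set (x := 16) (v := 0) (by omega)
  refine wp_traces hC (10 * s.r 10 + 20) (fun a s1 => (s1.r 10 = s.r 10 ∧ s1.a 6 = s.a 6 ∧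
      s1.a 8 = s.a 8) ∧ (s1.r 16 = 0 ∧ (∀ a' < a, Bad n k N ℓ S r par (s.r 10) (s.a 6) a') ∨
        s1.r 16 = 1 ∧ s1.r 18 < 2 ^ (S - r) ∧
          Good n k N ℓ S r par (s.r 10) (s.a 6) (s.a 8) (s1.r 18) (s1.r 19) (s1.r 23)))
    hI1 (by decide) ?_ ?_ ?_ ?_ ?_ ?_ ?_
  · rintro a s1 s2 h hs
    rw [hs.1 10 (by omega), hs.1 16 (by omega), hs.1 18 (by omega), hs.1 19 (by omega),
      hs.1 23 (by omega), hs.2 6 (by omega), hs.2 8 (by omega)]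
    exact h
  · rintro a s1 ha ⟨-, hJ⟩ h50
    have h16 : s1.r 16 ≤ 1 := by omega
    refine ⟨⟨trivial, by simp only [Ex.ok]; omega, trivial⟩, ⟨hC.one_lt, trivial, ?_⟩, ?_⟩
    · simp only [opOk, Ex.ev]; omega
    · simp only [opOk, Ex.ev, opEval]
      grind
  · intro s1 s2 hs h50
    simp only [searchSel, Ex.ev, h50, hs.1 16 (by omega)]
  · rintro a s1 ha ⟨hs, hJ⟩ h50 hno
    refine ⟨hs, hJ.imp (fun h => ⟨h.1, fun a' ha' => ?_⟩) id⟩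
    rcases Nat.lt_succ_iff_lt_or_eq.1 ha' with h' | rfl
    · exact h.2 a' h'
    · intro h0 hh
      rcases hno with hno | hno
      · simp only [searchSel, Ex.ev, opEval, h50, h.1, zero_mem_bs.1 h0] at hno
        omega
      · exact absurd hh hno
  · rintro a s1 ha ⟨⟨e1, e2, e3⟩, hJ⟩ hI2 h50 hsel hh hU
    have h16 : s1.r 16 = 0 := by
      rcases hJ with h | h
      · exact h.1
      · simp [searchSel, Ex.ev, opEval, h.1] at hsel
    have h0 : 0 ∈ bs a := by
      rw [zero_mem_bs]
      by_contra hne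
      simp only [searchSel, Ex.ev, opEval, h50, show a % 2 = 0 by omega] at hsel
      omega
    have hJ' := hJ.resolve_right fun h => by omega
    refine wp_searchBody hC hI2 ha hn h50 hU hh h0 fun s2 t2 hcase hF ht => ⟨?_, ⟨?_, ?_, ?_⟩, ?_⟩
    · grind
    · rw [hF.r 10 rfl, e1]
    · rw [hF.a 6 rfl, e2]
    · rw [hF.a 8 rfl, e3]
    grind
  · simp
  · rintro s' t ⟨-, hJ⟩ hI' ht
    refine ⟨hJ.imp (fun h => ⟨h.1, fun X hX hroot => ?_⟩) id, ?_⟩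
    · exact lt_card_of_bad hI.cov hC.gr hI.ent.ent hI.hr h.2 hX hroot
    · simp only [St.set_r, show (10 : ℕ) ≠ 16 by omega, if_false] at ht
      grind

/-! ### The list of an accepted trace -/

theorem Good.exists_list (hC : Cover n N ℓ S par) (hG : Gr n N)
    (hE : Entries n N ℓ S r H key cnt rep) (hr : r < S) {q d : ℕ} (ha : a < 2 ^ (S - r))
    (h : Good n k N ℓ S r par H key rep a q d) :
    ∃ l : List ℕ, l.length = d ∧ Nat.ofDigits n l = q ∧ (∀ v ∈ l, v < n) ∧
      CVC n N (assemble n N ℓ S r (bs a) l.toFinset) ∧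
      (assemble n N ℓ S r (bs a) l.toFinset).card =
        r + (bs a).card + (forced n N ℓ S r (bs a)).card + d := by
  obtain ⟨c, κ, hU, l, hnd, hl, hlen, hq, hconn⟩ := h.ex
  have hAs := lt_two_pow_iff.1 ha
  have heven : ∀ e ∈ l, e < H ∧ key e % 2 = 0 := fun e he => by
    obtain ⟨h1, h2, -⟩ := hl e he
    simp only [EMand, not_or] at h2
    omega
  have hset : (l.map rep).toFinset = l.toFinset.image rep := by ext; simp
  have h1 := cvc_of_entries hC hG hE hU h.root hAs h.hits l.toFinset (fun e he => by
    obtain ⟨a, b, -⟩ := hl e (List.mem_toFinset.1 he); exact ⟨a, b⟩)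
    fun U hUc hU0 hcl => Finset.Subset.antisymm hUc (hconn U hU0 hcl)
  refine ⟨l.map rep, by simpa, hq, fun v hv => ?_, hset ▸ h1.2, ?_⟩
  · obtain ⟨e, he, rfl⟩ := List.mem_map.1 hv
    obtain ⟨h2, h3⟩ := heven e he
    exact (hE.even e h2 h3).1
  · rw [hset, card_assemble h1.1, card_trace hC hr h.root hAs, card_image_of_injOn,
      List.toFinset_card_of_nodup hnd, hlen]
    intro e he e' he' hee
    rw [mem_coe, List.mem_toFinset] at he he'
    obtain ⟨h2, h3⟩ := heven e he
    obtain ⟨h4, h5⟩ := heven e' he'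
    refine hE.inj e h2 e' h4 ?_
    have h6 := (hE.even e h2 h3).2.2.1
    rw [hee, ← (hE.even e' h4 h5).2.2.1] at h6
    have := bs_injective h6
    omega

/-- Append a value to the new list in array 2. -/
def push (e : Ex) : Cmd := .sto 2 (.v 17) e ;; .set 17 (.op add (.v 17) (.c 1))

/-- The new list has the length `c` and the members `X`, and it begins like the old one. -/
structure Holds (ℓ : ℕ → ℕ) (r : ℕ) (X : Finset ℕ) (c : ℕ) (s : St) : Prop where
  len : s.r 17 = c
  set : lset (s.a 2) c = X
  pre : ∀ i < c, i ≤ r → s.a 2 i = ℓ i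

theorem Holds.congr (h : Holds ℓ r X c s) (h17 : s'.r 17 = s.r 17) (h2 : s'.a 2 = s.a 2) :
    Holds ℓ r X c s' :=
  ⟨by rw [h17, h.len], by rw [h2, h.set], by rw [h2]; exact h.pre⟩

theorem wp_push (hC : Ctx E n m k N) (hH : Holds ℓ r X c s) (hc : c < 3 * k + 8) (ho : e.ok E s)
    (hv : e.ev E s = v) (hpre : c ≤ r → v = ℓ c)
    (hQ : ∀ s', Holds ℓ r (insert v X) (c + 1) s' → Fr (push e) s s' → Q s' 2) :
    wp E (push e) s Q := by
  have hcap := hC.cap_lin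
  have hlin := hC.lin
  have h17 := hH.len
  suffices hw : wp E (push e) s fun s' t => Holds ℓ r (insert v X) (c + 1) s' ∧ t = 2 from
    wp_mono (wp_frame hw) fun s' t h => by grind
  refine wp_seq (wp_sto c v trivial ho h17 hv (by omega) ?_)
  refine wp_set (c + 1) ⟨trivial, hC.one_lt, ?_⟩ ?_ ⟨⟨by simp, ?_, fun i hi hir => ?_⟩, rfl⟩
  · simp only [opOk, Ex.ev, St.sto_r, h17]; omega
  · simp only [opEval, Ex.ev, St.sto_r, h17]
  · rw [St.set_a, St.sto_a_same, lset, range_add_one, image_insert, update_self,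
      ← hH.set, lset]
    grind
  · rw [St.set_a, St.sto_a_same]
    by_cases hic : i = c
    · grind
    · rw [update_of_ne hic]; exact hH.pre i (by omega) hir

/-- Append the vertices before the root's last one. -/
def copyRoot : Cmd := .forr 68 (.c 0) 8 (push (.ld 1 (.v 68)))

/-- Append the vertices of the trace. -/
def copyTrace : Cmd :=
  .forr 68 (.c 0) 9 (.ite (.c 0) (bitE (.v 18) (.v 68)) (push (.ld 1 (.op add (.v 8) (.v 68)))) .skip)

/-- Append the forced vertices. -/
def copyForced : Cmd :=
  .forr 42 (.c 0) 1 (.set 80 (.v 42) ;; mem ;; .ite (.v 81) (.v 7) .skip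
    (maskOf ;; .ite (andE (.v 47) (.v 18)) (.v 47) (push (.v 42)) .skip))

/-- Append the vertices that register 19 encodes. -/
def copyFree : Cmd :=
  .forr 68 (.c 0) 23 (push (.op rem (.v 19) (.v 1)) ;; .set 19 (.op quot (.v 19) (.v 1)))

theorem Holds.insert {f : ℕ → ℕ} (hi : i ∈ A) (h : Holds ℓ r (insert (f i) (X ∪ (A.filter (· <
    i)).image f)) (c + (A.filter (· < i)).card + 1) s) :
    Holds ℓ r (X ∪ (A.filter (· < i + 1)).image f) (c + (A.filter (· < i + 1)).card) s := by
  rwa [filter_lt_succ, if_pos hi, card_insert_of_notMem (by simp), image_insert,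
    union_insert]

theorem wp_copyRoot (hC : Ctx E n m k N) (hI : Inst n m k N ℓ S r par s) (hr : r ≤ 2 * k)
    (h17 : s.r 17 = 0)
    (hQ : ∀ s' t, Holds ℓ r ((range r).image ℓ) r s' → Fr copyRoot s s' → t ≤ 4 * r + 2 → Q s' t) :
    wp E copyRoot s Q := by
  have hcap := hC.cap_lin
  have hlin := hC.lin
  refine wp_for0 (fun i s1 => Holds ℓ r ((range i).image ℓ) i s1) 2 r hI.base.r8 (by omega)
    ⟨?_, by simp [lset], by omega⟩ ?_ ?_
  · simpa using h17
  · intro i hi s1 hJ hx hF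
    refine wp_push hC hJ (by omega) ⟨trivial, ?_⟩ rfl ?_ fun s2 hH hF2 => ⟨le_rfl, ?_⟩
    · simp only [Ex.ev, hx]; omega
    · intro _; simp only [Ex.ev, hx]; rw [hF.a 1 rfl, hI.base.a1]
    · rw [range_add_one, image_insert]
      simp only [Ex.ev, hx] at hH
      rw [hF.a 1 rfl, hI.base.a1] at hH
      exact hH.congr (by simp) rfl
  · intro s' t hJ _ hF ht
    refine hQ s' t hJ hF ?_
    omega

theorem wp_copyTrace (hC : Ctx E n m k N) (hI : Inst n m k N ℓ S r par s) (hr : r ≤ 2 * k)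
    (h18 : s.r 18 = a) (ha : a < 2 ^ (S - r)) (h0 : 0 ∈ bs a) (hH : Holds ℓ r X r s)
    (hQ : ∀ s' t, Holds ℓ r (X ∪ (bs a).image fun j => ℓ (r + j)) (r + (bs a).card) s' →
      Fr copyTrace s s' → t ≤ 5 * (S - r) + 2 → Q s' t) :
    wp E copyTrace s Q := by
  have hcap := hC.cap_lin
  have hlin := hC.lin
  have hp := hI.hp
  have hAs := lt_two_pow_iff.1 ha
  refine wp_for0 (fun j s1 => Holds ℓ r (X ∪ ((bs a).filter (· < j)).image fun j => ℓ (r + j))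
      (r + ((bs a).filter (· < j)).card) s1) 3 (S - r) hI.ent.r9 (by omega) ?_ ?_ ?_
  · simpa using hH.congr (s' := s.set 68 0) (by simp) rfl
  · intro j hj s1 hJ hx hF
    have hI1 := hI.fr hF (by decide)
    obtain ⟨ho, hv⟩ := bitE_spec hC hI1.base.tab (e := .v 18) (e' := .v 68) (x := a) (j := j)
      trivial trivial ((hF.r 18 rfl).trans h18) hx (by omega)
    have hcard : ((bs a).filter (· < j)).card ≤ j := by
      have : (bs a).filter (· < j) ⊆ range j := fun i hi => by grind
      simpa using card_le_card this
    refine wp_ite 0 _ hC.bd_pos ho rfl rfl (fun h => ?_) fun h => ?_ <;> rw [hv] at h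
    · have h8 := hI1.base.r8
      refine wp_push hC (v := ℓ (r + j)) hJ (by omega) ⟨⟨trivial, trivial, ?_⟩, ?_⟩ ?_ (fun hle => ?_)
        fun s2 hH2 _ => ⟨by omega, (Holds.insert (f := fun j => ℓ (r + j)) h hH2).congr (by simp) rfl⟩
      · simp only [opOk, Ex.ev, h8, hx]; omega
      · simp only [Ex.ev, opEval, h8, hx]; omega
      · simp only [Ex.ev, opEval, h8, hx, hI1.base.a1]
      · -- a prefix of length `r` is only possible before the position `0`
        have hj0 : j = 0 := by
          by_contra hj0
          have := card_pos.2 ⟨0, (mem_filter.2 ⟨h0, Nat.pos_of_ne_zero hj0⟩ :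
            0 ∈ (bs a).filter (· < j))⟩
          omega
        grind
    · refine ⟨by omega, ?_⟩
      rw [filter_lt_succ, if_neg h]
      exact hJ.congr (by simp) rfl
  · intro s' t hJ _ hF ht
    rw [filter_true_of_mem fun j hj => mem_range.1 (hAs hj)] at hJ
    refine hQ s' t hJ hF ?_
    omega

theorem wp_copyForced (hC : Ctx E n m k N) (hI : Inst n m k N ℓ S r par s) (hS : S ≤ 3 * k + 8)
    (h18 : s.r 18 = a) (ha : a < 2 ^ (S - r)) (hrc : r < c)
    (hc : c + (forced n N ℓ S r (bs a)).card ≤ 3 * k + 8) (hH : Holds ℓ r X c s)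
    (hQ : ∀ s' t, Holds ℓ r (X ∪ forced n N ℓ S r (bs a)) (c + (forced n N ℓ S r (bs a)).card) s' →
      Fr copyForced s s' → t ≤ (10 * S + 30) * (n + 2 * m) + 2 → Q s' t) :
    wp E copyForced s Q := by
  obtain ⟨l1, l2, l3, l4, l5, l6, l7, l8⟩ := hI.limits hC
  have hlin := hC.lin
  have hinj := hI.cov.inj
  have hid : ∀ A : Finset ℕ, A.image (fun v => v) = A := fun A => image_id
  refine wp_for
    (fun v s1 => Holds ℓ r (X ∪ ((forced n N ℓ S r (bs a)).filter (· < v)).image fun v => v)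
      (c + ((forced n N ℓ S r (bs a)).filter (· < v)).card) s1)
    (fun v => (5 * S + 14) * (N v).length + 5 * S + 13) 0 n hC.bd_pos rfl hI.base.r1 (Nat.zero_le _)
    (by omega) ?_ ?_ ?_
  · simpa using hH.congr (s' := s.set 42 0) (by simp) rfl
  · intro v _ hv s1 hJ hx hF
    have hI1 := hI.fr hF (by decide)
    have h7 := hI1.base.r7
    refine wp_seq (wp_set v trivial hx ?_)
    refine wp_seq (wp_mem hC (S := S) (by simp [h7]) hS fun s2 t2 hidx hF2 ht2 => ?_)
    simp only [St.set_a, St.set_r, if_true, hI1.base.a1] at hidx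
    have hI2 := (hI1.set (x := 80) (v := v) (by omega)).fr hF2 (by decide)
    have h172 : s2.r 17 = s1.r 17 := by rw [hF2.r 17 rfl]; simp
    have h22 : s2.a 2 = s1.a 2 := by rw [hF2.a 2 rfl]; rfl
    have hskip : ∀ s3 : St, v ∉ forced n N ℓ S r (bs a) → s3.r 17 = s1.r 17 → s3.a 2 = s1.a 2 →
        Holds ℓ r (X ∪ ((forced n N ℓ S r (bs a)).filter (· < v + 1)).image fun v => v)
        (c + ((forced n N ℓ S r (bs a)).filter (· < v + 1)).card) (s3.set 42 (v + 1)) := by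
      intro s3 hnot h17 h2
      rw [filter_lt_succ, if_neg hnot]
      exact hJ.congr (by simp [h17]) h2
    refine wp_ite (s2.r 81) S trivial trivial rfl hI2.base.r7 (fun hlt => ?_) fun hge => ?_
    · refine ⟨by omega, hskip _ (fun hf => ?_) h172 h22⟩
      obtain ⟨i, hi, hiv⟩ := hidx.inL.2 hlt
      exact (mem_forced.1 hf).2.1 i hi hiv
    · have hvs : ∀ i < S, ℓ i ≠ v := fun i hi hiv => hge (hidx.inL.1 ⟨i, hi, hiv⟩)
      refine wp_seq (wp_maskOf hC hI2.base hS hI.hp hinj (v := v) (by rw [hF2.r 42 rfl]; simp [hx]) hv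
        fun s3 t3 h47 hF3 ht3 => ?_)
      have hI3 := hI2.fr hF3 (by decide)
      have h173 : s3.r 17 = s1.r 17 := (hF3.r 17 rfl).trans h172
      have h23 : s3.a 2 = s1.a 2 := (hF3.a 2 rfl).trans h22
      have h183 : s3.r 18 = a := by rw [hF3.r 18 rfl, hF2.r 18 rfl]; simp [hF.r 18 rfl, h18]
      have h423 : s3.r 42 = v := by rw [hF3.r 42 rfl, hF2.r 42 rfl]; simp [hx]
      have h47lt : s3.r 47 < 2 ^ (S - r) := by
        rw [lt_two_pow_iff, h47]; exact posSet_subset_range hI.hr v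
      obtain ⟨ho, hvl⟩ := andE_spec hC hI3.base.tab (e := .v 47) (e' := .v 18)
        (x := s3.r 47) (y := a) trivial trivial rfl h183 (by omega) (by omega)
      have hle : s3.r 47 &&& a ≤ s3.r 47 := Nat.and_le_left
      have hmem : v ∈ forced n N ℓ S r (bs a) ↔ ¬ s3.r 47 &&& a = s3.r 47 := by
        rw [mem_forced, land_eq_left, h47]
        grind
      refine wp_ite _ (s3.r 47) ho trivial hvl rfl (fun h => ?_) fun h => ?_
      · have hvf := hmem.2 h.ne
        have hlt : ((forced n N ℓ S r (bs a)).filter (· < v)).card < (forced n N ℓ S r (bs a)).card :=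
          card_lt_card ⟨filter_subset _ _, fun h' => by simpa using h' hvf⟩
        refine wp_push hC (v := v) (hJ.congr h173 h23) (by omega) trivial h423 (fun h' => by omega)
          fun s4 hH4 _ => ⟨by omega, (Holds.insert (f := fun v => v) hvf hH4).congr (by simp) rfl⟩
      · exact ⟨by omega, hskip _ (fun hf => hmem.1 hf (by omega)) h173 h23⟩
  · intro s' t hJ _ hF ht
    rw [filter_true_of_mem fun v hv => (mem_forced.1 hv).1, hid] at hJ
    refine hQ s' t hJ hF (ht.trans ?_)
    rw [← range_eq_Ico, sum_add_distrib, sum_add_distrib, sum_add_distrib,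
      ← mul_sum, hC.sum]
    simp only [sum_const, card_range, smul_eq_mul]
    nlinarith

theorem wp_copyFree (hC : Ctx E n m k N) {l : List ℕ} (hI : Inst n m k N ℓ S r par s)
    (h23 : s.r 23 = l.length) (h19 : s.r 19 = Nat.ofDigits n l) (hl : ∀ v ∈ l, v < n) (hrc : r < c)
    (hc : c + l.length ≤ 3 * k + 8) (hH : Holds ℓ r X c s)
    (hQ : ∀ s' t, Holds ℓ r (X ∪ l.toFinset) (c + l.length) s' → Fr copyFree s s' →
      t ≤ 5 * l.length + 2 → Q s' t) :
    wp E copyFree s Q := by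
  have hlin := hC.lin
  refine wp_for0 (fun i s1 => Holds ℓ r (X ∪ (l.take i).toFinset) (c + i) s1 ∧
      s1.r 19 = Nat.ofDigits n (l.drop i)) 3 l.length h23 (by omega) ?_ ?_ ?_
  · exact ⟨by simpa using hH.congr (s' := s.set 68 0) (by simp) rfl, by simpa using h19⟩
  · rintro i hi s1 ⟨hJ, h19⟩ hx hF
    have h1 : s1.r 1 = n := (hF.r 1 rfl).trans hI.base.r1
    have hv := hl l[i] (List.getElem_mem hi)
    rw [List.drop_eq_getElem_cons hi, Nat.ofDigits_cons] at h19
    have hmod : s1.r 19 % n = l[i] := by rw [h19, Nat.add_mul_mod_self_left, Nat.mod_eq_of_lt hv]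
    have hdiv : s1.r 19 / n = Nat.ofDigits n (l.drop (i + 1)) := by
      rw [h19, Nat.add_mul_div_left _ _ (by omega), Nat.div_eq_of_lt hv, zero_add]
    refine wp_seq (wp_push hC (v := l[i]) hJ (by omega) ⟨trivial, trivial, trivial⟩
      (by simp only [Ex.ev, opEval, h1, hmod]) (fun h => by omega) fun s2 hH2 hF2 => ?_)
    have h19' : s2.r 19 = s1.r 19 := hF2.r 19 rfl
    have h12 : s2.r 1 = n := (hF2.r 1 rfl).trans h1
    refine wp_set _ ⟨trivial, trivial, trivial⟩ rfl ⟨by omega, ?_, ?_⟩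
    · rw [List.take_succ_eq_append_getElem hi, List.toFinset_append, List.toFinset_cons,
        List.toFinset_nil, insert_empty_eq, ← union_assoc, union_comm _ {l[i]}, ← insert_eq]
      exact hH2.congr (by simp) rfl
    · simp [Ex.ev, opEval, h19', h12, hdiv]
  · rintro s' t ⟨hJ, -⟩ _ hF ht
    rw [List.take_length] at hJ
    refine hQ s' t hJ hF ?_
    omega

/-- Replace the list by the one of the accepted trace. -/
def newList : Cmd :=
  .set 17 (.c 0) ;; copyRoot ;; copyTrace ;; copyForced ;; copyFree ;;
  .forr 68 (.c 0) 17 (.sto 1 (.v 68) (.ld 2 (.v 68))) ;; .set 7 (.v 17)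

theorem wp_newList (hC : Ctx E n m k N) (hI : Inst n m k N ℓ S r par s) (hr : r ≤ 2 * k)
    (ha : s.r 18 < 2 ^ (S - r))
    (hg : Good n k N ℓ S r par (s.r 10) (s.a 6) (s.a 8) (s.r 18) (s.r 19) (s.r 23)) :
    wp E newList s fun s' t => (CVC n N (lset (s'.a 1) (s'.r 7)) ∧ r < s'.r 7 ∧
      s'.r 7 ≤ r + k + 1 ∧ (∀ i < s'.r 7, ∀ j < s'.r 7, s'.a 1 i = s'.a 1 j → i = j) ∧
      ∀ i ≤ r, s'.a 1 i = ℓ i) ∧ t ≤ (10 * S + 30) * (n + 2 * m) + 5 * S + 12 * (k + r) + 40 := by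
  obtain ⟨l1, l2, l3, l4, l5, l6, l7, l8⟩ := hI.limits hC
  have hlin := hC.lin
  have hp := hI.hp
  obtain ⟨l, hl, hq, hln, hcvc, hcard⟩ := hg.exists_list hI.cov hC.gr hI.ent.ent hI.hr ha
  have hlt := hg.card
  have hA0 := card_pos.2 ⟨0, hg.root⟩
  unfold newList
  refine wp_seq (wp_set 0 hC.bd_pos rfl ?_)
  have hI0 := hI.set (x := 17) (v := 0) (by omega)
  refine wp_seq (wp_copyRoot hC hI0 hr (by simp) fun s1 t1 hH1 hF1 ht1 => ?_)
  have hI1 := hI0.fr hF1 (by decide)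
  have e18 : s1.r 18 = s.r 18 := by rw [hF1.r 18 rfl]; simp
  have e19 : s1.r 19 = s.r 19 := by rw [hF1.r 19 rfl]; simp
  have e23 : s1.r 23 = s.r 23 := by rw [hF1.r 23 rfl]; simp
  refine wp_seq (wp_copyTrace hC hI1 hr e18 ha hg.root hH1 fun s2 t2 hH2 hF2 ht2 => ?_)
  have hI2 := hI1.fr hF2 (by decide)
  refine wp_seq (wp_copyForced hC hI2 (by omega) ((hF2.r 18 rfl).trans e18) ha (by omega) (by omega)
    hH2 fun s3 t3 hH3 hF3 ht3 => ?_)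
  have hI3 := hI2.fr hF3 (by decide)
  refine wp_seq (wp_copyFree hC hI3 (l := l) (by rw [hF3.r 23 rfl, hF2.r 23 rfl, e23, hl])
    (by rw [hF3.r 19 rfl, hF2.r 19 rfl, e19, hq]) hln (by omega) (by omega) hH3
    fun s4 t4 hH4 hF4 ht4 => ?_)
  rw [← hl] at hcard
  set c := r + (bs (s.r 18)).card + (forced n N ℓ S r (bs (s.r 18))).card + l.length with hc
  have hX : (range r).image ℓ ∪ (bs (s.r 18)).image (fun j => ℓ (r + j)) ∪
      forced n N ℓ S r (bs (s.r 18)) ∪ l.toFinset = assemble n N ℓ S r (bs (s.r 18)) l.toFinset := by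
    rw [assemble, trace, filter_positions hI.hr hg.root (lt_two_pow_iff.1 ha), image_union,
      image_image]
    rfl
  rw [hX] at hH4
  have hinj : Set.InjOn (s4.a 2) (range c) := by
    rw [← card_image_iff, card_range]
    exact (congrArg card hH4.set).trans hcard
  refine wp_seq (wp_for0 (fun i s5 => ∀ i' < i, s5.a 1 i' = s4.a 2 i') 1 c hH4.len (by omega)
    (fun i hi => by omega) ?_ ?_)
  · intro i hi s5 hJ hx hF
    refine wp_sto i (s4.a 2 i) trivial ⟨trivial, ?_⟩ hx ?_ (by omega) ⟨le_rfl, fun i' hi' => ?_⟩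
    · simp only [Ex.ev, hx]; omega
    · simp only [Ex.ev, hx]; rw [hF.a 2 rfl]
    · rw [St.set_a, St.sto_a_same]
      grind
  intro s5 t5 hJ _ hF5 ht5
  have h17 : s5.r 17 = c := (hF5.r 17 rfl).trans hH4.len
  have hset : lset (s5.a 1) c = lset (s4.a 2) c :=
    image_congr fun i hi => hJ i (by simpa using hi)
  refine wp_set c trivial h17 ⟨?_, ?_⟩
  · simp only [St.set_a, St.set_r, if_true]
    refine ⟨?_, by omega, by omega, fun i hi j hj hij => ?_, fun i hi => ?_⟩
    · rw [hset, hH4.set]; exact hcvc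
    · rw [hJ i hi, hJ j hj] at hij
      exact hinj (by simpa using hi) (by simpa using hj) hij
    · rw [hJ i (by omega), hH4.pre i (by omega) hi]
  · omega

/-! ### Shrinking the list -/

theorem Base.relist (h : Base n k ℓ S r s) (hr : ∀ x ∈ [1, 3, 4, 5, 6], s'.r x = s.r x)
    (ha : ∀ x ∈ [0, 4, 16], s'.a x = s.a x) : Base n k (s'.a 1) (s'.r 7) (s'.r 8) s' where
  r1 := (hr 1 (by simp)).trans h.r1
  r3 := (hr 3 (by simp)).trans h.r3
  r4 := (hr 4 (by simp)).trans h.r4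
  r5 := (hr 5 (by simp)).trans h.r5
  r7 := rfl
  r8 := rfl
  a1 := rfl
  tab := h.tab.congr (hr 6 (by simp)) (ha 0 (by simp)) (ha 4 (by simp)) (ha 16 (by simp))

theorem Base.relist_fr (h : Base n k ℓ S r s) (f : Fr p s s')
    (hp : (∀ x ∈ [1, 3, 4, 5, 6], p.wr x = false) ∧ ∀ x ∈ [0, 4, 16], p.wa x = false) :
    Base n k (s'.a 1) (s'.r 7) (s'.r 8) s' :=
  h.relist (fun x hx => f.r x (hp.1 x hx)) fun x hx => f.a x (hp.2 x hx)

theorem succ_sq_le (k : ℕ) : (k + 1) * (k + 1) ≤ 4 * 2 ^ k := by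
  have : ∀ k, (k + 3) * (k + 3) ≤ 4 * 2 ^ (k + 2) := by
    intro k
    induction k with
    | zero => norm_num
    | succ k ih => grind
  match k with
  | 0 => norm_num
  | 1 => norm_num
  | k + 2 => exact this k

theorem Cover.lset_root (hC : Cover n N ℓ S par) (hG : Gr n N) (h0 : 0 < r) (hr : r < S)
    (hu : u ∈ root ℓ r) : N u ≠ [] := by
  obtain ⟨i, hi, rfl⟩ := mem_image.1 hu
  rw [mem_range] at hi
  by_cases hi0 : i = 0
  · have h1 := hC.par 1 (by omega) (by omega)
    rw [show par 1 = 0 by omega] at h1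
    rw [hi0]
    exact List.ne_nil_of_mem (hG.symm _ _ h1.2)
  · exact List.ne_nil_of_mem (hC.par i (by omega) (by omega)).2

/-- Replace the list by one in which the root, up to the index in register 8, has at most `k`
companions; set register 15 to `1` if there is none. -/
def chainStep : Cmd := order ;; types ;; search ;; .ite (.c 0) (.v 16) newList (.set 15 (.c 1))

/-- The list before the step for the root up to the index `r`, or the failure. -/
def ChainInv (n k : ℕ) (N : ℕ → List ℕ) (r : ℕ) (s : St) : Prop :=
  s.r 15 = 0 ∧ CList n N (s.a 1) (s.r 7) r ∧ r + 2 ≤ s.r 7 ∧ s.r 7 ≤ r + k + 2 ∨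
    s.r 15 = 1 ∧ ∀ X, CVC n N X → k < X.card

theorem wp_chainStep (hC : Ctx E n m k N) (hB : Base n k (s.a 1) (s.r 7) r s)
    (hL : CList n N (s.a 1) (s.r 7) r) (hS : s.r 7 ≤ r + k + 2) (h0 : 0 < r) (hr : r ≤ 2 * k)
    (h15 : s.r 15 = 0) :
    wp E chainStep s fun s' t => ChainInv n k N (r - 1) s' ∧ t ≤ 1300 * (2 ^ k * (n + 2 * m)) := by
  obtain ⟨S, hSd⟩ : ∃ S, s.r 7 = S := ⟨_, rfl⟩
  rw [hSd] at hB hL hS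
  have hSn := hL.le_n
  have hlt := hL.lt
  refine wp_seq (wp_order hC hSd (by omega) hB.r8 hL fun s1 t1 par hcov hpre hset h3 hF1 ht1 => ?_)
  have hB1 : Base n k (s1.a 1) S r s1 := by
    have := hB.relist_fr hF1 (by decide)
    rwa [hF1.r 7 rfl, hF1.r 8 rfl, hB.r8, hSd] at this
  refine wp_seq (wp_types hC hB1 (by omega) (by omega) hlt hcov.inj fun s2 t2 hE hF2 ht2 => ?_)
  have hI2 : Inst n m k N (s1.a 1) S r par s2 :=
    ⟨hB1.fr hF2 (by decide), hE, hcov, by rw [hF2.a 3 rfl]; exact h3, hlt, by omega⟩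
  refine wp_seq (wp_search hC hI2 (by omega) fun s3 t3 hcase hF3 ht3 => ?_)
  have hI3 := hI2.fr hF3 (by decide)
  have hH := hE.H_le'
  -- all terms of the running time are at most `2 ^ k * (n + 2 * m)`, up to constants
  have htime : t1 + (t2 + (t3 + (((10 * S + 30) * (n + 2 * m) + 5 * S + 12 * (k + r) + 40) + 2))) ≤
      1300 * (2 ^ k * (n + 2 * m)) := by
    have hD : 1 ≤ n + 2 * m := by omega
    have hkP : k + 1 ≤ 2 ^ k := Nat.lt_two_pow_self
    have hk2 := succ_sq_le k
    have e1 : S * ((5 * S + 20) * (n + 2 * m) + 12) ≤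
        3 * (k + 1) * (30 * (k + 1) * (n + 2 * m) + 12) :=
      Nat.mul_le_mul (by omega) (Nat.add_le_add_right (Nat.mul_le_mul_right _ (by omega)) _)
    have e3 : (10 * S + 30) * (n + 2 * m) ≤ 50 * (k + 1) * (n + 2 * m) :=
      Nat.mul_le_mul_right _ (by omega)
    have e4 : 2 ^ (S - r) ≤ 4 * 2 ^ k := by
      rw [show 4 * 2 ^ k = 2 ^ (k + 2) by ring]; exact Nat.pow_le_pow_right (by omega) (by omega)
    have e5 : 2 ^ (S - r) * (54 * s2.r 10 + 28 * (S - r) + 72) ≤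
        4 * 2 ^ k * (154 * (n + 2 * m)) := Nat.mul_le_mul e4 (by omega)
    have e6 : (k + 1) * (k + 1) * (n + 2 * m) ≤ 4 * 2 ^ k * (n + 2 * m) := Nat.mul_le_mul_right _ hk2
    have e7 : (k + 1) * (n + 2 * m) ≤ 2 ^ k * (n + 2 * m) := Nat.mul_le_mul_right _ hkP
    have e8 : 2 ^ k * 1 ≤ 2 ^ k * (n + 2 * m) := Nat.mul_le_mul_left _ hD
    grind
  rcases hcase with ⟨h16, hno⟩ | ⟨h16, h18, hg⟩
  · refine wp_ite 0 0 hC.bd_pos trivial rfl h16 (fun h => absurd h (by omega)) fun _ => ?_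
    refine wp_set 1 hC.one_lt rfl ⟨Or.inr ⟨by simp, fun X hX => ?_⟩, by omega⟩
    have h1 := hno _ (hX.union hC.gr fun u hu => hcov.lset_root hC.gr h0 hlt hu)
      subset_union_right
    grind
  · refine wp_ite 0 1 hC.bd_pos trivial rfl h16 (fun _ => ?_) fun h => absurd (by omega) h
    rw [← hF3.r 10 rfl, ← hF3.a 6 rfl, ← hF3.a 8 rfl] at hg
    refine wp_call (wp_newList hC hI3 hr h18 hg) ?_
    rintro s4 t4 ⟨⟨c1, c2, c3, c4, c5⟩, ht4⟩ hF4
    refine ⟨Or.inl ⟨?_, ⟨c4, fun i hi hir => ?_, c1, by omega⟩, by omega, by omega⟩, by omega⟩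
    · rw [hF4.r 15 rfl, hF3.r 15 rfl, hF2.r 15 rfl, hF1.r 15 rfl, h15]
    · obtain ⟨h1, h2⟩ := hcov.par i hi (by omega)
      grind

/-- Shrink the root step by step, until the list has at most `k + 2` vertices. -/
def chain : Cmd :=
  .set 91 (.op sub (.v 7) (.c 2)) ;;
  .forr 90 (.c 0) 91 (.ite (.v 15) (.c 1) (.set 8 (.op sub (.v 91) (.v 90)) ;; chainStep) .skip)

theorem wp_chain (hC : Ctx E n m k N) (hB : Base n k (s.a 1) (s.r 7) (s.r 8) s)
    (hS : s.r 15 = 0 → 2 ≤ s.r 7 ∧ s.r 7 ≤ 2 * k + 2)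
    (hI : s.r 15 = 0 → CList n N (s.a 1) (s.r 7) (s.r 7 - 2)) :
    s.r 15 = 0 → wp E chain s fun s' t => ChainInv n k N 0 s' ∧
      t ≤ 2 * k * (1300 * (2 ^ k * (n + 2 * m)) + 5) + 3 := by
  intro h15
  have hlin := hC.lin
  obtain ⟨hS1, hS2⟩ := hS h15
  have hL := hI h15
  set R := s.r 7 - 2
  refine wp_seq (wp_set R ⟨trivial, by simp only [Ex.ok]; omega, hS1⟩ rfl ?_)
  refine wp_for0 (fun i s1 => ChainInv n k N (R - i) s1) (1300 * (2 ^ k * (n + 2 * m)) + 3) R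
    (by simp) (by omega) ?_ ?_ ?_
  · exact Or.inl ⟨by simp [h15], by simpa using hL, by simp; omega, by simp; omega⟩
  · intro i hi s1 hJ hx hF
    have h25 : s1.r 91 = R := by rw [hF.r 91 rfl]; simp
    rcases hJ with ⟨j1, j2, -, j3⟩ | ⟨j1, j2⟩
    · refine wp_ite 0 1 trivial hC.one_lt j1 rfl (fun _ => ?_) fun h => absurd (by omega) h
      refine wp_seq (wp_set (R - i) ⟨trivial, trivial, ?_⟩ ?_ ?_)
      · simp only [opOk, Ex.ev, hx, h25]; omega
      · simp only [opEval, Ex.ev, hx, h25]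
      have hB1 : Base n k (s1.a 1) (s1.r 7) (R - i) (s1.set 8 (R - i)) :=
        hB.relist (s' := s1.set 8 (R - i)) (fun x hx => by
          rw [St.set_r, if_neg (by grind), hF.r x (by revert x; decide), St.set_r,
            if_neg (by grind)]) fun x hx => hF.a x (by revert x; decide)
      refine wp_mono (wp_chainStep hC hB1 j2 j3 (by omega) (by omega) j1) ?_
      rintro s2 t2 ⟨h2, ht2⟩
      exact ⟨by omega, by simpa [ChainInv, Nat.sub_sub] using h2⟩
    · refine wp_ite 1 1 trivial hC.one_lt j1 rfl (fun h => absurd h (by omega)) fun _ => ?_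
      exact ⟨by omega, Or.inr ⟨j1, j2⟩⟩
  · intro s' t hJ _ _ ht
    rw [Nat.sub_self] at hJ
    refine ⟨hJ, ?_⟩
    have : R * (1300 * (2 ^ k * (n + 2 * m)) + 3 + 2) ≤ 2 * k * (1300 * (2 ^ k * (n + 2 * m)) + 5) :=
      Nat.mul_le_mul_right _ (by omega)
    omega

/-! ### Connected sets of hyperedges by ranked division -/

variable {R : Type*} [CommRing R]

/-- The value at `range c` of the recursion for `con`, by the ranked division over the subsets of
`range c` that contain `0`; those are written as `2 * y + 1` with `y < 2 ^ (c - 1)`. -/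
theorem con_range (x : R) (D : Set (Finset ℕ)) (F : Finset ℕ) (t : ℕ → Finset ℕ)
    (ht : ∀ v ∈ F, (t v).Nonempty) (p : ℕ) (q : ℕ → ℕ → R) (hq : ∀ j ≤ p, ∀ y < 2 ^ p, q j y =
      rz (fun Z => tot x D F t (bs (2 * ofBits Z + 1))) j (bs y) -
      ∑ i ∈ Icc 1 j, rz (fun Z => tot x D F t (bs (2 * ofBits Z))) i (bs y) * q (j - i) y) :
    ∑ y ∈ range (2 ^ p), (-1) ^ (p - (bs y).card) * q p y = con x D F t (range (p + 1)) := by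
  classical
  have hof : ∀ Z ∈ (range p).powerset, ofBits Z < 2 ^ p := fun Z hZ => by
    rw [lt_two_pow_iff, bs_ofBits]; grind
  have hins : ∀ y, bs (2 * y + 1) = insert 0 (bs (2 * y)) := fun y => by
    ext i
    rcases i with - | i
    · simp [zero_mem_bs]
    · rw [mem_insert, succ_mem_bs, succ_mem_bs, show (2 * y + 1) / 2 = 2 * y / 2 by omega]; simp
  have hmem : ∀ Z i, i + 1 ∈ bs (2 * ofBits Z) ↔ i ∈ Z := fun Z i => by
    rw [succ_mem_bs, Nat.mul_div_cancel_left _ two_pos, bs_ofBits]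
  have h0 : ∀ y, 0 ∉ bs (2 * y) := fun y => by simp [zero_mem_bs]
  have h := ranked_division (range p) (fun Z => tot x D F t (bs (2 * ofBits Z)))
    (fun Z => tot x D F t (bs (2 * ofBits Z + 1))) (fun Z => con x D F t (bs (2 * ofBits Z + 1)))
    ?_ ?_ (fun j Z => q j (ofBits Z)) ?_
  · rw [card_range] at h
    rw [← sum_range_two_pow p fun Z => (-1) ^ (p - Z.card) * q p (ofBits Z)] at h
    simp only [ofBits_bs] at h
    rw [h]
    congr 1
    ext i
    rcases i with - | i
    · simp [zero_mem_bs]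
    grind
  · have he : F.filter (fun v => t v ⊆ bs 0) = ∅ := filter_eq_empty_iff.2 fun v hv h =>
      (ht v hv).ne_empty (subset_empty.1 h)
    rw [show 2 * ofBits ∅ = 0 by simp [ofBits], tot, he, if_pos (by simp [Closed])]
    simp
  · intro Z hZ
    rw [tot_eq_sum x D F t ht _ (by simp [hins])]
    refine (sum_bij (fun U _ => bs (2 * ofBits U + 1)) ?_ ?_ ?_ ?_).symm
    · intro U hU
      refine mem_filter.2 ⟨mem_powerset.2 fun i hi => ?_, by simp [hins]⟩
      rcases i with - | i
      · simp [hins]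
      grind
    · intro U _ U' _ hUU
      have := bs_injective hUU
      grind
    · intro U hU
      obtain ⟨h1, h2⟩ := mem_filter.1 hU
      refine ⟨bs (ofBits U / 2), mem_powerset.2 fun i hi => ?_, ?_⟩
      · rw [← succ_mem_bs, bs_ofBits] at hi
        grind
      · have h3 : ofBits U % 2 = 1 := by rwa [← zero_mem_bs, bs_ofBits]
        rw [ofBits_bs, show 2 * (ofBits U / 2) + 1 = ofBits U by omega, bs_ofBits]
    · intro U _
      congr 2
      ext i
      rcases i with - | i
      · simp [h0, hins]
      grind
  · intro j hj Z hZ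
    rw [card_range] at hj
    have h := hq j hj (ofBits Z) (hof Z (mem_powerset.2 hZ))
    rwa [bs_ofBits] at h

/-- The zeta transform with respect to the first `b` bits. -/
def zt (F : ℕ → R) : ℕ → ℕ → R
  | 0, x => F x
  | b + 1, x => if b ∈ bs x then zt F b x + zt F b (x - 2 ^ b) else zt F b x

theorem ofBits_le (h : Z ⊆ bs x) : ofBits Z ≤ x := by
  rw [← ofBits_bs x]; exact sum_le_sum_of_subset h

theorem bs_sub_two_pow (h : b ∈ bs x) : bs (x - 2 ^ b) = (bs x).erase b := by
  rw [← bs_ofBits ((bs x).erase b)]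
  congr 1
  have := add_sum_erase (bs x) (fun i => 2 ^ i) h
  have h2 := ofBits_bs x
  unfold ofBits at h2 ⊢
  omega

theorem zt_eq (F : ℕ → R) (b x : ℕ) :
    zt F b x = ∑ Z ∈ ((bs x).filter (· < b)).powerset, F (x - ofBits Z) := by
  induction b generalizing x with
  | zero => simp [zt, ofBits]
  | succ b ih =>
    rw [zt, filter_lt_succ]
    split_ifs with h
    · have hb : b ∉ (bs x).filter (· < b) := by simp
      rw [sum_powerset_insert hb, ih, ih, bs_sub_two_pow h]
      have : ((bs x).erase b).filter (· < b) = (bs x).filter (· < b) := by ext i; simp; omega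
      rw [this]
      congr 1
      refine sum_congr rfl fun Z hZ => ?_
      rw [ofBits, ofBits, sum_insert fun h => hb (mem_powerset.1 hZ h), Nat.sub_sub]
    · exact ih x

/-- The zeta transform with respect to the low bits, of a function that vanishes unless the number of
low bits is as given by the high bits, is a ranked zeta transform. -/
theorem zt_ranked (f : ℕ → R) (F : ℕ → R) {p : ℕ} (hy : y < 2 ^ p)
    (hF : ∀ z < 2 ^ p, F (w * 2 ^ p + z) = if (bs z).card = i then f z else 0) :
    zt F p (w * 2 ^ p + y) = rz (fun Z => f (ofBits Z)) i (bs y) := by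
  have h1 : (bs (w * 2 ^ p + y)).filter (· < p) = bs y := by
    ext j
    rw [mem_filter]
    constructor
    · rintro ⟨h, hj⟩
      rw [mem_bs, ← Nat.mod_eq_of_lt hy, Nat.testBit_mod_two_pow]
      rw [mem_bs, mul_comm, Nat.testBit_two_pow_mul_add _ hy, if_pos hj] at h
      simp [hj, h]
    · intro h
      have hj := mem_range.1 (lt_two_pow_iff.1 hy h)
      rw [mem_bs, mul_comm, Nat.testBit_two_pow_mul_add _ hy, if_pos hj]
      exact ⟨mem_bs.1 h, hj⟩
  have hsub : ∀ Z ∈ (bs y).powerset, y - ofBits Z = ofBits (bs y \ Z) := fun Z hZ => by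
    have h := sum_sdiff (f := fun i => 2 ^ i) (mem_powerset.1 hZ)
    have h2 := ofBits_bs y
    unfold ofBits at h2 ⊢
    omega
  rw [zt_eq, h1, rz, sum_filter]
  refine sum_bij' (fun Z _ => bs y \ Z) (fun Z _ => bs y \ Z) (by simp) (by simp) ?_ ?_ ?_
  · simp
  · simp
  · intro Z hZ
    have h3 := ofBits_le (mem_powerset.1 hZ)
    rw [Nat.add_sub_assoc h3, hF _ (by omega), hsub Z hZ, bs_ofBits]

/-! ### Weights of the sets of units -/

/-- `tot` for the hypergraph on the units of the trace `A`, modulo `bigN n k`. -/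
noncomputable def weight (n k : ℕ) (N : ℕ → List ℕ) (ℓ : ℕ → ℕ) (S r : ℕ) (A : Finset ℕ) (κ : ℕ → ℕ)
    (Y : Finset ℕ) : ZMod (bigN n k) :=
  tot (bigM n k : ZMod (bigN n k)) (tau A κ '' Mand n N ℓ S r A) (free n N ℓ S r A)
    (fun v => tau A κ (posSet N ℓ S r v)) Y

open Classical in
/-- The contribution of the first `e` entries to the weight. -/
noncomputable def entryWeight (n k : ℕ) (key cnt : ℕ → ℕ) (A : Finset ℕ) (κ : ℕ → ℕ) (Y : Finset ℕ)
    (e : ℕ) : ZMod (bigN n k) :=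
  ∏ e' ∈ range e,
    if tau A κ (emask key e') ⊆ Y then
      if EMand key A e' then 1 else (1 + (bigM n k : ZMod (bigN n k))) ^ cnt e'
    else if EMand key A e' ∧ (tau A κ (emask key e') ∩ Y).Nonempty then 0 else 1

theorem Entries.weight_eq (hE : Entries n N ℓ S r H key cnt rep) (Y : Finset ℕ) :
    weight n k N ℓ S r A κ Y = entryWeight n k key cnt A κ Y H := by
  classical
  rw [weight, tot, entryWeight]
  split_ifs with h
  · rw [hE.closed_iff] at h
    rw [hE.card_free, ← prod_pow_eq_pow_sum, prod_filter]
    refine prod_congr rfl fun e he => ?_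
    grind
  · rw [hE.closed_iff] at h
    push Not at h
    obtain ⟨e, he, h1, h2, h3⟩ := h
    exact (prod_eq_zero (mem_range.2 he) (by grind)).symm

/-- The number at `x` represents `z` modulo `M`. -/
def Rep (M x : ℕ) (z : ZMod M) : Prop := x < M ∧ (x : ZMod M) = z

theorem Rep.of_mod {M : ℕ} {z : ZMod M} (hM : 0 < M) (h : (x : ZMod M) = z) : Rep M (x % M) z :=
  ⟨Nat.mod_lt _ hM, by grind⟩

theorem forall_lt_update {P : ℕ → ℕ → Prop} {f : ℕ → ℕ} (h : ∀ j < i, P j (f j)) (hv : P i v) :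
    ∀ j < i + 1, P j (update f i v j) := fun j hj => by grind

/-- Multiply register 72 by the factor of the entry in register 73 for the set in register 71. -/
def weightStep : Cmd :=
  .ite (andE (.ld 13 (.v 73)) (.v 71)) (.ld 13 (.v 73))
    (.ite (.c 0) (.op mul (.ld 12 (.v 73)) (andE (.ld 13 (.v 73)) (.v 71))) (.set 72 (.c 0)) .skip)
    (.ite (.c 0) (.ld 12 (.v 73)) .skip
      (.set 72 (.op rem (.op mul (.v 72) (.ld 20 (.v 73))) (.v 5))))

/-- Fill array 17 with the weights of all sets of units. -/
def weights : Cmd :=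
  .set 70 (.ld 4 (.v 51)) ;; .forr 71 (.c 0) 70
    (.set 72 (.c 1) ;; .forr 73 (.c 0) 10 weightStep ;; .sto 17 (.v 71) (.v 72))

theorem wp_weightStep (hC : Ctx E n m k N) {e Y : ℕ} (hI : Inst n m k N ℓ S r par s)
    (ha : a < 2 ^ (S - r)) (hU : SetTo pf (bs a) (s.r 10) s) (h71 : s.r 71 = Y)
    (hY : Y < 2 ^ s.r 51) (h73 : s.r 73 = e) (he : e < s.r 10)
    (h : Rep (bigN n k) (s.r 72) (entryWeight n k (s.a 6) (s.a 7) (bs a) (s.a 10) (bs Y) e)) :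
    wp E weightStep s fun s' t =>
      Rep (bigN n k) (s'.r 72) (entryWeight n k (s.a 6) (s.a 7) (bs a) (s.a 10) (bs Y) (e + 1)) ∧
        t ≤ 3 := by
  classical
  obtain ⟨l1, l2, l3, l4, l5, l6, l7, l8⟩ := hI.limits hC
  have hp := hI.hp
  have hc := hU.c_le ha
  have h2c : 2 ^ s.r 51 ≤ 2 ^ (k + 2) := Nat.pow_le_pow_right (by omega) (by omega)
  have hmask := hU.mask_lt he
  have hNN := hC.bigN_sq
  have hM2 := two_le_bigM n k
  have hMN := bigM_le_bigN n k
  have h13 : (Ex.ld 13 (.v 73)).ok E s := ⟨trivial, by simp only [Ex.ev]; omega⟩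
  obtain ⟨ho, hv⟩ := andE_spec hC hI.base.tab (e := .ld 13 (.v 73)) (e' := .v 71)
    (x := s.a 13 e) (y := Y) h13 trivial (by simp only [Ex.ev, h73]) h71 (by omega) (by omega)
  have hle : s.a 13 e &&& Y ≤ s.a 13 e := Nat.and_le_left
  have hm := hU.mand e he
  have htau := hU.tau e he
  have h12 : (Ex.ld 12 (.v 73)).ok E s := ⟨trivial, by simp only [Ex.ev]; omega⟩
  have hmle : s.a 12 e ≤ 1 := by grind
  have hml : s.a 12 e * (s.a 13 e &&& Y) ≤ 1 * 2 ^ (k + 2) := Nat.mul_le_mul hmle (by omega)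
  have hsub : s.a 13 e &&& Y < s.a 13 e ↔ ¬ tau (bs a) (s.a 10) (emask (s.a 6) e) ⊆ bs Y := by
    rw [← htau, ← land_eq_left]; omega
  have hne := land_ne_zero (x := s.a 13 e) (y := Y)
  rw [htau] at hne
  have hE : entryWeight n k (s.a 6) (s.a 7) (bs a) (s.a 10) (bs Y) (e + 1) = _ :=
    prod_range_succ _ _
  rw [hE]
  refine wp_ite _ (s.a 13 e) ho h13 hv (by simp only [Ex.ev, h73]) (fun h1 => ?_) fun h1 => ?_
  · rw [hsub] at h1
    refine wp_ite 0 (s.a 12 e * (s.a 13 e &&& Y)) hC.bd_pos ⟨h12, ho, ?_⟩ rfl ?_ (fun h2 => ?_) fun h2 => ?_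
    · simp only [opOk, hv, Ex.ev, h73]; omega
    · simp only [Ex.ev, opEval, hv, h73]
    · have h3 : EMand (s.a 6) (bs a) e := by grind
      have h4 : s.a 13 e &&& Y ≠ 0 := by grind
      refine wp_set 0 hC.bd_pos rfl ⟨?_, by omega⟩
      rw [if_neg h1, if_pos ⟨h3, hne.1 h4⟩, mul_zero]
      exact ⟨by simp; omega, by simp⟩
    · refine ⟨?_, by omega⟩
      rw [if_neg h1, if_neg, mul_one]
      · exact h
      grind
  · rw [hsub, not_not] at h1
    refine wp_ite 0 (s.a 12 e) hC.bd_pos h12 rfl (by simp only [Ex.ev, h73]) (fun h2 => ?_) fun h2 => ?_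
    · refine ⟨?_, by omega⟩
      rw [if_pos h1, if_pos, mul_one]
      · exact h
      grind
    · have h3 : ¬ EMand (s.a 6) (bs a) e := fun h4 => by grind
      have h20 := hI.ent.pw e he
      have hlt : s.a 20 e < bigN n k := by rw [h20]; exact Nat.mod_lt _ (by omega)
      have hml := Nat.mul_le_mul h.1.le hlt.le
      refine wp_set (s.r 72 * s.a 20 e % bigN n k) ⟨⟨trivial, ⟨trivial, ?_⟩, ?_⟩, trivial, trivial⟩ ?_
        ⟨?_, by omega⟩
      · simp only [Ex.ev, h73]; omega
      · simp only [opOk, Ex.ev, h73]; omega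
      · simp only [opEval, Ex.ev, h73, hI.base.r5]
      · rw [if_pos h1, if_neg h3, St.set_r, if_pos rfl]
        refine Rep.of_mod (by omega) ?_
        rw [Nat.cast_mul, h.2, h20, ZMod.natCast_mod]
        push_cast
        rfl

theorem wp_weights (hC : Ctx E n m k N) (hI : Inst n m k N ℓ S r par s) (ha : a < 2 ^ (S - r))
    (hU : SetTo pf (bs a) (s.r 10) s) :
    wp E weights s fun s' t => (s'.r 70 = 2 ^ s.r 51 ∧ ∀ Y < 2 ^ s.r 51,
      Rep (bigN n k) (s'.a 17 Y) (weight n k N ℓ S r (bs a) (s.a 10) (bs Y))) ∧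
        t ≤ 2 ^ s.r 51 * (5 * s.r 10 + 6) + 3 := by
  classical
  obtain ⟨l1, l2, l3, l4, l5, l6, l7, l8⟩ := hI.limits hC
  have hp := hI.hp
  have hc := hU.c_le ha
  have h2c : 2 ^ s.r 51 ≤ 2 ^ (k + 2) := Nat.pow_le_pow_right (by omega) (by omega)
  have hM2 := two_le_bigM n k
  have hMN := bigM_le_bigN n k
  refine wp_seq (wp_set (2 ^ s.r 51) ⟨trivial, ?_⟩ ?_ ?_)
  · simp only [Ex.ev]; omega
  · simp only [Ex.ev]; exact hI.base.tab.pow _ (by omega)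
  have hI0 := hI.set (x := 70) (v := 2 ^ s.r 51) (by omega)
  have hU0 : SetTo pf (bs a) (s.r 10) (s.set 70 (2 ^ s.r 51)) := hU.congr rfl rfl fun _ _ => rfl
  refine wp_for0 (fun y s1 => ∀ Y < y, Rep (bigN n k) (s1.a 17 Y)
      (weight n k N ℓ S r (bs a) (s.a 10) (bs Y))) (5 * s.r 10 + 4) _ (by simp; rfl) (by omega)
    (fun Y hY => by omega) ?_ ?_
  · intro Y hY s1 hJ hx hF
    refine wp_seq (wp_set 1 hC.one_lt rfl ?_)
    have hag : ∀ s2, Fr (.forr 73 (.c 0) 10 weightStep) (s1.set 72 1) s2 → s2.r 10 = s.r 10 ∧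
        s2.r 51 = s.r 51 ∧ s2.r 71 = Y ∧ s2.a 6 = s.a 6 ∧ s2.a 7 = s.a 7 ∧ s2.a 10 = s.a 10 := by
      intro s2 hF2
      refine ⟨?_, ?_, ?_, ?_, ?_, ?_⟩
      · rw [hF2.r 10 rfl, St.set_r, if_neg (by omega), hF.r 10 rfl]; simp
      · rw [hF2.r 51 rfl, St.set_r, if_neg (by omega), hF.r 51 rfl]; simp
      · rw [hF2.r 71 rfl, St.set_r, if_neg (by omega), hx]
      · rw [hF2.a 6 rfl, St.set_a, hF.a 6 rfl]; rfl
      · rw [hF2.a 7 rfl, St.set_a, hF.a 7 rfl]; rfl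
      · rw [hF2.a 10 rfl, St.set_a, hF.a 10 rfl]; rfl
    have hI1 : Inst n m k N ℓ S r par (s1.set 72 1) := (hI0.fr hF (by decide)).set (by omega)
    have hU1 : SetTo pf (bs a) (s.r 10) (s1.set 72 1) :=
      (hU0.fr hF (by decide)).congr rfl rfl fun _ _ => rfl
    refine wp_seq (wp_for0 (fun e s2 => Rep (bigN n k) (s2.r 72)
      (entryWeight n k (s.a 6) (s.a 7) (bs a) (s.a 10) (bs Y) e)) 3 (s.r 10) ?_ (by omega) ?_ ?_ ?_)
    · exact (hF.r 10 rfl).trans (by simp)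
    · exact ⟨by simp; omega, by simp [entryWeight]⟩
    · intro e he s2 hJ2 hx2 hF2
      obtain ⟨g1, g2, g3, g4, g5, g6⟩ := hag s2 hF2
      rw [← g4, ← g5, ← g6] at hJ2 ⊢
      refine wp_mono (wp_weightStep hC (hI1.fr hF2 (by decide)) ha
        (by rw [g1]; exact hU1.fr hF2 (by decide)) g3 (by rwa [g2]) hx2 (by rwa [g1]) hJ2) ?_
      rintro s3 t3 ⟨h3, ht3⟩
      exact ⟨ht3, by simpa using h3⟩
    · intro s2 t2 hJ2 _ hF2 ht2
      obtain ⟨g1, g2, g3, g4, g5, g6⟩ := hag s2 hF2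
      refine wp_sto Y (s2.r 72) trivial trivial g3 rfl (by omega) ⟨by omega, ?_⟩
      rw [St.set_a, St.sto_a_same, hF2.a 17 rfl]
      refine forall_lt_update (P := fun Y z => Rep _ z (weight n k N ℓ S r (bs a) (s.a 10) (bs Y))) hJ ?_
      have := hI.ent.ent.weight_eq (n := n) (k := k) (A := bs a) (κ := s.a 10) (bs Y)
      grind
  · intro s' t hJ _ hF ht
    exact ⟨⟨by rw [hF.r 70 rfl]; simp, hJ⟩, by linarith⟩

/-! ### The ranked division as a program -/

section

variable {p M : ℕ}

/-- The limits for the ranked division over `p` bits. -/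
structure DivLim (E : Env) (p M : ℕ) : Prop where
  cap : (p + 1) * 2 ^ (p + 1) ≤ E.cap
  bd : (p + 1) * 2 ^ (p + 1) + p + 4 ≤ E.bd
  mod : 4 * (M * M) ≤ E.bd
  pos : 1 < M

/-- Array 18 receives the weights of the sets with and without `0`, sorted by cardinality. -/
def rank : Cmd :=
  .set 74 (.op quot (.v 70) (.c 2)) ;; .set 75 (.op mul (.v 51) (.v 70)) ;;
  .forr 71 (.c 0) 75 (.set 73 (.op rem (.v 71) (.v 74)) ;;
    .ifEq (.ld 16 (.v 73)) (.op rem (.op quot (.v 71) (.v 74)) (.v 51))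
      (.sto 18 (.v 71) (.ld 17 (.op add (.op mul (.c 2) (.v 73))
        (.op quot (.op quot (.v 71) (.v 74)) (.v 51)))))
      (.sto 18 (.v 71) (.c 0)))

/-- The contents of the ranked array. -/
def ranked (p : ℕ) (W : ℕ → ZMod M) (x : ℕ) : ZMod M :=
  if (bs (x % 2 ^ p)).card = x / 2 ^ p % (p + 1) then W (2 * (x % 2 ^ p) + x / 2 ^ p / (p + 1)) else 0

theorem wp_rank (hL : DivLim E p M) (hpk : p ≤ k + 1) (hT : Tab k s) {W : ℕ → ZMod M}
    (h51 : s.r 51 = p + 1) (h70 : s.r 70 = 2 ^ (p + 1))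
    (h17 : ∀ Y < 2 ^ (p + 1), Rep M (s.a 17 Y) (W Y)) :
    wp E rank s fun s' t => (s'.r 74 = 2 ^ p ∧ s'.r 75 = (p + 1) * 2 ^ (p + 1) ∧
      ∀ x < (p + 1) * 2 ^ (p + 1), Rep M (s'.a 18 x) (ranked p W x)) ∧
        t ≤ 6 * ((p + 1) * 2 ^ (p + 1)) + 4 := by
  obtain ⟨c1, c2, c3, c4⟩ := hL
  have h2 : 2 ^ (p + 1) = 2 * 2 ^ p := by ring
  have hB : 0 < 2 ^ p := by positivity
  have hB1 : 2 ^ (p + 1) ≤ (p + 1) * 2 ^ (p + 1) := Nat.le_mul_of_pos_left _ (by omega)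
  have hk3 : 2 ^ p ≤ 2 ^ (k + 3) := Nat.pow_le_pow_right (by omega) (by omega)
  refine wp_seq (wp_set (2 ^ p) ⟨trivial, ?_, trivial⟩ ?_ ?_)
  · simp only [Ex.ok]; omega
  · simp only [Ex.ev, opEval, h70]; omega
  refine wp_seq (wp_set ((p + 1) * 2 ^ (p + 1)) ⟨trivial, trivial, ?_⟩ ?_ ?_)
  · simp [opOk, Ex.ev, h70, h51]; omega
  · simp [opEval, Ex.ev, h70, h51]
  refine wp_for0 (fun x s1 => ∀ y < x, Rep M (s1.a 18 y) (ranked p W y)) 4 _ (by simp; rfl)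
    (by omega) (fun y hy => by omega) ?_ ?_
  · intro x hx s1 hJ h71 hF
    have g74 : s1.r 74 = 2 ^ p := by rw [hF.r 74 rfl]; simp
    have g51 : s1.r 51 = p + 1 := by rw [hF.r 51 rfl]; simp [h51]
    have g17 : s1.a 17 = s.a 17 := by rw [hF.a 17 rfl]; rfl
    have g16 : s1.a 16 = s.a 16 := by rw [hF.a 16 rfl]; rfl
    have hm : x % 2 ^ p < 2 ^ p := Nat.mod_lt _ hB
    have hd : x / 2 ^ p / (p + 1) < 2 := by
      rw [Nat.div_div_eq_div_mul]; exact Nat.div_lt_of_lt_mul (by nlinarith)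
    refine wp_seq (wp_set (x % 2 ^ p) ⟨trivial, trivial, trivial⟩ ?_ ?_)
    · simp only [Ex.ev, opEval, h71, g74]
    have e1 : ∀ {v : ℕ}, Rep M v (ranked p W x) → ∀ y < x + 1,
        Rep M ((((s1.set 73 (x % 2 ^ p)).sto 18 x v).set 71 (x + 1)).a 18 y) (ranked p W y) := by
      intro v hv
      rw [St.set_a, St.sto_a_same]
      exact forall_lt_update (P := fun y z => Rep M z (ranked p W y)) hJ hv
    refine wp_ifEq ⟨trivial, ?_⟩ ⟨⟨trivial, trivial, trivial⟩, trivial, trivial⟩ (fun he => ?_) fun he => ?_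
    · simp [Ex.ev]; omega
    · simp [Ex.ev, opEval, h71, g74, g51, g16, hT.pop _ (hm.trans_le hk3)] at he
      have h1 := h17 (2 * (x % 2 ^ p) + x / 2 ^ p / (p + 1)) (by omega)
      refine wp_sto x _ trivial ⟨⟨⟨?_, trivial, ?_⟩, ⟨⟨trivial, trivial, trivial⟩, trivial, trivial⟩, ?_⟩, ?_⟩
        (by simp [Ex.ev, h71]) rfl (by omega) ⟨by omega, e1 ?_⟩
      · simp only [Ex.ok]; omega
      · simp [opOk, Ex.ev]; omega
      · simp [opOk, opEval, Ex.ev, h71, g74, g51]; omega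
      · simp [opEval, Ex.ev, h71, g74, g51]; omega
      · rw [ranked, if_pos he]
        simpa [opEval, Ex.ev, h71, g74, g51, g17] using h1
    · simp [Ex.ev, opEval, h71, g74, g51, g16, hT.pop _ (hm.trans_le hk3)] at he
      refine wp_sto x 0 trivial (show 0 < E.bd by omega) (by simp [Ex.ev, h71]) rfl (by omega)
        (by have := e1 (v := 0) (by rw [ranked, if_neg he]; exact ⟨by omega, by simp⟩)
            grind)
  · intro s' t hJ _ hF ht
    exact ⟨⟨by rw [hF.r 74 rfl]; simp, by rw [hF.r 75 rfl]; simp, hJ⟩, by omega⟩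

/-- The zeta transform of array 18 with respect to all bits, in place. -/
def zeta : Cmd :=
  .set 76 (.op sub (.v 51) (.c 1)) ;;
  .forr 77 (.c 0) 76 (.set 78 (.ld 4 (.v 77)) ;;
    .forr 71 (.c 0) 75 (.ite (.c 0) (.op rem (.op quot (.v 71) (.v 78)) (.c 2))
      (.sto 18 (.v 71) (.op rem (.op add (.ld 18 (.v 71)) (.ld 18 (.op sub (.v 71) (.v 78)))) (.v 5)))
      .skip))

theorem wp_zeta (hL : DivLim E p M) (hpk : p ≤ k + 1) (hkc : k + 4 ≤ E.cap) (hT : Tab k s)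
    {G : ℕ → ZMod M} (h5 : s.r 5 = M) (h51 : s.r 51 = p + 1) {X : ℕ} (h75 : s.r 75 = X)
    (hX : X ≤ (p + 1) * 2 ^ (p + 1)) (h18 : ∀ x < X, Rep M (s.a 18 x) (G x)) :
    wp E zeta s fun s' t => (s'.r 76 = p ∧ ∀ x < X, Rep M (s'.a 18 x) (zt G p x)) ∧
        t ≤ p * (4 * X + 5) + 3 := by
  obtain ⟨c1, c2, c3, c4⟩ := hL
  have hMM : M ≤ M * M := Nat.le_mul_of_pos_left _ (by omega)
  refine wp_seq (wp_set p ⟨trivial, show 1 < E.bd by omega, ?_⟩ ?_ ?_)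
  · simp [opOk, Ex.ev, h51]
  · simp [opEval, Ex.ev, h51]
  refine wp_for0 (fun b s1 => ∀ x < X, Rep M (s1.a 18 x) (zt G b x)) (4 * X + 3) p (by simp)
    (by omega) (by simpa [zt] using h18) ?_ ?_
  · intro b hb s1 hJ h77 hF
    have g4 : s1.a 4 b = 2 ^ b := by rw [hF.a 4 rfl]; exact hT.pow b (by omega)
    refine wp_seq (wp_set (2 ^ b) ⟨trivial, ?_⟩ ?_ ?_)
    · simp only [Ex.ev, h77]; omega
    · simp only [Ex.ev, h77, g4]
    refine wp_for0
      (fun x s2 => ∀ y < X, Rep M (s2.a 18 y) (if y < x then zt G (b + 1) y else zt G b y)) 2 X ?_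
      (by omega) (by simpa using hJ) ?_ ?_
    · rw [St.set_r, if_neg (by omega), hF.r 75 rfl]; simpa using h75
    · intro x hx s2 hJ2 h71 hF2
      have g5 : s2.r 5 = M := by rw [hF2.r 5 rfl, St.set_r, if_neg (by omega), hF.r 5 rfl]; simpa using h5
      have g78 : s2.r 78 = 2 ^ b := by rw [hF2.r 78 rfl]; simp
      refine wp_ite 0 (x / 2 ^ b % 2) (show 0 < E.bd by omega)
        ⟨⟨trivial, trivial, trivial⟩, show 2 < E.bd by omega, trivial⟩ rfl
        (by simp only [opEval, Ex.ev, h71, g78]) (fun hbit => ?_) fun hbit => ?_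
      · have hmem : b ∈ bs x := mem_bs_iff_div.2 (by omega)
        have hle : 2 ^ b ≤ x := Nat.ge_two_pow_of_testBit (mem_bs.1 hmem)
        have hpos : 0 < 2 ^ b := by positivity
        have r1 := hJ2 x hx
        have r2 := hJ2 (x - 2 ^ b) (by omega)
        rw [if_neg (lt_irrefl x)] at r1
        rw [if_pos (by omega), zt, if_neg (by rw [bs_sub_two_pow hmem]; simp)] at r2
        have l1 := r1.1
        have l2 := r2.1
        refine wp_sto x ((s2.a 18 x + s2.a 18 (x - 2 ^ b)) % M) trivial
          ⟨⟨⟨trivial, ?_⟩, ⟨⟨trivial, trivial, ?_⟩, ?_⟩, ?_⟩, trivial, trivial⟩ h71 ?_ (by omega)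
          ⟨by omega, fun y hy => ?_⟩
        · simp only [Ex.ev, h71]; omega
        · simp only [opOk, Ex.ev, h71, g78]; omega
        · simp only [opEval, Ex.ev, h71, g78]; omega
        · simp only [opOk, opEval, Ex.ev, h71, g78]; omega
        · simp only [opEval, Ex.ev, h71, g78, g5]
        · rw [St.set_a, St.sto_a_same, update_apply]
          split_ifs with h1 h2 h2
          · rw [h1, zt, if_pos hmem]
            exact Rep.of_mod (by omega) (by rw [Nat.cast_add, r1.2, r2.2])
          · omega
          · grind
          grind
      · have hmem : b ∉ bs x := fun h => by rw [mem_bs_iff_div] at h; omega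
        refine ⟨by omega, fun y hy => ?_⟩
        have := hJ2 y hy
        rw [St.set_a]
        by_cases h1 : y = x
        · subst h1
          rw [if_neg (lt_irrefl y)] at this
          rwa [if_pos (by omega), zt, if_neg hmem]
        grind
    · intro s2 t2 hJ2 _ _ ht2
      refine ⟨by omega, fun x hx => ?_⟩
      have := hJ2 x hx
      rwa [if_pos hx] at this
  · intro s' t hJ _ hF ht
    exact ⟨⟨by rw [hF.r 76 rfl]; simp, hJ⟩, by linarith⟩

/-- The quotient of the two power series of array 18 goes to array 19. -/
def divide : Cmd :=
  .set 79 (.op mul (.v 51) (.v 74)) ;;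
  .forr 71 (.c 0) 79 (.set 72 (.ld 18 (.op add (.v 71) (.v 79))) ;;
    .set 73 (.op add (.op quot (.v 71) (.v 74)) (.c 1)) ;;
    .forr 77 (.c 1) 73 (.set 72 (.op rem (.op sub (.op add (.v 72) (.op mul (.v 5) (.v 5)))
      (.op mul (.ld 18 (.op add (.op mul (.v 77) (.v 74)) (.op rem (.v 71) (.v 74))))
        (.ld 19 (.op sub (.v 71) (.op mul (.v 77) (.v 74)))))) (.v 5))) ;;
    .sto 19 (.v 71) (.v 72))

theorem wp_divide (hL : DivLim E p M) {Z : ℕ → ZMod M} (h5 : s.r 5 = M) (h51 : s.r 51 = p + 1)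
    (h74 : s.r 74 = 2 ^ p) (h18 : ∀ x < (p + 1) * 2 ^ (p + 1), Rep M (s.a 18 x) (Z x)) :
    wp E divide s fun s' t => (∀ x < (p + 1) * 2 ^ p, Rep M (s'.a 19 x) (Z (x + (p + 1) * 2 ^ p) -
      ∑ i ∈ Icc 1 (x / 2 ^ p), Z (i * 2 ^ p + x % 2 ^ p) * (s'.a 19 (x - i * 2 ^ p) : ZMod M))) ∧
        t ≤ (p + 1) * 2 ^ p * (3 * p + 7) + 3 := by
  obtain ⟨c1, c2, c3, c4⟩ := hL
  have hX : (p + 1) * 2 ^ (p + 1) = 2 * ((p + 1) * 2 ^ p) := by ring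
  have hB : 0 < 2 ^ p := by positivity
  have hMM : M ≤ M * M := Nat.le_mul_of_pos_left _ (by omega)
  set B := 2 ^ p
  set L := (p + 1) * B with hL
  refine wp_seq (wp_set L ⟨trivial, trivial, ?_⟩ ?_ ?_)
  · simp only [opOk, Ex.ev, h51, h74]; omega
  · simp only [opEval, Ex.ev, h51, h74, hL]
  refine wp_for0 (fun x s1 => ∀ y < x, Rep M (s1.a 19 y) (Z (y + L) -
      ∑ i ∈ Icc 1 (y / B), Z (i * B + y % B) * (s1.a 19 (y - i * B) : ZMod M))) (3 * p + 5) L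
    (by simp) (by omega) (fun y hy => by omega) ?_ ?_
  · intro x hx s1 hJ h71 hF
    have g5 : s1.r 5 = M := by rw [hF.r 5 rfl]; simpa using h5
    have g74 : s1.r 74 = B := by rw [hF.r 74 rfl]; simpa using h74
    have g79 : s1.r 79 = L := by rw [hF.r 79 rfl]; simp
    have g18 : s1.a 18 = s.a 18 := by rw [hF.a 18 rfl]; rfl
    have hxd : x / B < p + 1 := Nat.div_lt_of_lt_mul (by rwa [mul_comm])
    have hxm : x % B < B := Nat.mod_lt _ hB
    have hxdm : x / B * B + x % B = x := Nat.div_add_mod' x B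
    refine wp_seq (wp_set (s.a 18 (x + L)) ⟨⟨trivial, trivial, ?_⟩, ?_⟩ ?_ ?_)
    · simp only [opOk, Ex.ev, h71, g79]; omega
    · simp only [opEval, Ex.ev, h71, g79]; omega
    · simp only [opEval, Ex.ev, h71, g79, g18]
    refine wp_seq (wp_set (x / B + 1) ⟨⟨trivial, trivial, trivial⟩, show 1 < E.bd by omega, ?_⟩ ?_ ?_)
    · simp [opOk, opEval, Ex.ev, h71, g74]; omega
    · simp [opEval, Ex.ev, h71, g74]
    refine wp_seq (wp_for (fun i s2 => Rep M (s2.r 72) (Z (x + L) -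
        ∑ i ∈ Ico 1 i, Z (i * B + x % B) * (s1.a 19 (x - i * B) : ZMod M))) (fun _ => 1) 1
      (x / B + 1) (show 1 < E.bd by omega) rfl (by simp) (Nat.le_add_left 1 _) (by omega)
      (by simpa using h18 (x + L) (by omega)) ?_ ?_)
    · intro i hi1 hi s2 hJ2 h77 hF2
      have f5 : s2.r 5 = M := by rw [hF2.r 5 rfl]; simpa using g5
      have f71 : s2.r 71 = x := by rw [hF2.r 71 rfl]; simpa using h71
      have f74 : s2.r 74 = B := by rw [hF2.r 74 rfl]; simpa using g74
      have f18 : s2.a 18 = s.a 18 := by rw [hF2.a 18 rfl]; simpa using g18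
      have f19 : s2.a 19 = s1.a 19 := by rw [hF2.a 19 rfl]; rfl
      have hiB : i * B ≤ x / B * B := Nat.mul_le_mul_right _ (by omega)
      have hiB1 : B ≤ i * B := Nat.le_mul_of_pos_left _ (by omega)
      have r1 := h18 (i * B + x % B) (by omega)
      have r2 := (hJ (x - i * B) (by omega)).1
      have l1 := hJ2.1
      have l2 := Nat.mul_le_mul r1.1.le r2.le
      refine wp_set ((s2.r 72 + M * M - s.a 18 (i * B + x % B) * s1.a 19 (x - i * B)) % M)
        ⟨⟨⟨trivial, ⟨trivial, trivial, ?_⟩, ?_⟩, ⟨⟨⟨⟨trivial, trivial, ?_⟩, ⟨trivial, trivial, trivial⟩, ?_⟩,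
          ?_⟩, ⟨⟨trivial, ⟨trivial, trivial, ?_⟩, ?_⟩, ?_⟩, ?_⟩, ?_⟩, trivial, trivial⟩ ?_
        ⟨le_rfl, ?_⟩ <;> try simp only [opOk, opEval, Ex.ev, h77, f5, f71, f74, f18, f19]
      any_goals omega
      rw [St.set_r, if_neg (by omega), St.set_r, if_pos rfl]
      refine Rep.of_mod (by omega) ?_
      rw [Nat.cast_sub (by omega), Nat.cast_add, Nat.cast_mul, Nat.cast_mul, ZMod.natCast_self, hJ2.2,
        r1.2, sum_Ico_succ_top hi1]
      ring
    · intro s2 t2 hJ2 _ hF2 ht2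
      simp only [sum_const, Nat.card_Ico, smul_eq_mul] at ht2
      have f71 : s2.r 71 = x := by rw [hF2.r 71 rfl]; simpa using h71
      have f19 : s2.a 19 = s1.a 19 := by rw [hF2.a 19 rfl]; rfl
      refine wp_sto x (s2.r 72) trivial trivial f71 rfl (by omega) ⟨by omega, fun y hy => ?_⟩
      rw [St.set_a, St.sto_a_same, f19]
      -- the cells that the recursion reads for `y` lie before `y`
      have hsum : ∀ i ∈ Icc 1 (y / B), update (s1.a 19) x (s2.r 72) (y - i * B) =
          s1.a 19 (y - i * B) := fun i hi => by
        obtain ⟨h1, h2⟩ := mem_Icc.1 hi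
        have h3 := Nat.mul_le_mul_right B h2
        have h4 := Nat.div_mul_le_self y B
        have h5 : B ≤ i * B := Nat.le_mul_of_pos_left _ (by omega)
        grind
      rw [sum_congr rfl fun i hi => by rw [hsum i hi]]
      by_cases hyx : y = x
      · rw [hyx, update_self]; exact hJ2
      grind
  · intro s' t hJ _ hF ht
    grind

/-- The Möbius inversion of the last row of array 19 at the full set. -/
def invert : Cmd :=
  .set 72 (.c 0) ;;
  .forr 71 (.c 0) 74 (.set 73 (.ld 19 (.op add (.op mul (.v 76) (.v 74)) (.v 71))) ;;
    .ite (.c 0) (.op rem (.op add (.v 76) (.ld 16 (.v 71))) (.c 2))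
      (.set 72 (.op rem (.op sub (.op add (.v 72) (.v 5)) (.v 73)) (.v 5)))
      (.set 72 (.op rem (.op add (.v 72) (.v 73)) (.v 5))))

theorem wp_invert (hL : DivLim E p M) (hpk : p ≤ k + 1) (hT : Tab k s) (h5 : s.r 5 = M)
    (h74 : s.r 74 = 2 ^ p) (h76 : s.r 76 = p) (h19 : ∀ x < (p + 1) * 2 ^ p, s.a 19 x < M) :
    wp E invert s fun s' t => Rep M (s'.r 72) (∑ y ∈ range (2 ^ p),
      (-1) ^ (p - (bs y).card) * (s.a 19 (p * 2 ^ p + y) : ZMod M)) ∧ t ≤ 5 * 2 ^ p + 3 := by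
  obtain ⟨c1, c2, c3, c4⟩ := hL
  have hX : (p + 1) * 2 ^ (p + 1) = 2 * (p * 2 ^ p + 2 ^ p) := by ring
  have hpp : p ≤ p * 2 ^ p := Nat.le_mul_of_pos_right _ (by positivity)
  have hMM : M ≤ M * M := Nat.le_mul_of_pos_left _ (by omega)
  have hk3 : 2 ^ p ≤ 2 ^ (k + 3) := Nat.pow_le_pow_right (by omega) (by omega)
  refine wp_seq (wp_set 0 (show 0 < E.bd by omega) rfl ?_)
  refine wp_for0 (fun y s1 => Rep M (s1.r 72) (∑ y ∈ range y,
      (-1) ^ (p - (bs y).card) * (s.a 19 (p * 2 ^ p + y) : ZMod M))) 3 (2 ^ p) (by simpa using h74)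
    (by omega) ⟨by simp; omega, by simp⟩ ?_ ?_
  · intro y hy s1 hJ h71 hF
    have g5 : s1.r 5 = M := by rw [hF.r 5 rfl]; simpa using h5
    have g74 : s1.r 74 = 2 ^ p := by rw [hF.r 74 rfl]; simpa using h74
    have g76 : s1.r 76 = p := by rw [hF.r 76 rfl]; simpa using h76
    have g19 : s1.a 19 = s.a 19 := by rw [hF.a 19 rfl]; rfl
    have g16 : s1.a 16 y = (bs y).card := by rw [hF.a 16 rfl]; exact hT.pop y (by omega)
    have hcard : (bs y).card ≤ p := by
      simpa using card_le_card (lt_two_pow_iff.1 hy)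
    have l1 := h19 (p * 2 ^ p + y) (by grind)
    have l2 := hJ.1
    refine wp_seq (wp_set (s.a 19 (p * 2 ^ p + y)) ⟨⟨⟨trivial, trivial, ?_⟩, trivial, ?_⟩, ?_⟩ ?_ ?_)
    · simp only [opOk, Ex.ev, g74, g76]; omega
    · simp only [opOk, opEval, Ex.ev, g74, g76, h71]; omega
    · simp only [opEval, Ex.ev, g74, g76, h71]; omega
    · simp only [opEval, Ex.ev, g74, g76, h71, g19]
    refine wp_ite 0 ((p + (bs y).card) % 2) (show 0 < E.bd by omega)
      ⟨⟨trivial, ⟨trivial, ?_⟩, ?_⟩, show 2 < E.bd by omega, trivial⟩ rfl ?_ (fun ho => ?_) fun ho => ?_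
    · simp [Ex.ev, h71]; omega
    · simp [opOk, Ex.ev, h71, g76, g16]; omega
    · simp [opEval, Ex.ev, h71, g76, g16]
    · refine wp_set ((s1.r 72 + M - s.a 19 (p * 2 ^ p + y)) % M)
        ⟨⟨⟨trivial, trivial, ?_⟩, trivial, ?_⟩, trivial, trivial⟩ ?_ ⟨by omega, ?_⟩
      · simp [opOk, Ex.ev, g5]; omega
      · simp [opOk, opEval, Ex.ev, g5]; omega
      · simp [opEval, Ex.ev, g5]
      · rw [St.set_r, if_neg (by omega), St.set_r, if_pos rfl]
        refine Rep.of_mod (by omega) ?_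
        rw [Nat.cast_sub (by omega), Nat.cast_add, ZMod.natCast_self, hJ.2, sum_range_succ,
          Odd.neg_one_pow (Nat.odd_iff.2 (by omega))]
        ring
    · refine wp_set ((s1.r 72 + s.a 19 (p * 2 ^ p + y)) % M)
        ⟨⟨trivial, trivial, ?_⟩, trivial, trivial⟩ ?_ ⟨by omega, ?_⟩
      · simp [opOk, Ex.ev]; omega
      · simp [opEval, Ex.ev, g5]
      · rw [St.set_r, if_neg (by omega), St.set_r, if_pos rfl]
        refine Rep.of_mod (by omega) ?_
        rw [Nat.cast_add, hJ.2, sum_range_succ, Even.neg_one_pow (Nat.even_iff.2 (by omega)),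
          one_mul]
  · intro s' t hJ _ hF ht
    grind

end

/-! ### Counting the covers with a given trace -/

/-- The generating function, at `bigM n k`, of the sets of free vertices that connect the trace. -/
noncomputable def conn (n k : ℕ) (N : ℕ → List ℕ) (ℓ : ℕ → ℕ) (S r : ℕ) (A : Finset ℕ) (κ : ℕ → ℕ)
    (c : ℕ) : ZMod (bigN n k) :=
  con (bigM n k : ZMod (bigN n k)) (tau A κ '' Mand n N ℓ S r A) (free n N ℓ S r A)
    (fun v => tau A κ (posSet N ℓ S r v)) (range c)

theorem zt_rank {M p : ℕ} (W : ℕ → ZMod M) (hi : i < p + 1) (hy : y < 2 ^ p) :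
    zt (ranked p W) p ((b * (p + 1) + i) * 2 ^ p + y) =
      rz (fun Z => W (2 * ofBits Z + b)) i (bs y) := by
  refine zt_ranked (fun z => W (2 * z + b)) _ hy fun z hz => ?_
  obtain ⟨h1, h2⟩ := mul_add_div_mod (b * (p + 1) + i) hz
  obtain ⟨h3, h4⟩ := mul_add_div_mod b hi
  rw [ranked, h1, h2, h3, h4]

/-- Register 72 receives the generating function of the connecting sets. -/
def connect : Cmd := weights ;; rank ;; zeta ;; divide ;; invert

theorem wp_connect (hC : Ctx E n m k N) (hI : Inst n m k N ℓ S r par s) (ha : a < 2 ^ (S - r))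
    (hU : SetTo pf (bs a) (s.r 10) s) (hc0 : 0 < s.r 51) :
    wp E connect s fun s' t => Rep (bigN n k) (s'.r 72) (conn n k N ℓ S r (bs a) (s.a 10) (s.r 51)) ∧
      t ≤ 2 ^ s.r 51 * (5 * s.r 10 + 40 * (s.r 51 * s.r 51)) := by
  obtain ⟨l1, l2, l3, l4, l5, l6, l7, l8⟩ := hI.limits hC
  have hp := hI.hp
  have hc := hU.c_le ha
  obtain ⟨p, hcp⟩ : ∃ p, s.r 51 = p + 1 := ⟨s.r 51 - 1, by omega⟩
  have hlin := hC.lin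
  have hcap2 := hC.cap
  have h2c : 2 ^ (p + 1) ≤ 2 ^ (k + 2) := Nat.pow_le_pow_right (by omega) (by omega)
  have hX1 : (p + 1) * 2 ^ (p + 1) ≤ (k + 2) * 2 ^ (k + 2) := Nat.mul_le_mul (by omega) h2c
  have hX2 : (k + 2) * 2 ^ (k + 2) ≤ 2 ^ (k + 2) * 2 ^ (k + 2) := Nat.mul_le_mul_right _ l8.le
  have hX3 : 2 ^ (k + 4) * (k + 4) = 4 * ((k + 2) * 2 ^ (k + 2)) + 8 * 2 ^ (k + 2) := by ring
  have hbd := hC.exp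
  have hbd2 : 2 ^ (2 * k + 20) = 65536 * (2 ^ (k + 2) * 2 ^ (k + 2)) := by ring
  have h2p : 2 ^ (p + 1) = 2 * 2 ^ p := by ring
  have hM2 := two_le_bigM n k
  have hL : DivLim E p (bigN n k) :=
    ⟨by omega, by omega, hC.bigN_sq, by have := bigM_le_bigN n k; omega⟩
  have hT := hI.base.tab
  have h5 := hI.base.r5
  refine wp_seq (wp_call (wp_weights hC hI ha hU) ?_)
  rintro s1 t1 ⟨⟨h70, h17⟩, ht1⟩ hF1
  rw [hcp] at h70 h17 ht1 ⊢
  have hT1 : Tab k s1 := hT.congr (hF1.r 6 rfl) (hF1.a 0 rfl) (hF1.a 4 rfl) (hF1.a 16 rfl)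
  have h51 : s1.r 51 = p + 1 := (hF1.r 51 rfl).trans hcp
  refine wp_seq (wp_call (wp_rank hL (by omega) hT1 h51 h70
    (W := fun Y => weight n k N ℓ S r (bs a) (s.a 10) (bs Y)) h17) ?_)
  rintro s2 t2 ⟨⟨h74, h75, h18⟩, ht2⟩ hF2
  have hT2 : Tab k s2 := hT1.congr (hF2.r 6 rfl) (hF2.a 0 rfl) (hF2.a 4 rfl) (hF2.a 16 rfl)
  have h52 : s2.r 5 = bigN n k := by rw [hF2.r 5 rfl, hF1.r 5 rfl, h5]
  refine wp_seq (wp_call (wp_zeta hL (by omega) (by omega) hT2 h52 ((hF2.r 51 rfl).trans h51) h75 le_rfl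
    h18) ?_)
  rintro s3 t3 ⟨⟨h76, h18'⟩, ht3⟩ hF3
  have hT3 : Tab k s3 := hT2.congr (hF3.r 6 rfl) (hF3.a 0 rfl) (hF3.a 4 rfl) (hF3.a 16 rfl)
  have h53 : s3.r 5 = bigN n k := (hF3.r 5 rfl).trans h52
  have h743 : s3.r 74 = 2 ^ p := (hF3.r 74 rfl).trans h74
  refine wp_seq (wp_call (wp_divide hL h53 (by rw [hF3.r 51 rfl, hF2.r 51 rfl, h51]) h743 h18') ?_)
  rintro s4 t4 ⟨h19, ht4⟩ hF4
  have hT4 : Tab k s4 := hT3.congr (hF4.r 6 rfl) (hF4.a 0 rfl) (hF4.a 4 rfl) (hF4.a 16 rfl)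
  refine wp_mono (wp_invert hL (by omega) hT4 ((hF4.r 5 rfl).trans h53) ((hF4.r 74 rfl).trans h743)
    ((hF4.r 76 rfl).trans h76) fun x hx => (h19 x hx).1) ?_
  rintro s5 t5 ⟨h72, ht5⟩
  refine ⟨?_, ?_⟩
  · have hne : ∀ v ∈ free n N ℓ S r (bs a), (tau (bs a) (s.a 10) (posSet N ℓ S r v)).Nonempty := by
      intro v hv
      obtain ⟨-, -, h1, j, hj⟩ := mem_free.1 hv
      exact ⟨_, mem_tau.2 ⟨j, hj, h1 hj, rfl⟩⟩
    rw [conn, ← con_range _ _ _ _ hne p (fun j y => (s4.a 19 (j * 2 ^ p + y) : ZMod (bigN n k)))]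
    · exact h72
    · intro j hj y hy
      obtain ⟨e1, e2⟩ := mul_add_div_mod j hy
      have hlt : j * 2 ^ p + y < (p + 1) * 2 ^ p := by
        have := Nat.mul_le_mul_right (2 ^ p) hj
        grind
      have hz : ∀ b, ∀ i ≤ p, zt (ranked p fun Y => weight n k N ℓ S r (bs a) (s.a 10) (bs Y)) p
          ((b * (p + 1) + i) * 2 ^ p + y) = rz (fun Z => tot (bigM n k : ZMod (bigN n k))
            (tau (bs a) (s.a 10) '' Mand n N ℓ S r (bs a)) (free n N ℓ S r (bs a))
            (fun v => tau (bs a) (s.a 10) (posSet N ℓ S r v)) (bs (2 * ofBits Z + b))) i (bs y) :=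
        fun b i hi => zt_rank _ (by omega) hy
      have h1 := hz 1 j hj
      rw [show (1 * (p + 1) + j) * 2 ^ p + y = j * 2 ^ p + y + (p + 1) * 2 ^ p by ring] at h1
      rw [(h19 _ hlt).2, e1, e2, h1]
      refine congrArg₂ _ rfl (sum_congr rfl fun i hi => ?_)
      obtain ⟨hi1, hi2⟩ := mem_Icc.1 hi
      have h2 := hz 0 i (by omega)
      rw [zero_mul, zero_add] at h2
      rw [h2, show j * 2 ^ p + y - i * 2 ^ p = (j - i) * 2 ^ p + y by
        rw [Nat.sub_mul]; have := Nat.mul_le_mul_right (2 ^ p) hi2; omega]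
      rfl
  · have hP : 1 ≤ 2 ^ p := Nat.one_le_two_pow
    have hpu : p ≤ p * 2 ^ p := Nat.le_mul_of_pos_right _ hP
    rw [h2p] at ht1 ht2 ht3 ⊢
    grind

/-! ### Counting all covers -/

open Classical in
/-- The generating function, at `bigM n k`, of the covers with trace `A`. -/
noncomputable def traceSum (n k : ℕ) (N : ℕ → List ℕ) (ℓ : ℕ → ℕ) (S : ℕ) (A : Finset ℕ) :
    ZMod (bigN n k) :=
  ∑ X ∈ (cvcs n N).filter (fun X => ∀ i < S, ℓ i ∈ X ↔ i - 0 ∈ A), (bigM n k : ZMod (bigN n k)) ^ X.card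

/-- Add the generating function of the covers with the trace in register 50 to register 17. -/
def countBody : Cmd :=
  connect ;; .set 73 (.op add (.v 53) (.ld 16 (.v 50))) ;;
  .forr 71 (.c 0) 73 (.set 72 (.op rem (.op mul (.v 72) (.v 4)) (.v 5))) ;;
  .set 17 (.op rem (.op add (.v 17) (.v 72)) (.v 5))

theorem Inst.exists_entry (hI : Inst n m k N ℓ S 0 par s) (hS : 1 < S) :
    ∃ e, e < s.r 10 := by
  obtain ⟨h1, h2⟩ := hI.cov.par 1 one_pos hS
  obtain ⟨e, he, -⟩ := hI.ent.ent.ofEdge 1 hS (par 1) (by omega) h2 (by omega)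
  exact ⟨e, he⟩

theorem Inst.traceSum_eq_zero (hG : Gr n N) (hI : Inst n m k N ℓ S 0 par s) (hS : 1 < S)
    (hA : A ⊆ range S) (h : ¬ EHits (s.r 10) (s.a 6) A) :
    traceSum n k N ℓ S A = 0 := by
  rcases A.eq_empty_or_nonempty with rfl | hne
  · refine sum_eq_zero fun X hX => ?_
    obtain ⟨h1, h2⟩ := mem_filter.1 hX
    obtain ⟨h3, h4⟩ := hI.cov.par 1 one_pos hS
    rcases (mem_cvcs.1 h1).cov _ _ h4 with h5 | h5
    · grind
    grind
  · refine sum_eq_zero fun X hX => absurd ?_ h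
    obtain ⟨h1, h2⟩ := mem_filter.1 hX
    exact (hI.ent.ent.hits_iff hG (Or.inl rfl)).1 (hI.cov.hits (r := 0) hne hA h2 (mem_cvcs.1 h1)).1

theorem wp_countBody (hC : Ctx E n m k N) (hk : 0 < k) {z : ZMod (bigN n k)}
    (hI : Inst n m k N ℓ S 0 par s) (hS : 1 < S) (hSn : S ≤ n) (h50 : s.r 50 = a) (ha : a < 2 ^ S)
    (hh : EHits (s.r 10) (s.a 6) (bs a)) (hU : SetTo (ppar par 0) (bs a) (s.r 10) s)
    (hz : Rep (bigN n k) (s.r 17) z) :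
    wp E countBody s fun s' t => t ≤ (200 * k * (n + 2 * m)) * 2 ^ s.r 51 ∧
      Rep (bigN n k) (s'.r 17) (z + traceSum n k N ℓ S (bs a)) := by
  have hMN := bigM_le_bigN n k
  have hM2 := two_le_bigM n k
  have hNN := hC.bigN_sq
  have hlin := hC.lin
  have hp := hI.hp
  have hcap := hC.cap_pow
  obtain ⟨l1, l2, l3, l4, l5, l6, l7, l8⟩ := hI.limits hC
  have hA := lt_two_pow_iff.1 ha
  have hcard : (bs a).card ≤ S := by simpa using card_le_card hA
  obtain ⟨e0, he0⟩ := hI.exists_entry hS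
  have hne : (bs a).Nonempty := (hh e0 he0).mono inter_subset_right
  obtain ⟨j0, hj0⟩ := hne
  have hc0 : 0 < s.r 51 := Nat.zero_lt_of_lt (hU.units.units.lt j0 hj0)
  have hc : s.r 51 ≤ S := hU.c_le (r := 0) ha
  have h53 : s.r 53 = (forced n N ℓ S 0 (bs a)).card := by
    rw [hU.forced, hI.ent.ent.card_forced]
  have hfn : (forced n N ℓ S 0 (bs a)).card ≤ n := by
    exact (card_le_card (filter_subset _ _)).trans (card_range n).le
  have hits : Hits n N ℓ S 0 (bs a) := (hI.ent.ent.hits_iff hC.gr (Or.inl rfl)).2 hh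
  have hsum : traceSum n k N ℓ S (bs a) = (bigM n k : ZMod (bigN n k)) ^ (s.r 53 + (bs a).card) *
      conn n k N ℓ S 0 (bs a) (s.a 10) (s.r 51) := by
    rw [traceSum, hI.cov.sum_cvc _ hC.gr hU.units.units ⟨j0, hj0⟩ hA, if_pos hits,
      card_trace_zero hI.cov hA, h53, add_comm (bs a).card]
    rfl
  refine wp_seq (wp_call (wp_connect hC hI ha hU hc0) ?_)
  rintro s1 t1 ⟨h72, ht1⟩ hF1
  have g53 : s1.r 53 = s.r 53 := hF1.r 53 rfl
  have g16 : s1.a 16 a = (bs a).card := by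
    rw [hF1.a 16 rfl]; exact hI.base.tab.pop a (by grind)
  have g50 : s1.r 50 = a := (hF1.r 50 rfl).trans h50
  refine wp_seq (wp_set (s.r 53 + (bs a).card) ⟨trivial, ⟨trivial, ?_⟩, ?_⟩ ?_ ?_)
  · simp only [Ex.ev, g50]; grind
  · simp only [opOk, Ex.ev, g50, g53, g16]; omega
  · simp only [opEval, Ex.ev, g50, g53, g16]
  refine wp_seq (wp_for0 (fun i s2 => Rep (bigN n k) (s2.r 72) ((bigM n k : ZMod (bigN n k)) ^ i *
    conn n k N ℓ S 0 (bs a) (s.a 10) (s.r 51))) 1 (s.r 53 + (bs a).card) (by simp) (by omega)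
    (by simpa using h72) ?_ ?_)
  · intro i hi s2 hJ hx hF
    have f4 : s2.r 4 = bigM n k := by
      rw [hF.r 4 rfl, St.set_r, if_neg (by omega), hF1.r 4 rfl, hI.base.r4]
    have f5 : s2.r 5 = bigN n k := by
      rw [hF.r 5 rfl, St.set_r, if_neg (by omega), hF1.r 5 rfl, hI.base.r5]
    have := Nat.mul_le_mul hJ.1.le hMN
    refine wp_set (s2.r 72 * bigM n k % bigN n k) ⟨⟨trivial, trivial, ?_⟩, trivial, trivial⟩ ?_
      ⟨le_rfl, ?_⟩
    · simp only [opOk, Ex.ev, f4]; omega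
    · simp only [opEval, Ex.ev, f4, f5]
    · rw [St.set_r, if_neg (by omega), St.set_r, if_pos rfl]
      refine Rep.of_mod (by omega) ?_
      rw [Nat.cast_mul, hJ.2]; ring
  intro s2 t2 hJ _ hF2 ht2
  have f5 : s2.r 5 = bigN n k := by
    rw [hF2.r 5 rfl, St.set_r, if_neg (by omega), hF1.r 5 rfl, hI.base.r5]
  have f17 : s2.r 17 = s.r 17 := by
    rw [hF2.r 17 rfl, St.set_r, if_neg (by omega), hF1.r 17 rfl]
  have k1 := hJ.1
  have k2 := hz.1
  refine wp_set ((s.r 17 + s2.r 72) % bigN n k) ⟨⟨trivial, trivial, ?_⟩, trivial, trivial⟩ ?_ ⟨?_, ?_⟩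
  · simp only [opOk, Ex.ev, f17]; nlinarith
  · simp only [opEval, Ex.ev, f17, f5]
  · have h1 : 1 ≤ 2 ^ s.r 51 := Nat.one_le_two_pow
    have h3 : 5 * s.r 10 + 40 * (s.r 51 * s.r 51) + (1 + (t2 + 1)) ≤ 200 * k * (n + 2 * m) := by
      have h4 := hI.ent.H_le'
      have h5 : s.r 51 * s.r 51 ≤ (3 * k) * n := Nat.mul_le_mul (by omega) (by omega)
      have h6 : 1 * (n + 2 * m) ≤ k * (n + 2 * m) := Nat.mul_le_mul_right _ hk
      grind
    have h10 := Nat.mul_le_mul_left (2 ^ s.r 51) h3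
    rw [Nat.mul_add, mul_comm _ (1 + (t2 + 1))] at h10
    rw [mul_comm (200 * k * (n + 2 * m))]
    have h2 := Nat.mul_le_mul_left (1 + (t2 + 1)) h1
    omega
  · rw [St.set_r, if_pos rfl]
    refine Rep.of_mod (by omega) ?_
    rw [Nat.cast_add, hJ.2, hz.2, hsum]

/-! ### The number of covers from the generating function -/

theorem sum_traceSum (n k : ℕ) (N : ℕ → List ℕ) (ℓ : ℕ → ℕ) (S : ℕ) :
    ∑ a ∈ range (2 ^ S), traceSum n k N ℓ S (bs a) =
      ∑ X ∈ cvcs n N, (bigM n k : ZMod (bigN n k)) ^ X.card := by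
  classical
  rw [sum_range_two_pow S (traceSum n k N ℓ S), ← sum_fiberwise_of_maps_to (s := cvcs n N)
    (t := (range S).powerset) (g := fun X => (range S).filter (ℓ · ∈ X))
    (fun X _ => mem_powerset.2 (filter_subset _ _))]
  refine sum_congr rfl fun A hA => ?_
  rw [traceSum]
  refine sum_congr (filter_congr fun X _ => ?_) fun _ _ => rfl
  grind

theorem card_small_le (n k : ℕ) (F : Finset (Finset ℕ)) (hF : F ⊆ (range n).powerset) :
    (F.filter fun X => X.card ≤ k).card ≤ (n + 1) ^ k := by
  induction k with
  | zero =>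
    refine (card_le_card (t := {∅}) fun X hX => ?_).trans (by simp)
    grind
  | succ k ih =>
    have h1 : F.filter (fun X => X.card ≤ k + 1) ⊆
        F.filter (fun X => X.card ≤ k) ∪ (range n).powersetCard (k + 1) := fun X hX => by
      grind
    have h2 := (card_le_card h1).trans (card_union_le _ _)
    rw [card_powersetCard, card_range] at h2
    have h3 := Nat.choose_le_pow n (k + 1)
    have h4 : n ^ k ≤ (n + 1) ^ k := Nat.pow_le_pow_left (by omega) k
    have h5 : n ^ (k + 1) ≤ n * (n + 1) ^ k := by rw [pow_succ']; exact Nat.mul_le_mul_left _ h4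
    grind

/-- Modulo `M ^ (k + 1)` only the sets with at most `k` elements contribute, and modulo `M - 1`
each of them contributes `1`. -/
theorem Rep.count {F : Finset (Finset ℕ)} (hF : F ⊆ (range n).powerset) (hn : 0 < n) {T : ℕ}
    (h : Rep (bigN n k) T (∑ X ∈ F, (bigM n k : ZMod (bigN n k)) ^ X.card)) :
    T % (bigM n k - 1) = (F.filter fun X => X.card ≤ k).card := by
  have hM2 := two_le_bigM n k
  have hlt : (F.filter fun X => X.card ≤ k).card + 1 < bigM n k := by
    have h1 := card_small_le n k F hF
    have h2 : (n + 1) ^ k ≤ (n + 2) ^ k := Nat.pow_le_pow_left (by omega) k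
    have h3 : 1 ≤ (n + 2) ^ k := Nat.one_le_pow _ _ (by omega)
    rw [bigM, pow_succ']
    nlinarith
  set V := ∑ X ∈ F.filter (fun X => X.card ≤ k), bigM n k ^ X.card with hV
  have hVlt : V < bigN n k := by
    have h1 : V ≤ (F.filter fun X => X.card ≤ k).card * bigM n k ^ k := by
      rw [← smul_eq_mul, ← sum_const]
      exact sum_le_sum fun X hX => Nat.pow_le_pow_right (by omega) (mem_filter.1 hX).2
    refine h1.trans_lt ?_
    rw [bigN_eq, pow_succ']
    exact Nat.mul_lt_mul_of_pos_right (by omega) (Nat.pow_pos (by omega))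
  have hTV : T = V := by
    have h1 : (T : ZMod (bigN n k)) = V := by
      rw [h.2, hV, Nat.cast_sum, sum_filter]
      refine sum_congr rfl fun X _ => ?_
      rw [← Nat.cast_pow]
      split_ifs with hX
      · rfl
      · rw [ZMod.natCast_eq_zero_iff, bigN_eq]
        exact pow_dvd_pow _ (by omega)
    rwa [ZMod.natCast_eq_natCast_iff', Nat.mod_eq_of_lt h.1, Nat.mod_eq_of_lt hVlt] at h1
  have h1 : ((V : ℕ) : ZMod (bigM n k - 1)) = (F.filter fun X => X.card ≤ k).card := by
    have h2 : ∀ M, 2 ≤ M → ((M : ℕ) : ZMod (M - 1)) = 1 := by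
      rintro (- | M) hM
      · omega
      · simp
    rw [hV, Nat.cast_sum]
    simp [h2 _ hM2]
  rw [ZMod.natCast_eq_natCast_iff', Nat.mod_eq_of_lt (a := card _) (by omega)] at h1
  rw [hTV, h1]

/-- With the list of a cover with at most `k + 2` vertices, count all covers with at most `k`. -/
def count : Cmd :=
  .set 8 (.c 0) ;; order ;; types ;; .set 17 (.c 0) ;; traces (.c 1) countBody ;;
    .set 0 (.op rem (.v 17) (.op sub (.v 4) (.c 1)))

theorem wp_count (hC : Ctx E n m k N) (hk : 0 < k) (hB : Base n k (s.a 1) (s.r 7) (s.r 8) s)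
    (hL : CList n N (s.a 1) (s.r 7) 0) (hS1 : 2 ≤ s.r 7) (hS2 : s.r 7 ≤ k + 2) :
    wp E count s fun s' t => s'.r 0 = ((cvcs n N).filter fun X => X.card ≤ k).card ∧
      t ≤ 8000 * (2 ^ k * k * (n + 2 * m)) := by
  have hM2 := two_le_bigM n k
  obtain ⟨S, hSd⟩ : ∃ S, s.r 7 = S := ⟨_, rfl⟩
  rw [hSd] at hB hL hS1 hS2
  have hSn := hL.le_n
  refine wp_seq (wp_set 0 hC.bd_pos rfl ?_)
  refine wp_seq (wp_order hC (S := S) (r := 0) (by simpa using hSd) (by omega) (by simp) hL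
    fun s1 t1 par hcov hpre hset h3 hF1 ht1 => ?_)
  have hB1 : Base n k (s1.a 1) S 0 s1 := by
    have := (hB.relist (s' := s.set 8 0) (fun x hx => by
      rw [St.set_r, if_neg (by grind)]) fun _ _ => rfl).relist_fr hF1 (by decide)
    rwa [hF1.r 7 rfl, hF1.r 8 rfl, St.set_r, St.set_r, if_neg (by omega), if_pos rfl, hSd] at this
  refine wp_seq (wp_types hC hB1 (by omega) (by omega) hL.lt hcov.inj fun s2 t2 hE hF2 ht2 => ?_)
  refine wp_seq (wp_set 0 hC.bd_pos rfl ?_)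
  have hI2 : Inst n m k N (s1.a 1) S 0 par (s2.set 17 0) := Inst.set
    ⟨hB1.fr hF2 (by decide), hE, hcov, by rw [hF2.a 3 rfl]; exact h3, hL.lt, by omega⟩ (by omega)
  have hz0 : Rep (bigN n k) 0 0 := ⟨by have := bigM_le_bigN n k; omega, by simp⟩
  refine wp_seq (wp_traces hC (200 * k * (n + 2 * m)) (fun a s3 => s3.r 10 = s2.r 10 ∧
      s3.a 6 = s2.a 6 ∧ Rep (bigN n k) (s3.r 17)
        (∑ a' ∈ range a, traceSum n k N (s1.a 1) S (bs a'))) hI2 (by decide) ?_ ?_ ?_ ?_ ?_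
    ⟨by simp, rfl, by simpa using hz0⟩ ?_)
  · rintro a s3 s4 ⟨j1, j2, j3⟩ ⟨e1, e2⟩
    grind
  · exact fun _ _ _ _ _ => hC.one_lt
  · exact fun _ _ _ _ => rfl
  · rintro a s3 ha ⟨j1, j2, j3⟩ _ (h | h)
    · exact absurd one_pos h
    · refine ⟨j1, j2, ?_⟩
      rw [sum_range_succ, hI2.traceSum_eq_zero hC.gr (by omega) (lt_two_pow_iff.1 ha) h, add_zero]
      exact j3
  · rintro a s3 ha ⟨j1, j2, j3⟩ hI3 h50 _ hh hU
    refine wp_call (wp_countBody hC hk hI3 (by omega) hSn h50 ha hh hU j3) ?_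
    rintro s4 t4 ⟨ht4, h4⟩ hF4
    refine ⟨ht4, (hF4.r 10 rfl).trans j1, (hF4.a 6 rfl).trans j2, ?_⟩
    rw [sum_range_succ]
    exact h4
  · rintro s3 t3 ⟨-, -, hR⟩ hI3 ht3
    rw [Nat.sub_zero, sum_traceSum] at hR
    have h4 := hI3.base.r4
    refine wp_set (s3.r 17 % (bigM n k - 1)) ⟨trivial, ⟨trivial, hC.one_lt, ?_⟩, trivial⟩ ?_ ⟨?_, ?_⟩
    · simp only [opOk, Ex.ev, h4]; omega
    · simp only [opEval, Ex.ev, h4]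
    · rw [St.set_r, if_pos rfl]
      exact hR.count (fun X hX => mem_powerset.2 (mem_cvcs.1 hX).sub) (by omega)
    · have hkP : k + 1 ≤ 2 ^ k := Nat.lt_two_pow_self
      have hH := hE.H_le'
      have e1 : S * ((5 * S + 20) * (n + 2 * m) + 12) ≤ 3 * k * (35 * k * (n + 2 * m) + 12) :=
        Nat.mul_le_mul (by omega) (Nat.add_le_add_right (Nat.mul_le_mul_right _ (by omega)) _)
      have e2 : (5 * S + 27) * (n + 2 * m) ≤ 42 * k * (n + 2 * m) := Nat.mul_le_mul_right _ (by omega)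
      have e4 : 2 ^ S ≤ 4 * 2 ^ k := by
        rw [show 4 * 2 ^ k = 2 ^ (k + 2) by ring]; exact Nat.pow_le_pow_right (by omega) (by omega)
      have e5 : 1 * (n + 2 * m) ≤ k * (n + 2 * m) := Nat.mul_le_mul_right _ hk
      have e6 : 1 * (k * (n + 2 * m)) ≤ 2 ^ k * (k * (n + 2 * m)) := Nat.mul_le_mul_right _ (by omega)
      have e7 : k * (k * (n + 2 * m)) ≤ 2 ^ k * (k * (n + 2 * m)) := Nat.mul_le_mul_right _ (by omega)
      have e8 : k * 1 ≤ k * (n + 2 * m) := Nat.mul_le_mul_left _ (by omega)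
      have e9 : 2 ^ k * 1 ≤ 2 ^ k * (k * (n + 2 * m)) := Nat.mul_le_mul_left _ (by omega)
      rw [Nat.sub_zero, show (s2.set 17 0).r 10 = s2.r 10 from rfl] at ht3
      have e3 := Nat.mul_le_mul e4 (show 34 * s2.r 10 + 28 * S + 32 + 2 * (200 * k * (n + 2 * m)) ≤
        500 * (k * (n + 2 * m)) by grind)
      grind

/-! ### The encoded input and the limits -/

variable {G : SimpleGraph (Fin n)} {adj : Fin n → List (Fin n)}

/-- The input as a list of natural numbers. -/
def natInput (n m k : ℕ) (N : ℕ → List ℕ) : List ℕ :=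
  [n, m, k] ++ (List.range (n + 1)).map (off n N) ++ ((List.range n).map N).flatten

theorem length_flatten_range (N : ℕ → List ℕ) (v : ℕ) :
    ((List.range v).map N).flatten.length = ∑ u ∈ range v, (N u).length := by
  rw [List.length_flatten, List.map_map]
  induction v with
  | zero => rfl
  | succ v ih => rw [List.range_succ, List.map_append, List.sum_append, ih, sum_range_succ]; simp

theorem natInput_cast (m k : ℕ) :
    (natInput n m k (natAdj adj)).map (fun v : ℕ => (v : ℤ)) = encodeInput m k adj := by
  have h1 : (List.ofFn adj).map (List.map Fin.val) = (List.range n).map (natAdj adj) := by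
    refine List.ext_getElem (by simp) fun i h1 h2 => ?_
    simp only [List.length_map, List.length_range] at h2
    simp [natAdj, h2]
  have h2 : ∀ i < n + 1, off n (natAdj adj) i = n + 4 + ((List.ofFn adj).take i).flatten.length := by
    intro i hi
    rw [off, ← length_flatten_range, ← List.length_map (f := Fin.val), List.map_flatten, List.map_take, h1,
      ← List.map_take, List.take_range, min_eq_left (by omega)]
  rw [natInput, encodeInput, ← h1, ← List.map_flatten, List.map_append, List.map_append, List.map_map,
    List.map_map]
  congr 1
  · congr 1
    refine List.map_congr_left fun i hi => ?_
    grind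
  · rw [← List.map_map]; exact congrArg _ List.map_eq_flatMap

theorem sum_length_natAdj (h : IsAdjacencyList G adj) :
    ∑ v ∈ range n, (natAdj adj v).length = 2 * G.edgeSet.ncard := by
  classical
  rw [sum_range, Set.ncard_eq_toFinset_card', ← SimpleGraph.edgeFinset,
    ← G.sum_degrees_eq_twice_card_edges]
  refine sum_congr rfl fun v _ => ?_
  rw [natAdj, dif_pos v.2, List.length_map, ← List.toFinset_card_of_nodup (h v).1, ← G.card_neighborFinset_eq_degree]
  congr 1
  ext w
  simp [(h v).2]

theorem two_mul_edges_le (h : IsAdjacencyList G adj) : 2 * G.edgeSet.ncard ≤ n * n := by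
  rw [← sum_length_natAdj h]
  refine (sum_le_card_nsmul _ _ n fun v _ => ?_).trans (by simp)
  have hg := gr_natAdj h
  rw [← List.toFinset_card_of_nodup (hg.nodup v)]
  refine (card_le_card fun w hw => ?_).trans (card_range n).le
  exact mem_range.2 (hg.lt _ _ (List.mem_toFinset.1 hw))

/-- The size of each array. -/
def arrSize (k : ℕ) : ℕ := 2 ^ (k + 4) * (k + 4)

/-- The limits for the execution on the input. -/
def env (n m k W : ℕ) (N : ℕ → List ℕ) : Env := ⟨natInput n m k N, arrSize k, 2 ^ W⟩

theorem ctx_natInput (h : IsAdjacencyList G adj) (hW : 50 * ((k + 1) ^ 2 * Nat.log 2 (n + 2)) ≤ W) :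
    Ctx (env n G.edgeSet.ncard k W (natAdj adj)) n G.edgeSet.ncard k (natAdj adj) := by
  set m := G.edgeSet.ncard
  set L := Nat.log 2 (n + 2)
  have hL1 : 1 ≤ L := Nat.log_pos (by omega) (by omega)
  have hn : n + 2 ≤ 2 ^ (2 * L) :=
    (Nat.lt_pow_succ_log_self (by omega) _).le.trans (Nat.pow_le_pow_right (by omega) (by omega))
  have hm2 : m ≤ 2 ^ (2 * L) * 2 ^ (2 * L) := by
    have h1 := two_mul_edges_le h
    have h2 := Nat.mul_le_mul (show n ≤ 2 ^ (2 * L) by omega) (show n ≤ 2 ^ (2 * L) by omega)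
    omega
  have hQ : k + 1 + L ≤ (k + 1) ^ 2 * L + 1 := by
    obtain ⟨L', hL'⟩ : ∃ L', L = L' + 1 := ⟨L - 1, by omega⟩
    rw [hL']; grind
  have hQ2 : k + 1 ≤ (k + 1) ^ 2 * L := by nlinarith
  set Q := (k + 1) ^ 2 * L
  have hlen : (natInput n m k (natAdj adj)).length = n + 4 + 2 * m := by
    rw [natInput, List.length_append, List.length_append, length_flatten_range, sum_length_natAdj h]
    simp
    omega
  refine ⟨gr_natAdj h, sum_length_natAdj h, rfl, rfl, rfl, fun v hv => ?_, fun v hv j hj => ?_, hlen, ?_, ?_,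
    ?_, le_rfl⟩
  · change (natInput n m k (natAdj adj)).getD (3 + v) 0 = _
    rw [natInput, List.getD_append _ _ _ _ (by simp; omega), List.getD_append_right _ _ _ _ (by simp)]
    grind
  · change (natInput n m k (natAdj adj)).getD (off n (natAdj adj) v + j) 0 = _
    have h1 : ((List.range n).map (natAdj adj)).flatten = ((List.range v).map (natAdj adj)).flatten ++
        (natAdj adj v ++ ((List.range' (v + 1) (n - v - 1)).map (natAdj adj)).flatten) := by
      rw [← List.flatten_cons, ← List.map_cons, ← List.flatten_append, ← List.map_append]
      congr 2
      have h2 := List.range'_append_1 (s := 0) (m := v) (n := n - v - 1 + 1)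
      rw [List.range_eq_range', List.range_eq_range', ← List.range'_succ]
      grind
    rw [natInput, List.getD_append_right _ _ _ _ (by simp [off]; omega), h1, List.getD_append_right _ _ _ _ ?_,
      List.getD_append _ _ _ _ ?_]
    · congr 1
      rw [length_flatten_range]; simp [off]; omega
    · rw [length_flatten_range]; simp [off]; omega
    · rw [length_flatten_range]; simp [off]; omega
  · refine le_trans ?_ (Nat.pow_le_pow_right (by omega) (show 8 + 4 * L + (k + 1) ≤ W by omega))
    have hk : k + 1 < 2 ^ (k + 1) := Nat.lt_two_pow_self
    have e1 : 2 ^ (8 + 4 * L + (k + 1)) = 256 * (2 ^ (2 * L) * 2 ^ (2 * L)) * 2 ^ (k + 1) := by ring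
    have e2 : 2 ≤ 2 ^ (2 * L) := by omega
    rw [e1]
    generalize 2 ^ (2 * L) = A at *
    generalize 2 ^ (k + 1) = B at *
    have e3 : A * 1 ≤ A * A := Nat.mul_le_mul_left _ (by omega)
    have e4 : A * A * 1 ≤ A * A * B := Nat.mul_le_mul_left _ (by omega)
    have e5 : 1 * B ≤ A * A * B := Nat.mul_le_mul_right _ (by omega)
    grind
  · exact Nat.pow_le_pow_right (by omega) (by omega)
  · refine le_trans ?_ (Nat.pow_le_pow_right (by omega) (show 2 + 4 * Q ≤ W by omega))
    rw [pow_add]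
    refine Nat.mul_le_mul_left _ ((Nat.pow_le_pow_left hn _).trans ?_)
    rw [← pow_mul]
    grind

/-! ### The algorithm -/

theorem PairList.clist (h : PairList n N ℓ S) (hG : Gr n N) (h2 : 2 ≤ S)
    (hs : ∀ u w, ¬ ScanHit N ℓ S 1 u w) : CList n N ℓ S (S - 2) := by
  refine ⟨h.inj, fun i h0 hi => h.par i h0 (by omega), ⟨fun v hv => ?_, fun u w hw => ?_, ?_⟩, by omega⟩
  · obtain ⟨i, hi, rfl⟩ := mem_lset.1 hv
    exact mem_range.2 (h.lt i hi)
  · by_contra hc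
    rw [mem_lset, mem_lset, not_or] at hc
    exact hs u w ⟨hc.1, hw, hc.2, Or.inl rfl⟩
  · intro Z hZ ⟨z, hz⟩ hcl
    have hmem : ∀ i < S, ℓ i ∈ lset ℓ S := fun i hi => mem_lset.2 ⟨i, hi, rfl⟩
    have h0 : ∀ i < S, ℓ i ∈ Z → ℓ 0 ∈ Z := by
      intro i
      induction i using Nat.strong_induction_on with
      | _ i ih =>
        intro hi hiZ
        rcases Nat.eq_zero_or_pos i with rfl | hi0
        · exact hiZ
        · obtain ⟨j, hj, hN⟩ := h.par i hi0 hi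
          grind
    obtain ⟨i, hi, rfl⟩ := mem_lset.1 (hZ hz)
    have hall : ∀ i < S, ℓ i ∈ Z := by
      intro j
      induction j using Nat.strong_induction_on with
      | _ j ih =>
        intro hj
        rcases Nat.eq_zero_or_pos j with rfl | hj0
        · exact h0 i hi hz
        · obtain ⟨j', hj', hN⟩ := h.par j hj0 hj
          exact hcl _ (ih j' hj' (by omega)) _ (hmem j hj) (hG.symm _ _ hN)
    refine Finset.Subset.antisymm hZ fun v hv => ?_
    obtain ⟨j, hj, rfl⟩ := mem_lset.1 hv
    exact hall j hj

/-- The number of connected vertex covers with at most `k` elements. -/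
noncomputable def answer (n k : ℕ) (N : ℕ → List ℕ) : ℕ := ((cvcs n N).filter fun X => X.card ≤ k).card

theorem answer_of_edge (hw : w ∈ N u) : answer n 0 N = 0 := by
  refine card_eq_zero.2 (filter_eq_empty_iff.2 fun X hX h => ?_)
  rw [card_eq_zero.1 (Nat.le_zero.1 h)] at hX
  simpa using (mem_cvcs.1 hX).cov u w hw

theorem answer_of_not_edge (h : ∀ u w, w ∉ N u) (k : ℕ) :
    answer n k N = if 0 < k then n + 1 else 1 := by
  have hc : ∀ X, X ∈ cvcs n N ↔ X ∈ insert ∅ ((range n).image fun v => ({v} : Finset ℕ)) := by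
    intro X
    rw [mem_cvcs, mem_insert, mem_image]
    constructor
    · intro hX
      rcases X.eq_empty_or_nonempty with h0 | ⟨v, hv⟩
      · exact Or.inl h0
      · exact Or.inr ⟨v, hX.sub hv, hX.conn {v} (by simpa using hv) ⟨v, by simp⟩
          fun u _ w _ hw => absurd hw (h u w)⟩
    · rintro (rfl | ⟨v, hv, rfl⟩)
      · exact ⟨by simp, fun u w hw => absurd hw (h u w), fun Z hZ _ _ => subset_empty.1 hZ⟩
      · refine ⟨by simpa using hv, fun u w hw => absurd hw (h u w), fun Z hZ hne _ => ?_⟩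
        grind
  rw [answer, ext hc, filter_insert, card_empty, if_pos (Nat.zero_le _)]
  split_ifs with hk
  · rw [filter_true_of_mem, card_insert_of_notMem (by simp),
      card_image_of_injective _ singleton_injective, card_range]
    grind
  · rw [filter_false_of_mem]
    · rfl
    grind

/-- The moduli go to the registers 4 and 5. -/
def moduli : Cmd :=
  .set 92 (.op add (.v 3) (.c 1)) ;; .set 93 (.op add (.v 1) (.c 2)) ;;
  .set 4 (.c 1) ;; .forr 94 (.c 0) 92 (.set 4 (.op mul (.v 4) (.v 93))) ;;
  .set 5 (.c 1) ;; .forr 94 (.c 0) 92 (.set 5 (.op mul (.v 5) (.v 4)))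

theorem wp_moduli (hC : Ctx E n m k N) (h1 : s.r 1 = n) (h3 : s.r 3 = k) :
    wp E moduli s fun s' t => (s'.r 4 = bigM n k ∧ s'.r 5 = bigN n k) ∧ t ≤ 6 * k + 20 := by
  have hlin := hC.lin
  have hsq := hC.bigN_sq
  have hMN := bigM_le_bigN n k
  have hM2 := two_le_bigM n k
  have hNN : bigN n k ≤ bigN n k * bigN n k := Nat.le_mul_of_pos_right _ (by omega)
  refine wp_seq (wp_set (k + 1) ⟨trivial, hC.one_lt, ?_⟩ ?_ (wp_seq (wp_set (n + 2) ⟨trivial, ?_, ?_⟩ ?_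
    (wp_seq (wp_set 1 hC.one_lt rfl ?_)))))
  · simp only [opOk, Ex.ev, h3]; omega
  · simp only [opEval, Ex.ev, h3]
  · simp only [Ex.ok]; omega
  · simp [opOk, Ex.ev, h1]; omega
  · simp [opEval, Ex.ev, h1]
  refine wp_seq (wp_for0 (fun i s1 => s1.r 4 = (n + 2) ^ i) 1 (k + 1) (by simp) (by omega) (by simp)
    ?_ ?_)
  · intro i hi s1 hJ _ hF
    have h93 : s1.r 93 = n + 2 := by rw [hF.r 93 rfl]; simp
    have : (n + 2) ^ (i + 1) ≤ bigM n k := Nat.pow_le_pow_right (by omega) (by omega)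
    rw [pow_succ] at this
    refine wp_set ((n + 2) ^ (i + 1)) ⟨trivial, trivial, ?_⟩ ?_ ⟨le_rfl, by simp⟩
    · simp only [opOk, Ex.ev, hJ, h93]; omega
    · simp only [opEval, Ex.ev, hJ, h93, pow_succ]
  intro s1 t1 hJ _ hF1 ht1
  refine wp_seq (wp_set 1 hC.one_lt rfl ?_)
  refine wp_for0 (fun i s2 => s2.r 5 = bigM n k ^ i) 1 (k + 1) ?_ (by omega) (by simp) ?_ ?_
  · simp [hF1.r 92 rfl]
  · intro i hi s2 hJ2 _ hF
    have h4 : s2.r 4 = bigM n k := by rw [hF.r 4 rfl]; simpa [bigM] using hJ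
    have : bigM n k ^ (i + 1) ≤ bigN n k := by
      rw [bigN_eq]; exact Nat.pow_le_pow_right (by omega) (by omega)
    rw [pow_succ] at this
    refine wp_set (bigM n k ^ (i + 1)) ⟨trivial, trivial, ?_⟩ ?_ ⟨le_rfl, by simp⟩
    · simp only [opOk, Ex.ev, hJ2, h4]; omega
    · simp only [opEval, Ex.ev, hJ2, h4, pow_succ]
  · intro s2 t2 hJ2 _ hF2 ht2
    refine ⟨⟨?_, by rw [hJ2, bigN_eq]⟩, by omega⟩
    rw [hF2.r 4 rfl]
    simpa [bigM] using hJ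

/-- The algorithm for a graph with an edge and `k > 0`. -/
def solve : Cmd :=
  moduli ;; tables ;; initList ;; .ite (.v 15) (.c 1)
    (chain ;; .ite (.v 15) (.c 1) count (.set 0 (.c 0))) (.set 0 (.c 0))

theorem wp_solve (hC : Ctx E n m k N) (hk : 0 < k) (hm : ∃ u w, w ∈ N u) (h1 : s.r 1 = n)
    (h3 : s.r 3 = k) :
    wp E solve s fun s' t => s'.r 0 = answer n k N ∧ t ≤ 20000 * (2 ^ k * k * (n + 2 * m)) := by
  have hD : 1 ≤ n + 2 * m := by
    obtain ⟨u, w, hw⟩ := hm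
    have := hC.gr.lt _ _ hw
    omega
  have h0 : (∀ X, CVC n N X → k < X.card) → 0 = answer n k N := fun h =>
    (card_eq_zero.2 (filter_eq_empty_iff.2 fun X hX => by
      have := h X (mem_cvcs.1 hX); omega)).symm
  have hkP : k + 1 ≤ 2 ^ k := Nat.lt_two_pow_self
  have e3 : k * (k * (n + 2 * m)) ≤ 2 ^ k * (k * (n + 2 * m)) := Nat.mul_le_mul_right _ (by omega)
  have e4 : k * 1 ≤ k * (n + 2 * m) := Nat.mul_le_mul_left _ hD
  have e5 : 2 ^ k * 1 ≤ 2 ^ k * (k * (n + 2 * m)) := Nat.mul_le_mul_left _ (by omega)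
  have e6 : (k + 2) * ((n + 2 * m) * (10 * k + 40) + 22) ≤ 3 * k * ((n + 2 * m) * (50 * k) + 22) :=
    Nat.mul_le_mul (by omega) (Nat.add_le_add_right (Nat.mul_le_mul_left _ (by omega)) _)
  have f1 : 3 * k * ((n + 2 * m) * (50 * k) + 22) = 150 * (k * (k * (n + 2 * m))) + 66 * k := by ring
  have f2 : 2 * k * (1300 * (2 ^ k * (n + 2 * m)) + 5) =
    2600 * (2 ^ k * (k * (n + 2 * m))) + 10 * k := by ring
  rw [Nat.mul_assoc (2 ^ k)]
  refine wp_seq (wp_call (wp_moduli hC h1 h3) ?_)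
  rintro s1 t1 ⟨⟨h4, h5⟩, ht1⟩ hF1
  refine wp_seq (wp_tables hC ((hF1.r 3 rfl).trans h3) fun s2 t2 hT hF2 ht2 => ?_)
  have h12 : s2.r 1 = n := by rw [hF2.r 1 rfl, hF1.r 1 rfl, h1]
  have h32 : s2.r 3 = k := by rw [hF2.r 3 rfl, hF1.r 3 rfl, h3]
  refine wp_seq (wp_initList hC hm h12 h32 fun s3 t3 hcase hF3 ht3 => ?_)
  have hB : Base n k (s3.a 1) (s3.r 7) (s3.r 8) s3 :=
    ⟨by rw [hF3.r 1 rfl, h12], by rw [hF3.r 3 rfl, h32], by rw [hF3.r 4 rfl, hF2.r 4 rfl, h4],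
      by rw [hF3.r 5 rfl, hF2.r 5 rfl, h5], rfl, rfl, rfl,
      hT.congr (hF3.r 6 rfl) (hF3.a 0 rfl) (hF3.a 4 rfl) (hF3.a 16 rfl)⟩
  rcases hcase with ⟨h15, hP, hS1, hS2, hs⟩ | ⟨h15, hno⟩
  · refine wp_ite 0 1 trivial hC.one_lt h15 rfl (fun _ => ?_) fun h => absurd one_pos h
    refine wp_seq (wp_call (wp_chain hC hB (fun _ => ⟨hS1, hS2⟩) (fun _ => hP.clist hC.gr hS1 hs) h15) ?_)
    rintro s4 t4 ⟨hI, ht4⟩ hF4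
    have hB4 := hB.relist_fr hF4 (by decide)
    rcases hI with ⟨j1, j2, j3, j4⟩ | ⟨j1, j2⟩
    · refine wp_ite 0 1 trivial hC.one_lt j1 rfl (fun _ => ?_) fun h => absurd one_pos h
      refine wp_mono (wp_count hC hk hB4 j2 (by omega) (by omega)) ?_
      rintro s5 t5 ⟨h5, ht5⟩
      rw [Nat.mul_assoc (2 ^ k)] at ht5
      exact ⟨h5, by omega⟩
    · refine wp_ite 1 1 trivial hC.one_lt j1 rfl (fun h => absurd h (by omega)) fun _ => ?_
      exact wp_set 0 hC.bd_pos rfl ⟨by simpa using h0 j2, by omega⟩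
  · refine wp_ite 1 1 trivial hC.one_lt h15 rfl (fun h => absurd h (by omega)) fun _ => ?_
    exact wp_set 0 hC.bd_pos rfl ⟨by simpa using h0 hno, by omega⟩

/-- The whole algorithm. -/
def algorithm : Cmd :=
  .set 1 (.inp (.c 0)) ;; .set 2 (.inp (.c 1)) ;; .set 3 (.inp (.c 2)) ;;
  .ite (.c 0) (.v 2) (.ite (.c 0) (.v 3) solve (.set 0 (.c 0)))
    (.ite (.c 0) (.v 3) (.set 0 (.op add (.v 1) (.c 1))) (.set 0 (.c 1)))

theorem wp_algorithm (hC : Ctx E n m k N) (hN : ∀ v, n ≤ v → N v = []) (s : St) :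
    wp E algorithm s fun s' t => s'.r 0 = answer n k N ∧
      t ≤ 20000 * (2 ^ k * k * (n + 2 * m)) + 10 := by
  have hlin := hC.lin
  have hlen := hC.len
  have hbd : 2 < E.bd := by omega
  refine wp_seq (wp_set n ⟨hC.bd_pos, ?_⟩ hC.i0 (wp_seq (wp_set m ⟨hC.one_lt, ?_⟩ hC.i1
    (wp_seq (wp_set k ⟨hbd, ?_⟩ hC.i2 ?_))))) <;> try (simp only [Ex.ev]; omega)
  refine wp_ite 0 m hC.bd_pos trivial rfl (by simp [Ex.ev]) (fun hm => ?_) fun hm => ?_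
  · have he : ∃ u w, w ∈ N u := by
      by_contra h
      push Not at h
      have := hC.sum
      rw [sum_eq_zero fun v _ => by rw [List.eq_nil_iff_forall_not_mem.2 (h v)]; rfl] at this
      omega
    refine wp_ite 0 k hC.bd_pos trivial rfl (by simp [Ex.ev]) (fun hk => ?_) fun hk => ?_
    · refine wp_mono (wp_solve hC hk he (by simp) (by simp)) ?_
      omega
    · obtain ⟨u, w, hw⟩ := he
      obtain rfl : k = 0 := by omega
      exact wp_set 0 hC.bd_pos rfl ⟨by simp [answer_of_edge hw], by omega⟩
  · have he : ∀ u w, w ∉ N u := by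
      intro u w hw
      by_cases hu : u < n
      · have := hC.length_le hu
        grind
      grind
    have hans := answer_of_not_edge (n := n) he k
    refine wp_ite 0 k hC.bd_pos trivial rfl (by simp [Ex.ev]) (fun hk => ?_) fun hk => ?_
    · refine wp_set (n + 1) ⟨trivial, hC.one_lt, ?_⟩ (by simp [opEval, Ex.ev])
        ⟨by rw [hans, if_pos hk]; simp, by omega⟩
      simp [opOk, Ex.ev]; omega
    · exact wp_set 1 hC.one_lt rfl ⟨by rw [hans, if_neg hk]; simp, by omega⟩

end ConnVC

theorem theorem2 :
    ∃ (P : RAM.Program) (C : ℕ),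
      ∀ (n : ℕ) (G : SimpleGraph (Fin n)) (k : ℕ) (adj : Fin n → List (Fin n)),
        IsAdjacencyList G adj →
          ∃ (t : ℕ) (s : RAM.State),
            RAM.Exec (encodeInput G.edgeSet.ncard k adj)
                (C * (2 ^ k * k + 1)) (C * ((k + 1) ^ 2 * Nat.log 2 (n + 2)))
                P RAM.State.init t s ∧
              t ≤ C * (2 ^ k * k * (n + G.edgeSet.ncard) + 1) ∧
              s.reg 0 = (numConnectedVertexCovers G k : ℤ) := by
  obtain ⟨F, hF⟩ : ∃ F, F = ConnVC.algorithm.fac := ⟨_, rfl⟩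
  refine ⟨ConnVC.algorithm.comp, 40000 * (F + 1), fun n G k adj h => ?_⟩
  set W := 40000 * (F + 1) * ((k + 1) ^ 2 * Nat.log 2 (n + 2)) with hW
  have hL1 : 1 ≤ Nat.log 2 (n + 2) := Nat.log_pos (by omega) (by omega)
  have hQ : k + 1 ≤ (k + 1) ^ 2 * Nat.log 2 (n + 2) := by nlinarith
  have hWQ : 40000 * ((k + 1) ^ 2 * Nat.log 2 (n + 2)) ≤ W := Nat.mul_le_mul_right _ (by omega)
  have hC := ConnVC.ctx_natInput h (k := k) (W := W) (by omega)
  have hlin := hC.lin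
  have hG := ConnVC.gr_natAdj h
  have hsz : 32 * ConnVC.arrSize k ≤ 2560 * (2 ^ k * k + 1) := by
    have h1 : 2 ^ k * (k + 4) ≤ 5 * (2 ^ k * k + 1) := by
      rcases Nat.eq_zero_or_pos k with rfl | hk
      · simp
      · have := Nat.mul_le_mul_left (2 ^ k) (show k + 4 ≤ 5 * k by omega)
        grind
    have h2 : 2 ^ (k + 4) * (k + 4) = 16 * (2 ^ k * (k + 4)) := by ring
    rw [ConnVC.arrSize, h2]
    omega
  have hszW : 2560 * (2 ^ k * k + 1) ≤ 2 ^ W := by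
    refine le_trans ?_ (Nat.pow_le_pow_right (by omega) (show 13 + k + k ≤ W by omega))
    have := Nat.mul_le_mul_left (2 ^ k) (Nat.lt_two_pow_self (n := k)).le
    have := Nat.mul_pos (Nat.two_pow_pos k) (Nat.two_pow_pos k)
    rw [pow_add, pow_add, Nat.mul_assoc]
    omega
  have hfits : (ConnVC.env n G.edgeSet.ncard k W (ConnVC.natAdj adj)).Fits
      (40000 * (F + 1) * (2 ^ k * k + 1)) W := by
    refine ⟨le_rfl, hsz.trans ?_, hsz.trans hszW, ?_, fun v hv => ?_⟩
    · grind
    · change 16 * _ ≤ 2 ^ W at hlin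
      omega
    · change _ < (ConnVC.env n G.edgeSet.ncard k W (ConnVC.natAdj adj)).bd
      simp only [ConnVC.env, ConnVC.natInput, List.mem_append, List.mem_cons, List.not_mem_nil, or_false,
        List.mem_map, List.mem_range, List.mem_flatten] at hv hlin ⊢
      rcases hv with ((rfl | rfl | rfl) | ⟨v, hv, rfl⟩) | ⟨_, ⟨u, _, rfl⟩, hv⟩
      · omega
      · omega
      · omega
      · have := hC.off_le (v := v) (by omega)
        omega
      · have := hG.lt _ _ hv
        omega
  obtain ⟨m', s', t, t', h1, h2, ⟨h3, h4⟩, h5⟩ := ConnVC.Cmd.comp_spec hfits ConnVC.algorithm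
    RAM.State.init ⟨fun _ => 0, fun _ _ => 0⟩ _ (by decide)
    (ConnVC.wp_algorithm hC (fun v hv => by rw [ConnVC.natAdj, dif_neg (by omega)]) _)
    ⟨fun _ _ => rfl, fun _ _ _ => rfl, fun _ => by simp [RAM.State.init], fun _ => by simp [RAM.State.init]⟩
  refine ⟨t, m', ?_, h2.trans ?_, ?_⟩
  · rw [← ConnVC.natInput_cast]
    exact h1
  · rw [← hF]
    have e1 : 2 ^ k * k * (n + 2 * G.edgeSet.ncard) ≤ 2 ^ k * k * (2 * (n + G.edgeSet.ncard)) :=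
      Nat.mul_le_mul_left _ (by omega)
    have e2 : 2 ^ k * k * (2 * (n + G.edgeSet.ncard)) = 2 * (2 ^ k * k * (n + G.edgeSet.ncard)) := by ring
    have e3 := Nat.mul_le_mul_left F (show t' ≤ 40000 * (2 ^ k * k * (n + G.edgeSet.ncard) + 1) by omega)
    grind
  · rw [h5.reg 0 (by omega), h3, ConnVC.num_eq h, ConnVC.answer]
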